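/- Graphs are finite and simple. The line graph $L(G)$ of a graph $G$ has the edges of $G$ as its vertices, two being adjacent when they are distinct and share an endpoint. A decomposition of a graph $K$ is a set of subgraphs of $K$ whose edge sets partition $E(K)$; a Hamilton decomposition of a graph is a decomposition of it into Hamilton cycles. For a positive integer $n$ let $N_n=\{0,1,\ldots,n-2,\infty\}$, $A_n=\{a_i : i\in N_n\}$ and $B_n=\{b_i : i\in N_n\}$, where the $2n$ elements of $A_n\cup B_n$ are distinct, and let $K_{A_n\cup B_n}$ be the complete graph with vertex set $A_n\cup B_n$. A directed $2$-factorisation $\{\overrightarrow F_i : i\in N_n\}$ of a $2n$-regular graph $G$ consists of spanning $2$-regular subgraphs $F_i$ of $G$ $(i\in N_n)$ whose edge sets partition $E(G)$, together with an orientation $\overrightarrow F_i$ of each $F_i$ in which every cycle of $F_i$ is a directed cycle. Given one, for each $v\in V(G)$ let $\sigma_v:A_n\cup B_n\to V(L(G))$ map $a_i$ to the edge of $\overrightarrow F_i$ directed into $v$ and $b_i$ to the edge of $\overrightarrow F_i$ directed out of $v$. For a subgraph $H$ of $K_{A_n\cup B_n}$ let $\bigcup_{v\in V(G)}\sigma_v(H)$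 be the spanning subgraph of $L(G)$ whose edges are the pairs $\sigma_v(x)\sigma_v(y)$ with $v\in V(G)$ and $xy\in E(H)$. The graph $H$ is a Hamilton fragment if, for every $2n$-regular graph $G$ that has a Hamilton cycle and every directed $2$-factorisation $\{\overrightarrow F_i : i\in N_n\}$ of $G$ in which $\overrightarrow F_\infty$ is a Hamilton cycle, the graph $\bigcup_{v\in V(G)}\sigma_v(H)$ has a Hamilton decomposition. Theorem. For every positive integer $n$, the complete graph $K_{A_n\cup B_n}$ has a decomposition into Hamilton fragments. Consequently, for every positive integer $n$, the line graph of every $2n$-regular graph that contains a Hamilton cycle has a Hamilton decomposition. -/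

import Mathlib

universe u

namespace HamFrag

/-- `IsDecomposition K D`: the edge sets of the graphs in `D` partition the edge set of `K`
(all graphs are spanning; no member of `D` is edgeless). -/
def IsDecomposition {W : Type*} (K : SimpleGraph W) (D : Set (SimpleGraph W)) : Prop :=
  (∀ H ∈ D, H ≠ ⊥ ∧ H ≤ K) ∧ ∀ e ∈ K.edgeSet, ∃! H, H ∈ D ∧ e ∈ H.edgeSet

open Classical in
/-- The graph `C` is a cycle through all of its vertices. -/
def IsHamiltonCycle {W : Type*} (C : SimpleGraph W) : Prop :=
  ∃ (w : W) (p : C.Walk w w), p.IsHamiltonianCycle ∧ ∀ e ∈ C.edgeSet, e ∈ p.edges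

/-- `L` has a Hamilton decomposition: a set of Hamilton cycles of `L` whose edge sets partition
the edge set of `L`. -/
def HamiltonDecomposable {W : Type*} (L : SimpleGraph W) : Prop :=
  ∃ D : Set (SimpleGraph W), IsDecomposition L D ∧ ∀ C ∈ D, IsHamiltonCycle C

/-- `G` contains a Hamilton cycle. -/
def HasHamiltonCycle {V : Type*} (G : SimpleGraph V) : Prop :=
  ∃ C : SimpleGraph V, C ≤ G ∧ IsHamiltonCycle C

/-- The index set `N_n = {0, 1, …, n-2, ∞}` (for `n ≥ 1`); `none` is the index `∞`. -/
abbrev Idx (n : ℕ) : Type := Option (Fin (n - 1))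

/-- The vertex set `A_n ∪ B_n`: `Sum.inl i` is `a_i` and `Sum.inr i` is `b_i`. -/
abbrev Lab (n : ℕ) : Type := Idx n ⊕ Idx n

/-- A directed `2`-factorisation `{F_i : i ∈ N_n}` of `G`. The directed `2`-factor `F_i`, in which
every vertex has exactly one arc in and one arc out, is given by the permutation `next i` that maps
each vertex `v` to the head of the arc of `F_i` that leaves `v`. -/
structure DirTwoFactorisation {V : Type*} (G : SimpleGraph V) (n : ℕ) where
  /-- the successor permutation of each factor -/
  next : Idx n → Equiv.Perm V
  /-- every arc is an oriented edge of `G` -/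
  adj : ∀ i v, G.Adj v (next i v)
  /-- no edge is used in both directions by the same factor (so all the cycles have length at
  least three) -/
  next_next_ne : ∀ i v, next i (next i v) ≠ v
  /-- every edge of `G` belongs to exactly one factor -/
  existsUnique : ∀ u v, G.Adj u v → ∃! i, next i u = v ∨ next i v = u

namespace DirTwoFactorisation

variable {V : Type*} {G : SimpleGraph V} {n : ℕ} (F : DirTwoFactorisation G n)

/-- The map `σ_v`: it sends `a_i` to the edge of `F_i` directed into `v`, and `b_i` to the edge of
`F_i` directed out of `v`, as vertices of the line graph. -/
def sigmaFun (v : V) : Lab n → G.edgeSet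
  | Sum.inl i => ⟨s((F.next i).symm v, v),
      G.mem_edgeSet.mpr (by simpa using F.adj i ((F.next i).symm v))⟩
  | Sum.inr i => ⟨s(v, F.next i v), G.mem_edgeSet.mpr (F.adj i v)⟩

theorem sigmaFun_injective (v : V) : Function.Injective (F.sigmaFun v) := by
  have key : ∀ i j w, (F.next i w = v ∨ F.next i v = w) → (F.next j w = v ∨ F.next j v = w) →
      i = j := by
    intro i j w hi hj
    have hw : G.Adj w v := by
      rcases hi with h | h
      · exact h ▸ F.adj i w
      · exact h ▸ (F.adj i v).symm
    exact (F.existsUnique w v hw).unique hi hj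
  have mixed : ∀ i j, (F.next i).symm v ≠ F.next j v := by
    intro i j h
    have hij := key i j (F.next j v) (Or.inl (by rw [← h]; simp)) (Or.inr rfl)
    subst hij
    exact F.next_next_ne i v (by rw [← h]; simp)
  rintro (i | i) (j | j) h <;> replace h := congrArg Subtype.val h <;> simp only [sigmaFun] at h
  · rw [Sym2.congr_left] at h
    rw [key i j ((F.next i).symm v) (Or.inl (by simp)) (Or.inl (by rw [h]; simp))]
  · rw [Sym2.eq_swap, Sym2.congr_right] at h
    exact absurd h (mixed i j)
  · rw [Sym2.eq_swap, Sym2.congr_left] at h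
    exact absurd h.symm (mixed j i)
  · rw [Sym2.congr_right] at h
    rw [key i j (F.next i v) (Or.inr rfl) (Or.inr h.symm)]

/-- `σ_v` as an injection from `A_n ∪ B_n` to the vertices of the line graph of `G`. -/
def sigma (v : V) : Lab n ↪ G.edgeSet := ⟨F.sigmaFun v, F.sigmaFun_injective v⟩

/-- The graph `⋃_{v ∈ V(G)} σ_v(H)` on the vertex set of the line graph of `G`. -/
def unionCopies (H : SimpleGraph (Lab n)) : SimpleGraph G.edgeSet :=
  ⨆ v : V, H.map (F.sigma v)

end DirTwoFactorisation

/-- A subgraph `H` of the complete graph on `A_n ∪ B_n` is a Hamilton fragment if, for every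
(finite, simple) `2n`-regular graph `G` that has a Hamilton cycle and every directed
`2`-factorisation of `G` in which `F_∞` is a Hamilton cycle, the graph `⋃_v σ_v(H)` has a Hamilton
decomposition. -/
def IsHamiltonFragment {n : ℕ} (H : SimpleGraph (Lab n)) : Prop :=
  ∀ (V : Type u) [Fintype V] (G : SimpleGraph V) [DecidableRel G.Adj],
    G.IsRegularOfDegree (2 * n) → HasHamiltonCycle G →
    ∀ F : DirTwoFactorisation G n, (∀ v w : V, (F.next none).SameCycle v w) →
      HamiltonDecomposable (F.unionCopies H)

end HamFrag

namespace HamFrag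

/-! ### Hamilton cycles as connected 2-regular graphs, and the handshake parity -/

section Basics

variable {W : Type*}

/-! The complete graph on `A ∪ B` is itself a Hamilton fragment, so the decomposition with one
member proves the first claim. Its union of copies is `L(G)`, and this gives the second claim once
the Hamilton cycle has been split off and the rest of `G` divided, as in Petersen's theorem, into
directed 2-factors.

An edge of `G` that lies in factor `k` is `b_k` in the copy at its tail and `a_k` in the copy at its
head. Colour the edges of every copy so that in each colour the degree of `b_k` at the tail and the
degree of `a_k` at the head add up to two. The colour classes of `L(G)` are then spanning 2-regular
graphs that partition its edges, and the task is to make each of them connected.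

Switching. Call a point of local degree one in a colour a port. When the local colouring at a vertex
is erased, what remains of a colour pairs up the ports of that vertex. If the admissible local
colourings can answer every such pairing, joining all ports of a prescribed block, then the vertices
can be treated one after another without destroying joins made before (`Copies.exists_switching`).
Label `∞` has ports in every colour at every vertex, and `F_∞` is a Hamilton cycle, so all its ports
end up in one component. Another label with ports is followed around the cycles of its factor. On
every such cycle one vertex is called first, its successor second, the rest other, and the local
colouring depends on these roles in such a way that somewhere on the cycle the label shares a block
with a label nearer to `∞` (`Scheme.exists_core`).

Gadgets. A label `k` may instead have its rung `a_k b_k` in a colour in which it meets nothing else;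
each cycle of its factor then gives a separate cycle of that colour. An exchange of edges between
three colours, located at two consecutive vertices, merges this cycle with the rest and keeps the
two auxiliary colours connected (`HasGadget.exists_exchange`, `exists_exchange_family`). Together
the two devices give `Scheme.hamiltonDecomposable`.

Local colourings. For `n` at most six they are listed as numbers and checked by evaluation; for `n =
3` one combination of roles has no colouring and is avoided by Hall's theorem
(`exists_placement_avoiding`). For larger `n`, with `N = n - 1`, they come from a decomposition of
the complete graph on `2 N` points into transversal paths, rungs and one closed transversal
(`EPlus`). One distinguished label is handled by switching between just two configurations
(`Core.switchable`), all other finite labels by gadgets. Such decompositions are listed for `N` from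
6 to 11, and two of them compose to one for `2 N` or `2 N + 1` labels, with zigzag paths taking most
of the pairs between the two parts (`EPlus.double`). -/

theorem isHamiltonCycle_of_regular [Finite W] {C : SimpleGraph W}
    (hreg : ∀ w, (C.neighborSet w).ncard = 2) (hconn : C.Connected) : IsHamiltonCycle C := by
  classical
  cases nonempty_fintype W
  obtain ⟨v⟩ := hconn.nonempty
  have hcyc : C.IsCycles := fun w _ => hreg w
  have hne : ∀ w, (C.neighborSet w).Nonempty := fun w => by
    rw [← Set.ncard_pos (Set.toFinite _), hreg]; norm_num
  obtain ⟨p, hp, hpv⟩ := hcyc.exists_cycle_toSubgraph_verts_eq_connectedComponentSupp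
    (c := C.connectedComponentMk v) rfl (hne v)
  have hmem : ∀ w, w ∈ p.support := fun w => by
    rw [← SimpleGraph.Walk.mem_verts_toSubgraph, hpv]
    exact SimpleGraph.ConnectedComponent.sound (hconn.preconnected w v)
  -- The cycle already has two edges at each of its vertices, so these are all the edges of `C`
  -- there.
  have hadj : ∀ w, p.toSubgraph.neighborSet w = C.neighborSet w := fun w => by
    apply Set.eq_of_subset_of_ncard_le (p.toSubgraph.neighborSet_subset w) _ (Set.toFinite _)
    rw [hreg, hp.ncard_neighborSet_toSubgraph_eq_two (hmem w)]
  refine ⟨v, p, ?_, ?_⟩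
  · rw [SimpleGraph.Walk.isHamiltonianCycle_isCycle_and_isHamiltonian_tail]
    refine ⟨hp, hp.isPath_tail.isHamiltonian_of_mem fun w => ?_⟩
    rw [SimpleGraph.Walk.support_tail_of_not_nil _ hp.not_nil]
    rcases (SimpleGraph.Walk.mem_support_iff _).1 (hmem w) with rfl | h
    · exact SimpleGraph.Walk.end_mem_tail_support hp.not_nil
    · exact h
  · intro e he
    induction e with | _ x y =>
    rw [← SimpleGraph.Walk.mem_edges_toSubgraph, SimpleGraph.Subgraph.mem_edgeSet,
      ← SimpleGraph.Subgraph.mem_neighborSet, hadj]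
    exact he

theorem IsHamiltonCycle.ncard_neighborSet {C : SimpleGraph W} (h : IsHamiltonCycle C) (w : W) :
    (C.neighborSet w).ncard = 2 := by
  classical
  obtain ⟨v, p, hp, he⟩ := h
  rw [← hp.isCycle.ncard_neighborSet_toSubgraph_eq_two (hp.mem_support w)]
  congr 1
  ext y
  rw [SimpleGraph.Subgraph.mem_neighborSet, ← SimpleGraph.Subgraph.mem_edgeSet,
    SimpleGraph.Walk.mem_edges_toSubgraph]
  exact ⟨fun hy => he _ hy, fun hy => p.edges_subset_edgeSet hy⟩

theorem IsHamiltonCycle.connected {C : SimpleGraph W} (h : IsHamiltonCycle C) : C.Connected := by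
  classical
  obtain ⟨v, p, hp, he⟩ := h
  have hr : ∀ w, C.Reachable v w := fun w => ⟨p.takeUntil w (hp.mem_support w)⟩
  exact { preconnected := fun a b => (hr a).symm.trans (hr b), nonempty := ⟨v⟩ }

/-- A set of vertices closed under adjacency contains an even number of odd vertices. -/
theorem even_ncard_odd_of_closed [Finite W] (G : SimpleGraph W) (S : Set W)
    (hS : ∀ x ∈ S, ∀ y, G.Adj x y → y ∈ S) :
    Even {x | x ∈ S ∧ Odd (G.neighborSet x).ncard}.ncard := by
  classical
  cases nonempty_fintype W
  -- Keeping only the edges inside `S` isolates everything else, so the handshake lemma counts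
  -- exactly the odd vertices of `S`.
  let G' : SimpleGraph W :=
    { Adj := fun x y => G.Adj x y ∧ x ∈ S
      symm := ⟨fun x y h => ⟨h.1.symm, hS x h.2 y h.1⟩⟩
      loopless := ⟨fun x h => G.loopless.irrefl x h.1⟩ }
  have hdeg : ∀ x, G'.degree x = if x ∈ S then (G.neighborSet x).ncard else 0 := by
    intro x
    rw [← SimpleGraph.card_neighborSet_eq_degree, ← Nat.card_eq_fintype_card, Nat.card_coe_set_eq]
    split_ifs with hx
    · congr 1; ext y; simp [G', hx]
    · rw [Set.ncard_eq_zero]; ext y; simp [G', hx]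
  have := G'.even_card_odd_degree_vertices
  rw [← Set.ncard_coe_finset] at this
  convert this using 2
  ext x
  simp only [Set.mem_ofPred_eq, Finset.coe_filter, Finset.mem_univ, true_and, hdeg]
  split_ifs with hx <;> simp [hx]

theorem reachable_map {W' : Type*} {G : SimpleGraph W} {G' : SimpleGraph W'} (φ : W → W')
    (h : ∀ x y, G.Adj x y → G'.Reachable (φ x) (φ y)) {x y : W} (hxy : G.Reachable x y) :
    G'.Reachable (φ x) (φ y) := by
  obtain ⟨p⟩ := hxy
  induction p with
  | nil => rfl
  | cons hadj _ ih => exact (h _ _ hadj).trans ih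

end Basics

/-! ### Pairings inside the classes of an equivalence relation -/

section Matchings

variable {α : Type*} [DecidableEq α]

/-- The perfect matchings of a list, found with the given amount of fuel. -/
def perfectMatchings : ℕ → List α → List (List (α × α))
  | _, [] => [[]]
  | 0, _ :: _ => []
  | n + 1, a :: l => l.flatMap fun b => (perfectMatchings n (l.erase b)).map ((a, b) :: ·)

/-- The class of the first element has even size, so it contains a partner; pair the two and
recurse. This replaces an arbitrary outside connectivity by one of finitely many pairings, which can
be enumerated by evaluation. -/
theorem exists_perfectMatching (E : α → α → Prop) (hE : Equivalence E) [DecidableRel E] :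
    ∀ (n : ℕ) (l : List α), l.Nodup → l.length ≤ 2 * n →
      (∀ x ∈ l, Even (l.countP fun y => E x y)) →
      ∃ M ∈ perfectMatchings n l, ∀ q ∈ M, E q.1 q.2 := by
  intro n
  induction n with
  | zero =>
    intro l _ hl _
    have : l = [] := List.length_eq_zero_iff.mp (by omega)
    subst this
    exact ⟨[], by simp [perfectMatchings], by simp⟩
  | succ n ih =>
    intro l hnd hl hev
    rcases l with _ | ⟨a, l⟩
    · exact ⟨[], by simp [perfectMatchings], by simp⟩
    have hnd' := List.nodup_cons.mp hnd
    have ha := hev a (by simp)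
    rw [List.countP_cons_of_pos (by simpa using hE.refl a)] at ha
    have hpos : 0 < l.countP fun y => E a y := by
      by_contra h
      have : (l.countP fun y => E a y) = 0 := by omega
      rw [this] at ha
      exact absurd ha (by decide)
    obtain ⟨b, hb, hab⟩ := List.countP_pos_iff.mp hpos
    have hab : E a b := by simpa using hab
    have hperm := List.perm_cons_erase hb
    have hlen : (l.erase b).length + 1 = l.length := by
      have := hperm.length_eq; simpa using this.symm
    obtain ⟨M, hM, hME⟩ := ih (l.erase b) (hnd'.2.erase b)
      (by simp only [List.length_cons] at hl; omega) (by
        intro x hx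
        have h := hev x (List.mem_cons_of_mem _ (List.mem_of_mem_erase hx))
        rw [List.countP_cons, hperm.countP_eq, List.countP_cons] at h
        -- The two removed elements are equivalent, so each class loses none or two of its members
        -- and parity persists.
        have hiff : E x a ↔ E x b := ⟨fun h => hE.trans h hab, fun h => hE.trans h (hE.symm hab)⟩
        by_cases hxa : E x a
        · have hxb := hiff.1 hxa
          simp only [hxa, hxb, decide_true, if_true] at h
          rw [add_assoc, Nat.even_add] at h
          exact h.2 (by decide)
        · have hxb : ¬ E x b := fun h => hxa (hiff.2 h)
          simpa [hxa, hxb] using h)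
    refine ⟨(a, b) :: M, ?_, ?_⟩
    · simp only [perfectMatchings, List.mem_flatMap, List.mem_map]
      exact ⟨b, hb, M, hM, rfl⟩
    · intro q hq
      rcases List.mem_cons.mp hq with rfl | hq
      · exact hab
      · exact hME q hq

end Matchings

/-! ### Hall's theorem from degree bounds -/

section Hall

/-- Hall's theorem for a bipartite relation whose left degrees are at least, and whose right
degrees are at most, `k`. -/
theorem exists_injective_of_degrees {A B : Type*} [Finite A] [Finite B] (r : A → B → Prop) (k : ℕ)
    (hk : 0 < k) (hA : ∀ a, k ≤ {b | r a b}.ncard) (hB : ∀ b, {a | r a b}.ncard ≤ k) :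
    ∃ f : A → B, Function.Injective f ∧ ∀ a, r a (f a) := by
  classical
  cases nonempty_fintype A
  cases nonempty_fintype B
  let t : A → Finset B := fun a => Finset.univ.filter (r a)
  have hA' : ∀ a, k ≤ (t a).card := fun a => by
    have := hA a
    rwa [show {b | r a b} = ↑(t a) by ext; simp [t], Set.ncard_coe_finset] at this
  -- Count the related pairs with first member in `s`: there are at least `k` per element of `s`,
  -- and at most `k` per element of its neighbourhood.
  have key : ∀ s : Finset A, s.card ≤ (s.biUnion t).card := by
    intro s
    have h1 : s.card * k ≤ ∑ a ∈ s, (t a).card := by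
      simpa using Finset.card_nsmul_le_sum s (fun a => (t a).card) k fun a _ => hA' a
    have h2 : ∑ a ∈ s, (t a).card
        = ∑ b ∈ s.biUnion t, (s.filter fun a => r a b).card := by
      refine Eq.trans ?_ (Finset.sum_card_bipartiteAbove_eq_sum_card_bipartiteBelow r)
      refine Finset.sum_congr rfl fun a ha => ?_
      congr 1
      ext b
      simp only [t, Finset.mem_filter, Finset.mem_univ, true_and, Finset.bipartiteAbove,
        Finset.mem_biUnion]
      exact ⟨fun h => ⟨⟨a, ha, h⟩, h⟩, fun h => h.2⟩
    have h3 : ∑ b ∈ s.biUnion t, (s.filter fun a => r a b).card ≤ (s.biUnion t).card * k := by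
      refine (Finset.sum_le_card_nsmul _ _ k fun b _ => ?_).trans (by simp)
      refine le_trans ?_ (hB b)
      rw [← Set.ncard_coe_finset]
      exact Set.ncard_le_ncard (fun a ha => by simpa using (Finset.mem_filter.mp ha).2)
    exact Nat.le_of_mul_le_mul_right (h1.trans (h2 ▸ h3)) hk
  obtain ⟨f, hf, hft⟩ := (Finset.all_card_le_biUnion_card_iff_exists_injective t).mp key
  exact ⟨f, hf, fun a => by simpa [t] using hft a⟩

end Hall

end HamFrag

/-! ### Gluing local graphs and switching them one vertex at a time -/

namespace HamFrag

/-- Copies of a set `H` in `W`, one for each `v : V`, such that every point of `W` lies in exactly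
two copies, and two copies share at most one point. -/
structure Copies (V H W : Type*) where
  σ : V → H → W
  inj : ∀ v, Function.Injective (σ v)
  disj : ∀ {v u x x' y y'}, σ v x = σ u x' → σ v y = σ u y' → v = u ∨ x = y
  incidence : ∀ w, ∃ v x v' x', v ≠ v' ∧ ∀ u y, σ u y = w ↔ (u = v ∧ y = x) ∨ (u = v' ∧ y = x')

namespace Copies

variable {V H W C : Type*} (S : Copies V H W)

/-- The union of the images of a family of graphs on `H`. -/
def glue (L : V → SimpleGraph H) : SimpleGraph W where
  Adj w w' := ∃ v x y, (L v).Adj x y ∧ S.σ v x = w ∧ S.σ v y = w'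
  symm := ⟨fun _ _ ⟨v, x, y, h, hx, hy⟩ => ⟨v, y, x, h.symm, hy, hx⟩⟩
  loopless := ⟨fun _ ⟨v, _, _, h, hx, hy⟩ => h.ne (S.inj v (hx.trans hy.symm))⟩

variable {S}

theorem glue_adj (L : V → SimpleGraph H) {v : V} {x y : H} (h : (L v).Adj x y) :
    (S.glue L).Adj (S.σ v x) (S.σ v y) := ⟨v, x, y, h, rfl, rfl⟩

theorem glue_adj_iff (L : V → SimpleGraph H) {v : V} {x y : H} :
    (S.glue L).Adj (S.σ v x) (S.σ v y) ↔ (L v).Adj x y := by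
  refine ⟨?_, glue_adj L⟩
  rintro ⟨u, x', y', h, hx, hy⟩
  obtain rfl | h' := S.disj hx hy
  · rwa [S.inj _ hx, S.inj _ hy] at h
  · exact absurd h' h.ne

theorem glue_reachable (L : V → SimpleGraph H) {v : V} {x y : H} (h : (L v).Reachable x y) :
    (S.glue L).Reachable (S.σ v x) (S.σ v y) :=
  reachable_map (S.σ v) (fun _ _ h => (glue_adj L h).reachable) h

/-- Two copies meet in at most one point, here `w`, so the neighbourhoods contributed by the two
copies are disjoint and the degrees add. -/
theorem ncard_glue [Finite H] (L : V → SimpleGraph H) {v v' : V} {x x' : H} {w : W} (hv : v ≠ v')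
    (hw : ∀ u y, S.σ u y = w ↔ (u = v ∧ y = x) ∨ (u = v' ∧ y = x')) :
    ((S.glue L).neighborSet w).ncard
      = ((L v).neighborSet x).ncard + ((L v').neighborSet x').ncard := by
  have hx : S.σ v x = w := (hw v x).2 (Or.inl ⟨rfl, rfl⟩)
  have hx' : S.σ v' x' = w := (hw v' x').2 (Or.inr ⟨rfl, rfl⟩)
  have : (S.glue L).neighborSet w
      = S.σ v '' (L v).neighborSet x ∪ S.σ v' '' (L v').neighborSet x' := by
    ext w'
    simp only [SimpleGraph.mem_neighborSet, Set.mem_union, Set.mem_image]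
    constructor
    · rintro ⟨u, y, y', h, hy, hy'⟩
      rcases (hw u y).1 hy with ⟨rfl, rfl⟩ | ⟨rfl, rfl⟩
      · exact Or.inl ⟨y', h, hy'⟩
      · exact Or.inr ⟨y', h, hy'⟩
    · rintro (⟨y, h, hy⟩ | ⟨y, h, hy⟩)
      · exact ⟨v, x, y, h, hx, hy⟩
      · exact ⟨v', x', y, h, hx', hy⟩
  rw [this, Set.ncard_union_eq _ ((Set.toFinite _).image _) ((Set.toFinite _).image _),
    Set.ncard_image_of_injective _ (S.inj v), Set.ncard_image_of_injective _ (S.inj v')]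
  rw [Set.disjoint_left]
  rintro _ ⟨y, h, rfl⟩ ⟨y', h', hy⟩
  rcases S.disj (hx.trans hx'.symm) hy.symm with h1 | h1
  · exact hv h1
  · exact h.ne h1

section Switch

variable [DecidableEq V]

/-- Erasing the graph in copy `v` leaves degree two outside the copy and two minus the local degree
inside it. The odd points are therefore exactly the ports of `v`, and each component contains an
even number of them. -/
theorem even_ports [Finite W] [Finite H] (L : V → SimpleGraph H)
    (hreg : ∀ w, ((S.glue L).neighborSet w).ncard = 2) (v : V) (w : W) :
    Even {y | ((L v).neighborSet y).ncard = 1 ∧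
      (S.glue (Function.update L v ⊥)).Reachable w (S.σ v y)}.ncard := by
  set O := S.glue (Function.update L v ⊥) with hO
  have key := even_ncard_odd_of_closed O {w' | O.Reachable w w'}
    (fun x hx y hxy => SimpleGraph.Reachable.trans hx hxy.reachable)
  have hbot : ((⊥ : SimpleGraph H).neighborSet) = fun _ => ∅ := by ext; simp
  have hsum : ∀ y, ((L v).neighborSet y).ncard + (O.neighborSet (S.σ v y)).ncard = 2 := by
    intro y
    obtain ⟨a, x, a', x', ha, hw⟩ := S.incidence (S.σ v y)
    rw [hO, ncard_glue _ ha hw]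
    have h2 := hreg (S.σ v y)
    rw [ncard_glue _ ha hw] at h2
    rcases (hw v y).1 rfl with ⟨rfl, rfl⟩ | ⟨rfl, rfl⟩
    · rw [Function.update_self, Function.update_of_ne ha.symm]; simpa [hbot] using h2
    · rw [Function.update_self, Function.update_of_ne ha, add_comm]; simpa [hbot] using h2
  have hother : ∀ w', (∀ y, S.σ v y ≠ w') → (O.neighborSet w').ncard = 2 := by
    intro w' hne
    obtain ⟨a, x, a', x', ha, hw⟩ := S.incidence w'
    rw [hO, ncard_glue _ ha hw, ← hreg w', ncard_glue _ ha hw]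
    have h1 : a ≠ v := by rintro rfl; exact hne x ((hw _ _).2 (Or.inl ⟨rfl, rfl⟩))
    have h2 : a' ≠ v := by rintro rfl; exact hne x' ((hw _ _).2 (Or.inr ⟨rfl, rfl⟩))
    rw [Function.update_of_ne h1, Function.update_of_ne h2]
  have : {x | x ∈ {w' | O.Reachable w w'} ∧ Odd (O.neighborSet x).ncard}
      = S.σ v '' {y | ((L v).neighborSet y).ncard = 1 ∧ O.Reachable w (S.σ v y)} := by
    ext w'
    simp only [Set.mem_ofPred_eq, Set.mem_image]
    constructor
    · rintro ⟨hr, hodd⟩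
      by_cases h : ∃ y, S.σ v y = w'
      · obtain ⟨y, rfl⟩ := h
        refine ⟨y, ⟨?_, hr⟩, rfl⟩
        have := hsum y
        obtain ⟨k, hk⟩ := hodd
        omega
      · rw [hother w' (by simpa using h)] at hodd
        exact absurd hodd (by decide)
    · rintro ⟨y, ⟨h1, hr⟩, rfl⟩
      refine ⟨hr, ?_⟩
      have := hsum y
      rw [show (O.neighborSet (S.σ v y)).ncard = 1 by omega]
      exact odd_one
  rw [this, Set.ncard_image_of_injective _ (S.inj v)] at key
  exact key

theorem reachable_update (L : V → SimpleGraph H) (v : V) (g : SimpleGraph H) {w w' : W}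
    (h : (S.glue (Function.update L v ⊥)).Reachable w w') :
    (S.glue (Function.update L v g)).Reachable w w' := by
  refine h.mono ?_
  rintro _ _ ⟨u, x, y, hxy, rfl, rfl⟩
  by_cases hu : u = v
  · subst hu; simp at hxy
  · refine ⟨u, x, y, ?_, rfl, rfl⟩
    rwa [Function.update_of_ne hu] at hxy ⊢

theorem reachable_of_eqvGen (L : V → SimpleGraph H) (v : V) (g : SimpleGraph H) {x y : H}
    (h : Relation.EqvGen (fun a b =>
      (S.glue (Function.update L v ⊥)).Reachable (S.σ v a) (S.σ v b) ∨ g.Adj a b) x y) :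
    (S.glue (Function.update L v g)).Reachable (S.σ v x) (S.σ v y) := by
  induction h with
  | rel a b h =>
    rcases h with h | h
    · exact reachable_update L v g h
    · exact (glue_adj (S := S) (Function.update L v g) (v := v)
        (by rwa [Function.update_self])).reachable
  | refl a => rfl
  | symm a b _ ih => exact ih.symm
  | trans a b c _ _ ih1 ih2 => exact ih1.trans ih2

/-- Replacing the graph at one vertex keeps points connected that do not lie inside that
vertex. -/
theorem reachable_switch [Finite H] (L : V → SimpleGraph H)
    (hreg : ∀ w, ((S.glue L).neighborSet w).ncard = 2) (v : V) (g : SimpleGraph H)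
    (hatt : ∀ x, ((L v).neighborSet x).ncard ≠ 0 →
      ∃ p, ((L v).neighborSet p).ncard = 1 ∧ (L v).Reachable x p)
    (hports : ∀ x y, ((L v).neighborSet x).ncard = 1 → ((L v).neighborSet y).ncard = 1 →
      (L v).Reachable x y → (S.glue (Function.update L v g)).Reachable (S.σ v x) (S.σ v y))
    {w w' : W} (hw : ∀ x, S.σ v x = w → ((L v).neighborSet x).ncard ≠ 2)
    (hw' : ∀ x, S.σ v x = w' → ((L v).neighborSet x).ncard ≠ 2)
    (h : (S.glue L).Reachable w w') :
    (S.glue (Function.update L v g)).Reachable w w' := by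
  classical
  -- The map `φ` pushes a point that is interior to copy `v` (local degree two) along its local path
  -- to a port and fixes all other points. It then suffices that old edges go to connected pairs.
  have hφ : ∀ w, ∃ w₁, (∀ x, S.σ v x = w → ((L v).neighborSet x).ncard = 2 →
        ∃ p, ((L v).neighborSet p).ncard = 1 ∧ (L v).Reachable x p ∧ w₁ = S.σ v p) ∧
      ((∀ x, S.σ v x = w → ((L v).neighborSet x).ncard ≠ 2) → w₁ = w) := by
    intro w
    by_cases hi : ∃ x, S.σ v x = w ∧ ((L v).neighborSet x).ncard = 2
    · obtain ⟨x, rfl, hx⟩ := hi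
      obtain ⟨p, hp, hr⟩ := hatt x (by omega)
      refine ⟨S.σ v p, ?_, fun h => absurd hx (h x rfl)⟩
      intro x' hx' _
      rw [S.inj v hx']
      exact ⟨p, hp, hr, rfl⟩
    · exact ⟨w, fun x hx h2 => absurd ⟨x, hx, h2⟩ hi, fun _ => rfl⟩
  choose φ hφ1 hφ2 using hφ
  have hle2 : ∀ x, ((L v).neighborSet x).ncard ≤ 2 := fun x => by
    obtain ⟨a, b, a', b', ha, hab⟩ := S.incidence (S.σ v x)
    have := hreg (S.σ v x)
    rw [ncard_glue _ ha hab] at this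
    rcases (hab v x).1 rfl with ⟨rfl, rfl⟩ | ⟨rfl, rfl⟩ <;> omega
  have hport : ∀ x, ((L v).neighborSet x).ncard ≠ 0 →
      ∃ p, ((L v).neighborSet p).ncard = 1 ∧ (L v).Reachable x p ∧ φ (S.σ v x) = S.σ v p := by
    intro x hx
    by_cases h2 : ((L v).neighborSet x).ncard = 2
    · exact hφ1 _ x rfl h2
    · refine ⟨x, by have := hle2 x; omega, by rfl, hφ2 _ fun y hy => ?_⟩
      rwa [S.inj v hy]
  have := reachable_map (G' := S.glue (Function.update L v g)) φ ?_ h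
  · rwa [hφ2 w hw, hφ2 w' hw'] at this
  rintro _ _ ⟨u, x, y, hxy, rfl, rfl⟩
  by_cases hu : u = v
  · subst hu
    have hne : ∀ a b, (L u).Adj a b → ((L u).neighborSet a).ncard ≠ 0 := fun a b hab =>
      (Set.ncard_pos (Set.toFinite _)).2 ⟨b, hab⟩ |>.ne'
    obtain ⟨p, hp, hxp, hp'⟩ := hport x (hne x y hxy)
    obtain ⟨q, hq, hyq, hq'⟩ := hport y (hne y x hxy.symm)
    rw [hp', hq']
    exact hports p q hp hq (hxp.symm.trans (hxy.reachable.trans hyq))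
  -- A point carrying an edge of another copy `u` has local degree at most one in copy `v`, because
  -- its total degree is two; hence `φ` fixes it.
  · have hnot : ∀ a b, (L u).Adj a b → φ (S.σ u a) = S.σ u a := by
      intro a b hab
      apply hφ2
      intro z hz h2
      obtain ⟨a1, b1, a2, b2, ha, hab'⟩ := S.incidence (S.σ u a)
      have hr := hreg (S.σ u a)
      rw [ncard_glue _ ha hab'] at hr
      have hpos : 0 < ((L u).neighborSet a).ncard := (Set.ncard_pos (Set.toFinite _)).2 ⟨b, hab⟩
      rcases (hab' u a).1 rfl with ⟨rfl, rfl⟩ | ⟨rfl, rfl⟩ <;>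
        rcases (hab' v z).1 hz with ⟨h3, h4⟩ | ⟨h3, h4⟩ <;>
        first
        | exact hu h3.symm
        | (subst h3 h4; omega)
    rw [hnot x y hxy, hnot y x hxy.symm]
    exact (glue_adj (S := S) (Function.update L v g) (v := u)
      (by rwa [Function.update_of_ne hu])).reachable

end Switch

/-- A list of local configurations whose members can be chosen so as to connect all ports of the
same block, whatever the connections outside are. -/
structure Switchable (d : C → H → ℕ) (β : Type*) (blk : C → H → β)
    (Λ : Set (C → SimpleGraph H)) : Prop where
  nonempty : Λ.Nonempty
  degree : ∀ ℓ ∈ Λ, ∀ c x, ((ℓ c).neighborSet x).ncard = d c x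
  attach : ∀ ℓ ∈ Λ, ∀ c x, d c x ≠ 0 → ∃ p, d c p = 1 ∧ (ℓ c).Reachable x p
  block : ∀ ℓ ∈ Λ, ∀ c x y, d c x = 1 → d c y = 1 → (ℓ c).Reachable x y → blk c x = blk c y
  -- `E c` is the connectivity of colour `c` outside the vertex, and evenness is what `even_ports`
  -- supplies. One member of `Λ` has to serve all colours simultaneously.
  choice : ∀ E : C → H → H → Prop, (∀ c, Equivalence (E c)) →
    (∀ c x, Even {y | d c y = 1 ∧ E c x y}.ncard) →
    ∃ ℓ ∈ Λ, ∀ c x y, d c x = 1 → d c y = 1 → blk c x = blk c y →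
      Relation.EqvGen (fun a b => E c a b ∨ (ℓ c).Adj a b) x y

/-- The vertices are treated in turn, each choice answering the connectivity outside the vertex at
that moment. Joins made before survive: by `block`, the old local graph connected only ports of one
block, and the new one, with outside help, reconnects them. -/
theorem exists_switching [Finite V] [Finite W] [Finite H] (d : V → C → H → ℕ) {β : Type*}
    (blk : V → C → H → β) (Λ : V → Set (C → SimpleGraph H))
    (hΛ : ∀ v, Switchable (d v) β (blk v) (Λ v))
    (hd : ∀ v x v' x', v ≠ v' → S.σ v x = S.σ v' x' → ∀ c, d v c x + d v' c x' = 2) :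
    ∃ L : V → C → SimpleGraph H, (∀ v, L v ∈ Λ v) ∧
      ∀ v c x y, d v c x = 1 → d v c y = 1 → blk v c x = blk v c y →
        (S.glue fun u => L u c).Reachable (S.σ v x) (S.σ v y) := by
  classical
  have hreg : ∀ L : V → C → SimpleGraph H, (∀ v, L v ∈ Λ v) → ∀ c w,
      ((S.glue fun u => L u c).neighborSet w).ncard = 2 := by
    intro L hL c w
    obtain ⟨v, x, v', x', hv, hw⟩ := S.incidence w
    rw [ncard_glue _ hv hw, (hΛ v).degree _ (hL v), (hΛ v').degree _ (hL v')]
    exact hd v x v' x' hv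
      (((hw v x).2 (Or.inl ⟨rfl, rfl⟩)).trans ((hw v' x').2 (Or.inr ⟨rfl, rfl⟩)).symm) c
  cases nonempty_fintype V
  have main : ∀ s : Finset V, ∃ L : V → C → SimpleGraph H, (∀ v, L v ∈ Λ v) ∧
      ∀ v ∈ s, ∀ c x y, d v c x = 1 → d v c y = 1 → blk v c x = blk v c y →
        (S.glue fun u => L u c).Reachable (S.σ v x) (S.σ v y) := by
    intro s
    induction s using Finset.induction_on with
    | empty =>
      choose ℓ hℓ using fun v => (hΛ v).nonempty
      exact ⟨ℓ, hℓ, by simp⟩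
    | insert v s _ ih =>
      obtain ⟨L, hL, hs⟩ := ih
      have hupd : ∀ (ℓ : C → SimpleGraph H) (c : C), (fun u => Function.update L v ℓ u c)
          = Function.update (fun u => L u c) v (ℓ c) := by
        intro ℓ c; funext u
        by_cases hu : u = v
        · subst hu; simp
        · simp [Function.update_of_ne hu]
      obtain ⟨ℓ, hℓ, hch⟩ := (hΛ v).choice
        (fun c x y => (S.glue (Function.update (fun u => L u c) v ⊥)).Reachable
          (S.σ v x) (S.σ v y))
        (fun c => ⟨fun _ => by rfl, fun h => h.symm, fun h h' => h.trans h'⟩)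
        (fun c x => by
          have := even_ports (S := S) (fun u => L u c) (hreg L hL c) v (S.σ v x)
          simpa only [(hΛ v).degree _ (hL v)] using this)
      have hnew : ∀ c x y, d v c x = 1 → d v c y = 1 → blk v c x = blk v c y →
          (S.glue fun u => Function.update L v ℓ u c).Reachable (S.σ v x) (S.σ v y) := by
        intro c x y hx hy hb
        rw [hupd]
        exact reachable_of_eqvGen _ v _ (hch c x y hx hy hb)
      refine ⟨Function.update L v ℓ, fun u => ?_, fun u hu c x y hx hy hb => ?_⟩
      · by_cases huv : u = v
        · subst huv; simpa using hℓ
        · simpa [Function.update_of_ne huv] using hL u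
      · by_cases huv : u = v
        · subst huv; exact hnew c x y hx hy hb
        have hus : u ∈ s := (Finset.mem_insert.mp hu).resolve_left huv
        have hold := hs u hus c x y hx hy hb
        rw [hupd]
        -- A port of `u` has degree one there, so also degree one in the second copy containing it;
        -- it is never interior to `v`, as `reachable_switch` requires.
        have hnd : ∀ z, d u c z = 1 → ∀ z', S.σ v z' = S.σ u z →
            ((L v c).neighborSet z').ncard ≠ 2 := by
          intro z hz z' hz'
          have := hd v z' u z (Ne.symm huv) hz' c
          rw [(hΛ v).degree _ (hL v)]
          omega
        refine reachable_switch (S := S) (fun u => L u c) (hreg L hL c) v (ℓ c) ?_ ?_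
          (hnd x hx) (hnd y hy) hold
        · intro z hz
          simp only [(hΛ v).degree _ (hL v)] at hz ⊢
          exact (hΛ v).attach _ (hL v) c z hz
        · intro p q hp hq hpq
          simp only [(hΛ v).degree _ (hL v)] at hp hq
          rw [← hupd]
          exact hnew c p q hp hq ((hΛ v).block _ (hL v) c p q hp hq hpq)
  obtain ⟨L, hL, h⟩ := main Finset.univ
  exact ⟨L, hL, fun v => h v (Finset.mem_univ v)⟩

end Copies

end HamFrag

/-! ### The copies inside a line graph, and schemes of local colourings -/

namespace HamFrag

namespace DirTwoFactorisation

variable {V : Type*} {G : SimpleGraph V} {n : ℕ} (F : DirTwoFactorisation G n)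

theorem sigma_inl (v : V) (k : Idx n) : F.sigma (F.next k v) (Sum.inl k) = F.sigma v (Sum.inr k) := by
  apply Subtype.ext
  simp [sigma, sigmaFun]

theorem sigma_inr_injective {u u' : V} {k k' : Idx n}
    (h : F.sigma u (Sum.inr k) = F.sigma u' (Sum.inr k')) : u = u' ∧ k = k' := by
  replace h := congrArg Subtype.val h
  simp only [sigma, sigmaFun, Function.Embedding.coeFn_mk] at h
  rcases Sym2.eq_iff.mp h with ⟨h1, h2⟩ | ⟨h1, h2⟩
  · subst h1
    exact ⟨rfl, (F.existsUnique _ _ (F.adj k u)).unique (Or.inl rfl) (Or.inl h2.symm)⟩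
  · have hk : k = k' := (F.existsUnique _ _ (F.adj k u)).unique (Or.inl rfl)
      (Or.inr (by rw [h2, h1]))
    subst hk
    exact absurd (by rw [h2, ← h1]) (F.next_next_ne k u)

theorem exists_sigma_inr (w : G.edgeSet) : ∃ v k, F.sigma v (Sum.inr k) = w := by
  obtain ⟨e, he⟩ := w
  induction e with | _ x y =>
  obtain ⟨i, hi | hi, _⟩ := F.existsUnique x y he
  · exact ⟨x, i, Subtype.ext (by simp [sigma, sigmaFun, hi])⟩
  · exact ⟨y, i, Subtype.ext (by simp [sigma, sigmaFun, hi, Sym2.eq_swap])⟩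

/-- Every edge of `G` occurs in exactly two roles: as `b_k` at its tail and as `a_k` at its head. -/
theorem sigma_eq_inr {u v : V} {k : Idx n} {y : Lab n} (h : F.sigma u y = F.sigma v (Sum.inr k)) :
    (u = v ∧ y = Sum.inr k) ∨ (u = F.next k v ∧ y = Sum.inl k) := by
  rcases y with j | j
  · have h' := F.sigma_inl ((F.next j).symm u) j
    rw [Equiv.apply_symm_apply] at h'
    obtain ⟨h1, rfl⟩ := F.sigma_inr_injective (h'.symm.trans h)
    exact Or.inr ⟨by rw [← h1, Equiv.apply_symm_apply], rfl⟩
  · obtain ⟨rfl, rfl⟩ := F.sigma_inr_injective h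
    exact Or.inl ⟨rfl, rfl⟩

theorem mem_sigma (v : V) (x : Lab n) : v ∈ (F.sigma v x).1 := by
  rcases x with k | k <;> simp [sigma, sigmaFun]

/-- The maps `σ_v` as a system of copies. -/
def copies : Copies V (Lab n) G.edgeSet where
  σ := fun v => F.sigma v
  inj := fun v => (F.sigma v).injective
  disj := by
    intro v u x x' y y' hx hy
    by_cases hvu : v = u
    · exact Or.inl hvu
    · right
      apply (F.sigma v).injective
      apply Subtype.ext
      -- An edge of `G` in the copies of two distinct vertices contains both of them, and a simple
      -- graph has only one such edge.
      have h1 : (F.sigma v x).1 = s(v, u) :=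
        (Sym2.mem_and_mem_iff hvu).1 ⟨F.mem_sigma v x, hx ▸ F.mem_sigma u x'⟩
      have h2 : (F.sigma v y).1 = s(v, u) :=
        (Sym2.mem_and_mem_iff hvu).1 ⟨F.mem_sigma v y, hy ▸ F.mem_sigma u y'⟩
      exact h1.trans h2.symm
  incidence := by
    intro w
    obtain ⟨v, k, rfl⟩ := F.exists_sigma_inr w
    refine ⟨v, Sum.inr k, F.next k v, Sum.inl k, (F.adj k v).ne, fun u y => ⟨F.sigma_eq_inr, ?_⟩⟩
    rintro (⟨rfl, rfl⟩ | ⟨rfl, rfl⟩)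
    · rfl
    · exact F.sigma_inl v k

theorem copies_inl (v : V) (k : Idx n) :
    F.copies.σ (F.next k v) (Sum.inl k) = F.copies.σ v (Sum.inr k) := F.sigma_inl v k

end DirTwoFactorisation

/-- The role of a vertex in a cycle of a `2`-factor: each cycle has one vertex of class `first`,
its successor has class `second`, and all others have class `other`. -/
inductive Cls
  | first
  | second
  | other
  deriving DecidableEq

/-- A choice of roles for the vertices with respect to all the factors. -/
structure Placement {V I : Type*} (next : I → Equiv.Perm V) where
  κ : V → I → Cls
  step : ∀ v k, κ v k = Cls.first ↔ κ (next k v) k = Cls.second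
  hits : ∀ k v j, ∃ u, (next k).SameCycle v u ∧ κ u k = j

/-- The label of an element of `A_n ∪ B_n`. -/
def label {n : ℕ} : Lab n → Idx n := Sum.elim id id

/-- The degrees prescribed for a colour class by the numbers of edges at the tails. -/
def degOf {n : ℕ} {C : Type*} (D X : Idx n → C → ℕ) (κ : Idx n → Cls) (c : C) : Lab n → ℕ
  | Sum.inl k => 2 - (if κ k = Cls.second then X k c else D k c)
  | Sum.inr k => if κ k = Cls.first then X k c else D k c

/-- `s t` together with the two halves of label `k`. -/
def quad {n : ℕ} (s t : Lab n) (k : Idx n) : Set (Lab n) := {s, t, Sum.inl k, Sum.inr k}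

/-- Local edge colourings from which a Hamilton decomposition of the line graph of every
`2n`-regular graph with a directed `2`-factorisation can be assembled. -/
structure Scheme (n : ℕ) (C : Type*) where
  allowed : (Idx n → Cls) → Prop
  -- `X` prescribes the degree of `b_k` at the first vertex of a cycle of factor `k`, and `D` the
  -- degree at all its other vertices; the degree of `a_k` at the head is the complement to two.
  D : Idx n → C → ℕ
  X : Idx n → C → ℕ
  D_le : ∀ k c, D k c ≤ 2
  X_le : ∀ k c, X k c ≤ 2
  -- Whether a label has ports in a colour thus does not depend on the vertex, so a port continues
  -- around a whole cycle of its factor.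
  euler : ∀ k c, D k c = 1 ↔ X k c = 1
  blk : (Idx n → Cls) → C → Idx n → Idx n
  Λ : (Idx n → Cls) → Set (C → SimpleGraph (Lab n))
  switch : ∀ κ, allowed κ →
    Copies.Switchable (degOf D X κ) (Idx n) (fun c x => blk κ c (label x)) (Λ κ)
  partition : ∀ κ, allowed κ → ∀ ℓ ∈ Λ κ, ∀ x y, x ≠ y → ∃! c, (ℓ c).Adj x y
  -- These labels run through closed cycles of rungs in colour `z k`; the colours `p k` and `i k`
  -- lend edges when such a cycle is merged with the rest.
  gam : Idx n → Prop
  z : Idx n → C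
  p : Idx n → C
  i : Idx n → C
  gam_top : ¬ gam none
  z_ne_p : ∀ k, gam k → z k ≠ p k
  z_ne_i : ∀ k, gam k → z k ≠ i k
  p_ne_i : ∀ k, gam k → p k ≠ i k
  rank : Idx n → ℕ
  -- Every cycle of factor `k` has a vertex in role `j`, and there the block of `k` contains a label
  -- of smaller rank. The descent can only stop at `∞`.
  link : ∀ c k, D k c = 1 → ¬ (gam k ∧ z k = c) → k ≠ none → ∃ j, ∀ κ, allowed κ → κ k = j →
    ∃ k', D k' c = 1 ∧ ¬ (gam k' ∧ z k' = c) ∧ rank k' < rank k ∧ blk κ c k = blk κ c k'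
  attach : ∀ κ, allowed κ → ∀ ℓ ∈ Λ κ, ∀ c x, degOf D X κ c x ≠ 0 →
    ¬ (gam (label x) ∧ z (label x) = c) → ∃ y, degOf D X κ c y = 1 ∧
      ¬ (gam (label y) ∧ z (label y) = c) ∧ (ℓ c).Reachable x y
  gadget : ∀ κ, allowed κ → ∀ ℓ ∈ Λ κ, ∃ s t : Idx n → Lab n,
    (∀ k, gam k → label (s k) ≠ k ∧ label (t k) ≠ k ∧
      ¬ (gam (label (s k)) ∧ z (label (s k)) = z k) ∧
      (ℓ (z k)).Adj (Sum.inl k) (Sum.inr k) ∧ (ℓ (z k)).Adj (s k) (t k) ∧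
      (ℓ (p k)).Adj (s k) (Sum.inr k) ∧ (ℓ (p k)).Adj (Sum.inr k) (t k) ∧
      (ℓ (i k)).Adj (s k) (Sum.inl k) ∧ (ℓ (i k)).Adj (Sum.inl k) (t k)) ∧
    ∀ k k', gam k → gam k' → k ≠ k' →
      (quad (s k) (t k) k ∩ quad (s k') (t k') k').Subsingleton

namespace Scheme

variable {n : ℕ} {C : Type*} (Sc : Scheme n C)

/-- Label `k` runs through closed cycles of its own in colour `c`. -/
def own (c : C) (k : Idx n) : Prop := Sc.gam k ∧ Sc.z k = c

theorem deg_eq_one {κ : Idx n → Cls} {c : C} {x : Lab n} :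
    degOf Sc.D Sc.X κ c x = 1 ↔ Sc.D (label x) c = 1 := by
  have h1 := Sc.euler (label x) c
  have h2 := Sc.D_le (label x) c
  have h3 := Sc.X_le (label x) c
  rcases x with k | k <;> simp only [degOf, label, Sum.elim_inl, Sum.elim_inr, id] at * <;>
    split_ifs <;> omega

variable {V : Type*} {G : SimpleGraph V} (F : DirTwoFactorisation G n)

/-- After switching, ports of one block are connected at every vertex. Both ends of a label lie in
one block, so connectivity propagates along the cycles of its factor; `link` passes to labels of
smaller rank until the Hamilton cycle `F_∞` reaches all vertices. Points that are no ports are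
attached to ports by `attach`. -/
theorem exists_core [Finite V] (P : Placement F.next) (hP : ∀ v, Sc.allowed (P.κ v))
    (htop : ∀ v w : V, (F.next none).SameCycle v w) :
    ∃ L : V → C → SimpleGraph (Lab n), (∀ v, L v ∈ Sc.Λ (P.κ v)) ∧
      (∀ c w, ((F.copies.glue fun u => L u c).neighborSet w).ncard = 2) ∧
      ∀ c v v' k k', ¬ Sc.own c k → ¬ Sc.own c k' → (F.copies.glue fun u => L u c).Reachable
        (F.copies.σ v (Sum.inr k)) (F.copies.σ v' (Sum.inr k')) := by
  have hfin : Finite G.edgeSet := inferInstance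
  -- The head has role second exactly when the tail has role first, so both degrees refer to the
  -- same entry of `D` or `X`.
  have hd0 : ∀ v k c, degOf Sc.D Sc.X (P.κ v) c (Sum.inr k)
      + degOf Sc.D Sc.X (P.κ (F.next k v)) c (Sum.inl k) = 2 := by
    intro v k c
    have h1 := P.step v k
    have h2 := Sc.D_le k c
    have h3 := Sc.X_le k c
    simp only [degOf, ← h1]
    split_ifs <;> omega
  have hd : ∀ v x v' x', v ≠ v' → F.copies.σ v x = F.copies.σ v' x' → ∀ c,
      degOf Sc.D Sc.X (P.κ v) c x + degOf Sc.D Sc.X (P.κ v') c x' = 2 := by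
    intro v x v' x' hv h c
    rcases x' with k | k
    · have h' := F.copies_inl ((F.next k).symm v') k
      rw [Equiv.apply_symm_apply] at h'
      rcases F.sigma_eq_inr (h.trans h') with ⟨rfl, rfl⟩ | ⟨h1, rfl⟩
      · have := hd0 ((F.next k).symm v') k c
        rwa [Equiv.apply_symm_apply] at this
      · exact absurd (by rw [h1, Equiv.apply_symm_apply]) hv
    · rcases F.sigma_eq_inr h with ⟨rfl, rfl⟩ | ⟨rfl, rfl⟩
      · exact absurd rfl hv
      · rw [add_comm]; exact hd0 v' k c
  obtain ⟨L, hL, hports⟩ := Copies.exists_switching (S := F.copies)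
    (fun v => degOf Sc.D Sc.X (P.κ v)) (fun v c x => Sc.blk (P.κ v) c (label x))
    (fun v => Sc.Λ (P.κ v)) (fun v => Sc.switch _ (hP v)) hd
  have hdeg : ∀ v c x, ((L v c).neighborSet x).ncard = degOf Sc.D Sc.X (P.κ v) c x :=
    fun v => (Sc.switch _ (hP v)).degree _ (hL v)
  refine ⟨L, hL, ?_, ?_⟩
  · intro c w
    obtain ⟨v, x, v', x', hv, hw⟩ := F.copies.incidence w
    rw [Copies.ncard_glue _ hv hw, hdeg, hdeg]
    exact hd v x v' x' hv
      (((hw v x).2 (Or.inl ⟨rfl, rfl⟩)).trans ((hw v' x').2 (Or.inr ⟨rfl, rfl⟩)).symm) c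
  intro c
  set Gc := F.copies.glue fun u => L u c with hGc
  have hp' : ∀ v x y, Sc.D (label x) c = 1 → Sc.D (label y) c = 1 →
      Sc.blk (P.κ v) c (label x) = Sc.blk (P.κ v) c (label y) →
      Gc.Reachable (F.copies.σ v x) (F.copies.σ v y) := fun v x y hx hy hb =>
    hports v c x y (Sc.deg_eq_one.2 hx) (Sc.deg_eq_one.2 hy) hb
  have hcyc : ∀ k, Sc.D k c = 1 → ∀ v u, (F.next k).SameCycle v u →
      Gc.Reachable (F.copies.σ v (Sum.inr k)) (F.copies.σ u (Sum.inr k)) := by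
    intro k hk v u hvu
    obtain ⟨j, rfl⟩ : ∃ j : ℕ, (F.next k ^ j) v = u :=
      let ⟨j, _, h⟩ := hvu.exists_pow_eq'; ⟨j, h⟩
    clear hvu
    induction j with
    | zero => rfl
    | succ j ih =>
      rw [pow_succ', Equiv.Perm.mul_apply]
      refine ih.trans ?_
      rw [← F.copies_inl]
      exact hp' _ _ _ hk hk rfl
  -- Strong induction on the rank: go around the cycle to a vertex in the linking role, and change
  -- to the label of smaller rank there.
  have heul : ∀ r k, Sc.rank k ≤ r → Sc.D k c = 1 → ¬ Sc.own c k → ∀ v u,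
      Gc.Reachable (F.copies.σ v (Sum.inr k)) (F.copies.σ u (Sum.inr none)) := by
    intro r
    induction r using Nat.strong_induction_on with
    | _ r ih =>
      intro k hr hk hown v u
      rcases eq_or_ne k none with rfl | hne
      · exact hcyc none hk v u (htop v u)
      obtain ⟨j, hj⟩ := Sc.link c k hk hown hne
      obtain ⟨a, hva, ha⟩ := P.hits k v j
      obtain ⟨k', hk', hown', hrank, hblk⟩ := hj _ (hP a) ha
      exact (hcyc k hk v a hva).trans ((hp' a (Sum.inr k) (Sum.inr k') hk hk' hblk).trans
        (ih (Sc.rank k') (by omega) k' le_rfl hk' hown' a u))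
  have hport : ∀ v x, Sc.D (label x) c = 1 → ¬ Sc.own c (label x) → ∀ u,
      Gc.Reachable (F.copies.σ v x) (F.copies.σ u (Sum.inr none)) := by
    intro v x hx hown u
    exact (hp' v x (Sum.inr (label x)) hx hx rfl).trans (heul _ _ le_rfl hx hown v u)
  have hall : ∀ v k, ¬ Sc.own c k → ∀ u,
      Gc.Reachable (F.copies.σ v (Sum.inr k)) (F.copies.σ u (Sum.inr none)) := by
    intro v k hown u
    have hatt : ∀ a x, label x = k → degOf Sc.D Sc.X (P.κ a) c x ≠ 0 →
        Gc.Reachable (F.copies.σ a x) (F.copies.σ u (Sum.inr none)) := by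
      intro a x hx h0
      obtain ⟨y, hy, hyown, hxy⟩ := Sc.attach _ (hP a) _ (hL a) c x h0 (by rw [hx]; exact hown)
      exact (Copies.glue_reachable (S := F.copies) (fun u => L u c) hxy).trans
        (hport a y (Sc.deg_eq_one.1 hy) hyown u)
    -- Degree zero at the tail means degree two at the head, so the point is attached from one of
    -- its two sides.
    by_cases h0 : degOf Sc.D Sc.X (P.κ v) c (Sum.inr k) = 0
    · rw [← F.copies_inl]
      exact hatt _ _ rfl (by have := hd0 v k c; omega)
    · exact hatt _ _ rfl h0
  intro v v' k k' hk hk'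
  exact (hall v k hk v).trans (hall v' k' hk' v).symm

end Scheme

end HamFrag

/-! ### The gadget exchange between three colours -/

namespace HamFrag

section Components

variable {α : Type*} [DecidableEq α]

/-- Representatives of the connected components of a list of edges. -/
def compRep : List (α × α) → α → α
  | [], x => x
  | (a, b) :: l, x =>
    let r := compRep l
    if r x = r a then r b else r x

theorem eqvGen_compRep (l : List (α × α)) (x : α) :
    Relation.EqvGen (fun a b => (a, b) ∈ l) x (compRep l x) := by
  induction l generalizing x with
  | nil => exact Relation.EqvGen.refl _
  | cons q l ih =>
    obtain ⟨a, b⟩ := q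
    have ih' : ∀ x, Relation.EqvGen (fun a' b' => (a', b') ∈ (a, b) :: l) x (compRep l x) :=
      fun x => (ih x).mono fun _ _ h => List.mem_cons_of_mem _ h
    simp only [compRep]
    split_ifs with h
    · refine (ih' x).trans _ _ _ ?_
      rw [h]
      exact ((ih' a).symm _ _).trans _ _ _ ((Relation.EqvGen.rel _ _ (by simp)).trans _ _ _ (ih' b))
    · exact ih' x

theorem eqvGen_of_compRep_eq {l : List (α × α)} {x y : α} (h : compRep l x = compRep l y) :
    Relation.EqvGen (fun a b => (a, b) ∈ l) x y :=
  (eqvGen_compRep l x).trans _ _ _ (h ▸ (eqvGen_compRep l y).symm _ _)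

end Components

section Recolour

/-- The symmetric relation given by a list of pairs. -/
def symRel {α : Type*} (l : List (α × α)) (a b : α) : Prop := (a, b) ∈ l ∨ (b, a) ∈ l

instance {α : Type*} [DecidableEq α] (l : List (α × α)) : DecidableRel (symRel l) :=
  fun _ _ => inferInstanceAs (Decidable (_ ∨ _))

theorem symRel.symm {α : Type*} {l : List (α × α)} {a b : α} (h : symRel l a b) : symRel l b a :=
  Or.symm h

/-- Edges removed from the three colours of a gadget. -/
def gadgetOld : Fin 3 → List (Fin 7 × Fin 7)
  -- Vertex 0 is the edge of factor `k` from `v` to its successor, 1 and 2 are the next and the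
  -- previous edge of that factor; 3, 4 are the points `s`, `t` at the successor and 5, 6 those at
  -- `v`. Before the exchange colour 0 has the rungs 2-0-1 and the chords 3-4 and 5-6, colour 1 has
  -- the paths 3-1-4 and 5-0-6, and colour 2 has the paths 3-0-4 and 5-2-6.
  | 0 => [(3, 4), (0, 1), (5, 6), (0, 2)]
  | 1 => [(1, 4), (5, 0), (0, 6)]
  | 2 => [(3, 0), (0, 4), (2, 6)]

/-- Edges added to the three colours of a gadget. -/
def gadgetNew : Fin 3 → List (Fin 7 × Fin 7)
  -- In colour 1 vertex 0 moves from between 5 and 6 to between 1 and 4, in colour 2 from between 3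
  -- and 4 to between 2 and 6. Colour 0 gives up its four edges and receives four from the other two
  -- colours.
  | 0 => [(3, 0), (1, 4), (5, 0), (2, 6)]
  | 1 => [(1, 0), (0, 4), (5, 6)]
  | 2 => [(3, 4), (2, 0), (0, 6)]

/-- Edges of the three colours of a gadget before the exchange. -/
def gadgetAll : Fin 3 → List (Fin 7 × Fin 7)
  | 0 => [(3, 4), (0, 1), (5, 6), (0, 2)]
  | 1 => [(3, 1), (1, 4), (5, 0), (0, 6)]
  | 2 => [(3, 0), (0, 4), (5, 2), (2, 6)]

/-- All pairs of a gadget. -/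
def gadgetPairs : List (Fin 7 × Fin 7) :=
  [(3, 4), (0, 1), (5, 6), (0, 2), (3, 1), (1, 4), (5, 0), (0, 6), (3, 0), (0, 4), (5, 2), (2, 6)]

theorem gadgetNew_irrefl : ∀ j a, ¬ symRel (gadgetNew j) a a := by decide

variable {W C : Type*}

/-- Exchange of the edges of a gadget. -/
def recolour (Gr : C → SimpleGraph W) (q : Fin 7 ↪ W) (col : Fin 3 → C) (c : C) :
    SimpleGraph W where
  Adj x y := (Gr c).Adj x y ∧ (¬ ∃ j a b, col j = c ∧ symRel (gadgetOld j) a b ∧ q a = x ∧ q b = y) ∨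
    ∃ j a b, col j = c ∧ symRel (gadgetNew j) a b ∧ q a = x ∧ q b = y
  symm := ⟨by
    rintro x y (⟨h, hn⟩ | ⟨j, a, b, hj, hab, hx, hy⟩)
    · exact Or.inl ⟨h.symm, fun ⟨j, a, b, hj, hab, hx, hy⟩ => hn ⟨j, b, a, hj, hab.symm, hy, hx⟩⟩
    · exact Or.inr ⟨j, b, a, hj, hab.symm, hy, hx⟩⟩
  loopless := ⟨by
    rintro x (⟨h, _⟩ | ⟨j, a, b, _, hab, hx, hy⟩)
    · exact h.ne rfl
    · have := q.injective (hx.trans hy.symm)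
      subst this
      exact gadgetNew_irrefl j a hab⟩

/-- The edge-disjoint families in which a given gadget is present. -/
structure HasGadget (Gr : C → SimpleGraph W) (q : Fin 7 ↪ W) (col : Fin 3 → C) : Prop where
  disj : ∀ c c' x y, (Gr c).Adj x y → (Gr c').Adj x y → c = c'
  reg : ∀ c w, ((Gr c).neighborSet w).ncard = 2
  inj : Function.Injective col
  edges : ∀ j a b, symRel (gadgetAll j) a b → (Gr (col j)).Adj (q a) (q b)

variable {Gr : C → SimpleGraph W} {q : Fin 7 ↪ W} {col : Fin 3 → C}

theorem gadgetOld_all : ∀ j a b, symRel (gadgetOld j) a b → symRel (gadgetAll j) a b := by decide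

theorem exists_gadgetOld : ∀ j a b, symRel (gadgetNew j) a b →
    ¬ symRel (gadgetOld j) a b ∧ ∃ j', symRel (gadgetOld j') a b := by decide

theorem exists_gadgetNew : ∀ j a b, symRel (gadgetOld j) a b →
    ∃ j', symRel (gadgetNew j') a b := by decide

theorem gadgetNew_unique : ∀ j j' a b, symRel (gadgetNew j) a b → symRel (gadgetNew j') a b →
    j = j' := by decide

theorem gadget_degree : ∀ j a, (Finset.univ.filter fun b => symRel (gadgetOld j) a b).card
    = (Finset.univ.filter fun b => symRel (gadgetNew j) a b).card := by decide

theorem HasGadget.old (h : HasGadget Gr q col) {j a b} (hab : symRel (gadgetOld j) a b) :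
    (Gr (col j)).Adj (q a) (q b) := h.edges j a b (gadgetOld_all j a b hab)

theorem HasGadget.recolour_disj (h : HasGadget Gr q col) (c c' x y)
    (h1 : (recolour Gr q col c).Adj x y) (h2 : (recolour Gr q col c').Adj x y) : c = c' := by
  have mixed : ∀ c c' x y, ((Gr c).Adj x y ∧
      (¬ ∃ j a b, col j = c ∧ symRel (gadgetOld j) a b ∧ q a = x ∧ q b = y)) →
      (∃ j a b, col j = c' ∧ symRel (gadgetNew j) a b ∧ q a = x ∧ q b = y) → False := by
    rintro c c' x y ⟨hc, hn⟩ ⟨j, a, b, rfl, hab, rfl, rfl⟩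
    obtain ⟨_, j', hj'⟩ := exists_gadgetOld j a b hab
    exact hn ⟨j', a, b, h.disj _ _ _ _ (h.old hj') hc, hj', rfl, rfl⟩
  rcases h1 with h1 | h1 <;> rcases h2 with h2 | h2
  · exact h.disj _ _ _ _ h1.1 h2.1
  · exact (mixed _ _ _ _ h1 h2).elim
  · exact (mixed _ _ _ _ h2 h1).elim
  · obtain ⟨j, a, b, rfl, hab, rfl, rfl⟩ := h1
    obtain ⟨j', a', b', rfl, hab', ha, hb⟩ := h2
    rw [q.injective ha, q.injective hb] at hab'
    rw [gadgetNew_unique _ _ _ _ hab hab']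

theorem HasGadget.recolour_union (h : HasGadget Gr q col) (x y) :
    (∃ c, (recolour Gr q col c).Adj x y) ↔ ∃ c, (Gr c).Adj x y := by
  constructor
  · rintro ⟨c, h1 | ⟨j, a, b, rfl, hab, rfl, rfl⟩⟩
    · exact ⟨c, h1.1⟩
    · obtain ⟨_, j', hj'⟩ := exists_gadgetOld j a b hab
      exact ⟨_, h.old hj'⟩
  · rintro ⟨c, hc⟩
    by_cases hn : ∃ j a b, col j = c ∧ symRel (gadgetOld j) a b ∧ q a = x ∧ q b = y
    · obtain ⟨j, a, b, _, hab, hx, hy⟩ := hn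
      obtain ⟨j', hj'⟩ := exists_gadgetNew j a b hab
      exact ⟨col j', Or.inr ⟨j', a, b, rfl, hj', hx, hy⟩⟩
    · exact ⟨c, Or.inl ⟨hc, hn⟩⟩

theorem recolour_of_ne {c : C} (hc : ∀ j, col j ≠ c) : recolour Gr q col c = Gr c := by
  ext x y
  simp [recolour, hc]

theorem HasGadget.recolour_reg [Finite W] (h : HasGadget Gr q col) (c w) :
    ((recolour Gr q col c).neighborSet w).ncard = 2 := by
  classical
  by_cases hc : ∀ j, col j ≠ c
  · rw [recolour_of_ne hc]; exact h.reg c w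
  push Not at hc
  obtain ⟨j, rfl⟩ := hc
  by_cases hw : ∃ a, q a = w
  · obtain ⟨a, rfl⟩ := hw
    have hset : (recolour Gr q col (col j)).neighborSet (q a)
        = ((Gr (col j)).neighborSet (q a) \ q '' {b | symRel (gadgetOld j) a b})
          ∪ q '' {b | symRel (gadgetNew j) a b} := by
      ext y
      simp only [SimpleGraph.mem_neighborSet, recolour, Set.mem_union, Set.mem_sdiff, Set.mem_image,
        Set.mem_ofPred_eq]
      constructor
      · rintro (⟨h1, h2⟩ | ⟨j', a', b, hj, hab, ha, hb⟩)
        · exact Or.inl ⟨h1, fun ⟨b, hb, hy⟩ => h2 ⟨j, a, b, rfl, hb, rfl, hy⟩⟩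
        · rw [h.inj hj, q.injective ha] at hab
          exact Or.inr ⟨b, hab, hb⟩
      · rintro (⟨h1, h2⟩ | ⟨b, hb, hy⟩)
        · refine Or.inl ⟨h1, fun ⟨j', a', b, hj, hab, ha, hb⟩ => h2 ⟨b, ?_, hb⟩⟩
          rwa [h.inj hj, q.injective ha] at hab
        · exact Or.inr ⟨j, a, b, rfl, hb, rfl, hy⟩
    have hsub : q '' {b | symRel (gadgetOld j) a b} ⊆ (Gr (col j)).neighborSet (q a) := by
      rintro _ ⟨b, hb, rfl⟩
      exact h.old hb
    have hdis : Disjoint ((Gr (col j)).neighborSet (q a) \ q '' {b | symRel (gadgetOld j) a b})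
        (q '' {b | symRel (gadgetNew j) a b}) := by
      rw [Set.disjoint_left]
      rintro _ ⟨h1, h2⟩ ⟨b, hb, rfl⟩
      obtain ⟨hn, j', hj'⟩ := exists_gadgetOld j a b hb
      have := h.inj (h.disj _ _ _ _ (h.old hj') h1)
      rw [this] at hj'
      exact hn hj'
    have hcard : ∀ l : List (Fin 7 × Fin 7), (q '' {b | symRel l a b}).ncard
        = (Finset.univ.filter fun b => symRel l a b).card := by
      intro l
      rw [Set.ncard_image_of_injective _ q.injective, ← Set.ncard_coe_finset]
      congr 1; ext; simp
    rw [hset, Set.ncard_union_eq hdis (Set.toFinite _) (Set.toFinite _),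
      Set.ncard_sdiff hsub (Set.toFinite _), h.reg, hcard, hcard, gadget_degree]
    have := Set.ncard_le_ncard hsub (Set.toFinite _)
    rw [h.reg, hcard, gadget_degree] at this
    omega
  · rw [← h.reg (col j) w]
    congr 1
    ext y
    simp only [SimpleGraph.mem_neighborSet, recolour]
    constructor
    · rintro (⟨h1, _⟩ | ⟨_, a, _, _, _, ha, _⟩)
      · exact h1
      · exact absurd ⟨a, ha⟩ hw
    · exact fun h1 => Or.inl ⟨h1, fun ⟨_, a, _, _, _, ha, _⟩ => hw ⟨a, ha⟩⟩

theorem recolour_new (j : Fin 3) {a b : Fin 7} (hab : symRel (gadgetNew j) a b) :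
    (recolour Gr q col (col j)).Adj (q a) (q b) := Or.inr ⟨j, a, b, rfl, hab, rfl, rfl⟩

/-- Edges of a colour that stay. -/
theorem HasGadget.recolour_keep (h : HasGadget Gr q col) {j x y} (hxy : (Gr (col j)).Adj x y)
    (hn : ∀ a b, symRel (gadgetOld j) a b → q a = x → q b ≠ y) :
    (recolour Gr q col (col j)).Adj x y := by
  refine Or.inl ⟨hxy, ?_⟩
  rintro ⟨j', a, b, hj, hab, hx, hy⟩
  rw [h.inj hj] at hab
  exact hn a b hab hx hy

/-- All neighbours of a vertex of which two are known. -/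
theorem HasGadget.nbr [Finite W] (h : HasGadget Gr q col) {j : Fin 3} {a b b' : Fin 7}
    (hb : symRel (gadgetAll j) a b) (hb' : symRel (gadgetAll j) a b') (hne : b ≠ b') {y : W}
    (hy : (Gr (col j)).Adj (q a) y) : y = q b ∨ y = q b' := by
  have hsub : {q b, q b'} ⊆ (Gr (col j)).neighborSet (q a) := by
    rintro _ (rfl | rfl)
    · exact h.edges _ _ _ hb
    · exact h.edges _ _ _ hb'
  have := Set.eq_of_subset_of_ncard_le hsub
    (by rw [h.reg, Set.ncard_pair (q.injective.ne hne)]) (Set.toFinite _)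
  have hy' : y ∈ (Gr (col j)).neighborSet (q a) := hy
  rw [← this] at hy'
  simpa using hy'

/-- The colours whose edges are rerouted around the middle vertex stay as connected as they were
before. -/
theorem HasGadget.recolour_reachable [Finite W] (h : HasGadget Gr q col) {j : Fin 3} {u : Fin 7}
    {b b' : Fin 7} (hb : symRel (gadgetAll j) 0 b) (hb' : symRel (gadgetAll j) 0 b')
    (hbb' : symRel (gadgetNew j) b b')
    (hu : symRel (gadgetNew j) 0 u) (hmove : ∀ a c, symRel (gadgetOld j) a c → a ≠ 0 → c ≠ 0 →
      symRel (gadgetNew j) a 0 ∧ symRel (gadgetNew j) 0 c)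
    (hu0 : u ≠ 0)
    (h0u : (Gr (col j)).Reachable (q 0) (q u)) {x y : W} (hxy : (Gr (col j)).Reachable x y) :
    (recolour Gr q col (col j)).Reachable x y := by
  classical
  set N := recolour Gr q col (col j)
  have hne : b ≠ b' := by rintro rfl; exact gadgetNew_irrefl _ _ hbb'
  -- the map that sends the middle vertex to its old neighbour
  let φ : W → W := fun w => if w = q 0 then q b else w
  have hφ : ∀ x y, (Gr (col j)).Adj x y → N.Reachable (φ x) (φ y) := by
    have h0 : ∀ y, (Gr (col j)).Adj (q 0) y → N.Reachable (q b) y := by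
      intro y hy
      rcases h.nbr hb hb' hne hy with rfl | rfl
      · rfl
      · exact (recolour_new j hbb').reachable
    intro x y hxy
    by_cases hx : x = q 0
    · subst hx
      simp only [φ, if_true, if_neg hxy.ne.symm]
      exact h0 y hxy
    by_cases hy : y = q 0
    · subst hy
      simp only [φ, if_true, if_neg hxy.ne]
      exact (h0 x hxy.symm).symm
    simp only [φ, if_neg hx, if_neg hy]
    by_cases hold : ∃ a c, symRel (gadgetOld j) a c ∧ q a = x ∧ q c = y
    · obtain ⟨a, c, hac, rfl, rfl⟩ := hold
      obtain ⟨h1, h2⟩ := hmove a c hac (fun h => hx (by rw [h])) (fun h => hy (by rw [h]))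
      exact (recolour_new j h1).reachable.trans (recolour_new j h2).reachable
    · exact (h.recolour_keep hxy fun a c hac ha hc => hold ⟨a, c, hac, ha, hc⟩).reachable
  have hqu : φ (q u) = q u := if_neg (q.injective.ne hu0)
  -- Under `φ` the old connection from the middle vertex to `u` becomes a new connection from `b` to
  -- `u`; the new edge at `u` then reattaches the middle vertex.
  have hbu : N.Reachable (q b) (q u) := by
    have := reachable_map φ hφ h0u
    rwa [hqu, show φ (q 0) = q b from if_pos rfl] at this
  have h0b : N.Reachable (q 0) (q b) := (recolour_new j hu).reachable.trans hbu.symm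
  have hself : ∀ w, N.Reachable w (φ w) := by
    intro w
    by_cases hw : w = q 0
    · subst hw; simp only [φ, if_true]; exact h0b
    · simp only [φ, if_neg hw]; rfl
  exact (hself x).trans ((reachable_map φ hφ hxy).trans (hself y).symm)

/-- The symmetries of a gadget. -/
def gadgetSymm : List (Equiv.Perm (Fin 7)) :=
  [1, Equiv.swap 3 4, Equiv.swap 5 6, Equiv.swap 3 4 * Equiv.swap 5 6]

theorem gadgetAll_symm : ∀ τ ∈ gadgetSymm, ∀ j a b, symRel (gadgetAll j) a b →
    symRel (gadgetAll j) (τ a) (τ b) := by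
  intro τ hτ
  simp only [gadgetSymm, List.mem_cons, List.not_mem_nil, or_false] at hτ
  rcases hτ with rfl | rfl | rfl | rfl <;> decide

theorem gadgetOld_symm : ∀ τ ∈ gadgetSymm, ∀ a b, symRel (gadgetOld 0) a b →
    symRel (gadgetOld 0) (τ a) (τ b) := by
  intro τ hτ
  simp only [gadgetSymm, List.mem_cons, List.not_mem_nil, or_false] at hτ
  rcases hτ with rfl | rfl | rfl | rfl <;> decide

theorem gadgetPairs_symm : ∀ τ ∈ gadgetSymm, ∀ j a b,
    symRel (gadgetNew j) a b ∨ symRel (gadgetOld j) a b →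
    symRel gadgetPairs (τ a) (τ b) := by
  intro τ hτ
  simp only [gadgetSymm, List.mem_cons, List.not_mem_nil, or_false] at hτ
  rcases hτ with rfl | rfl | rfl | rfl <;> decide

/-- Outside the gadget, colour 0 induces one of fifteen pairings of the vertices 1 to 6. Exchanging
3 with 4, or 5 with 6, gives four variants of the new edges, and for every pairing one of them
produces a connected graph. -/
theorem gadget_connected : ∀ M ∈ perfectMatchings 3 [1, 2, 3, 4, 5, 6], ∃ τ ∈ gadgetSymm,
    ∀ a, compRep (M ++ (gadgetNew 0).map (Prod.map τ τ)) a
      = compRep (M ++ (gadgetNew 0).map (Prod.map τ τ)) 0 := by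
  have : ∀ M ∈ perfectMatchings 3 [1, 2, 3, 4, 5, 6], (gadgetSymm.any fun τ => decide
    (∀ a, compRep (M ++ (gadgetNew 0).map (Prod.map τ τ)) a
      = compRep (M ++ (gadgetNew 0).map (Prod.map τ τ)) 0)) = true := by decide +kernel
  simpa using this

theorem HasGadget.symm (h : HasGadget Gr q col) {τ : Equiv.Perm (Fin 7)} (hτ : τ ∈ gadgetSymm) :
    HasGadget Gr (τ.toEmbedding.trans q) col :=
  { h with edges := fun j a b hab => h.edges j _ _ (gadgetAll_symm τ hτ j a b hab) }

/-- Let `R` be what is left of colour 0 in all four variants. In it the middle vertex is isolated,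
the vertices 1 to 6 have degree one and all others degree two. The handshake lemma yields a pairing
of the six inside components of `R`, and the finite check applies to it. -/
theorem HasGadget.exists_symm [Finite W] (h : HasGadget Gr q col) : ∃ τ ∈ gadgetSymm,
    ∀ a, (recolour Gr (τ.toEmbedding.trans q) col (col 0)).Reachable (q a) (q 0) := by
  classical
  let R : SimpleGraph W :=
    { Adj := fun x y => (Gr (col 0)).Adj x y ∧ ∀ a b, symRel (gadgetOld 0) a b → q a = x → q b ≠ y
      symm := ⟨fun x y hxy => ⟨hxy.1.symm, fun a b hab ha hb => hxy.2 b a hab.symm hb ha⟩⟩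
      loopless := ⟨fun x hx => hx.1.ne rfl⟩ }
  have hR : ∀ τ ∈ gadgetSymm, R ≤ recolour Gr (τ.toEmbedding.trans q) col (col 0) := by
    intro τ hτ x y hxy
    exact (h.symm hτ).recolour_keep hxy.1 fun a b hab ha =>
      hxy.2 _ _ (gadgetOld_symm τ hτ a b hab) ha
  have hodd : ∀ w, {x | x ∈ {y | R.Reachable w y} ∧ Odd (R.neighborSet x).ncard}
      = q '' {a | a ≠ 0 ∧ R.Reachable w (q a)} := by
    intro w
    ext x
    simp only [Set.mem_ofPred_eq, Set.mem_image]
    by_cases hx : ∃ a, q a = x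
    · obtain ⟨a, rfl⟩ := hx
      have hset : R.neighborSet (q a)
          = (Gr (col 0)).neighborSet (q a) \ q '' {b | symRel (gadgetOld 0) a b} := by
        ext y
        simp only [SimpleGraph.mem_neighborSet, Set.mem_sdiff, Set.mem_image, Set.mem_ofPred_eq, R]
        refine and_congr_right fun _ => ⟨?_, ?_⟩
        · rintro h1 ⟨b, hb, rfl⟩; exact h1 a b hb rfl rfl
        · rintro h1 a' b hab ha rfl
          rw [q.injective ha] at hab
          exact h1 ⟨b, hab, rfl⟩
      have hsub : q '' {b | symRel (gadgetOld 0) a b} ⊆ (Gr (col 0)).neighborSet (q a) := by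
        rintro _ ⟨b, hb, rfl⟩
        exact h.old hb
      have hcard : (q '' {b | symRel (gadgetOld 0) a b}).ncard
          = (Finset.univ.filter fun b => symRel (gadgetOld 0) a b).card := by
        rw [Set.ncard_image_of_injective _ q.injective, ← Set.ncard_coe_finset]
        congr 1; ext; simp
      have hdec : ∀ a, Odd (2 - (Finset.univ.filter fun b => symRel (gadgetOld 0) a b).card)
          ↔ a ≠ 0 := by decide
      rw [hset, Set.ncard_sdiff hsub (Set.toFinite _), h.reg, hcard, hdec]
      constructor
      · rintro ⟨h1, h2⟩; exact ⟨a, ⟨h2, h1⟩, rfl⟩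
      · rintro ⟨a', ⟨h2, h1⟩, ha⟩
        rw [q.injective ha] at h1 h2
        exact ⟨h1, h2⟩
    · constructor
      · rintro ⟨_, h1⟩
        have : R.neighborSet x = (Gr (col 0)).neighborSet x := by
          ext y
          simp only [SimpleGraph.mem_neighborSet, R]
          exact ⟨fun h => h.1, fun h1 => ⟨h1, fun a b _ ha => absurd ⟨a, ha⟩ hx⟩⟩
        rw [this, h.reg] at h1
        exact absurd h1 (by decide)
      · rintro ⟨a, _, ha⟩; exact absurd ⟨a, ha⟩ hx
  have heven : ∀ w, Even ([1, 2, 3, 4, 5, 6].countP fun a : Fin 7 => R.Reachable w (q a)) := by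
    intro w
    have := even_ncard_odd_of_closed R {y | R.Reachable w y}
      (fun x hx y hxy => SimpleGraph.Reachable.trans hx hxy.reachable)
    rw [hodd, Set.ncard_image_of_injective _ q.injective] at this
    rw [List.countP_eq_length_filter,
      ← List.toFinset_card_of_nodup (List.Nodup.filter _ (by decide)), ← Set.ncard_coe_finset]
    convert this using 2
    ext a
    have hmem : ∀ a : Fin 7, a ∈ [1, 2, 3, 4, 5, 6] ↔ a ≠ 0 := by decide
    simp [← hmem]
  obtain ⟨M, hM, hMR⟩ := exists_perfectMatching (fun a b => R.Reachable (q a) (q b))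
    ⟨fun _ => by rfl, fun h => h.symm, fun h h' => h.trans h'⟩ 3 [1, 2, 3, 4, 5, 6] (by decide)
    (by decide) (fun x _ => heven _)
  obtain ⟨τ, hτ, hc⟩ := gadget_connected M hM
  refine ⟨τ, hτ, fun a => ?_⟩
  have key := eqvGen_of_compRep_eq (hc a)
  generalize (0 : Fin 7) = a0 at key ⊢
  induction key with
  | rel a b hab =>
    rcases List.mem_append.mp hab with hab | hab
    · exact (hMR _ hab).mono (hR τ hτ)
    · obtain ⟨⟨a', b'⟩, hab', hq⟩ := List.mem_map.mp hab
      obtain ⟨rfl, rfl⟩ := Prod.mk.inj hq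
      exact (recolour_new (q := τ.toEmbedding.trans q) 0 (Or.inl hab')).reachable
  | refl a => rfl
  | symm a b _ ih => exact ih.symm
  | trans a b c _ _ ih1 ih2 => exact ih1.trans ih2

/-- Exchanging the edges of one gadget. -/
theorem HasGadget.exists_exchange [Finite W] (h : HasGadget Gr q col)
    (hp : (Gr (col 1)).Reachable (q 0) (q 1)) (hi : (Gr (col 2)).Reachable (q 0) (q 2)) :
    ∃ Gr' : C → SimpleGraph W,
      (∀ c c' x y, (Gr' c).Adj x y → (Gr' c').Adj x y → c = c') ∧
      (∀ c w, ((Gr' c).neighborSet w).ncard = 2) ∧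
      (∀ x y, (∃ c, (Gr' c).Adj x y) ↔ ∃ c, (Gr c).Adj x y) ∧
      (∀ c x y, (¬ ∃ a b, symRel gadgetPairs a b ∧ q a = x ∧ q b = y) → (Gr c).Adj x y →
        (Gr' c).Adj x y) ∧
      (∀ c x y, (Gr c).Reachable x y → (Gr' c).Reachable x y) ∧
      (Gr' (col 0)).Reachable (q 0) (q 3) := by
  obtain ⟨τ, hτ, hconn⟩ := h.exists_symm
  have h' := h.symm hτ
  have h012 : ∀ τ ∈ gadgetSymm, τ 0 = 0 ∧ τ 1 = 1 ∧ τ 2 = 2 := by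
    intro τ hτ
    simp only [gadgetSymm, List.mem_cons, List.not_mem_nil, or_false] at hτ
    rcases hτ with rfl | rfl | rfl | rfl <;> decide
  obtain ⟨t0, t1, t2⟩ := h012 τ hτ
  refine ⟨recolour Gr (τ.toEmbedding.trans q) col, h'.recolour_disj, h'.recolour_reg,
    h'.recolour_union, ?_, ?_, (hconn 3).symm⟩
  · intro c x y hn hxy
    refine Or.inl ⟨hxy, ?_⟩
    rintro ⟨j, a, b, _, hab, hx, hy⟩
    exact hn ⟨τ a, τ b, gadgetPairs_symm τ hτ j a b (Or.inr hab), hx, hy⟩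
  · intro c x y hxy
    by_cases hc : ∀ j, col j ≠ c
    · rwa [recolour_of_ne hc]
    push Not at hc
    obtain ⟨j, rfl⟩ := hc
    have hj : j = 0 ∨ j = 1 ∨ j = 2 := by clear hxy; revert j; decide
    rcases hj with rfl | rfl | rfl
    -- In colour 0 the ends of every removed edge are gadget vertices, all of which are now
    -- connected to one another.
    · refine reachable_map id (fun x y hxy => ?_) hxy
      by_cases hold : ∃ a b, symRel (gadgetOld 0) a b ∧ (τ.toEmbedding.trans q) a = x ∧
          (τ.toEmbedding.trans q) b = y
      · obtain ⟨a, b, _, rfl, rfl⟩ := hold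
        exact (hconn _).trans (hconn _).symm
      · exact (h'.recolour_keep hxy fun a b hab ha hb => hold ⟨a, b, hab, ha, hb⟩).reachable
    -- In colour 1 the middle vertex had the neighbours 5 and 6, which become adjacent, and 1 is one
    -- of its new neighbours. In colour 2 the same is done with 3, 4 and 2.
    · refine h'.recolour_reachable (b := 5) (b' := 6) (u := 1) (by decide) (by decide)
        (by decide) (by decide) (by decide) (by decide) ?_ hxy
      simpa [t0, t1] using hp
    · refine h'.recolour_reachable (b := 3) (b' := 4) (u := 2) (by decide) (by decide)
        (by decide) (by decide) (by decide) (by decide) ?_ hxy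
      simpa [t0, t2] using hi

/-- Exchanging the edges of a family of edge-disjoint gadgets. -/
theorem exists_exchange_family [Finite W] {T : Type*} [Finite T] (q : T → Fin 7 ↪ W)
    (col : T → Fin 3 → C) (h : ∀ t, HasGadget Gr (q t) (col t))
    (hdisj : (∀ c c' x y, (Gr c).Adj x y → (Gr c').Adj x y → c = c'))
    (hreg : (∀ c w, ((Gr c).neighborSet w).ncard = 2))
    (hsep : ∀ t t' a b a' b', t ≠ t' → symRel gadgetPairs a b → symRel gadgetPairs a' b' →
      q t a = q t' a' → q t b ≠ q t' b')
    (hp : ∀ t, (Gr (col t 1)).Reachable (q t 0) (q t 1))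
    (hi : ∀ t, (Gr (col t 2)).Reachable (q t 0) (q t 2)) :
    ∃ Gr' : C → SimpleGraph W,
      (∀ c c' x y, (Gr' c).Adj x y → (Gr' c').Adj x y → c = c') ∧
      (∀ c w, ((Gr' c).neighborSet w).ncard = 2) ∧
      (∀ x y, (∃ c, (Gr' c).Adj x y) ↔ ∃ c, (Gr c).Adj x y) ∧
      (∀ c x y, (Gr c).Reachable x y → (Gr' c).Reachable x y) ∧
      ∀ t, (Gr' (col t 0)).Reachable (q t 0) (q t 3) := by
  classical
  cases nonempty_fintype T
  have main : ∀ s : Finset T, ∃ Gr' : C → SimpleGraph W,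
      (∀ c c' x y, (Gr' c).Adj x y → (Gr' c').Adj x y → c = c') ∧
      (∀ c w, ((Gr' c).neighborSet w).ncard = 2) ∧
      (∀ x y, (∃ c, (Gr' c).Adj x y) ↔ ∃ c, (Gr c).Adj x y) ∧
      (∀ c x y, (Gr c).Reachable x y → (Gr' c).Reachable x y) ∧
      (∀ t ∈ s, (Gr' (col t 0)).Reachable (q t 0) (q t 3)) ∧
      ∀ t ∉ s, HasGadget Gr' (q t) (col t) := by
    intro s
    induction s using Finset.induction_on with
    | empty => exact ⟨Gr, hdisj, hreg, fun _ _ => Iff.rfl, fun _ _ _ h => h, by simp, fun t _ => h t⟩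
    | insert t s hts ih =>
      obtain ⟨Gr₁, -, -, u1, r1, s1, g1⟩ := ih
      obtain ⟨Gr₂, d2, e2, u2, k2, r2, s2⟩ :=
        (g1 t hts).exists_exchange (r1 _ _ _ (hp t)) (r1 _ _ _ (hi t))
      refine ⟨Gr₂, d2, e2, fun x y => (u2 x y).trans (u1 x y),
        fun c x y hxy => r2 _ _ _ (r1 _ _ _ hxy), ?_, ?_⟩
      · intro t' ht'
        rcases Finset.mem_insert.mp ht' with rfl | ht'
        · exact s2
        · exact r2 _ _ _ (s1 t' ht')
      · intro t' ht'
        rw [Finset.mem_insert, not_or] at ht'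
        have hpairs : ∀ j a b, symRel (gadgetAll j) a b → symRel gadgetPairs a b := by decide
        -- An exchange changes the colours of pairs of its own gadget only, so an edge-disjoint
        -- gadget remains present.
        exact ⟨d2, e2, (h t').inj, fun j a b hab => k2 _ _ _
          (fun ⟨a', b', hab', ha, hb⟩ => hsep t t' a' b' a b (Ne.symm ht'.1) hab' (hpairs j a b hab)
            ha hb) ((g1 t' ht'.2).edges j a b hab)⟩
  obtain ⟨Gr', h1, h2, h3, h4, h5, -⟩ := main Finset.univ
  exact ⟨Gr', h1, h2, h3, h4, fun t => h5 t (Finset.mem_univ t)⟩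

end Recolour

end HamFrag

/-! ### From a scheme to a Hamilton decomposition of the line graph -/

namespace HamFrag

theorem injective_vec3 {α : Type*} {a b c : α} (h1 : a ≠ b) (h2 : a ≠ c) (h3 : b ≠ c) :
    Function.Injective ![a, b, c] := by
  intro i j h
  fin_cases i <;> fin_cases j <;> simp_all [eq_comm]

namespace DirTwoFactorisation

variable {V : Type*} {G : SimpleGraph V} {n : ℕ} (F : DirTwoFactorisation G n)

/-- The seven edges of `G` in the gadget of a pair of consecutive vertices. -/
def gadgetFun (s t : V → Idx n → Lab n) (v : V) (k : Idx n) : Fin 7 → G.edgeSet :=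
  ![F.copies.σ v (Sum.inr k), F.copies.σ (F.next k v) (Sum.inr k), F.copies.σ v (Sum.inl k),
    F.copies.σ (F.next k v) (s (F.next k v) k), F.copies.σ (F.next k v) (t (F.next k v) k),
    F.copies.σ v (s v k), F.copies.σ v (t v k)]

theorem gadgetFun_injective (s t : V → Idx n → Lab n) (v : V) (k : Idx n)
    (hs : ∀ v, label (s v k) ≠ k) (ht : ∀ v, label (t v k) ≠ k) (hst : ∀ v, s v k ≠ t v k) :
    Function.Injective (F.gadgetFun s t v k) := by
  have hvα : F.next k v ≠ v := (F.adj k v).ne'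
  -- The copies at `v` and at its successor meet only in the edge joining them, which is `a_k` at
  -- the successor.
  have cross : ∀ x y, F.copies.σ (F.next k v) x = F.copies.σ v y → x = Sum.inl k := by
    intro x y h
    rcases F.copies.disj h (F.copies_inl v k) with h1 | h1
    · exact absurd h1 hvα
    · exact h1
  have hsl : ∀ v, s v k ≠ Sum.inl k := fun v h => hs v (by rw [h]; rfl)
  have hsr : ∀ v, s v k ≠ Sum.inr k := fun v h => hs v (by rw [h]; rfl)
  have htl : ∀ v, t v k ≠ Sum.inl k := fun v h => ht v (by rw [h]; rfl)
  have htr : ∀ v, t v k ≠ Sum.inr k := fun v h => ht v (by rw [h]; rfl)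
  have key : ∀ i j : Fin 7, i < j → F.gadgetFun s t v k i ≠ F.gadgetFun s t v k j := by
    have a1 : ∀ x y, x ≠ y → F.copies.σ v x ≠ F.copies.σ v y :=
      fun x y h h' => h (F.copies.inj v h')
    have a2 : ∀ x y, x ≠ y → F.copies.σ (F.next k v) x ≠ F.copies.σ (F.next k v) y :=
      fun x y h h' => h (F.copies.inj _ h')
    have a3 : ∀ x y, x ≠ Sum.inl k → F.copies.σ (F.next k v) x ≠ F.copies.σ v y :=
      fun x y h h' => h (cross x y h')
    have a4 : ∀ x y, x ≠ Sum.inl k → F.copies.σ v y ≠ F.copies.σ (F.next k v) x :=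
      fun x y h h' => h (cross x y h'.symm)
    intro i j hij
    fin_cases i <;> fin_cases j <;> simp only [Fin.reduceFinMk, Fin.zero_eta, Fin.isValue,
      Fin.mk_one, Fin.reduceLT, lt_self_iff_false] at hij <;>
      simp only [gadgetFun, Fin.reduceFinMk, Fin.zero_eta, Fin.isValue, Fin.mk_one] <;>
      first
      | exact absurd hij (by decide)
      | exact a1 _ _ Sum.inr_ne_inl
      | exact a1 _ _ (hsr _).symm
      | exact a1 _ _ (htr _).symm
      | exact a1 _ _ (hsl _).symm
      | exact a1 _ _ (htl _).symm
      | exact a1 _ _ (hst _)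
      | exact a2 _ _ (hsr _).symm
      | exact a2 _ _ (htr _).symm
      | exact a2 _ _ (hst _)
      | exact a3 _ _ Sum.inr_ne_inl
      | exact a3 _ _ (hsl _)
      | exact a3 _ _ (htl _)
      | exact a4 _ _ Sum.inr_ne_inl
      | exact a4 _ _ (hsl _)
      | exact a4 _ _ (htl _)
  intro i j h
  rcases lt_trichotomy i j with hij | hij | hij
  · exact absurd h (key i j hij)
  · exact hij
  · exact absurd h.symm (key j i hij)

theorem gadgetFun_pair (s t : V → Idx n → Lab n) (v : V) (k : Idx n) {a b : Fin 7}
    (hab : symRel gadgetPairs a b) : ∃ y x x', (y = v ∨ y = F.next k v) ∧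
      x ∈ quad (s y k) (t y k) k ∧ x' ∈ quad (s y k) (t y k) k ∧
      F.gadgetFun s t v k a = F.copies.σ y x ∧ F.gadgetFun s t v k b = F.copies.σ y x' := by
  have h1 : ∀ a : Fin 7, a = 0 ∨ a = 1 ∨ a = 3 ∨ a = 4 → ∃ x,
      x ∈ quad (s (F.next k v) k) (t (F.next k v) k) k ∧
      F.gadgetFun s t v k a = F.copies.σ (F.next k v) x := by
    rintro a (rfl | rfl | rfl | rfl)
    · exact ⟨Sum.inl k, by simp [quad], (F.copies_inl v k).symm⟩
    · exact ⟨Sum.inr k, by simp [quad], rfl⟩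
    · exact ⟨_, by simp [quad], rfl⟩
    · exact ⟨_, by simp [quad], rfl⟩
  have h2 : ∀ a : Fin 7, a = 0 ∨ a = 2 ∨ a = 5 ∨ a = 6 → ∃ x,
      x ∈ quad (s v k) (t v k) k ∧ F.gadgetFun s t v k a = F.copies.σ v x := by
    rintro a (rfl | rfl | rfl | rfl)
    · exact ⟨Sum.inr k, by simp [quad], rfl⟩
    · exact ⟨Sum.inl k, by simp [quad], rfl⟩
    · exact ⟨_, by simp [quad], rfl⟩
    · exact ⟨_, by simp [quad], rfl⟩
  have h3 : ((a = 0 ∨ a = 1 ∨ a = 3 ∨ a = 4) ∧ (b = 0 ∨ b = 1 ∨ b = 3 ∨ b = 4)) ∨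
      ((a = 0 ∨ a = 2 ∨ a = 5 ∨ a = 6) ∧ (b = 0 ∨ b = 2 ∨ b = 5 ∨ b = 6)) := by
    revert a b; decide
  rcases h3 with ⟨ha, hb⟩ | ⟨ha, hb⟩
  · obtain ⟨x, hx, hax⟩ := h1 a ha
    obtain ⟨y, hy, hby⟩ := h1 b hb
    exact ⟨_, x, y, Or.inr rfl, hx, hy, hax, hby⟩
  · obtain ⟨x, hx, hax⟩ := h2 a ha
    obtain ⟨y, hy, hby⟩ := h2 b hb
    exact ⟨_, x, y, Or.inl rfl, hx, hy, hax, hby⟩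

end DirTwoFactorisation

namespace Scheme

variable {n : ℕ} {C : Type*} (Sc : Scheme n C)

-- `exists_core` leaves one large component in each colour together with the cycles of rungs of the
-- labels owned by that colour. One gadget per such cycle merges it with the large component, and
-- the colour classes become connected 2-regular graphs.
set_option maxHeartbeats 800000 in
theorem hamiltonDecomposable {V : Type*} [Finite V] {G : SimpleGraph V}
    (F : DirTwoFactorisation G n) (P : Placement F.next) (hP : ∀ v, Sc.allowed (P.κ v))
    (htop : ∀ v w : V, (F.next none).SameCycle v w) :
    HamiltonDecomposable (F.unionCopies ⊤) := by
  classical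
  rcases isEmpty_or_nonempty V with hV | ⟨⟨v0⟩⟩
  · refine ⟨∅, ⟨by simp, fun e _ => ?_⟩, by simp⟩
    induction e with | _ x y =>
    obtain ⟨v, _⟩ := F.exists_sigma_inr x
    exact hV.elim v
  obtain ⟨L, hL, hreg, hcore⟩ := Sc.exists_core F P hP htop
  set Gr : C → SimpleGraph G.edgeSet := fun c => F.copies.glue fun u => L u c with hGr
  have hdisj : ∀ c c' x y, (Gr c).Adj x y → (Gr c').Adj x y → c = c' := by
    rintro c c' _ _ ⟨v, x, y, h, rfl, rfl⟩ h'
    have h'' := (Copies.glue_adj_iff (S := F.copies) (fun u => L u c')).1 h'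
    exact (Sc.partition _ (hP v) _ (hL v) x y h.ne).unique h h''
  have hunion : ∀ x y, (F.unionCopies ⊤).Adj x y ↔ ∃ c, (Gr c).Adj x y := by
    intro x y
    simp only [DirTwoFactorisation.unionCopies, SimpleGraph.iSup_adj, SimpleGraph.map_adj,
      SimpleGraph.top_adj]
    constructor
    · rintro ⟨v, a, b, hab, rfl, rfl⟩
      obtain ⟨c, hc, _⟩ := Sc.partition _ (hP v) _ (hL v) a b hab
      exact ⟨c, v, a, b, hc, rfl, rfl⟩
    · rintro ⟨c, v, a, b, hab, rfl, rfl⟩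
      exact ⟨v, a, b, hab.ne, rfl, rfl⟩
  choose s t hgad hquad using fun v => Sc.gadget _ (hP v) _ (hL v)
  -- One gadget for each cycle of each factor with own cycles, placed at the first vertex of the
  -- cycle and its successor.
  let T := {x : V × Idx n // Sc.gam x.2 ∧ P.κ x.1 x.2 = Cls.first}
  have hinj : ∀ x : T, Function.Injective (F.gadgetFun s t x.1.1 x.1.2) := fun x =>
    F.gadgetFun_injective s t _ _ (fun v => (hgad v _ x.2.1).1) (fun v => (hgad v _ x.2.1).2.1)
      (fun v => (hgad v _ x.2.1).2.2.2.2.1.ne)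
  let q : T → Fin 7 ↪ G.edgeSet := fun x => ⟨_, hinj x⟩
  let col : T → Fin 3 → C := fun x => ![Sc.z x.1.2, Sc.p x.1.2, Sc.i x.1.2]
  have hhas : ∀ x, HasGadget Gr (q x) (col x) := by
    rintro ⟨⟨v, k⟩, hk, hv⟩
    refine ⟨hdisj, hreg, ?_, ?_⟩
    · exact injective_vec3 (Sc.z_ne_p k hk) (Sc.z_ne_i k hk) (Sc.p_ne_i k hk)
    · have h1 := hgad v k hk
      have h2 := hgad (F.next k v) k hk
      have hg : ∀ c u x y, (L u c).Adj x y → (Gr c).Adj (F.copies.σ u x) (F.copies.σ u y) :=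
        fun c u x y h => Copies.glue_adj (S := F.copies) (fun u => L u c) h
      have main : ∀ j, ∀ ab ∈ gadgetAll j,
          (Gr (col ⟨⟨v, k⟩, hk, hv⟩ j)).Adj (q ⟨⟨v, k⟩, hk, hv⟩ ab.1) (q ⟨⟨v, k⟩, hk, hv⟩ ab.2) := by
        have e : F.copies.σ v (Sum.inr k) = F.copies.σ (F.next k v) (Sum.inl k) :=
          (F.copies_inl v k).symm
        have e1 : ∀ c w, (Gr c).Adj (F.copies.σ (F.next k v) (Sum.inl k)) w →
          (Gr c).Adj (F.copies.σ v (Sum.inr k)) w := fun c w h => e ▸ h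
        obtain ⟨-, -, -, a1, a2, a3, a4, a5, a6⟩ := h1
        obtain ⟨-, -, -, b1, b2, b3, b4, b5, b6⟩ := h2
        intro j ab hab
        fin_cases j <;> simp only [gadgetAll, List.mem_cons, List.not_mem_nil, or_false] at hab <;>
          rcases hab with rfl | rfl | rfl | rfl
        · exact hg _ _ _ _ b2
        · exact e1 _ _ (hg _ _ _ _ b1)
        · exact hg _ _ _ _ a2
        · exact (hg _ _ _ _ a1).symm
        · exact hg _ _ _ _ b3
        · exact hg _ _ _ _ b4
        · exact hg _ _ _ _ a3
        · exact hg _ _ _ _ a4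
        · exact (e1 _ _ (hg _ _ _ _ b5).symm).symm
        · exact e1 _ _ (hg _ _ _ _ b6)
        · exact hg _ _ _ _ a5
        · exact hg _ _ _ _ a6
      rintro j a b (hab | hab)
      · exact main j _ hab
      · exact (main j _ hab).symm
  have hsep : ∀ t t' a b a' b', t ≠ t' → symRel gadgetPairs a b → symRel gadgetPairs a' b' →
      q t a = q t' a' → q t b ≠ q t' b' := by
    rintro ⟨⟨v, k⟩, hk, hv⟩ ⟨⟨v', k'⟩, hk', hv'⟩ a b a' b' hne hab hab' h1 h2
    have hab0 : ∀ a b, symRel gadgetPairs a b → a ≠ b := by decide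
    obtain ⟨y, x1, x2, hy, hx1, hx2, e1, e2⟩ := F.gadgetFun_pair s t v k hab
    obtain ⟨y', x1', x2', hy', hx1', hx2', e1', e2'⟩ := F.gadgetFun_pair s t v' k' hab'
    have f1 : F.copies.σ y x1 = F.copies.σ y' x1' := e1.symm.trans (h1.trans e1')
    have f2 : F.copies.σ y x2 = F.copies.σ y' x2' := e2.symm.trans (h2.trans e2')
    have hx : x1 ≠ x2 := by
      rintro rfl
      exact hab0 a b hab ((q ⟨⟨v, k⟩, hk, hv⟩).injective (e1.trans e2.symm))
    obtain rfl : y = y' := (F.copies.disj f1 f2).resolve_right hx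
    rw [← F.copies.inj _ f1] at hx1'
    rw [← F.copies.inj _ f2] at hx2'
    -- A common pair of two gadgets lies in one copy `y`. For equal labels `y` would be the first
    -- vertex of one and the second of the other, or the gadgets coincide; for different labels the
    -- two quadruples at `y` share at most one point.
    by_cases hkk : k = k'
    · subst hkk
      have hsec : ∀ v, P.κ v k = Cls.first → P.κ (F.next k v) k = Cls.second :=
        fun v => (P.step v k).1
      have g1 := hsec v hv
      have g2 := hsec v' hv'
      simp only at hv hv'
      rcases hy with rfl | rfl <;> rcases hy' with h | h
      · subst h; exact hne rfl
      · rw [h, g2] at hv; cases hv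
      · rw [← h, g1] at hv'; cases hv'
      · have := (F.next k).injective h
        subst this; exact hne rfl
    · exact hx (hquad y k k' hk hk' hkk ⟨hx1, hx1'⟩ ⟨hx2, hx2'⟩)
  obtain ⟨Gr', d', r', u', m', s'⟩ := exists_exchange_family q col hhas hdisj hreg hsep
    (by
      rintro ⟨⟨v, k⟩, hk, hv⟩
      exact hcore _ _ _ _ _ (fun h => Sc.z_ne_p k hk h.2) (fun h => Sc.z_ne_p k hk h.2))
    (by
      rintro ⟨⟨v, k⟩, hk, hv⟩
      have := hcore (Sc.i k) v ((F.next k).symm v) k k (fun h => Sc.z_ne_i k hk h.2)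
        (fun h => Sc.z_ne_i k hk h.2)
      rw [← F.copies_inl ((F.next k).symm v), Equiv.apply_symm_apply] at this
      exact this)
  have hgood : ∀ c v k, ¬ Sc.own c k →
      (Gr' c).Reachable (F.copies.σ v (Sum.inr k)) (F.copies.σ v0 (Sum.inr none)) :=
    fun c v k hk => m' _ _ _ (hcore c v v0 k none hk fun h => Sc.gam_top h.1)
  have hgood' : ∀ c v x, ¬ Sc.own c (label x) →
      (Gr' c).Reachable (F.copies.σ v x) (F.copies.σ v0 (Sum.inr none)) := by
    rintro c v (k | k) hk
    · have := hgood c ((F.next k).symm v) k hk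
      rwa [← F.copies_inl, Equiv.apply_symm_apply] at this
    · exact hgood c v k hk
  have hown : ∀ k, Sc.gam k → ∀ v,
      (Gr' (Sc.z k)).Reachable (F.copies.σ v (Sum.inr k)) (F.copies.σ v0 (Sum.inr none)) := by
    intro k hk v
    obtain ⟨a, hva, ha⟩ := P.hits k v Cls.first
    have h1 : (Gr (Sc.z k)).Reachable (F.copies.σ v (Sum.inr k)) (F.copies.σ a (Sum.inr k)) := by
      obtain ⟨j, rfl⟩ : ∃ j : ℕ, (F.next k ^ j) v = a :=
        let ⟨j, _, h⟩ := hva.exists_pow_eq'; ⟨j, h⟩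
      clear hva ha
      induction j with
      | zero => rfl
      | succ j ih =>
        rw [pow_succ', Equiv.Perm.mul_apply]
        refine ih.trans ?_
        rw [← F.copies_inl]
        exact (Copies.glue_adj (S := F.copies) (fun u => L u (Sc.z k)) (hgad _ k hk).2.2.2.1).reachable
    -- Rungs lead to the first vertex `a` of the cycle. The gadget there connects them to the point
    -- `s` at the successor, whose label does not run through own cycles in this colour.
    refine (m' _ _ _ h1).trans ((s' ⟨⟨a, k⟩, hk, ha⟩).trans (hgood' _ _ _ fun h => ?_))
    exact (hgad (F.next k a) k hk).2.2.1 h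
  have hall : ∀ c w, (Gr' c).Reachable w (F.copies.σ v0 (Sum.inr none)) := by
    intro c w
    obtain ⟨v, k, rfl⟩ := F.exists_sigma_inr w
    by_cases hk : Sc.own c k
    · obtain ⟨hk, rfl⟩ := hk
      exact hown k hk v
    · exact hgood c v k hk
  have hham : ∀ c, IsHamiltonCycle (Gr' c) := fun c =>
    isHamiltonCycle_of_regular (r' c)
      { preconnected := fun x y => (hall c x).trans (hall c y).symm
        nonempty := ⟨F.copies.σ v0 (Sum.inr none)⟩ }
  refine ⟨Set.range Gr', ⟨?_, ?_⟩, by rintro _ ⟨c, rfl⟩; exact hham c⟩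
  · rintro _ ⟨c, rfl⟩
    refine ⟨fun h => ?_, fun x y hxy => (hunion x y).2 ((u' x y).1 ⟨c, hxy⟩)⟩
    have := r' c (F.copies.σ v0 (Sum.inr none))
    rw [h] at this
    simp at this
  · intro e he
    induction e with | _ x y =>
    obtain ⟨c, hc⟩ := (u' x y).2 ((hunion x y).1 he)
    refine ⟨Gr' c, ⟨⟨c, rfl⟩, hc⟩, ?_⟩
    rintro _ ⟨⟨c', rfl⟩, hc'⟩
    rw [d' c' c x y hc' hc]

end Scheme

end HamFrag

/-! ### Existence of directed 2-factorisations and of placements -/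

namespace HamFrag

section Orientation

variable {V : Type*}

/-- Every `2d`-regular graph has an orientation in which all in- and out-degrees are `d`. -/
theorem exists_orientation [Finite V] (H : SimpleGraph V) (d : ℕ)
    (hH : ∀ v, (H.neighborSet v).ncard = 2 * d) :
    ∃ o : V → V → Prop, (∀ x y, H.Adj x y ↔ o x y ∨ o y x) ∧ (∀ x y, o x y → ¬ o y x) ∧
      (∀ v, {y | o v y}.ncard = d) ∧ ∀ v, {x | o x v}.ncard = d := by
  classical
  cases nonempty_fintype V
  rcases Nat.eq_zero_or_pos d with rfl | hd
  · refine ⟨fun _ _ => False, fun x y => ?_, by simp, by simp, by simp⟩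
    have := hH x
    rw [mul_zero, Set.ncard_eq_zero] at this
    simp only [or_self, iff_false]
    intro h
    have h' : y ∈ H.neighborSet x := h
    simp [this] at h'
  -- Every vertex offers `d` slots and every edge takes a slot at one of its ends, from which it is
  -- then directed away. An edge may use `2 d` slots, and a slot suits at most `2 d` edges.
  obtain ⟨f, hf, hfr⟩ := exists_injective_of_degrees
    (fun (e : H.edgeSet) (b : V × Fin d) => b.1 ∈ e.1) (2 * d) (by omega)
    (by
      rintro ⟨e, he⟩
      induction e with | _ x y =>
      have hxy : x ≠ y := H.ne_of_adj he
      rw [show {b : V × Fin d | b.1 ∈ s(x, y)} = ({x, y} : Set V) ×ˢ Set.univ by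
        ext ⟨a, i⟩; simp, Set.ncard_prod, Set.ncard_pair hxy, Set.ncard_univ]
      simp)
    (by
      rintro ⟨v, i⟩
      rw [← hH v]
      have : ∀ a : H.edgeSet, v ∈ a.1 → ∃ y, a.1 = s(v, y) := fun a ha =>
        ⟨Sym2.Mem.other ha, (Sym2.other_spec ha).symm⟩
      refine Set.ncard_le_ncard_of_injOn
        (fun a => if h : v ∈ a.1 then Sym2.Mem.other h else v) ?_ ?_ (Set.toFinite _)
      · intro a ha
        have ha : v ∈ a.1 := ha
        simp only [ha, dif_pos]
        have := a.2
        rw [← Sym2.other_spec ha] at this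
        exact this
      · intro a ha b hb hab
        have ha : v ∈ a.1 := ha
        have hb : v ∈ b.1 := hb
        simp only [ha, hb, dif_pos] at hab
        apply Subtype.ext
        rw [← Sym2.other_spec ha, ← Sym2.other_spec hb, hab])
  let o : V → V → Prop := fun x y => ∃ h : H.Adj x y, (f ⟨s(x, y), h⟩).1 = x
  have hadj : ∀ x y, H.Adj x y ↔ o x y ∨ o y x := by
    intro x y
    constructor
    · intro h
      have hm := hfr ⟨s(x, y), h⟩
      rcases Sym2.mem_iff.mp hm with h1 | h1
      · exact Or.inl ⟨h, h1⟩
      · refine Or.inr ⟨h.symm, ?_⟩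
        have : (⟨s(y, x), h.symm⟩ : H.edgeSet) = ⟨s(x, y), h⟩ := Subtype.ext Sym2.eq_swap
        rw [this]; exact h1
    · rintro (⟨h, _⟩ | ⟨h, _⟩)
      · exact h
      · exact h.symm
  have hanti : ∀ x y, o x y → ¬ o y x := by
    rintro x y ⟨h, h1⟩ ⟨h', h2⟩
    have : (⟨s(y, x), h'⟩ : H.edgeSet) = ⟨s(x, y), h⟩ := Subtype.ext Sym2.eq_swap
    rw [this] at h2
    exact h.ne (h1.symm.trans h2)
  have hout : ∀ v, {y | o v y}.ncard ≤ d := by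
    intro v
    have : {y | o v y}.ncard ≤ (Set.univ : Set (Fin d)).ncard := by
      refine Set.ncard_le_ncard_of_injOn
        (fun y => if h : H.Adj v y then (f ⟨s(v, y), h⟩).2 else ⟨0, hd⟩) (fun _ _ => trivial) ?_
        (Set.toFinite _)
      rintro y ⟨hy, hy'⟩ z ⟨hz, hz'⟩ hyz
      simp only [hy, hz, dif_pos] at hyz
      have := hf (Prod.ext (hy'.trans hz'.symm) hyz)
      have := congrArg Subtype.val this
      exact Sym2.congr_right.mp this
    simpa [Set.ncard_univ] using this
  have hsum2 : ∀ v, {y | o v y}.ncard + {x | o x v}.ncard = 2 * d := by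
    intro v
    rw [← hH v, ← Set.ncard_union_eq _ (Set.toFinite _) (Set.toFinite _)]
    · congr 1
      ext y
      simp [hadj v y]
    · rw [Set.disjoint_left]
      exact fun y h1 h2 => hanti _ _ h1 h2
  have hcount : ∑ v, {y | o v y}.ncard = ∑ v, {x | o x v}.ncard := by
    have := Finset.sum_card_bipartiteAbove_eq_sum_card_bipartiteBelow (s := Finset.univ)
      (t := Finset.univ) o
    simp only [Finset.bipartiteAbove, Finset.bipartiteBelow] at this
    convert this using 2 with v _ v _
    · rw [← Set.ncard_coe_finset]; congr 1; ext; simp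
    · rw [← Set.ncard_coe_finset]; congr 1; ext; simp
  have htot : ∑ v, {y | o v y}.ncard = ∑ _v : V, d := by
    have h1 : ∑ v, ({y | o v y}.ncard + {x | o x v}.ncard) = ∑ _v : V, 2 * d :=
      Finset.sum_congr rfl fun v _ => hsum2 v
    rw [Finset.sum_add_distrib, ← hcount] at h1
    simp only [Finset.sum_const, smul_eq_mul] at h1 ⊢
    have : (Finset.univ : Finset V).card * (2 * d) = 2 * ((Finset.univ : Finset V).card * d) := by ring
    omega
  -- Slots bound all out-degrees by `d`, while the out-degrees sum to `d` times the number of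
  -- vertices, so equality holds everywhere.
  have hout' : ∀ v, {y | o v y}.ncard = d := fun v =>
    (Finset.sum_eq_sum_iff_of_le fun v _ => hout v).mp htot v (Finset.mem_univ v)
  exact ⟨o, hadj, hanti, hout', fun v => by have := hsum2 v; have := hout' v; omega⟩

/-- A `d`-regular digraph is the union of `d` disjoint permutations. -/
theorem exists_perms [Finite V] (d : ℕ) : ∀ o : V → V → Prop, (∀ v, {y | o v y}.ncard = d) →
    (∀ v, {x | o x v}.ncard = d) → ∃ π : Fin d → Equiv.Perm V,
      (∀ x y, o x y ↔ ∃ i, π i x = y) ∧ ∀ i j x, π i x = π j x → i = j := by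
  induction d with
  | zero =>
    intro o ho _
    refine ⟨Fin.elim0, fun x y => ⟨fun h => ?_, fun ⟨i, _⟩ => i.elim0⟩, fun i => i.elim0⟩
    have := ho x
    rw [Set.ncard_eq_zero] at this
    have h' : y ∈ {y | o x y} := h
    simp [this] at h'
  | succ d ih =>
    intro o ho hi
    -- In a regular digraph Hall's condition holds between tails and heads. Removing the permutation
    -- so found lowers all degrees by one.
    obtain ⟨f, hf, hfo⟩ := exists_injective_of_degrees o (d + 1) (by omega)
      (fun a => (ho a).ge) (fun b => (hi b).le)
    let φ : Equiv.Perm V := Equiv.ofBijective f (Finite.injective_iff_bijective.mp hf)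
    obtain ⟨π, hπ, hπ'⟩ := ih (fun x y => o x y ∧ y ≠ f x)
      (fun v => by
        rw [show {y | o v y ∧ y ≠ f v} = {y | o v y} \ {f v} by ext; simp,
          Set.ncard_sdiff_singleton_of_mem (show f v ∈ {y | o v y} from hfo v), ho]; rfl)
      (fun v => by
        have h1 : {x | o x v ∧ v ≠ f x} = {x | o x v} \ {φ.symm v} := by
          ext x
          simp only [Set.mem_ofPred_eq, Set.mem_sdiff, Set.mem_singleton_iff, ne_eq,
            Equiv.eq_symm_apply]
          exact and_congr_right fun _ => not_congr eq_comm
        rw [h1, Set.ncard_sdiff_singleton_of_mem, hi]; · rfl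
        have := hfo (φ.symm v)
        rwa [show f (φ.symm v) = v from φ.apply_symm_apply v] at this)
    refine ⟨Fin.cons φ π, fun x y => ?_, ?_⟩
    · rw [Fin.exists_fin_succ]
      simp only [Fin.cons_zero, Fin.cons_succ, ← hπ]
      by_cases h : y = f x
      · subst h; exact ⟨fun _ => Or.inl rfl, fun _ => hfo x⟩
      · exact ⟨fun h' => Or.inr ⟨h', h⟩,
          fun h' => h'.elim (fun h' => absurd h'.symm h) fun h' => h'.1⟩
    · intro i j x hij
      have hne : ∀ i x, π i x ≠ φ x := fun i x h => ((hπ x (π i x)).2 ⟨i, rfl⟩).2 h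
      induction i using Fin.cases with
      | zero =>
        induction j using Fin.cases with
        | zero => rfl
        | succ j => exact absurd hij.symm (hne j x)
      | succ i =>
        induction j using Fin.cases with
        | zero => exact absurd hij (hne i x)
        | succ j => exact congrArg Fin.succ (hπ' i j x hij)

end Orientation

section Existence

variable {V : Type*} [Finite V] {G : SimpleGraph V}

/-- The Hamilton cycle is oriented separately and becomes `F_∞`; the remaining graph is regular of
degree `2 (n - 1)` and splits into `n - 1` permutations along a balanced orientation. Balanced
orientations contain no edge in both directions, so no factor has a cycle of length two. -/
theorem exists_dirTwoFactorisation {n : ℕ} (hn : 0 < n)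
    (hG : ∀ v, (G.neighborSet v).ncard = 2 * n) {C : SimpleGraph V} (hCG : C ≤ G)
    (hC : IsHamiltonCycle C) :
    ∃ F : DirTwoFactorisation G n, ∀ v w : V, (F.next none).SameCycle v w := by
  have hC2 := hC.ncard_neighborSet
  obtain ⟨o, ho, hoa, ho1, ho2⟩ := exists_orientation C 1 hC2
  obtain ⟨π, hπ, -⟩ := exists_perms 1 o ho1 ho2
  obtain ⟨o', ho', hoa', ho1', ho2'⟩ := exists_orientation (G \ C) (n - 1) (fun v => by
    have : (G \ C).neighborSet v = G.neighborSet v \ C.neighborSet v := by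
      ext y; simp
    have hsub : C.neighborSet v ⊆ G.neighborSet v := fun y hy => hCG hy
    rw [this, Set.ncard_sdiff hsub (Set.toFinite _), hG, hC2]
    omega)
  obtain ⟨π', hπ', hu'⟩ := exists_perms (n - 1) o' ho1' ho2'
  have hπ1 : ∀ x y, o x y ↔ π 0 x = y := fun x y => by
    rw [hπ]; exact ⟨fun ⟨i, h⟩ => by rwa [Subsingleton.elim 0 i], fun h => ⟨0, h⟩⟩
  let nx : Idx n → Equiv.Perm V := fun i => i.elim (π 0) π'
  have hCo : ∀ x, C.Adj x (π 0 x) := fun x => (ho _ _).2 (Or.inl ((hπ1 _ _).2 rfl))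
  have hDo : ∀ i x, (G \ C).Adj x (π' i x) := fun i x =>
    (ho' _ _).2 (Or.inl ((hπ' _ _).2 ⟨i, rfl⟩))
  refine ⟨⟨nx, ?_, ?_, ?_⟩, ?_⟩
  · rintro (_ | i) v
    · exact hCG (hCo v)
    · exact (hDo i v).1
  · rintro (_ | i) v h
    · exact hoa _ _ ((hπ1 v _).2 rfl) ((hπ1 _ _).2 h)
    · exact hoa' _ _ ((hπ' v _).2 ⟨i, rfl⟩) ((hπ' _ _).2 ⟨i, h⟩)
  · intro x y hxy
    by_cases hc : C.Adj x y
    · refine ⟨none, ?_, ?_⟩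
      · simpa only [nx, Option.elim, ← hπ1] using (ho x y).1 hc
      · rintro (_ | i) hi
        · rfl
        · rcases hi with rfl | rfl
          · exact absurd hc (hDo i x).2
          · exact absurd hc.symm (hDo i y).2
    · have hd : (G \ C).Adj x y := ⟨hxy, hc⟩
      have hex : ∃ i, π' i x = y ∨ π' i y = x := by
        rcases (ho' x y).1 hd with h | h
        · obtain ⟨i, hi⟩ := (hπ' _ _).1 h; exact ⟨i, Or.inl hi⟩
        · obtain ⟨i, hi⟩ := (hπ' _ _).1 h; exact ⟨i, Or.inr hi⟩
      obtain ⟨i, hi⟩ := hex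
      refine ⟨some i, hi, ?_⟩
      rintro (_ | j) hj
      · rcases hj with rfl | rfl
        · exact absurd (hCo x) hc
        · exact absurd (hCo y).symm hc
      · have hj : π' j x = y ∨ π' j y = x := hj
        have hxor : ∀ i j, π' i x = y → π' j y = x → False := fun i j h1 h2 =>
          hoa' x y ((hπ' _ _).2 ⟨i, h1⟩) ((hπ' _ _).2 ⟨j, h2⟩)
        rcases hi with hi | hi <;> rcases hj with hj | hj
        · rw [hu' i j x (hi.trans hj.symm)]
        · exact (hxor _ _ hi hj).elim
        · exact (hxor _ _ hj hi).elim
        · rw [hu' i j y (hi.trans hj.symm)]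
  · intro v w
    obtain ⟨p⟩ := hC.connected.preconnected v w
    change (π 0).SameCycle v w
    induction p with
    | nil => exact Equiv.Perm.SameCycle.refl _ _
    | cons h _ ih =>
      refine Equiv.Perm.SameCycle.trans ?_ ih
      rcases (ho _ _).1 h with h | h
      · rw [← (hπ1 _ _).1 h]; exact Equiv.Perm.sameCycle_apply_right.2 (Equiv.Perm.SameCycle.refl _ _)
      · rw [← (hπ1 _ _).1 h]; exact Equiv.Perm.sameCycle_apply_left.2 (Equiv.Perm.SameCycle.refl _ _)

end Existence

section Placements

variable {V : Type*} {G : SimpleGraph V} {n : ℕ} (F : DirTwoFactorisation G n)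

/-- Each edge at `v` is directed into or out of `v` in its factor, so `σ_v` is onto the edges at `v`
and the copy at `v` is the clique of the line graph belonging to `v`. -/
theorem unionCopies_top :
    F.unionCopies ⊤ = G.lineGraph := by
  ext x y
  simp only [DirTwoFactorisation.unionCopies, SimpleGraph.iSup_adj, SimpleGraph.map_adj,
    SimpleGraph.top_adj, SimpleGraph.lineGraph_adj_iff_exists]
  constructor
  · rintro ⟨v, a, b, hab, rfl, rfl⟩
    exact ⟨fun h => hab ((F.sigma v).injective h), v, F.mem_sigma v a, F.mem_sigma v b⟩
  · rintro ⟨hne, v, hx, hy⟩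
    have key : ∀ w : G.edgeSet, v ∈ w.1 → ∃ a, F.sigma v a = w := by
      intro w hw
      obtain ⟨u, k, rfl⟩ := F.exists_sigma_inr w
      simp only [DirTwoFactorisation.sigma, DirTwoFactorisation.sigmaFun,
        Function.Embedding.coeFn_mk, Sym2.mem_iff] at hw
      rcases hw with rfl | rfl
      · exact ⟨_, rfl⟩
      · exact ⟨_, F.sigma_inl u k⟩
    obtain ⟨a, rfl⟩ := key x hx
    obtain ⟨b, rfl⟩ := key y hy
    exact ⟨v, a, b, fun h => hne (by rw [h]), rfl, rfl⟩

/-- The placement given by representatives of the cycles. -/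
def Placement.ofRep [DecidableEq V] (f : Idx n → V → V) (hf : ∀ k v, (F.next k).SameCycle v (f k v))
    (hf' : ∀ k v u, (F.next k).SameCycle v u → f k v = f k u) : Placement F.next where
  κ v k := if f k v = v then Cls.first
    else if f k ((F.next k).symm v) = (F.next k).symm v then Cls.second else Cls.other
  step v k := by
    have h1 : f k (F.next k v) = f k v :=
      hf' k _ _ (Equiv.Perm.sameCycle_apply_left.2 (Equiv.Perm.SameCycle.refl _ _))
    have h2 := (F.adj k v).ne
    simp only [Equiv.symm_apply_apply, h1]
    by_cases hv : f k v = v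
    · simp [hv, h2]
    · simp only [hv, if_false]
      split_ifs <;> simp
  hits k v j := by
    have h0 : f k (f k v) = f k v := hf' k _ _ (hf k v).symm
    have h1 : f k (F.next k (f k v)) = f k v := by
      rw [hf' k _ (f k v) (Equiv.Perm.sameCycle_apply_left.2 (Equiv.Perm.SameCycle.refl _ _)), h0]
    have h2 : f k (F.next k (F.next k (f k v))) = f k v := by
      rw [hf' k _ _ (Equiv.Perm.sameCycle_apply_left.2 (Equiv.Perm.SameCycle.refl _ _)), h1]
    have n1 := (F.adj k (f k v)).ne
    have n2 := F.next_next_ne k (f k v)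
    rcases j with _ | _ | _
    · exact ⟨f k v, hf k v, by simp [h0]⟩
    · exact ⟨F.next k (f k v), Equiv.Perm.sameCycle_apply_right.2 (hf k v), by
        simp [h0, h1, n1]⟩
    -- The third vertex of a cycle is neither its first nor its second because cycles have length at
    -- least three.
    · exact ⟨F.next k (F.next k (f k v)), Equiv.Perm.sameCycle_apply_right.2
        (Equiv.Perm.sameCycle_apply_right.2 (hf k v)), by simp [h1, h2, n1, n2.symm]⟩

theorem exists_placement : Nonempty (Placement F.next) := by
  classical
  refine ⟨Placement.ofRep F
    (fun k v => (Quotient.mk (Equiv.Perm.SameCycle.setoid (F.next k)) v).out) ?_ ?_⟩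
  · intro k v
    exact (Quotient.exact (Quotient.out_eq (Quotient.mk (Equiv.Perm.SameCycle.setoid (F.next k)) v))).symm
  · intro k v u h
    exact congrArg Quotient.out (Quotient.sound h)

/-- A placement in which no vertex is at the same time first for label `k₀` and second for
label `k₁`. -/
theorem exists_placement_avoiding [Finite V] (k₀ k₁ : Idx n) (hk : k₀ ≠ k₁) :
    ∃ P : Placement F.next, ∀ v, ¬ (P.κ v k₀ = Cls.first ∧ P.κ v k₁ = Cls.second) := by
  classical
  let Q : Idx n → Type _ := fun k => Quotient (Equiv.Perm.SameCycle.setoid (F.next k))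
  let mk : ∀ k, V → Q k := fun k v => Quotient.mk _ v
  have hfin : ∀ k, Finite (Q k) := fun k => Quotient.finite _
  have hmk : ∀ k v u, mk k v = mk k u ↔ (F.next k).SameCycle v u := fun k v u => Quotient.eq
  have htwo : ∀ k (c : Q k), 2 ≤ {v | mk k v = c}.ncard := by
    intro k c
    obtain ⟨v, rfl⟩ := Quotient.exists_rep c
    rw [← Set.ncard_pair (F.adj k v).ne]
    refine Set.ncard_le_ncard ?_ (Set.toFinite _)
    rintro _ (rfl | rfl)
    · rfl
    · exact (hmk _ _ _).2 (Equiv.Perm.sameCycle_apply_left.2 (Equiv.Perm.SameCycle.refl _ _))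
  -- Distinct vertices are selected for all cycles of the two factors: each cycle has at least two
  -- vertices, and each vertex lies on one cycle of either factor.
  obtain ⟨g, hg, hgr⟩ := exists_injective_of_degrees
    (fun (a : Q k₀ ⊕ Q k₁) (v : V) => a = Sum.inl (mk k₀ v) ∨ a = Sum.inr (mk k₁ v)) 2 (by omega)
    (by
      rintro (c | c)
      · convert htwo k₀ c using 3; ext v; simp [eq_comm]
      · convert htwo k₁ c using 3; ext v; simp [eq_comm])
    (fun v => by
      rw [show {a : Q k₀ ⊕ Q k₁ | a = Sum.inl (mk k₀ v) ∨ a = Sum.inr (mk k₁ v)}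
        = {Sum.inl (mk k₀ v), Sum.inr (mk k₁ v)} by ext; simp]
      exact (Set.ncard_pair Sum.inl_ne_inr).le)
  have hg0 : ∀ c, mk k₀ (g (Sum.inl c)) = c := fun c => by simpa [eq_comm] using hgr (Sum.inl c)
  have hg1 : ∀ c, mk k₁ (g (Sum.inr c)) = c := fun c => by simpa [eq_comm] using hgr (Sum.inr c)
  -- For `k₁` the representative is the predecessor of the selected vertex, so that the selected
  -- vertex itself has role second. Distinctness then excludes the forbidden pair of roles.
  let f : Idx n → V → V := fun k v => if k = k₀ then g (Sum.inl (mk k₀ v)) else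
    if k = k₁ then (F.next k₁).symm (g (Sum.inr (mk k₁ v))) else (mk k v).out
  have hf0 : ∀ v, f k₀ v = g (Sum.inl (mk k₀ v)) := fun v => if_pos rfl
  have hf1 : ∀ v, f k₁ v = (F.next k₁).symm (g (Sum.inr (mk k₁ v))) := fun v => by
    simp [f, hk.symm]
  refine ⟨Placement.ofRep F f ?_ ?_, ?_⟩
  · intro k v
    by_cases h0 : k = k₀
    · subst h0
      rw [hf0]
      exact (hmk _ _ _).1 (hg0 _).symm
    by_cases h1 : k = k₁
    · subst h1
      rw [hf1]
      exact Equiv.Perm.sameCycle_symm_apply_right.2 ((hmk _ _ _).1 (hg1 _).symm)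
    · simp only [f, if_neg h0, if_neg h1]
      exact (hmk _ _ _).1 (Quotient.out_eq _).symm
  · intro k v u h
    have h := (hmk _ _ _).2 h
    by_cases h0 : k = k₀
    · subst h0; rw [hf0, hf0, h]
    by_cases h1 : k = k₁
    · subst h1; rw [hf1, hf1, h]
    · simp only [f, if_neg h0, if_neg h1, h]
  · rintro v ⟨h0, h1⟩
    simp only [Placement.ofRep] at h0 h1
    have e0 : f k₀ v = v := by
      by_contra h
      rw [if_neg h] at h0
      split_ifs at h0
    have e1 : f k₁ ((F.next k₁).symm v) = (F.next k₁).symm v := by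
      by_contra h
      rw [if_neg h] at h1
      split_ifs at h1
    rw [hf0] at e0
    rw [hf1] at e1
    have := (F.next k₁).symm.injective e1
    exact absurd (hg (e0.trans this.symm)) (by simp)

end Placements

end HamFrag

/-! ### Local colourings coded by numbers, and their checkable conditions -/

namespace HamFrag

/-- The two ends of an edge are represented by the same element. -/
theorem compRep_eq_of_mem {α : Type*} [DecidableEq α] {l : List (α × α)} {a b : α}
    (h : (a, b) ∈ l) : compRep l a = compRep l b := by
  induction l with
  | nil => simp at h
  | cons q l ih =>
    obtain ⟨a', b'⟩ := q
    simp only [compRep]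
    rcases List.mem_cons.1 h with h | h
    · obtain ⟨rfl, rfl⟩ := Prod.mk.inj h
      simp
    · rw [ih h]

/-- The code of a vertex class. -/
def Cls.code : Cls → ℕ
  | first => 0
  | second => 1
  | other => 2

theorem Cls.code_lt (j : Cls) : j.code < 3 := by cases j <;> decide

theorem Cls.code_injective : Function.Injective Cls.code := by
  intro i j; cases i <;> cases j <;> simp [Cls.code]

/-- The number with the given ternary digits. -/
def ternary (g : ℕ → ℕ) : ℕ → ℕ
  | 0 => 0
  | f + 1 => ternary g f + 3 ^ f * g f

theorem ternary_lt {g : ℕ → ℕ} (hg : ∀ k, g k < 3) (f : ℕ) : ternary g f < 3 ^ f := by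
  induction f with
  | zero => simp [ternary]
  | succ f ih =>
    have := Nat.mul_le_mul_left (3 ^ f) (Nat.le_of_lt_succ (hg f))
    rw [ternary, pow_succ]; omega

theorem digit_ternary {g : ℕ → ℕ} (hg : ∀ k, g k < 3) {f k : ℕ} (hk : k < f) :
    ternary g f / 3 ^ k % 3 = g k := by
  induction f with
  | zero => omega
  | succ f ih =>
    rcases Nat.lt_succ_iff_lt_or_eq.1 hk with h | rfl
    · have e : 3 ^ f = 3 ^ k * (3 * 3 ^ (f - k - 1)) := by
        rw [← pow_succ', ← pow_add]; congr 1; omega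
      rw [ternary, e, mul_assoc, Nat.add_mul_div_left _ _ (by positivity), mul_assoc,
        Nat.add_mul_mod_self_left, ih h]
    · rw [ternary, Nat.add_mul_div_left _ _ (by positivity), Nat.div_eq_of_lt (ternary_lt hg k),
        zero_add, Nat.mod_eq_of_lt (hg k)]

namespace Code

/-- The code of an index. -/
def idx {m : ℕ} : Idx (m + 1) → ℕ
  | none => m
  | some i => i.val

/-- The code of an element of `A_n ∪ B_n`. -/
def enc {m : ℕ} : Lab (m + 1) → ℕ
  | Sum.inl none => 2 * m
  | Sum.inl (some i) => i.val
  | Sum.inr none => 2 * m + 1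
  | Sum.inr (some i) => i.val + m

/-- The index with the given code. -/
def unidx (m k : ℕ) : Idx (m + 1) := if h : k < m then some ⟨k, h⟩ else none

/-- The element of `A_n ∪ B_n` with the given code. -/
def dec (m a : ℕ) : Lab (m + 1) :=
  if a < m then Sum.inl (unidx m a) else if a < 2 * m then Sum.inr (unidx m (a - m))
  else if a = 2 * m then Sum.inl none else Sum.inr none

/-- The code of the label of an element. -/
def lab (m a : ℕ) : ℕ := if a < m then a else if a < 2 * m then a - m else m

variable {m : ℕ}

theorem idx_le (k : Idx (m + 1)) : idx k ≤ m := by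
  rcases k with _ | i
  · exact le_rfl
  · exact i.isLt.le

theorem idx_lt {k : Idx (m + 1)} (h : k ≠ none) : idx k < m := by
  rcases k with _ | i
  · exact absurd rfl h
  · exact i.isLt

theorem unidx_idx (k : Idx (m + 1)) : unidx m (idx k) = k := by
  rcases k with _ | i
  · simp [unidx, idx]
  · have : i.val < m := i.isLt
    simp [unidx, idx, this]

theorem idx_unidx {k : ℕ} (hk : k ≤ m) : idx (unidx m k) = k := by
  unfold unidx
  split_ifs with h
  · rfl
  · exact le_antisymm (not_lt.1 h) hk

theorem dec_enc (x : Lab (m + 1)) : dec m (enc x) = x := by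
  rcases x with (_ | i) | (_ | i)
  · simp [dec, enc]; intro h; omega
  · have : i.val < m := i.isLt
    simp [dec, enc, unidx, this]
  · simp [dec, enc]; omega
  · have : i.val < m := i.isLt
    have h : ¬ i.val + m < m := by omega
    have h' : i.val + m < 2 * m := by omega
    simp [dec, enc, unidx, h', this]

theorem enc_lt (x : Lab (m + 1)) : enc x < 2 * m + 2 := by
  rcases x with (_ | i) | (_ | i) <;> simp only [enc]
  · omega
  · have : i.val < m := i.isLt
    omega
  · omega
  · have : i.val < m := i.isLt
    omega

theorem enc_inl (k : Idx (m + 1)) : enc (Sum.inl k) = if idx k = m then 2 * m else idx k := by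
  rcases k with _ | i
  · simp [enc, idx]
  · have : i.val < m := i.isLt
    simp [enc, idx, this.ne]

theorem enc_inr (k : Idx (m + 1)) :
    enc (Sum.inr k) = if idx k = m then 2 * m + 1 else idx k + m := by
  rcases k with _ | i
  · simp [enc, idx]
  · have : i.val < m := i.isLt
    simp [enc, idx, this.ne]

theorem enc_dec {a : ℕ} (ha : a < 2 * m + 2) : enc (dec m a) = a := by
  unfold dec
  split_ifs with h1 h2 h3
  · rw [enc_inl, idx_unidx h1.le, if_neg h1.ne]
  · rw [enc_inr, idx_unidx (by omega), if_neg (by omega)]; omega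
  · simp [enc, h3]
  · simp [enc]; omega

theorem enc_injective : Function.Injective (enc : Lab (m + 1) → ℕ) :=
  Function.LeftInverse.injective dec_enc

theorem lab_enc (x : Lab (m + 1)) : lab m (enc x) = idx (label x) := by
  rcases x with k | k
  · have := idx_le k
    simp only [label, Sum.elim_inl, id, enc_inl, lab]
    split_ifs <;> omega
  · have := idx_le k
    simp only [label, Sum.elim_inr, id, enc_inr, lab]
    split_ifs <;> omega

/-- The colour of a pair in the colouring with the given code, whose hexadecimal digits are the
colours of the pairs in colexicographic order. -/
def col (g a b : ℕ) : ℕ := g / 16 ^ (max a b * (max a b - 1) / 2 + min a b) % 16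

theorem col_comm (g a b : ℕ) : col g a b = col g b a := by
  rw [col, col, max_comm, min_comm]

/-- The graph of a colour. -/
def gr (m g c : ℕ) : SimpleGraph (Lab (m + 1)) where
  Adj x y := x ≠ y ∧ col g (enc x) (enc y) = c
  symm := ⟨fun _ _ h => ⟨h.1.symm, by rw [col_comm]; exact h.2⟩⟩
  loopless := ⟨fun _ h => h.1 rfl⟩

/-- The list of the edges of a colour. -/
def edges (m g c : ℕ) : List (ℕ × ℕ) :=
  (List.range (2 * m + 2)).flatMap fun b =>
    ((List.range b).filter fun a => col g a b = c).map fun a => (a, b)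

theorem mem_edges {g c a b : ℕ} : (a, b) ∈ edges m g c ↔ b < 2 * m + 2 ∧ a < b ∧ col g a b = c := by
  simp only [edges, List.mem_flatMap, List.mem_range, List.mem_map, List.mem_filter,
    decide_eq_true_eq, Prod.mk.injEq]
  constructor
  · rintro ⟨b', h1, a', ⟨h2, h3⟩, rfl, rfl⟩
    exact ⟨h1, h2, h3⟩
  · rintro ⟨h1, h2, h3⟩
    exact ⟨b, h1, a, ⟨h2, h3⟩, rfl, rfl⟩

theorem gr_adj_dec {g c a b : ℕ} (h : (a, b) ∈ edges m g c) : (gr m g c).Adj (dec m a) (dec m b) := by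
  obtain ⟨h1, h2, h3⟩ := mem_edges.1 h
  refine ⟨fun h => ?_, by rw [enc_dec (by omega), enc_dec h1]; exact h3⟩
  have := congrArg enc h
  rw [enc_dec (by omega), enc_dec h1] at this
  omega

theorem gr_adj_of_col {g c : ℕ} {x y : Lab (m + 1)} (h : enc x ≠ enc y)
    (h' : col g (enc x) (enc y) = c) : (gr m g c).Adj x y := ⟨fun e => h (by rw [e]), h'⟩

/-- The representative of a component of a colour. -/
def rep (m g c a : ℕ) : ℕ := compRep (edges m g c) a

theorem reachable_of_rep {g c : ℕ} {x y : Lab (m + 1)} (h : rep m g c (enc x) = rep m g c (enc y)) :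
    (gr m g c).Reachable x y := by
  have main : ∀ a b, Relation.EqvGen (fun a b => (a, b) ∈ edges m g c) a b →
      (gr m g c).Reachable (dec m a) (dec m b) := by
    intro a b h
    induction h with
    | rel a b h => exact (gr_adj_dec h).reachable
    | refl a => exact SimpleGraph.Reachable.refl _
    | symm _ _ _ ih => exact ih.symm
    | trans _ _ _ _ _ ih ih' => exact ih.trans ih'
  have := main _ _ (eqvGen_of_compRep_eq h)
  rwa [dec_enc, dec_enc] at this

theorem rep_of_reachable {g c : ℕ} {x y : Lab (m + 1)} (h : (gr m g c).Reachable x y) :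
    rep m g c (enc x) = rep m g c (enc y) := by
  have main : ∀ x y, (gr m g c).Adj x y → rep m g c (enc x) = rep m g c (enc y) := by
    intro x y hxy
    rcases lt_trichotomy (enc x) (enc y) with h | h | h
    · exact compRep_eq_of_mem (mem_edges.2 ⟨enc_lt y, h, hxy.2⟩)
    · exact absurd (enc_injective h) hxy.1
    · exact (compRep_eq_of_mem (mem_edges.2 ⟨enc_lt x, h, by rw [col_comm]; exact hxy.2⟩)).symm
  obtain ⟨p⟩ := h
  induction p with
  | nil => rfl
  | cons h _ ih => exact (main _ _ h).trans ih

theorem ncard_enc (p : ℕ → Prop) [DecidablePred p] :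
    {x : Lab (m + 1) | p (enc x)}.ncard = ((List.range (2 * m + 2)).filter fun a => p a).length := by
  rw [← List.toFinset_card_of_nodup (List.nodup_range.filter _), ← Set.ncard_coe_finset,
    ← Set.ncard_image_of_injective _ enc_injective]
  congr 1
  ext a
  simp only [Set.mem_image, Set.mem_ofPred_eq, List.coe_toFinset, List.mem_filter, List.mem_range,
    decide_eq_true_eq]
  constructor
  · rintro ⟨x, h, rfl⟩
    exact ⟨enc_lt x, h⟩
  · rintro ⟨h, h'⟩
    exact ⟨dec m a, by rwa [enc_dec h], enc_dec h⟩

end Code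

/-- Local colourings given by numbers: the digits of the elements of `cfgs` are the colours of the
pairs. The labels below `f` are those whose classes matter, and the others have gadgets. -/
structure Table where
  m : ℕ
  f : ℕ
  D : List (List ℕ)
  X : List (List ℕ)
  blk : ℕ → ℕ → ℕ → ℕ
  z : List ℕ
  p : List ℕ
  i : List ℕ
  -- The position in the outer list is the ternary code of the roles of the labels below `f`. An
  -- entry consists of a colouring and the pairs `s`, `t` of its gadgets; an empty list means that
  -- this combination of roles is not allowed.
  cfgs : List (List (ℕ × List (ℕ × ℕ)))

namespace Table

open Code

variable (T : Table)

/-- The numbers of edges of colour `c` at the tails of label `k`. -/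
def tail (L : List (List ℕ)) (k c : ℕ) : ℕ := if k = T.m then 1 else (L.getD k []).getD c 0

/-- The label has a gadget. -/
def Gam (k : ℕ) : Prop := T.f ≤ k ∧ k < T.m

instance (k : ℕ) : Decidable (T.Gam k) := inferInstanceAs (Decidable (_ ∧ _))

/-- The colour in which label `k` runs through cycles of its own. -/
def own (k : ℕ) : ℕ := T.z.getD (k - T.f) 0

/-- The colour in which the gadget of label `k` has a path through the outgoing edge. -/
def out (k : ℕ) : ℕ := T.p.getD (k - T.f) 0

/-- The colour in which the gadget of label `k` has a path through the incoming edge. -/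
def inc (k : ℕ) : ℕ := T.i.getD (k - T.f) 0

/-- Label `k` runs through cycles of its own in colour `c`. -/
def IsOwn (c k : ℕ) : Prop := T.Gam k ∧ T.own k = c

instance (c k : ℕ) : Decidable (T.IsOwn c k) := inferInstanceAs (Decidable (_ ∧ _))

/-- The prescribed degrees, where `q` encodes the classes. -/
def deg (q c a : ℕ) : ℕ :=
  if a < T.m then 2 - (if q / 3 ^ a % 3 = 1 then T.tail T.X a c else T.tail T.D a c)
  else if a < 2 * T.m then
    if q / 3 ^ (a - T.m) % 3 = 0 then T.tail T.X (a - T.m) c else T.tail T.D (a - T.m) c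
  else 1

/-- The ends of the paths of colour `c`. -/
def ports (q c : ℕ) : List ℕ := (List.range (2 * T.m + 2)).filter fun a => T.deg q c a = 1

/-- The colourings with the given code of the classes. -/
def conf (q : ℕ) : List (ℕ × List (ℕ × ℕ)) := T.cfgs.getD q []

/-- Together with the given pairing of the ends of paths, a colour class is connected as
required. -/
def Fits (q c g : ℕ) (M : List (ℕ × ℕ)) : Prop :=
  ∀ a ∈ T.ports q c, ∀ b ∈ T.ports q c, T.blk q c (lab T.m a) = T.blk q c (lab T.m b) →
    compRep (M ++ edges T.m g c) a = compRep (M ++ edges T.m g c) b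

instance (q c g : ℕ) (M : List (ℕ × ℕ)) : Decidable (T.Fits q c g M) :=
  inferInstanceAs (Decidable (∀ _ ∈ _, ∀ _ ∈ _, _ → _))

/-- For all pairings of the ends of paths some colouring is connected as required. -/
def choose (q : ℕ) : List ℕ → List (ℕ × List (ℕ × ℕ)) → Bool
  | [], l => !l.isEmpty
  | c :: cs, l => (perfectMatchings (T.m + 1) (T.ports q c)).all fun M =>
      choose q cs (l.filter fun g => T.Fits q c g.1 M)

/-- The first further vertex of the gadget of a label. -/
def src (g : ℕ × List (ℕ × ℕ)) (k : ℕ) : ℕ := (g.2.getD (k - T.f) 0).1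

/-- The second further vertex of the gadget of a label. -/
def tgt (g : ℕ × List (ℕ × ℕ)) (k : ℕ) : ℕ := (g.2.getD (k - T.f) 0).2

/-- The vertices of the gadget of a label. -/
def tetra (g : ℕ × List (ℕ × ℕ)) (k : ℕ) : List ℕ := [T.src g k, T.tgt g k, k, k + T.m]

/-- The conditions under which a table gives a scheme. -/
structure Good : Prop where
  deg_le : ∀ k < T.m, ∀ c < 2 * T.m + 1, T.tail T.D k c ≤ 2 ∧ T.tail T.X k c ≤ 2 ∧
    (T.tail T.D k c = 1 ↔ T.tail T.X k c = 1)
  gam : ∀ k < T.m, T.Gam k → (∀ c < 2 * T.m + 1, T.tail T.X k c = T.tail T.D k c ∧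
    (T.tail T.D k c = 1 → c = T.own k)) ∧ T.own k < 2 * T.m + 1 ∧ T.out k < 2 * T.m + 1 ∧
    T.inc k < 2 * T.m + 1 ∧ T.own k ≠ T.out k ∧ T.own k ≠ T.inc k ∧ T.out k ≠ T.inc k
  link : ∀ k < T.f, ∀ c < 2 * T.m + 1, T.tail T.D k c = 1 → ∃ j < 3, ∀ q < 3 ^ T.f, T.conf q ≠ [] →
    q / 3 ^ k % 3 = j → T.blk q c T.m = T.blk q c k ∨
      ∃ k' < k, T.tail T.D k' c = 1 ∧ T.blk q c k' = T.blk q c k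
  col_lt : ∀ q < 3 ^ T.f, ∀ g ∈ T.conf q, ∀ a < 2 * T.m + 2, ∀ b < 2 * T.m + 2,
    col g.1 a b < 2 * T.m + 1
  degree : ∀ q < 3 ^ T.f, ∀ g ∈ T.conf q, ∀ c < 2 * T.m + 1, ∀ a < 2 * T.m + 2,
    ((List.range (2 * T.m + 2)).filter fun b => a ≠ b ∧ col g.1 a b = c).length = T.deg q c a
  attach : ∀ q < 3 ^ T.f, ∀ g ∈ T.conf q, ∀ c < 2 * T.m + 1, ∀ a < 2 * T.m + 2, T.deg q c a ≠ 0 →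
    ∃ b < 2 * T.m + 2, T.deg q c b = 1 ∧ (T.IsOwn c (lab T.m b) → T.IsOwn c (lab T.m a)) ∧
      rep T.m g.1 c a = rep T.m g.1 c b
  block : ∀ q < 3 ^ T.f, ∀ g ∈ T.conf q, ∀ c < 2 * T.m + 1, ∀ a ∈ T.ports q c, ∀ b ∈ T.ports q c,
    rep T.m g.1 c a = rep T.m g.1 c b → T.blk q c (lab T.m a) = T.blk q c (lab T.m b)
  choice : ∀ q < 3 ^ T.f, T.conf q ≠ [] → T.choose q (List.range (2 * T.m + 1)) (T.conf q) = true
  gadget : ∀ q < 3 ^ T.f, ∀ g ∈ T.conf q, ∀ k < T.m, T.Gam k →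
    T.src g k < 2 * T.m + 2 ∧ T.tgt g k < 2 * T.m + 2 ∧ T.src g k ≠ T.tgt g k ∧
    lab T.m (T.src g k) ≠ k ∧ lab T.m (T.tgt g k) ≠ k ∧
    ¬ T.IsOwn (T.own k) (lab T.m (T.src g k)) ∧ col g.1 k (k + T.m) = T.own k ∧
    col g.1 (T.src g k) (T.tgt g k) = T.own k ∧ col g.1 (T.src g k) (k + T.m) = T.out k ∧
    col g.1 (k + T.m) (T.tgt g k) = T.out k ∧ col g.1 (T.src g k) k = T.inc k ∧
    col g.1 k (T.tgt g k) = T.inc k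
  quads : ∀ q < 3 ^ T.f, ∀ g ∈ T.conf q, ∀ k < T.m, ∀ k' < T.m, T.Gam k → T.Gam k' → k ≠ k' →
    ((T.tetra g k).filter fun a => a ∈ T.tetra g k').length ≤ 1
  blk_le : ∀ q < 3 ^ T.f, ∀ c < 2 * T.m + 1, ∀ k < T.m + 1, T.blk q c k ≤ T.m

variable {T}

/-- Each colour filters the list left over by the colours before it, so a surviving configuration
answers the pairings of all colours at the same time. -/
theorem exists_fits {q : ℕ} {M : ℕ → List (ℕ × ℕ)} (cs : List ℕ)
    (hM : ∀ c ∈ cs, M c ∈ perfectMatchings (T.m + 1) (T.ports q c)) (l : List (ℕ × List (ℕ × ℕ)))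
    (h : T.choose q cs l = true) : ∃ g ∈ l, ∀ c ∈ cs, T.Fits q c g.1 (M c) := by
  induction cs generalizing l with
  | nil =>
    rcases l with _ | ⟨g, l⟩
    · simp [choose] at h
    · exact ⟨g, by simp, by simp⟩
  | cons c cs ih =>
    rw [choose, List.all_eq_true] at h
    obtain ⟨g, hg, hg'⟩ := ih (fun c' hc' => hM c' (List.mem_cons_of_mem _ hc')) _ (h _ (hM c (by simp)))
    rw [List.mem_filter, decide_eq_true_eq] at hg
    refine ⟨g, hg.1, fun c' hc' => ?_⟩
    rcases List.mem_cons.1 hc' with rfl | hc'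
    · exact hg.2
    · exact hg' c' hc'

variable (T)

/-- The code of the classes. -/
def key (κ : Idx (T.m + 1) → Cls) : ℕ := ternary (fun k => (κ (unidx T.m k)).code) T.f

theorem key_lt (κ : Idx (T.m + 1) → Cls) : T.key κ < 3 ^ T.f := ternary_lt (fun _ => Cls.code_lt _) _

variable {T}

theorem digit_key (κ : Idx (T.m + 1) → Cls) {k : Idx (T.m + 1)} (hk : idx k < T.f) :
    T.key κ / 3 ^ idx k % 3 = (κ k).code := by
  rw [key, digit_ternary (fun _ => Cls.code_lt _) hk, unidx_idx]

namespace Good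

/-- The key records only the roles of labels below `f`; for the labels with gadgets `X` and `D`
agree, so their roles have no influence on degrees. -/
theorem state (h : T.Good) (κ : Idx (T.m + 1) → Cls) {k : Idx (T.m + 1)} (hk : idx k < T.m) {c : ℕ}
    (hc : c < 2 * T.m + 1) (j : Cls) :
    (if κ k = j then T.tail T.X (idx k) c else T.tail T.D (idx k) c) =
      if T.key κ / 3 ^ idx k % 3 = j.code then T.tail T.X (idx k) c else T.tail T.D (idx k) c := by
  by_cases hf : idx k < T.f
  · rw [digit_key κ hf]
    simp only [Cls.code_injective.eq_iff]
  · rw [((h.gam _ hk ⟨not_lt.1 hf, hk⟩).1 c hc).1, ite_self, ite_self]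

theorem degOf_eq (h : T.Good) (κ : Idx (T.m + 1) → Cls) (c : Fin (2 * T.m + 1)) (x : Lab (T.m + 1)) :
    degOf (fun k (c : Fin (2 * T.m + 1)) => T.tail T.D (idx k) c)
      (fun k c => T.tail T.X (idx k) c) κ c x = T.deg (T.key κ) c (enc x) := by
  rcases x with k | k
  · simp only [degOf, enc_inl, deg]
    by_cases hk : idx k = T.m
    · simp [hk, tail]
      intro h; omega
    · have hk' : idx k < T.m := lt_of_le_of_ne (idx_le k) hk
      rw [if_neg hk, if_pos hk', h.state κ hk' c.isLt]
      rfl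
  · simp only [degOf, enc_inr, deg]
    by_cases hk : idx k = T.m
    · simp [hk, tail]
      intro h; omega
    · have hk' : idx k < T.m := lt_of_le_of_ne (idx_le k) hk
      rw [if_neg hk, if_neg (show ¬ idx k + T.m < T.m by omega),
        if_pos (show idx k + T.m < 2 * T.m by omega), Nat.add_sub_cancel, h.state κ hk' c.isLt]
      rfl

theorem deg_enc (h : T.Good) (κ : Idx (T.m + 1) → Cls) {g : ℕ × List (ℕ × ℕ)}
    (hg : g ∈ T.conf (T.key κ)) (c : Fin (2 * T.m + 1)) (x : Lab (T.m + 1)) :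
    ((gr T.m g.1 c).neighborSet x).ncard = T.deg (T.key κ) c (enc x) := by
  rw [← h.degree _ (T.key_lt κ) g hg c c.isLt _ (enc_lt x), ← ncard_enc]
  congr 1
  ext y
  simp [gr, enc_injective.eq_iff]

theorem fin_ofNat (h : T.Good) {k : ℕ} (hk : T.Gam k) :
    ((Fin.ofNat (2 * T.m + 1) (T.own k)).val = T.own k) ∧
    ((Fin.ofNat (2 * T.m + 1) (T.out k)).val = T.out k) ∧
    ((Fin.ofNat (2 * T.m + 1) (T.inc k)).val = T.inc k) := by
  obtain ⟨-, h1, h2, h3, -⟩ := h.gam k hk.2 hk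
  exact ⟨Nat.mod_eq_of_lt h1, Nat.mod_eq_of_lt h2, Nat.mod_eq_of_lt h3⟩

theorem isOwn_iff (h : T.Good) (k : ℕ) (c : Fin (2 * T.m + 1)) :
    (T.Gam k ∧ Fin.ofNat (2 * T.m + 1) (T.own k) = c) ↔ T.IsOwn c k := by
  refine and_congr_right fun hk => ?_
  rw [Fin.ext_iff, (h.fin_ofNat hk).1]

theorem blk_eq (h : T.Good) (κ : Idx (T.m + 1) → Cls) (c : Fin (2 * T.m + 1)) {k k' : ℕ}
    (hk : k ≤ T.m) (hk' : k' ≤ T.m) :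
    unidx T.m (T.blk (T.key κ) c k) = unidx T.m (T.blk (T.key κ) c k') ↔
      T.blk (T.key κ) c k = T.blk (T.key κ) c k' := by
  refine ⟨fun e => ?_, fun e => by rw [e]⟩
  have := congrArg idx e
  rwa [idx_unidx (h.blk_le _ (T.key_lt κ) c c.isLt k (by omega)),
    idx_unidx (h.blk_le _ (T.key_lt κ) c c.isLt k' (by omega))] at this

theorem mem_ports {q c : ℕ} {x : Lab (T.m + 1)} (hx : T.deg q c (enc x) = 1) : enc x ∈ T.ports q c := by
  simp [ports, hx, enc_lt x]

theorem attach' (h : T.Good) (κ : Idx (T.m + 1) → Cls) {g : ℕ × List (ℕ × ℕ)}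
    (hg : g ∈ T.conf (T.key κ)) (c : Fin (2 * T.m + 1)) (x : Lab (T.m + 1))
    (hx : T.deg (T.key κ) c (enc x) ≠ 0) : ∃ y : Lab (T.m + 1), T.deg (T.key κ) c (enc y) = 1 ∧
      (T.IsOwn c (idx (label y)) → T.IsOwn c (idx (label x))) ∧ (gr T.m g.1 c).Reachable x y := by
  obtain ⟨b, hb, h1, h2, h3⟩ := h.attach _ (T.key_lt κ) g hg c c.isLt _ (enc_lt x) hx
  refine ⟨dec T.m b, by rwa [enc_dec hb], ?_, reachable_of_rep (by rwa [enc_dec hb])⟩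
  rwa [← lab_enc, ← lab_enc, enc_dec hb]

/-- Evenness of the classes turns the outside connectivity of every colour into a pairing of its
ports. The check `choose` has run through all families of pairings, hence through this one. -/
theorem switchable (h : T.Good) (κ : Idx (T.m + 1) → Cls) (hκ : T.conf (T.key κ) ≠ []) :
    Copies.Switchable (fun (c : Fin (2 * T.m + 1)) x => T.deg (T.key κ) c (enc x)) (Idx (T.m + 1))
      (fun c x => unidx T.m (T.blk (T.key κ) c (idx (label x))))
      {ℓ | ∃ g ∈ T.conf (T.key κ), ℓ = fun c : Fin (2 * T.m + 1) => gr T.m g.1 c} where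
  nonempty := by
    obtain ⟨g, hg⟩ := List.exists_mem_of_ne_nil _ hκ
    exact ⟨_, g, hg, rfl⟩
  degree := by
    rintro _ ⟨g, hg, rfl⟩ c x
    exact h.deg_enc κ hg c x
  attach := by
    rintro _ ⟨g, hg, rfl⟩ c x hx
    obtain ⟨y, h1, -, h2⟩ := h.attach' κ hg c x hx
    exact ⟨y, h1, h2⟩
  block := by
    rintro _ ⟨g, hg, rfl⟩ c x y hx hy hxy
    have := h.block _ (T.key_lt κ) g hg c c.isLt _ (mem_ports hx) _ (mem_ports hy) (rep_of_reachable hxy)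
    rw [lab_enc, lab_enc] at this
    simp only [this]
  choice := by
    classical
    intro E hE hev
    have key : ∀ c : ℕ, ∃ M, ∀ hc : c < 2 * T.m + 1,
        M ∈ perfectMatchings (T.m + 1) (T.ports (T.key κ) c) ∧
        ∀ e ∈ M, E ⟨c, hc⟩ (dec T.m e.1) (dec T.m e.2) := by
      intro c
      by_cases hc : c < 2 * T.m + 1
      · obtain ⟨M, hM, hM'⟩ := exists_perfectMatching (fun a b => E ⟨c, hc⟩ (dec T.m a) (dec T.m b))
          ⟨fun a => (hE _).refl _, (hE _).symm, (hE _).trans⟩ (T.m + 1) (T.ports (T.key κ) c)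
          (List.nodup_range.filter _) ((List.length_filter_le _ _).trans (by simp; omega)) (by
            intro a _
            have := hev ⟨c, hc⟩ (dec T.m a)
            have e := ncard_enc (m := T.m) fun b => T.deg (T.key κ) c b = 1 ∧
              E ⟨c, hc⟩ (dec T.m a) (dec T.m b)
            simp only [dec_enc] at e
            rw [e] at this
            rw [List.countP_eq_length_filter, ports, List.filter_filter]
            convert this using 4
            simp [and_comm])
        exact ⟨M, fun _ => ⟨hM, hM'⟩⟩
      · exact ⟨[], fun hc' => absurd hc' hc⟩
    choose M hM using key
    obtain ⟨g, hg, hfit⟩ := exists_fits (List.range (2 * T.m + 1))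
      (fun c hc => (hM c (List.mem_range.1 hc)).1) _ (h.choice _ (T.key_lt κ) hκ)
    refine ⟨_, ⟨g, hg, rfl⟩, fun c x y hx hy hxy => ?_⟩
    have e := hfit c (List.mem_range.2 c.isLt) _ (mem_ports hx) _ (mem_ports hy) (by
      rw [lab_enc, lab_enc]
      exact (h.blk_eq κ c (idx_le _) (idx_le _)).1 hxy)
    have main : ∀ a b, Relation.EqvGen (fun a b => (a, b) ∈ M c ++ edges T.m g.1 c) a b →
        Relation.EqvGen (fun x y => E c x y ∨ (gr T.m g.1 c).Adj x y) (dec T.m a) (dec T.m b) := by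
      intro a b hab
      induction hab with
      | rel a b hab =>
        refine .rel _ _ ?_
        rcases List.mem_append.1 hab with hab | hab
        · exact Or.inl ((hM c c.isLt).2 _ hab)
        · exact Or.inr (gr_adj_dec hab)
      | refl a => exact .refl _
      | symm _ _ _ ih => exact .symm _ _ ih
      | trans _ _ _ _ _ ih ih' => exact .trans _ _ _ ih ih'
    have := main _ _ (eqvGen_of_compRep_eq e)
    rwa [dec_enc, dec_enc] at this

/-- The scheme given by a table. -/
def scheme (h : T.Good) : Scheme (T.m + 1) (Fin (2 * T.m + 1)) where
  allowed := fun κ => T.conf (T.key κ) ≠ []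
  D := fun k c => T.tail T.D (idx k) c
  X := fun k c => T.tail T.X (idx k) c
  D_le := by
    intro k c
    by_cases hk : k = none
    · subst hk; simp [tail, idx]
    · exact (h.deg_le _ (idx_lt hk) c c.isLt).1
  X_le := by
    intro k c
    by_cases hk : k = none
    · subst hk; simp [tail, idx]
    · exact (h.deg_le _ (idx_lt hk) c c.isLt).2.1
  euler := by
    intro k c
    by_cases hk : k = none
    · subst hk; simp [tail, idx]
    · exact (h.deg_le _ (idx_lt hk) c c.isLt).2.2
  blk := fun κ c k => unidx T.m (T.blk (T.key κ) c (idx k))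
  Λ := fun κ => {ℓ | ∃ g ∈ T.conf (T.key κ), ℓ = fun c : Fin (2 * T.m + 1) => gr T.m g.1 c}
  switch := by
    intro κ hκ
    have e : degOf (fun k (c : Fin (2 * T.m + 1)) => T.tail T.D (idx k) c)
        (fun k c => T.tail T.X (idx k) c) κ
        = fun (c : Fin (2 * T.m + 1)) x => T.deg (T.key κ) c (enc x) := by
      funext c x
      exact h.degOf_eq κ c x
    rw [e]
    exact h.switchable κ hκ
  partition := by
    rintro κ _ _ ⟨g, hg, rfl⟩ x y hxy
    exact ⟨⟨col g.1 (enc x) (enc y), h.col_lt _ (T.key_lt κ) g hg _ (enc_lt x) _ (enc_lt y)⟩,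
      ⟨hxy, rfl⟩, fun c hc => Fin.ext hc.2.symm⟩
  gam := fun k => T.Gam (idx k)
  z := fun k => Fin.ofNat _ (T.own (idx k))
  p := fun k => Fin.ofNat _ (T.out (idx k))
  i := fun k => Fin.ofNat _ (T.inc (idx k))
  gam_top := fun hk => (hk.2.ne rfl).elim
  z_ne_p := by
    intro k hk e
    obtain ⟨h1, h2, h3⟩ := h.fin_ofNat hk
    have := congrArg Fin.val e
    rw [h1, h2] at this
    exact (h.gam _ hk.2 hk).2.2.2.2.1 this
  z_ne_i := by
    intro k hk e
    obtain ⟨h1, h2, h3⟩ := h.fin_ofNat hk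
    have := congrArg Fin.val e
    rw [h1, h3] at this
    exact (h.gam _ hk.2 hk).2.2.2.2.2.1 this
  p_ne_i := by
    intro k hk e
    obtain ⟨h1, h2, h3⟩ := h.fin_ofNat hk
    have := congrArg Fin.val e
    rw [h2, h3] at this
    exact (h.gam _ hk.2 hk).2.2.2.2.2.2 this
  rank := fun k => if k = none then 0 else idx k + 1
  link := by
    intro c k hD hown hk
    rw [h.isOwn_iff] at hown
    have hk' := idx_lt hk
    -- A label with a gadget has odd degree in its own colour only, so any other label with ports is
    -- one of those below `f`.
    have hf : idx k < T.f := by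
      by_contra hf
      have hg : T.Gam (idx k) := ⟨not_lt.1 hf, hk'⟩
      exact hown ⟨hg, ((h.gam _ hk' hg).1 c c.isLt).2 hD |>.symm⟩
    obtain ⟨j, hj, hl⟩ := h.link _ hf c c.isLt hD
    obtain ⟨J, rfl⟩ : ∃ J : Cls, J.code = j := by
      interval_cases j
      · exact ⟨.first, rfl⟩
      · exact ⟨.second, rfl⟩
      · exact ⟨.other, rfl⟩
    refine ⟨J, fun κ hκ hJ => ?_⟩
    rcases hl _ (T.key_lt κ) hκ (by rw [digit_key κ hf, hJ]) with hl | ⟨k', hk1, hk2, hk3⟩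
    · refine ⟨none, by simp [tail, idx], fun hg => hg.1.2.ne rfl, by simp [hk], ?_⟩
      rw [← show T.blk (T.key κ) c T.m = _ from hl]
      rfl
    · have e : idx (unidx T.m k') = k' := idx_unidx (by omega)
      have hn : unidx T.m k' ≠ none := by
        intro hn
        rw [hn] at e
        simp only [idx] at e
        omega
      refine ⟨unidx T.m k', by rwa [e], fun hg => ?_, ?_, ?_⟩
      · have := hg.1.1
        rw [e] at this
        omega
      · rw [if_neg hn, if_neg hk, e]; omega
      · simp only [e, hk3]
  attach := by
    rintro κ _ _ ⟨g, hg, rfl⟩ c x hx hown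
    have e := h.degOf_eq κ c
    rw [h.isOwn_iff] at hown
    obtain ⟨y, h1, h2, h3⟩ := h.attach' κ hg c x (by rw [← e]; exact hx)
    exact ⟨y, (e y).trans h1, fun hy => hown (h2 ((h.isOwn_iff _ c).1 hy)), h3⟩
  gadget := by
    rintro κ _ _ ⟨g, hg, rfl⟩
    have hq := T.key_lt κ
    refine ⟨fun k => dec T.m (T.src g (idx k)), fun k => dec T.m (T.tgt g (idx k)), ?_, ?_⟩
    · intro k hk
      obtain ⟨h1, h2, h3, h4, h5, h6, h7, h8, h9, h10, h11, h12⟩ := h.gadget _ hq g hg _ hk.2 hk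
      obtain ⟨z1, z2, z3⟩ := h.fin_ofNat hk
      have el : enc (Sum.inl k : Lab (T.m + 1)) = idx k := by rw [enc_inl, if_neg hk.2.ne]
      have er : enc (Sum.inr k : Lab (T.m + 1)) = idx k + T.m := by rw [enc_inr, if_neg hk.2.ne]
      have hne : ∀ a, lab T.m a ≠ idx k → a ≠ idx k ∧ a ≠ idx k + T.m := by
        intro a ha
        have := hk.2
        unfold lab at ha
        split_ifs at ha <;> omega
      have hs := hne _ h4
      have ht := hne _ h5
      have hk0 : 0 < T.m := lt_of_le_of_lt (Nat.zero_le _) hk.2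
      refine ⟨fun e => h4 ?_, fun e => h5 ?_, fun e => h6 ?_, ?_, ?_, ?_, ?_, ?_, ?_⟩
      · exact (by rw [enc_dec h1] : lab T.m (T.src g (idx k)) = lab T.m (enc (dec T.m (T.src g (idx k))))).trans
          ((lab_enc _).trans (congrArg idx e))
      · exact (by rw [enc_dec h2] : lab T.m (T.tgt g (idx k)) = lab T.m (enc (dec T.m (T.tgt g (idx k))))).trans
          ((lab_enc _).trans (congrArg idx e))
      · have := (h.isOwn_iff _ _).1 e
        rwa [← lab_enc, enc_dec h1, z1] at this
      all_goals
        apply gr_adj_of_col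
        all_goals simp only [enc_dec h1, enc_dec h2, el, er, z1, z2, z3]
      all_goals first | assumption | exact hs.1 | exact hs.2 | exact ht.1.symm | exact ht.2.symm | omega
    · intro k k' hk hk' hkk x hx y hy
      have key : ∀ (k : Idx (T.m + 1)) (hk : T.Gam (idx k)) (x : Lab (T.m + 1)),
          x ∈ quad (dec T.m (T.src g (idx k))) (dec T.m (T.tgt g (idx k))) k →
          enc x ∈ T.tetra g (idx k) := by
        intro k hk x hx
        obtain ⟨h1, h2, -⟩ := h.gadget _ hq g hg _ hk.2 hk
        simp only [quad, Set.mem_insert_iff, Set.mem_singleton_iff] at hx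
        rcases hx with rfl | rfl | rfl | rfl
        · simp [tetra, enc_dec h1]
        · simp [tetra, enc_dec h2]
        · simp [tetra, enc_inl, hk.2.ne]
        · simp [tetra, enc_inr, hk.2.ne]
      have hne : idx k ≠ idx k' := fun e => hkk (by rw [← unidx_idx k, e, unidx_idx])
      have hl := h.quads _ hq g hg _ hk.2 _ hk'.2 hk hk' hne
      have h1 := List.mem_filter (p := fun a => decide (a ∈ T.tetra g (idx k'))).2 ⟨key k hk x hx.1, decide_eq_true (key k' hk' x hx.2)⟩
      have h2 := List.mem_filter (p := fun a => decide (a ∈ T.tetra g (idx k'))).2 ⟨key k hk y hy.1, decide_eq_true (key k' hk' y hy.2)⟩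
      apply enc_injective
      generalize List.filter _ _ = l at hl h1 h2
      rcases l with _ | ⟨a, _ | ⟨b, l⟩⟩
      · simp at h1
      · simp at h1 h2
        rw [h1, h2]
      · simp at hl

end Good

end Table

end HamFrag

/-! ### Tables for at most five labels besides `∞` -/

namespace HamFrag

/-- The table for zero labels. -/
def tableZero : Table where
  m := 0
  f := 0
  D := []
  X := []
  blk := fun _ _ k => k
  z := []
  p := []
  i := []
  cfgs := [[(0, [])]]

set_option maxRecDepth 100000 in
set_option synthInstance.maxHeartbeats 200000 in
set_option synthInstance.maxSize 1000 in
theorem good_tableZero : tableZero.Good where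
  deg_le := by decide +kernel
  gam := by decide +kernel
  link := by decide +kernel
  col_lt := by decide +kernel
  degree := by decide +kernel
  attach := by decide +kernel
  block := by decide +kernel
  choice := by decide +kernel
  gadget := by decide +kernel
  quads := by decide +kernel
  blk_le := by decide +kernel

/-- The table for one labels. -/
def tableOne : Table where
  m := 1
  f := 0
  D := [[1, 2, 0]]
  X := [[1, 2, 0]]
  blk := fun _ _ k => k
  z := [0]
  p := [1]
  i := [2]
  cfgs := [[(74016, [(2, 3)])]]

set_option maxRecDepth 100000 in
set_option synthInstance.maxHeartbeats 200000 in
set_option synthInstance.maxSize 1000 in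
theorem good_tableOne : tableOne.Good where
  deg_le := by decide +kernel
  gam := by decide +kernel
  link := by decide +kernel
  col_lt := by decide +kernel
  degree := by decide +kernel
  attach := by decide +kernel
  block := by decide +kernel
  choice := by decide +kernel
  gadget := by decide +kernel
  quads := by decide +kernel
  blk_le := by decide +kernel

/-- The blocks of the labels in the table for two labels. -/
def blkTwo : List (List (List ℕ)) :=
  [[[0, 2, 2, 2, 2, 2, 2, 2, 0], [2, 0, 2, 0, 2, 0, 2, 0, 2], [2, 2, 0, 0, 2, 0, 0, 2, 2]], [[0, 2, 2, 1, 2, 2, 1, 1, 1]]]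

/-- The table for two labels. -/
def tableTwo : Table where
  m := 2
  f := 2
  D := [[1, 1, 1, 0, 2], [1, 0, 2, 0, 2]]
  X := [[1, 1, 1, 2, 0], [1, 0, 0, 2, 2]]
  blk := fun q c k => (blkTwo.getD k []).getD c [] |>.getD q k
  z := []
  p := []
  i := []
  cfgs := [[(18878898939048240, []),
      (18598519198724865, []),
      (18878898438864915, []),
      (18351132857348865, []),
      (18878898435732240, []),
      (18598527251972115, []),
      (18598519198908465, []),
      (18598527248839440, [])],
    [(72677941972254977, []),
      (86696501316894977, []),
      (86136016641130817, []),
      (90127182948663617, []),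
      (86135758943109377, []),
      (73238684346040577, []),
      (86696776123498817, []),
      (90687942431031617, [])],
    [(162150700665733411, []),
      (162463855623221281, []),
      (145262254408020256, []),
      (145295239253537056, []),
      (158769754755051811, []),
      (162183480158138656, []),
      (145262258686210081, []),
      (162183686266040611, [])],
    [],
    [(216494123249705025, []),
      (226323611240120850, []),
      (217318611008766480, []),
      (234751384975720770, []),
      (234471009510638145, []),
      (225465871877947905, []),
      (234223473436795200, []),
      (234503977750766145, []),
      (225201989338939680, []),
      (225202126492549650, []),
      (234470992402055745, []),
      (234751367867138370, [])],
    [(82194267203830049, []),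
      (145262253904634384, []),
      (162150494809235984, []),
      (90110630127862049, [])],
    [(162150765339616019, []),
      (162464113318961969, []),
      (162150757286552369, []),
      (162991878900294419, [])],
    [(90687857374536001, []),
      (81122123325653281, []),
      (81122252174664001, []),
      (82243608073224481, [])],
    [(10154274176639235, []),
      (18631379474456835, []),
      (10187259022156035, []),
      (18598394628940035, [])]]

set_option maxRecDepth 100000 in
set_option synthInstance.maxHeartbeats 200000 in
set_option synthInstance.maxSize 1000 in
theorem good_tableTwo : tableTwo.Good where
  deg_le := by decide +kernel
  gam := by decide +kernel
  link := by decide +kernel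
  col_lt := by decide +kernel
  degree := by decide +kernel
  attach := by decide +kernel
  block := by decide +kernel
  choice := by decide +kernel
  gadget := by decide +kernel
  quads := by decide +kernel
  blk_le := by decide +kernel

/-- The table for three labels. -/
def tableThree : Table where
  m := 3
  f := 3
  D := [[1, 1, 1, 0, 0, 2, 2], [0, 0, 2, 1, 2, 0, 2], [0, 2, 0, 2, 1, 0, 2]]
  X := [[1, 1, 1, 0, 0, 2, 2], [2, 0, 2, 1, 0, 0, 2], [2, 2, 0, 0, 1, 0, 2]]
  blk := fun q c k => if c < 3 ∧ k = 0 ∧ q % 3 = c ∨ c = 3 ∧ k = 1 ∧ q / 3 % 3 = 0 ∨ c = 4 ∧ k = 2 ∧ q / 9 % 3 = 1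
    then 3 else k
  z := []
  p := []
  i := []
  cfgs := [[(1326369502015114920551051384923457, []),
      (1321368901552920000411281872987457, []),
      (1318843502663818570329946709824832, [])],
    [(1306087111754276363978763114980672, []),
      (1321368900343995333735749491172672, []),
      (1318843502663818570329946709824832, [])],
    [(1322636531601375861658178582222147, []),
      (1306086531545439659761306361140547, []),
      (1318843502663818570329946709824832, [])],
    [(449145749593095232286969794995460, []),
      (327555286031593266266028997149985, [])],
    [(28295660917331590604736312976705, []),
      (327555286031593266266028997149985, [])],
    [(126948644202264233356346126570500, []),
      (327555286031593266266028997149985, [])],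
    [(1321392118670430486923348655019296, []),
      (1422700483171949249636608936056096, [])],
    [(1422408020134291606153916657771841, []),
      (1326368637610925425380790657951041, [])],
    [(1321368900343960746090758136665376, []),
      (1306086531469882948956906106918176, [])],
    [(669811370053987596310191220790048, []),
      (676946836672602430641999443202848, []),
      (677336495224412470169828357899553, []),
      (408675269058427825936528198149443, []),
      (677336495224706464873127638795553, [])],
    [(1062697267904902576979691726505283, []),
      (124641145857205897517660514559283, []),
      (677336495224412470169828357899553, []),
      (125903845627875065039551284127043, []),
      (677336495224706464873127638795553, [])],
    [(28063257036013786174197687391523, []),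
      (406140006543597594801805821281603, []),
      (68636735784053390945704222200608, []),
      (669816300076483074382690390181153, []),
      (23309563947035334512474437522208, [])],
    [(775827295340755645362757007906116, []),
      (25839891640005741529782199321921, []),
      (677337662112240865774408871253316, [])],
    [(124641143161600673277346880750881, []),
      (23319141977649467207743741166881, []),
      (25839891640005741529782199321921, [])],
    [(28295654895743773816580092265761, []),
      (23309561542519538098451919209761, []),
      (25839891640005741529782199321921, [])],
    [(390923212219916602405973342037297, []),
      (451689719850075261415214443144497, []),
      (449159390961721250530250304324897, [])],
    [(68859571012141880935910239905072, []),
      (124641145729698737372650145850672, []),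
      (449159390961721250530250304324897, [])],
    [(25844826475147221380543391208752, []),
      (23309565169241656657341756478752, []),
      (408683686506973473085616348792097, [])],
    [(996850367237255660093566899791105, []),
      (717886768862042355226513285059875, []),
      (717886768636807610086519705244960, [])],
    [(717886768862042355226513285059875, []),
      (710384854844886348751078713262115, []),
      (68543890281366395043998793539585, [])],
    [(1001604062729937098244828901152035, []),
      (717886768862042355226513285059875, []),
      (68859564991384167014226913989920, [])],
    [(715455377475565038059640100033828, []),
      (677322861261762208398515200398628, [])],
    [(677322861260361408770417886299428, []),
      (717887639364189188563929662555428, [])],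
    [(28295657465225343717411565933828, []),
      (66418308844928107971820355130628, [])],
    [(388378085021217742522192610993409, []),
      (717886768937599066030923874047264, [])],
    [(674890309210672990332235348770849, []),
      (717594305603317894940978956271649, [])],
    [(451466890641827913311409082269729, []),
      (717886768937599066030923874047264, [])]]

set_option maxRecDepth 100000 in
set_option synthInstance.maxHeartbeats 200000 in
set_option synthInstance.maxSize 1000 in
theorem good_tableThree : tableThree.Good where
  deg_le := by decide +kernel
  gam := by decide +kernel
  link := by decide +kernel
  col_lt := by decide +kernel
  degree := by decide +kernel
  attach := by decide +kernel
  block := by decide +kernel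
  choice := by decide +kernel
  gadget := by decide +kernel
  quads := by decide +kernel
  blk_le := by decide +kernel

/-- The table for four labels. -/
def tableFour : Table where
  m := 4
  f := 2
  D := [[1, 1, 1, 2, 2, 0, 2, 0, 0], [0, 0, 0, 1, 0, 2, 2, 2, 2], [2, 0, 2, 0, 1, 2, 2, 0, 0], [2, 2, 0, 0, 2, 1, 0, 0, 2]]
  X := [[1, 1, 1, 2, 2, 0, 2, 0, 0], [0, 0, 2, 1, 0, 2, 0, 2, 2], [2, 0, 2, 0, 1, 2, 2, 0, 0], [2, 2, 0, 0, 2, 1, 0, 0, 2]]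
  blk := fun q c k => if c < 3 ∧ k = 0 ∧ q % 3 = c ∨ c = 3 ∧ k = 1 ∧ q / 3 % 3 = 0 then 4 else k
  z := [4, 5]
  p := [0, 8]
  i := [1, 7]
  cfgs := [[(199489717121384194888933147827988656566498298575352176, [(1, 7), (0, 5)]),
      (199980507572959316585474244400991313305231667215102336, [(1, 7), (0, 5)]),
      (193509251352382806312844488100963004426019489646276976, [(1, 7), (0, 5)]),
      (194000041803957928009385584673965661164752858286027136, [(1, 7), (0, 5)])],
    [(193504873604603412744672112969911918551522393181024641, [(1, 7), (0, 5)]),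
      (193995658369483065627261569220806874675293204761440641, [(1, 7), (0, 5)]),
      (199495567387380274010727208225422588909685871463264641, [(1, 7), (0, 5)]),
      (199986352152259926893316664476317545033456683043680641, [(1, 7), (0, 5)])],
    [(24819541023428111505414264735384358703078910347866496, [(1, 7), (0, 5)]),
      (97704902426221755328576295383217373710832495395762561, [(1, 7), (0, 5)]),
      (120670658294307401768552163716440804480128977581797761, [(1, 7), (0, 5)]),
      (97821822445688168031344159987887551893800027855942001, [(1, 7), (0, 5)])],
    [(295761387533241285534459020678930626734374785662546304, [(1, 7), (0, 5)]),
      (289780921764239896958370360951904974593895976733471104, [(1, 7), (0, 5)])],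
    [(289355631611903995738765095558631136664124979485569409, [(1, 7), (0, 5)]),
      (295346325394680857004820190814141807022288457767809409, [(1, 7), (0, 5)])],
    [(122092608110507431731802473071979425095193677400535409, [(1, 7), (0, 5)]),
      (97844927802120869992382686858313244270273133880439169, [(1, 7), (0, 5)])],
    [(199916205832863392613054437254124796798895071318667650, [(1, 7), (0, 5)]),
      (199611021578865809217542192223963887257008003261559170, [(1, 7), (0, 5)])],
    [(193929895483167937358698929216468207714202207466451330, [(1, 7), (0, 5)]),
      (217569952293440996768996010579830637137488838420230530, [(1, 7), (0, 5)])],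
    [(98148924535861806892984507142680203728935292754882945, [(1, 7), (0, 5)]),
      (121788981011623688403206694261029273490453946057257345, [(1, 7), (0, 5)])]]

set_option maxRecDepth 100000 in
set_option synthInstance.maxHeartbeats 200000 in
set_option synthInstance.maxSize 1000 in
theorem good_tableFour : tableFour.Good where
  deg_le := by decide +kernel
  gam := by decide +kernel
  link := by decide +kernel
  col_lt := by decide +kernel
  degree := by decide +kernel
  attach := by decide +kernel
  block := by decide +kernel
  choice := by decide +kernel
  gadget := by decide +kernel
  quads := by decide +kernel
  blk_le := by decide +kernel

/-- The table for five labels. -/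
def tableFive : Table where
  m := 5
  f := 1
  D := [[1, 1, 1, 2, 0, 2, 0, 2, 2, 0, 0], [2, 0, 2, 1, 0, 0, 2, 2, 2, 0, 0], [0, 2, 2, 0, 1, 2, 2, 0, 2, 0, 0], [0, 0, 2, 2, 0, 1, 2, 0, 0, 2, 2], [2, 2, 0, 0, 0, 2, 1, 0, 2, 2, 0]]
  X := [[1, 1, 1, 2, 0, 2, 0, 2, 2, 0, 0], [2, 0, 2, 1, 0, 0, 2, 2, 2, 0, 0], [0, 2, 2, 0, 1, 2, 2, 0, 2, 0, 0], [0, 0, 2, 2, 0, 1, 2, 0, 0, 2, 2], [2, 2, 0, 0, 0, 2, 1, 0, 2, 2, 0]]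
  blk := fun q c k => if c < 3 ∧ k = 0 ∧ q % 3 = c then 5 else k
  z := [3, 4, 5, 6]
  p := [6, 6, 2, 9]
  i := [10, 10, 8, 10]
  cfgs := [[(4352386463377421865091625413078745814810187310976180916239525079716048849357225, [(8, 10), (0, 11), (5, 7), (0, 8)]),
      (4655838588481165916335533602275549855767853688862035514519165900925111473818025, [(8, 11), (0, 10), (5, 7), (0, 8)])],
    [(4699543207350315373879807722600037309823681335420827626989686629591711842847145, [(8, 10), (0, 11), (5, 7), (0, 8)]),
      (3729503682842179945960703801852806588272138678592382305910091131878097912351145, [(8, 11), (0, 10), (5, 7), (0, 8)])],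
    [(994252890862794944577869888893357600764990931196142694904331160656110288128425, [(8, 10), (0, 11), (5, 7), (0, 8)]),
      (601308022041994652059508265080649101254715903376988499588831022947406314752425, [(8, 11), (0, 10), (5, 7), (0, 8)])]]

set_option maxRecDepth 100000 in
set_option synthInstance.maxHeartbeats 200000 in
set_option synthInstance.maxSize 1000 in
theorem good_tableFive : tableFive.Good where
  deg_le := by decide +kernel
  gam := by decide +kernel
  link := by decide +kernel
  col_lt := by decide +kernel
  degree := by decide +kernel
  attach := by decide +kernel
  block := by decide +kernel
  choice := by decide +kernel
  gadget := by decide +kernel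
  quads := by decide +kernel
  blk_le := by decide +kernel

theorem exists_scheme_of_lt_six (N : ℕ) (hN : N < 6) (hN' : N ≠ 2) :
    ∃ (C : Type) (Sc : Scheme (N + 1) C), ∀ κ, Sc.allowed κ := by
  have key : ∀ (T : Table) (h : T.Good), (∀ q < 3 ^ T.f, T.conf q ≠ []) →
      ∃ (C : Type) (Sc : Scheme (T.m + 1) C), ∀ κ, Sc.allowed κ :=
    fun T h hq => ⟨_, h.scheme, fun κ => hq _ (T.key_lt κ)⟩
  interval_cases N
  · exact key tableZero good_tableZero (by decide +kernel)
  · exact key tableOne good_tableOne (by decide +kernel)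
  · exact absurd rfl hN'
  · exact key tableThree good_tableThree (by decide +kernel)
  · exact key tableFour good_tableFour (by decide +kernel)
  · exact key tableFive good_tableFive (by decide +kernel)

/-- Both finite labels are linked by switching alone, and the table has no configuration for one
pair of roles; the placement is later chosen so that this pair does not occur. -/
theorem exists_scheme_two : ∃ (C : Type) (Sc : Scheme 3 C) (k₀ k₁ : Idx 3), k₀ ≠ k₁ ∧
    ∀ κ, ¬ (κ k₀ = Cls.first ∧ κ k₁ = Cls.second) → Sc.allowed κ := by
  refine ⟨_, good_tableTwo.scheme, some 0, some 1, by decide, fun κ hκ => ?_⟩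
  -- The code 3 has the ternary digits 0 and 1, that is, role first for label 0 and second for label
  -- 1.
  have hq : ∀ q < 3 ^ tableTwo.f, q ≠ 3 → tableTwo.conf q ≠ [] := by decide +kernel
  refine hq _ (tableTwo.key_lt κ) fun h3 => hκ ⟨?_, ?_⟩
  · have := Table.digit_key (T := tableTwo) κ (k := (some 0 : Idx 3)) (by decide)
    rw [h3] at this
    exact Cls.code_injective this.symm
  · have := Table.digit_key (T := tableTwo) κ (k := (some 1 : Idx 3)) (by decide)
    rw [h3] at this
    exact Cls.code_injective this.symm

end HamFrag

/-! ### Words, zigzags and cyclic coordinates -/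

namespace HamFrag

section Lists

variable {α β : Type*}

/-- `x` and `y` are consecutive in the list, in some order. -/
def Nb (l : List α) (x y : α) : Prop := [x, y] <:+: l ∨ [y, x] <:+: l

/-- `a`, `b`, `c` are consecutive in the list, in this order or in the reverse order. -/
def Tr (l : List α) (a b c : α) : Prop := [a, b, c] <:+: l ∨ [c, b, a] <:+: l

theorem Nb.symm {l : List α} {x y : α} (h : Nb l x y) : Nb l y x := Or.symm h

theorem Nb.mono {l l' : List α} {x y : α} (h : Nb l x y) (hl : l <:+: l') : Nb l' x y :=
  h.imp (fun h => h.trans hl) fun h => h.trans hl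

theorem Tr.mono {l l' : List α} {x y z : α} (h : Tr l x y z) (hl : l <:+: l') : Tr l' x y z :=
  h.imp (fun h => h.trans hl) fun h => h.trans hl

theorem Nb.reverse {l : List α} {x y : α} (h : Nb l x y) : Nb l.reverse x y :=
  (h.imp (fun h => by simpa using List.reverse_infix.2 h)
    fun h => by simpa using List.reverse_infix.2 h).symm

theorem Tr.reverse {l : List α} {x y z : α} (h : Tr l x y z) : Tr l.reverse x y z :=
  (h.imp (fun h => by simpa using List.reverse_infix.2 h)
    fun h => by simpa using List.reverse_infix.2 h).symm

theorem Nb.map {l : List α} {x y : α} (f : α → β) (h : Nb l x y) : Nb (l.map f) (f x) (f y) :=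
  h.imp (fun h => by simpa using h.map f) fun h => by simpa using h.map f

theorem Tr.map {l : List α} {x y z : α} (f : α → β) (h : Tr l x y z) :
    Tr (l.map f) (f x) (f y) (f z) :=
  h.imp (fun h => by simpa using h.map f) fun h => by simpa using h.map f

theorem infix_cons_cases {a b : α} {l m : List α} (h : b :: m <:+: a :: l) :
    (b = a ∧ m <+: l) ∨ b :: m <:+: l := by
  rcases List.infix_cons_iff.mp h with h | h
  · exact Or.inl (List.cons_prefix_cons.mp h)
  · exact Or.inr h

/-- A pair of consecutive elements of `a :: b :: l` is `a`, `b` or lies in `b :: l`. -/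
theorem Nb.of_cons {a b x y : α} {l : List α} (h : Nb (a :: b :: l) x y) :
    (x = a ∧ y = b) ∨ (x = b ∧ y = a) ∨ Nb (b :: l) x y := by
  rcases h with h | h
  · rcases infix_cons_cases h with ⟨h1, h2⟩ | h1
    · exact Or.inl ⟨h1, (List.cons_prefix_cons.mp h2).1⟩
    · exact Or.inr (Or.inr (Or.inl h1))
  · rcases infix_cons_cases h with ⟨h1, h2⟩ | h1
    · exact Or.inr (Or.inl ⟨(List.cons_prefix_cons.mp h2).1, h1⟩)
    · exact Or.inr (Or.inr (Or.inr h1))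

theorem Tr.of_cons {a b x y z : α} {l : List α} (h : Tr (a :: b :: l) x y z)
    (hn : ¬ ((a = x ∨ a = z) ∧ b = y)) : Tr (b :: l) x y z := by
  rcases h with h | h
  · rcases infix_cons_cases h with ⟨h1, h2⟩ | h1
    · exact absurd ⟨Or.inl h1.symm, (List.cons_prefix_cons.mp h2).1.symm⟩ hn
    · exact Or.inl h1
  · rcases infix_cons_cases h with ⟨h1, h2⟩ | h1
    · exact absurd ⟨Or.inr h1.symm, (List.cons_prefix_cons.mp h2).1.symm⟩ hn
    · exact Or.inr h1

theorem Nb.of_concat {a b x y : α} {l : List α} (h : Nb (l ++ [b, a]) x y) :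
    (x = a ∧ y = b) ∨ (x = b ∧ y = a) ∨ Nb (l ++ [b]) x y := by
  have h' := h.reverse
  rw [List.reverse_append] at h'
  rcases Nb.of_cons (a := a) (b := b) (l := l.reverse) (by simpa using h') with h | h | h
  · exact Or.inl h
  · exact Or.inr (Or.inl h)
  · exact Or.inr (Or.inr (by simpa using h.reverse))

theorem Tr.of_concat {a b x y z : α} {l : List α} (h : Tr (l ++ [b, a]) x y z)
    (hn : ¬ ((a = x ∨ a = z) ∧ b = y)) : Tr (l ++ [b]) x y z := by
  have h' := h.reverse
  rw [List.reverse_append] at h'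
  have := Tr.of_cons (a := a) (b := b) (l := l.reverse) (by simpa using h') hn
  simpa using this.reverse

theorem pair_infix_append {l₁ l₂ : List α} {x y : α} (h1 : l₁.getLast? = some x)
    (h2 : l₂.head? = some y) : [x, y] <:+: l₁ ++ l₂ := by
  obtain ⟨l, rfl⟩ := List.getLast?_eq_some_iff.mp h1
  obtain ⟨l', rfl⟩ := List.head?_eq_some_iff.mp h2
  exact ⟨l, l', by simp⟩

theorem Nb.mem {l : List α} {x y : α} (h : Nb l x y) : x ∈ l ∧ y ∈ l := by
  rcases h with h | h <;> exact ⟨h.subset (by simp), h.subset (by simp)⟩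

/-- The list `f a, h b, f (a - 1), h (b + 1), …` of length `2 n`. -/
def zigzag (f h : ℤ → α) : ℕ → ℤ → ℤ → List α
  | 0, _, _ => []
  | n + 1, a, b => f a :: h b :: zigzag f h n (a - 1) (b + 1)

variable (f h : ℤ → α)

theorem length_zigzag (n : ℕ) (a b : ℤ) : (zigzag f h n a b).length = 2 * n := by
  induction n generalizing a b with
  | zero => rfl
  | succ n ih => simp only [zigzag, List.length_cons, ih]; ring

theorem zigzag_pair₁ {n i : ℕ} (hi : i < n) (a b : ℤ) :
    [f (a - i), h (b + i)] <:+: zigzag f h n a b := by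
  induction n generalizing a b i with
  | zero => omega
  | succ n ih =>
    rcases i with _ | i
    · exact ⟨[], zigzag f h n (a - 1) (b + 1), by simp [zigzag]⟩
    · have := ih (i := i) (by omega) (a - 1) (b + 1)
      rw [show a - 1 - (i : ℤ) = a - ((i + 1 : ℕ) : ℤ) by push_cast; ring,
        show b + 1 + (i : ℤ) = b + ((i + 1 : ℕ) : ℤ) by push_cast; ring] at this
      exact this.trans ⟨[f a, h b], [], by simp [zigzag]⟩

theorem zigzag_pair₂ {n i : ℕ} (hi : i + 1 < n) (a b : ℤ) :
    [h (b + i), f (a - i - 1)] <:+: zigzag f h n a b := by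
  induction n generalizing a b i with
  | zero => omega
  | succ n ih =>
    rcases i with _ | i
    · rcases n with _ | n
      · omega
      · exact ⟨[f a], h (b + 1) :: zigzag f h n (a - 1 - 1) (b + 1 + 1), by simp [zigzag]⟩
    · have := ih (i := i) (by omega) (a - 1) (b + 1)
      rw [show a - 1 - (i : ℤ) - 1 = a - ((i + 1 : ℕ) : ℤ) - 1 by push_cast; ring,
        show b + 1 + (i : ℤ) = b + ((i + 1 : ℕ) : ℤ) by push_cast; ring] at this
      exact this.trans ⟨[f a, h b], [], by simp [zigzag]⟩

theorem mem_zigzag₁ {n i : ℕ} (hi : i < n) (a b : ℤ) : f (a - i) ∈ zigzag f h n a b :=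
  (zigzag_pair₁ f h hi a b).subset (by simp)

theorem mem_zigzag₂ {n i : ℕ} (hi : i < n) (a b : ℤ) : h (b + i) ∈ zigzag f h n a b :=
  (zigzag_pair₁ f h hi a b).subset (by simp)

theorem getLast?_zigzag (n : ℕ) (a b : ℤ) :
    (zigzag f h (n + 1) a b).getLast? = some (h (b + n)) := by
  induction n generalizing a b with
  | zero => simp [zigzag]
  | succ n ih =>
    have := ih (a - 1) (b + 1)
    rw [zigzag, List.getLast?_cons_cons]
    rw [zigzag] at this ⊢
    rw [List.getLast?_cons_cons, this]
    congr 2; push_cast; ring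

end Lists

section Coordinates

variable {V : Type*}

/-- Coordinates modulo `2 N` in which the partner of `x` is `x + N`. -/
structure Coord (N : ℕ) (par : V → V) where
  u : ℤ → V
  idx : V → ℤ
  u_add : ∀ i, u (i + N) = par (u i)
  u_idx : ∀ x, u (idx x) = x
  idx_nonneg : ∀ x, 0 ≤ idx x
  idx_lt : ∀ x, idx x < 2 * N
  inj : ∀ i j, u i = u j → i - j < 2 * N → j - i < 2 * N → i = j

namespace Coord

variable {N : ℕ} {par : V → V} (c : Coord N par)

theorem u_add_two (hpar : ∀ x, par (par x) = x) (i : ℤ) : c.u (i + 2 * N) = c.u i := by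
  rw [show i + 2 * (N : ℤ) = i + N + N by ring, c.u_add, c.u_add, hpar]

theorem u_sub_two (hpar : ∀ x, par (par x) = x) (i : ℤ) : c.u (i - 2 * N) = c.u i := by
  rw [← c.u_add_two hpar]; congr 1; ring

theorem idx_u {i : ℤ} (h0 : 0 ≤ i) (h1 : i < 2 * N) : c.idx (c.u i) = i := by
  have := c.idx_nonneg (c.u i)
  have := c.idx_lt (c.u i)
  exact c.inj _ _ (c.u_idx _) (by omega) (by omega)

/-- Every window of length `N` contains an element of each label. -/
theorem window (hpar : ∀ x, par (par x) = x) (hN : 0 < N) (x : V) (a : ℤ) :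
    ∃ i : ℕ, i < N ∧ (x = c.u (a + i) ∨ par x = c.u (a + i)) := by
  have hk : ∀ (k : ℕ) (i : ℤ), (c.u i = c.u (i + N * k) ∨ par (c.u i) = c.u (i + N * k)) := by
    intro k
    induction k with
    | zero => intro i; left; simp
    | succ k ih =>
      intro i
      have e : i + (N : ℤ) * ((k + 1 : ℕ) : ℤ) = i + N * k + N := by push_cast; ring
      rw [e, c.u_add]
      rcases ih i with h | h
      · exact Or.inr (by rw [h])
      · exact Or.inl (by rw [← h, hpar])
  have hk' : ∀ (k : ℤ) (i : ℤ), (c.u i = c.u (i + N * k) ∨ par (c.u i) = c.u (i + N * k)) := by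
    intro k i
    rcases le_total 0 k with h | h
    · obtain ⟨n, rfl⟩ := Int.eq_ofNat_of_zero_le h
      exact hk n i
    · obtain ⟨n, hn⟩ := Int.eq_ofNat_of_zero_le (neg_nonneg.mpr h)
      have e : i = (i + N * k) + N * (n : ℤ) := by rw [← Int.ofNat_eq_natCast, ← hn]; ring
      rcases hk n (i + N * k) with h | h
      · left; rw [← e] at h; exact h.symm
      · right; rw [← e] at h; rw [← h, hpar]
  have hN' : (0 : ℤ) < N := by exact_mod_cast hN
  have h1 := Int.emod_nonneg (c.idx x - a) hN'.ne'
  have h2 := Int.emod_lt_of_pos (c.idx x - a) hN'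
  obtain ⟨i, hi⟩ := Int.eq_ofNat_of_zero_le h1
  refine ⟨i, by omega, ?_⟩
  have h3 := Int.mul_ediv_add_emod (c.idx x - a) N
  have e : a + (i : ℤ) = c.idx x + N * (-((c.idx x - a) / N)) := by
    rw [hi] at h3
    linear_combination h3
  rw [e]
  have := hk' (-((c.idx x - a) / N)) (c.idx x)
  rwa [c.u_idx] at this

end Coord

theorem exists_coord [Fintype V] [DecidableEq V] (N : ℕ) (hN : 0 < N) (par : V → V)
    (hpar : ∀ x, par (par x) = x) (hne : ∀ x, par x ≠ x) (hcard : Fintype.card V = 2 * N)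
    (p : Fin N → Option V)
    (hp : ∀ i j x y, p i = some x → p j = some y → (y = x ∨ y = par x) → i = j) :
    ∃ c : Coord N par, ∀ (i : Fin N) x, p i = some x → c.u (i : ℕ) = x := by
  let S : Setoid V :=
    { r := fun x y => y = x ∨ y = par x
      iseqv := ⟨fun _ => Or.inl rfl, by rintro x y (rfl | rfl) <;> simp [hpar], by
        rintro x y z (rfl | rfl) (rfl | rfl) <;> simp [hpar]⟩ }
  have : DecidableRel S.r := fun x y => inferInstanceAs (Decidable (y = x ∨ y = par x))
  have hrel : ∀ x y, (Quotient.mk S x = Quotient.mk S y) ↔ (y = x ∨ y = par x) :=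
    fun x y => Quotient.eq
  have hQ : Fintype.card (Fin N) = (Finset.univ : Finset (Quotient S)).card := by
    have h1 : Fintype.card V
        = ∑ q : Quotient S, (Finset.univ.filter fun x => Quotient.mk S x = q).card :=
      Finset.card_eq_sum_card_fiberwise (fun _ _ => Finset.mem_coe.2 (Finset.mem_univ _))
    have h2 : ∀ q : Quotient S, (Finset.univ.filter fun x => Quotient.mk S x = q).card = 2 := by
      intro q
      obtain ⟨x, rfl⟩ := Quotient.exists_rep q
      have : (Finset.univ.filter fun y => Quotient.mk S y = Quotient.mk S x) = {x, par x} := by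
        ext y
        simp only [Finset.mem_filter, Finset.mem_univ, true_and, Finset.mem_insert,
          Finset.mem_singleton]
        rw [eq_comm]; exact hrel x y
      rw [this, Finset.card_pair (hne x).symm]
    rw [Finset.sum_congr rfl fun q _ => h2 q, Finset.sum_const, smul_eq_mul, hcard] at h1
    rw [Fintype.card_fin]
    omega
  obtain ⟨x0⟩ : Nonempty V := Fintype.card_pos_iff.mp (by omega)
  -- The prescribed elements have pairwise different labels, so the prescription extends to a
  -- bijection from the `N` positions to the labels. The remaining `N` indices are filled with the
  -- partners.
  obtain ⟨g, hg⟩ := Finset.exists_equiv_extend_of_card_eq hQ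
    (s := Finset.univ.filter fun i => (p i).isSome)
    (f := fun i => Quotient.mk S ((p i).getD x0)) (Finset.subset_univ _) (by
      intro i hi j hj hij
      simp only [Finset.coe_filter, Finset.mem_univ, true_and, Set.mem_ofPred_eq,
        Option.isSome_iff_exists] at hi hj
      obtain ⟨x, hx⟩ := hi
      obtain ⟨y, hy⟩ := hj
      simp only [hx, hy, Option.getD_some, hrel] at hij
      exact hp i j x y hx hy hij)
  let rep : Fin N → V := fun i => (p i).getD (g i : Quotient S).out
  have hrep : ∀ i, Quotient.mk S (rep i) = g i := by
    intro i
    rcases hi : p i with _ | x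
    · simp [rep, hi]
    · rw [hg i (by simp [hi])]
      simp [rep, hi]
  have hrepinj : ∀ i j, (rep j = rep i ∨ rep j = par (rep i)) → i = j := by
    intro i j h
    have := (hrel _ _).2 h
    rw [hrep, hrep] at this
    exact g.injective (Subtype.ext this)
  have hM : (0 : ℤ) < 2 * N := by omega
  let u : ℤ → V := fun z => if h : (z % (2 * N)).toNat < N then rep ⟨_, h⟩
    else if h : (z % (2 * N)).toNat - N < N then par (rep ⟨_, h⟩) else x0
  have hu1 : ∀ (z : ℤ) (i : Fin N), z % (2 * N) = (i : ℕ) → u z = rep i := by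
    intro z i hi
    have h : (z % (2 * N)).toNat = i := by omega
    have h' : (z % (2 * N)).toNat < N := by omega
    simp only [u, dif_pos h']
    congr 1; exact Fin.ext h
  have hu2 : ∀ (z : ℤ) (i : Fin N), z % (2 * N) = (i : ℕ) + N → u z = par (rep i) := by
    intro z i hi
    have h : (z % (2 * N)).toNat - N = i := by omega
    have h1 : ¬ (z % (2 * N)).toNat < N := by omega
    have h2 : (z % (2 * N)).toNat - N < N := by omega
    simp only [u, dif_neg h1, dif_pos h2]
    congr 2; exact Fin.ext h
  have hcases : ∀ z : ℤ, ∃ i : Fin N, z % (2 * N) = (i : ℕ) ∨ z % (2 * N) = (i : ℕ) + N := by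
    intro z
    have h1 := Int.emod_nonneg z hM.ne'
    have h2 := Int.emod_lt_of_pos z hM
    by_cases h : z % (2 * N) < N
    · exact ⟨⟨(z % (2 * N)).toNat, by omega⟩, Or.inl (by simp only; omega)⟩
    · exact ⟨⟨(z % (2 * N)).toNat - N, by omega⟩, Or.inr (by simp only; omega)⟩
  have hsmall : ∀ z : ℤ, 0 ≤ z → z < 2 * N → z % (2 * N) = z :=
    fun z h1 h2 => Int.emod_eq_of_lt h1 h2
  have hidx : ∀ x, ∃ z : ℤ, u z = x ∧ 0 ≤ z ∧ z < 2 * N := by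
    intro x
    let i := g.symm ⟨Quotient.mk S x, Finset.mem_univ _⟩
    have hi : Quotient.mk S (rep i) = Quotient.mk S x := by
      rw [hrep]; simp [i]
    have hlt := i.2
    rcases (hrel _ _).1 hi with h | h
    · exact ⟨(i : ℕ), by rw [hu1 _ i (hsmall _ (by omega) (by omega)), h], by omega, by omega⟩
    · exact ⟨(i : ℕ) + N, by rw [hu2 _ i (hsmall _ (by omega) (by omega)), h], by omega, by omega⟩
  choose idx h1 h2 h3 using hidx
  refine ⟨⟨u, idx, ?_, h1, h2, h3, ?_⟩, ?_⟩
  · intro z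
    have hz := Int.mul_ediv_add_emod z (2 * N)
    obtain ⟨i, hi | hi⟩ := hcases z
    · rw [hu1 z i hi, hu2 (z + N) i]
      refine ((Int.ediv_emod_unique hM (q := z / (2 * N))).2 ⟨?_, by omega, by omega⟩).2
      rw [hi] at hz
      linear_combination hz
    · rw [hu2 z i hi, hpar, hu1 (z + N) i]
      refine ((Int.ediv_emod_unique hM (q := z / (2 * N) + 1)).2 ⟨?_, by omega, by omega⟩).2
      rw [hi] at hz
      linear_combination hz
  · intro a b hab h4 h5
    have key : a % (2 * N) = b % (2 * N) := by
      obtain ⟨i, hi | hi⟩ := hcases a <;> obtain ⟨j, hj | hj⟩ := hcases b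
      · rw [hu1 a i hi, hu1 b j hj] at hab
        rw [hi, hj, hrepinj i j (Or.inl hab.symm)]
      · rw [hu1 a i hi, hu2 b j hj] at hab
        have := hrepinj j i (Or.inr hab)
        subst this
        exact absurd hab.symm (hne _)
      · rw [hu2 a i hi, hu1 b j hj] at hab
        have := hrepinj i j (Or.inr hab.symm)
        subst this
        exact absurd hab (hne _)
      · rw [hu2 a i hi, hu2 b j hj] at hab
        have : rep i = rep j := by rw [← hpar (rep i), hab, hpar]
        rw [hi, hj, hrepinj i j (Or.inl this.symm)]
    have hd := Int.emod_emod_of_dvd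
    have h6 : (a - b) % (2 * N) = 0 := Int.emod_eq_emod_iff_emod_sub_eq_zero.mp key
    obtain ⟨k, hk⟩ := Int.dvd_of_emod_eq_zero h6
    have hk1 : k < 1 := by
      by_contra h
      have : (2 * N : ℤ) * 1 ≤ 2 * N * k := mul_le_mul_of_nonneg_left (by omega) hM.le
      omega
    have hk2 : -1 < k := by
      by_contra h
      have : (2 * N : ℤ) * k ≤ 2 * N * (-1) := mul_le_mul_of_nonneg_left (by omega) hM.le
      omega
    have : k = 0 := by omega
    rw [this] at hk
    omega
  · intro i x hx
    have := i.2
    rw [show (⟨u, idx, _, h1, h2, h3, _⟩ : Coord N par).u = u from rfl,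
      hu1 _ i (hsmall _ (by omega) (by omega))]
    simp [rep, hx]

end Coordinates

end HamFrag

/-! ### Degree and parity counts for families of paths -/

namespace HamFrag

section Forest

variable {H : Type*}

theorem nb_cons_iff {a b x y : H} {l : List H} :
    Nb (a :: b :: l) x y ↔ (x = a ∧ y = b) ∨ (x = b ∧ y = a) ∨ Nb (b :: l) x y := by
  refine ⟨Nb.of_cons, ?_⟩
  rintro (⟨rfl, rfl⟩ | ⟨rfl, rfl⟩ | h)
  · exact Or.inl ⟨[], l, rfl⟩
  · exact Or.inr ⟨[], l, rfl⟩
  · exact h.mono ⟨[a], [], by simp⟩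

theorem not_nb_singleton {a x y : H} : ¬ Nb [a] x y := by
  rintro (h | h) <;> simpa using h.length_le

/-- An occurrence of `x` inside the list contributes at most two neighbours, one at an end at most
one. Only upper bounds are needed, since `partition_of_cover` turns them into equalities. -/
theorem ncard_nb_le [DecidableEq H] (l : List H) (hl : l ≠ []) (x : H) :
    {y | Nb l x y}.Finite ∧
    {y | Nb l x y}.ncard + (if l.head? = some x then 1 else 0)
      + (if l.getLast? = some x then 1 else 0) ≤ 2 * l.count x := by
  induction l with
  | nil => exact absurd rfl hl
  | cons a l ih =>
    rcases l with _ | ⟨b, l⟩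
    · have : {y | Nb [a] x y} = ∅ := Set.eq_empty_of_forall_notMem fun y h => not_nb_singleton h
      rw [this]
      refine ⟨Set.finite_empty, ?_⟩
      by_cases h : a = x <;> simp [h]
    · obtain ⟨hf, h⟩ := ih (by simp)
      have hsub : {y | Nb (a :: b :: l) x y} ⊆
          ((if x = a then {b} else ∅) ∪ if x = b then {a} else ∅) ∪ {y | Nb (b :: l) x y} := by
        intro y hy
        rcases nb_cons_iff.1 hy with ⟨h1, h2⟩ | ⟨h1, h2⟩ | h1
        · left; left; rw [if_pos h1]; exact h2
        · left; right; rw [if_pos h1]; exact h2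
        · exact Or.inr h1
      have hfin : (((if x = a then {b} else ∅) ∪ if x = b then {a} else ∅ : Set H)).Finite := by
        split_ifs <;> simp
      have hc : (((if x = a then {b} else ∅) ∪ if x = b then {a} else ∅ : Set H)).ncard
          ≤ (if x = a then 1 else 0) + if x = b then 1 else 0 := by
        refine (Set.ncard_union_le _ _).trans ?_
        split_ifs <;> simp
      have h1 := Set.ncard_le_ncard hsub (hfin.union hf)
      have h2 := Set.ncard_union_le ((if x = a then {b} else ∅) ∪ if x = b then {a} else ∅ : Set H)
        {y | Nb (b :: l) x y}
      refine ⟨(hfin.union hf).subset hsub, ?_⟩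
      rw [List.count_cons, List.getLast?_cons_cons]
      simp only [List.head?_cons, Option.some.injEq, beq_iff_eq] at h ⊢
      have e1 : (if a = x then 1 else 0) = if x = a then 1 else 0 := by simp only [eq_comm]
      have e2 : (if b = x then 1 else 0) = if x = b then 1 else 0 := by simp only [eq_comm]
      rw [e2] at h
      rw [e1]
      omega

theorem ncard_forest_le [DecidableEq H] (F : List (List H)) (hF : [] ∉ F) (x : H) :
    {y | ∃ l ∈ F, Nb l x y}.Finite ∧
    {y | ∃ l ∈ F, Nb l x y}.ncard + (F.map fun l => (if l.head? = some x then 1 else 0)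
      + if l.getLast? = some x then 1 else 0).sum ≤ (F.map fun l => 2 * l.count x).sum := by
  induction F with
  | nil => simp
  | cons l F ih =>
    obtain ⟨h1, h2⟩ := ih fun h => hF (List.mem_cons_of_mem _ h)
    obtain ⟨h3, h4⟩ := ncard_nb_le l (fun h => hF (h ▸ List.mem_cons_self)) x
    have e : {y | ∃ l' ∈ l :: F, Nb l' x y} = {y | Nb l x y} ∪ {y | ∃ l ∈ F, Nb l x y} := by
      ext y; simp
    rw [e]
    refine ⟨h3.union h1, ?_⟩
    have := Set.ncard_union_le {y | Nb l x y} {y | ∃ l ∈ F, Nb l x y}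
    simp only [List.map_cons, List.sum_cons]
    omega

theorem eqvGen_of_mem_list {r : H → H → Prop} (l : List H) (hr : ∀ x y, Nb l x y → r x y)
    {x y : H} (hx : x ∈ l) (hy : y ∈ l) : Relation.EqvGen r x y := by
  have key : ∀ l : List H, (∀ x y, Nb l x y → r x y) → ∀ a, l.head? = some a → ∀ x ∈ l,
      Relation.EqvGen r a x := by
    intro l
    induction l with
    | nil => simp
    | cons a l ih =>
      rintro hr a' h x hx
      obtain rfl : a = a' := by simpa using h
      rcases List.mem_cons.1 hx with rfl | hx
      · exact .refl _
      rcases l with _ | ⟨b, l⟩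
      · simp at hx
      · exact (Relation.EqvGen.rel _ _ (hr a b (nb_cons_iff.2 (Or.inl ⟨rfl, rfl⟩)))).trans _ _ _
          (ih (fun x y h => hr x y (nb_cons_iff.2 (Or.inr (Or.inr h)))) b rfl x hx)
  rcases l with _ | ⟨a, l⟩
  · simp at hx
  · exact (((key _ hr a rfl x hx).symm).trans _ _ _ (key _ hr a rfl y hy))

/-- Upper bounds for the degrees of graphs which cover all pairs are attained if they have the
right sum, and the graphs are edge-disjoint. -/
theorem partition_of_cover [Fintype H] [DecidableEq H] {C : Type*} [Fintype C]
    (ℓ : C → SimpleGraph H) (d : C → H → ℕ) (hle : ∀ c x, ((ℓ c).neighborSet x).ncard ≤ d c x)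
    (hcov : ∀ x y, x ≠ y → ∃ c, (ℓ c).Adj x y)
    (hsum : ∑ x, ∑ c, d c x ≤ Fintype.card H * (Fintype.card H - 1)) :
    (∀ c x, ((ℓ c).neighborSet x).ncard = d c x) ∧ ∀ x y, x ≠ y → ∃! c, (ℓ c).Adj x y := by
  classical
  let Nf : C → H → Finset H := fun c x => Finset.univ.filter fun y => (ℓ c).Adj x y
  have hN : ∀ c x, (Nf c x).card = ((ℓ c).neighborSet x).ncard := by
    intro c x
    rw [← Set.ncard_coe_finset]
    congr 1; ext y; simp [Nf]
  have hun : ∀ x, (Finset.univ.biUnion fun c => Nf c x) = Finset.univ.erase x := by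
    intro x; ext y
    simp only [Finset.mem_biUnion, Finset.mem_univ, true_and, Finset.mem_filter,
      Finset.mem_erase, Nf, and_true]
    exact ⟨fun ⟨c, h⟩ => h.ne', fun h => hcov x y h.symm⟩
  have h1 : ∀ x, Fintype.card H - 1 ≤ ∑ c, (Nf c x).card := by
    intro x
    have := Finset.card_biUnion_le (s := (Finset.univ : Finset C)) (t := fun c => Nf c x)
    rwa [hun, Finset.card_erase_of_mem (Finset.mem_univ _), Finset.card_univ] at this
  have h2 : ∀ x, ∑ c, (Nf c x).card ≤ ∑ c, d c x :=
    fun x => Finset.sum_le_sum fun c _ => by rw [hN]; exact hle c x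
  -- Covering forces at least `card H - 1` incidences at each point, the degree bounds allow at most
  -- the prescribed number, and the totals agree.
  have h3 : ∀ x, Fintype.card H - 1 = ∑ c, d c x := by
    have := (Finset.sum_eq_sum_iff_of_le (s := (Finset.univ : Finset H))
      (f := fun _ => Fintype.card H - 1) (g := fun x => ∑ c, d c x)
      fun x _ => (h1 x).trans (h2 x)).1 (le_antisymm
        (Finset.sum_le_sum fun x _ => (h1 x).trans (h2 x)) (by simpa using hsum))
    exact fun x => this x (Finset.mem_univ _)
  have h4 : ∀ x, ∑ c, (Nf c x).card = ∑ c, d c x :=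
    fun x => le_antisymm (h2 x) ((h3 x).symm.le.trans (h1 x))
  have h5 : ∀ c x, ((ℓ c).neighborSet x).ncard = d c x := by
    intro c x
    rw [← hN]
    exact (Finset.sum_eq_sum_iff_of_le (fun c _ => by rw [hN]; exact hle c x)).1 (h4 x) c
      (Finset.mem_univ _)
  refine ⟨h5, fun x y hxy => ?_⟩
  obtain ⟨c, hc⟩ := hcov x y hxy
  refine ⟨c, hc, fun c' hc' => ?_⟩
  by_contra hne
  -- If two colours contained the pair, it could be deleted from one of them and the neighbourhoods
  -- of `x` would still cover, contradicting the exact count.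
  have hlt : (Finset.univ.erase x).card < ∑ c, (Nf c x).card := by
    have hu : Finset.univ.erase x = Finset.univ.biUnion
        fun e => if e = c' then (Nf e x).erase y else Nf e x := by
      rw [← hun]
      ext w
      simp only [Finset.mem_biUnion, Finset.mem_univ, true_and]
      constructor
      · rintro ⟨e, he⟩
        by_cases hw : w = y
        · subst hw
          exact ⟨c, by rw [if_neg (Ne.symm hne)]; simp [Nf, hc]⟩
        · refine ⟨e, ?_⟩
          split_ifs
          · exact Finset.mem_erase.2 ⟨hw, he⟩
          · exact he
      · rintro ⟨e, he⟩
        refine ⟨e, ?_⟩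
        split_ifs at he
        · exact Finset.mem_of_mem_erase he
        · exact he
    rw [hu]
    refine lt_of_le_of_lt Finset.card_biUnion_le (Finset.sum_lt_sum (fun e _ => ?_)
      ⟨c', Finset.mem_univ _, ?_⟩)
    · split_ifs
      · exact Finset.card_le_card (Finset.erase_subset _ _)
      · exact le_rfl
    · rw [if_pos rfl]
      exact Finset.card_erase_lt_of_mem (by simp [Nf, hc'])
  rw [h4, ← h3, Finset.card_erase_of_mem (Finset.mem_univ _), Finset.card_univ] at hlt
  exact lt_irrefl _ hlt

/-- `S` is a union of classes, and each class contains an even number of the points in question. -/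
theorem even_ncard_of_saturated [Finite H] {E : H → H → Prop} (hE : Equivalence E) (p : H → Prop)
    (h : ∀ x, Even {y | p y ∧ E x y}.ncard) (S : Set H) (hS : ∀ x y, E x y → x ∈ S → y ∈ S) :
    Even {y | p y ∧ y ∈ S}.ncard := by
  classical
  have := Fintype.ofFinite H
  let St : Setoid H := ⟨E, hE⟩
  have key : {y | p y ∧ y ∈ S}.ncard = ∑ q : Quotient St,
      ((Finset.univ.filter fun y => p y ∧ y ∈ S).filter fun y => Quotient.mk St y = q).card := by
    rw [← Finset.card_eq_sum_card_fiberwise (fun _ _ => Finset.mem_coe.2 (Finset.mem_univ _)),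
      ← Set.ncard_coe_finset]
    congr 1; ext y; simp
  rw [key]
  refine Finset.even_sum _ fun q _ => ?_
  obtain ⟨x, rfl⟩ := Quotient.exists_rep q
  by_cases hx : x ∈ S
  · have e : ((Finset.univ.filter fun y => p y ∧ y ∈ S).filter
        fun y => Quotient.mk St y = Quotient.mk St x).card = {y | p y ∧ E x y}.ncard := by
      rw [← Set.ncard_coe_finset]
      congr 1; ext y
      have hq : (Quotient.mk St y = Quotient.mk St x) ↔ E y x := Quotient.eq
      simp only [Finset.coe_filter, Finset.mem_filter, Finset.mem_univ, true_and, hq,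
        Set.mem_ofPred_eq]
      exact ⟨fun h => ⟨h.1.1, hE.symm h.2⟩, fun h => ⟨⟨h.1, hS _ _ h.2 hx⟩, hE.symm h.2⟩⟩
    rw [e]; exact h x
  · have e : ((Finset.univ.filter fun y => p y ∧ y ∈ S).filter
        fun y => Quotient.mk St y = Quotient.mk St x) = ∅ := by
      refine Finset.filter_eq_empty_iff.2 fun y hy hq => hx ?_
      have hq : E y x := Quotient.eq.1 hq
      exact hS _ _ hq (Finset.mem_filter.1 hy).2.2
    rw [e]; simp

end Forest

end HamFrag

/-! ### Local colourings with one distinguished label -/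

namespace HamFrag

/-- The shapes of a colour class of a local colouring near a distinguished label. -/
inductive Kind
  | plain
  | intact
  | linked
  | closed
  deriving DecidableEq

/-- The number of occurrences of `x` in a list. -/
def occ {H : Type*} [DecidableEq H] (x : H) (l : List H) : ℕ := l.count x

theorem occ_append {H : Type*} [DecidableEq H] (x : H) (l l' : List H) :
    occ x (l ++ l') = occ x l + occ x l' := List.count_append

theorem occ_eq_zero {H : Type*} [DecidableEq H] {x : H} {l : List H} : occ x l = 0 ↔ x ∉ l :=
  List.count_eq_zero

theorem occ_pos {H : Type*} [DecidableEq H] {x : H} {l : List H} : 0 < occ x l ↔ x ∈ l :=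
  List.count_pos_iff

section Strands

variable {H : Type*} (A B l l' : H) (G₁ G₂ : List H) (μ : Bool)

/-- The paths that form a colour class of the given shape. -/
def strands : Kind → List (List H)
  | .plain => [A :: (G₁ ++ (B :: G₂).reverse)]
  -- In this shape and the next two the ends are `A`, `B` and the two halves `l`, `l'`, so degrees
  -- do not depend on the shape. They differ in how the ends are joined: `linked` leaves `G₁` and
  -- `G₂` on separate paths, `closed` joins them at their heads.
  | .intact => [A :: (G₁ ++ (B :: G₂).reverse), [l, l']]
  | .linked => [A :: (G₁ ++ [bif μ then l else l']), B :: (G₂ ++ [bif μ then l' else l])]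
  | .closed => [[A, B], (G₁ ++ [bif μ then l else l']).reverse ++ (G₂ ++ [bif μ then l' else l])]

theorem ncard_strands_le [DecidableEq H] (K : Kind) (x : H) :
    {y | ∃ s ∈ strands A B l l' G₁ G₂ μ K, Nb s x y}.Finite ∧
    {y | ∃ s ∈ strands A B l l' G₁ G₂ μ K, Nb s x y}.ncard ≤
      2 * (occ x G₁ + occ x G₂) + ((if A = x then 1 else 0) + if B = x then 1 else 0)
        + if K = .plain then 0 else (if l = x then 1 else 0) + if l' = x then 1 else 0 := by
  obtain ⟨h1, h2⟩ := ncard_forest_le (strands A B l l' G₁ G₂ μ K)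
    (by cases K <;> simp [strands]) x
  refine ⟨h1, ?_⟩
  cases K <;> cases μ <;>
    simp [strands, occ, List.count_cons, List.getLast?_cons, List.getLast?_append] at h2 ⊢ <;> omega

theorem nb_strands₁ {K : Kind} {x y : H} (h : Nb G₁ x y) :
    ∃ s ∈ strands A B l l' G₁ G₂ μ K, Nb s x y := by
  cases K
  · exact ⟨_, List.mem_cons_self, h.mono ⟨[A], (B :: G₂).reverse, by simp⟩⟩
  · exact ⟨_, List.mem_cons_self, h.mono ⟨[A], (B :: G₂).reverse, by simp⟩⟩
  · exact ⟨_, List.mem_cons_self, h.mono ⟨[A], [bif μ then l else l'], by simp⟩⟩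
  · exact ⟨_, List.mem_cons_of_mem _ List.mem_cons_self,
      h.reverse.mono ⟨[bif μ then l else l'], G₂ ++ [bif μ then l' else l], by simp⟩⟩

theorem nb_strands₂ {K : Kind} {x y : H} (h : Nb G₂ x y) :
    ∃ s ∈ strands A B l l' G₁ G₂ μ K, Nb s x y := by
  cases K
  · exact ⟨_, List.mem_cons_self, h.reverse.mono ⟨A :: G₁, [B], by simp⟩⟩
  · exact ⟨_, List.mem_cons_self, h.reverse.mono ⟨A :: G₁, [B], by simp⟩⟩
  · exact ⟨_, List.mem_cons_of_mem _ List.mem_cons_self,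
      h.mono ⟨[B], [bif μ then l' else l], by simp⟩⟩
  · exact ⟨_, List.mem_cons_of_mem _ List.mem_cons_self,
      h.mono ⟨(G₁ ++ [bif μ then l else l']).reverse, [bif μ then l' else l], by simp⟩⟩

theorem nb_strands_open₁ {K : Kind} (hK : K ≠ .closed) {x y : H} (h : Nb (A :: G₁) x y) :
    ∃ s ∈ strands A B l l' G₁ G₂ μ K, Nb s x y := by
  cases K
  · exact ⟨_, List.mem_cons_self, h.mono ⟨[], (B :: G₂).reverse, by simp⟩⟩
  · exact ⟨_, List.mem_cons_self, h.mono ⟨[], (B :: G₂).reverse, by simp⟩⟩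
  · exact ⟨_, List.mem_cons_self, h.mono ⟨[], [bif μ then l else l'], by simp⟩⟩
  · exact absurd rfl hK

theorem nb_strands_open₂ {K : Kind} (hK : K ≠ .closed) {x y : H} (h : Nb (B :: G₂) x y) :
    ∃ s ∈ strands A B l l' G₁ G₂ μ K, Nb s x y := by
  cases K
  · exact ⟨_, List.mem_cons_self, h.reverse.mono ⟨A :: G₁, [], by simp⟩⟩
  · exact ⟨_, List.mem_cons_self, h.reverse.mono ⟨A :: G₁, [], by simp⟩⟩
  · exact ⟨_, List.mem_cons_of_mem _ List.mem_cons_self,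
      h.mono ⟨[], [bif μ then l' else l], by simp⟩⟩
  · exact absurd rfl hK

end Strands

/-- Data from which a scheme is built: in every colour except `z`, `q`, `r` the local colouring
consists of a path through `A`, `B` and single edges joining the two halves of a label. -/
structure Core (n : ℕ) (C : Type*) [DecidableEq C] where
  lam : Idx n
  S : Lab n
  T : Lab n
  X : Lab n
  Y : Lab n
  z : C
  q : C
  r : C
  G₁ : C → List (Lab n)
  G₂ : C → List (Lab n)
  σ : C → Bool
  own : Idx n → C
  p : Idx n → C
  i : Idx n → C
  s : Idx n → Lab n
  t : Idx n → Lab n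
  lam_ne : lam ≠ none
  z_ne_q : z ≠ q
  z_ne_r : z ≠ r
  q_ne_r : q ≠ r
  own_lam : own lam = z
  mem_ne_none : ∀ c, ∀ x ∈ G₁ c ++ G₂ c, label x ≠ none
  count : ∀ c k, k ≠ none → occ (Sum.inl k) (G₁ c ++ G₂ c) + occ (Sum.inr k) (G₁ c ++ G₂ c)
    = if own k = c ∨ (k = lam ∧ (c = q ∨ c = r)) then 0 else 1
  last₁ : ∀ c, c = z ∨ c = q ∨ c = r → (G₁ c).getLast? = some (bif σ c then S else T)
  last₂ : ∀ c, c = z ∨ c = q ∨ c = r → (G₂ c).getLast? = some (bif σ c then T else S)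
  head₁ : ∀ c, c = q ∨ c = r → (G₁ c).head? = some X
  head₂ : ∀ c, c = q ∨ c = r → (G₂ c).head? = some Y
  -- Two groups of pairs are exempt because the shapes distribute them: those among `S`, `T` and the
  -- halves of the distinguished label, and the pair `X`, `Y`.
  cover : ∀ x y, x ≠ y → label x = label y ∨ (x ∈ quad S T lam ∧ y ∈ quad S T lam) ∨
    (x = X ∧ y = Y) ∨ (x = Y ∧ y = X) ∨
    ∃ c, Nb (G₁ c) x y ∨ Nb (G₂ c) x y ∨
      (c ≠ q ∧ (Nb (Sum.inl none :: G₁ c) x y ∨ Nb (Sum.inr none :: G₂ c) x y)) ∨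
      (¬ (c = z ∨ c = q ∨ c = r) ∧ Nb (Sum.inl none :: (G₁ c ++ (Sum.inr none :: G₂ c).reverse)) x y)
  own_ne_p : ∀ k, k ≠ none → k ≠ lam → own k ≠ p k
  own_ne_i : ∀ k, k ≠ none → k ≠ lam → own k ≠ i k
  p_ne_i : ∀ k, k ≠ none → k ≠ lam → p k ≠ i k
  s_ne_t : ∀ k, k ≠ none → k ≠ lam → s k ≠ t k
  gadget : ∀ k, k ≠ none → k ≠ lam →
    (Nb (G₁ (own k)) (s k) (t k) ∨ Nb (G₂ (own k)) (s k) (t k)) ∧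
    (Nb (G₁ (p k)) (s k) (Sum.inr k) ∨ Nb (G₂ (p k)) (s k) (Sum.inr k)) ∧
    (Nb (G₁ (p k)) (Sum.inr k) (t k) ∨ Nb (G₂ (p k)) (Sum.inr k) (t k)) ∧
    (Nb (G₁ (i k)) (s k) (Sum.inl k) ∨ Nb (G₂ (i k)) (s k) (Sum.inl k)) ∧
    (Nb (G₁ (i k)) (Sum.inl k) (t k) ∨ Nb (G₂ (i k)) (Sum.inl k) (t k))
  quads : ∀ k k', k ≠ none → k ≠ lam → k' ≠ none → k' ≠ lam → k ≠ k' →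
    (quad (s k) (t k) k ∩ quad (s k') (t k') k').Subsingleton

namespace Core

variable {n : ℕ} {C : Type*} [DecidableEq C] (K : Core n C)

/-- The colour class is one of the three that pass through the distinguished label. -/
def sp (c : C) : Prop := c = K.z ∨ c = K.q ∨ c = K.r

/-- An element whose label runs through closed cycles of its own in colour `c`. -/
def isOwn (c : C) (x : Lab n) : Prop := label x ≠ none ∧ label x ≠ K.lam ∧ K.own (label x) = c

instance (c : C) : Decidable (K.sp c) := inferInstanceAs (Decidable (_ ∨ _))

instance (c : C) (x : Lab n) : Decidable (K.isOwn c x) := inferInstanceAs (Decidable (_ ∧ _))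

/-- The shape of colour `c` when the distinguished label has role `j`. -/
def kind (j : Cls) (c : C) : Kind :=
  -- For each role one special colour is linked, one is intact, and one of `q`, `r` is closed. Each
  -- special colour is linked in exactly one role, and every cycle of the factor has vertices in all
  -- three roles, so the label meets `∞` on each cycle in each of these colours.
  if c = K.z then (if j = .first then .linked else .intact)
  else if c = K.r then (match j with | .first => .intact | .second => .closed | .other => .linked)
  else if c = K.q then (if j = .second then .linked else .closed)
  else .plain

/-- The bit telling which half of the distinguished label is attached to the first strand. -/
def bit (j : Cls) (b : Bool) (c : C) : Bool :=
  -- Since `σ` tells whether the first strand ends in `S` or `T`, the bit `b` alone decides which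
  -- half meets `S`. The linked and the closed colour take complementary matchings, so no pair is
  -- used twice for either value of `b`.
  if K.kind j c = .linked then b ^^ K.σ c else !b ^^ K.σ c

/-- The paths of colour `c`. -/
def paths (j : Cls) (b : Bool) (c : C) : List (List (Lab n)) :=
  strands (Sum.inl none) (Sum.inr none) (Sum.inl K.lam) (Sum.inr K.lam) (K.G₁ c) (K.G₂ c)
    (K.bit j b c) (K.kind j c)

/-- The local colouring. -/
def conf (j : Cls) (b : Bool) (c : C) : SimpleGraph (Lab n) where
  Adj x y := x ≠ y ∧ ((∃ l ∈ K.paths j b c, Nb l x y) ∨ (label x = label y ∧ K.isOwn c x))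
  symm := ⟨fun _ _ h => ⟨h.1.symm, h.2.imp (fun ⟨l, hl, h⟩ => ⟨l, hl, h.symm⟩)
    fun h => ⟨h.1.symm, by unfold isOwn at *; rw [← h.1]; exact h.2⟩⟩⟩
  loopless := ⟨fun _ h => h.1 rfl⟩

/-- The degrees of the local colouring. -/
def deg (c : C) (x : Lab n) : ℕ :=
  2 * (occ x (K.G₁ c) + occ x (K.G₂ c)) + (if label x = none then 1 else 0)
    + (if K.sp c ∧ label x = K.lam then 1 else 0) + if K.isOwn c x then 1 else 0

theorem label_cases (x y : Lab n) (h : label x = label y) :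
    x = y ∨ (x = Sum.inl (label y) ∧ y = Sum.inr (label y)) ∨
      (x = Sum.inr (label y) ∧ y = Sum.inl (label y)) := by
  rcases x with k | k <;> rcases y with k' | k' <;> simp_all [label]

theorem kind_eq_plain (j : Cls) (c : C) : K.kind j c = .plain ↔ ¬ K.sp c := by
  unfold kind sp
  split_ifs with h1 h2 h3 h4 h5 <;> (try (cases j)) <;> simp_all

theorem ncard_conf_le (j : Cls) (b : Bool) (c : C) (x : Lab n) :
    ((K.conf j b c).neighborSet x).ncard ≤ K.deg c x := by
  obtain ⟨h1, h2⟩ := ncard_strands_le (Sum.inl none) (Sum.inr none) (Sum.inl K.lam)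
    (Sum.inr K.lam) (K.G₁ c) (K.G₂ c) (K.bit j b c) (K.kind j c) x
  have hsub : (K.conf j b c).neighborSet x ⊆ {y | ∃ s ∈ K.paths j b c, Nb s x y} ∪
      {y | y ≠ x ∧ label x = label y ∧ K.isOwn c x} := by
    rintro y ⟨hy1, hy2 | hy2⟩
    · exact Or.inl hy2
    · exact Or.inr ⟨Ne.symm hy1, hy2.1, hy2.2⟩
  have h3 : {y | y ≠ x ∧ label x = label y ∧ K.isOwn c x}.ncard
      ≤ if K.isOwn c x then 1 else 0 := by
    split_ifs with h
    · refine (Set.ncard_le_one (Set.toFinite _)).2 ?_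
      rintro y ⟨hy, hy', -⟩ w ⟨hw, hw', -⟩
      rcases x with x | x <;> rcases y with y | y <;> rcases w with w | w <;> simp_all [label]
    · simp [h]
  have h4 := (Set.ncard_le_ncard hsub (Set.toFinite _)).trans (Set.ncard_union_le _ _)
  refine h4.trans ((Nat.add_le_add h2 h3).trans ?_)
  unfold deg
  have e1 : (if (Sum.inl none : Lab n) = x then 1 else 0) + (if (Sum.inr none : Lab n) = x then 1 else 0)
      = if label x = none then 1 else 0 := by
    rcases x with k | k <;> by_cases hk : k = none <;> simp [label, hk, @eq_comm _ none k]
  have e2 : (if K.kind j c = .plain then 0 else (if (Sum.inl K.lam : Lab n) = x then 1 else 0)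
      + (if (Sum.inr K.lam : Lab n) = x then 1 else 0))
      = if K.sp c ∧ label x = K.lam then 1 else 0 := by
    have hp := K.kind_eq_plain j c
    rcases x with k | k <;> by_cases h : K.sp c <;> by_cases hl : k = K.lam <;>
      simp [label, hl, h, hp, @eq_comm _ K.lam k]
  rw [← e1, ← e2]

theorem deg_add (c : C) (k : Idx n) : K.deg c (Sum.inl k) + K.deg c (Sum.inr k) = 2 := by
  unfold deg
  by_cases hk : k = none
  · have h1 : ∀ x : Lab n, label x = none → occ x (K.G₁ c) + occ x (K.G₂ c) = 0 := by
      intro x hx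
      rw [← occ_append]
      exact occ_eq_zero.2 fun h => K.mem_ne_none c x h hx
    have h2 : k ≠ K.lam := fun h => K.lam_ne (h ▸ hk)
    have e1 := h1 (Sum.inl k) hk
    have e2 := h1 (Sum.inr k) hk
    rw [e1, e2]
    simp [label, hk, isOwn, K.lam_ne.symm]
  · have h := K.count c k hk
    rw [occ_append, occ_append] at h
    by_cases hl : k = K.lam
    · subst hl
      have : (K.own K.lam = c ∨ K.lam = K.lam ∧ (c = K.q ∨ c = K.r)) ↔ K.sp c := by
        rw [K.own_lam]; unfold sp; simp [eq_comm]
      simp only [true_and] at h this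
      by_cases hs : K.sp c <;> simp only [this] at h <;> simp [hs, label, hk, isOwn] at h ⊢ <;> omega
    · by_cases ho : K.own k = c <;> simp [ho, label, hk, hl, isOwn] at h ⊢ <;> omega

theorem mem_G {c : C} {x : Lab n} (h : x ∈ K.G₁ c ++ K.G₂ c) :
    label x ≠ none ∧ K.own (label x) ≠ c ∧ (K.sp c → label x ≠ K.lam) := by
  have h0 := K.mem_ne_none c x h
  have h1 := K.count c (label x) h0
  have h2 : 0 < occ x (K.G₁ c ++ K.G₂ c) := occ_pos.2 h
  have h3 : ¬ (K.own (label x) = c ∨ label x = K.lam ∧ (c = K.q ∨ c = K.r)) := by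
    intro h'
    rw [if_pos h'] at h1
    rcases x with k | k <;> simp only [label, Sum.elim_inl, Sum.elim_inr, id] at h1 <;> omega
  refine ⟨h0, fun h' => h3 (Or.inl h'), fun hs hl => ?_⟩
  rcases hs with hs | hs
  · exact h3 (Or.inl (by rw [hl, K.own_lam, hs]))
  · exact h3 (Or.inr ⟨hl, hs⟩)

theorem deg_eq_one {c : C} {x : Lab n} (h : K.deg c x = 1) :
    label x = none ∨ (K.sp c ∧ label x = K.lam) ∨ K.isOwn c x := by
  by_contra hn
  push Not at hn
  unfold deg at h
  rw [if_neg hn.1, if_neg (fun h => hn.2.1 h.1 h.2), if_neg hn.2.2] at h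
  omega

theorem deg_of_none {c : C} {x : Lab n} (h : label x = none) : K.deg c x = 1 := by
  unfold deg
  have : x ∉ K.G₁ c ++ K.G₂ c := fun h' => (K.mem_G h').1 h
  rw [List.mem_append, not_or] at this
  rw [occ_eq_zero.2 this.1, occ_eq_zero.2 this.2]
  simp [h, isOwn, K.lam_ne.symm]

theorem deg_of_lam {c : C} {x : Lab n} (hc : K.sp c) (h : label x = K.lam) : K.deg c x = 1 := by
  unfold deg
  have : x ∉ K.G₁ c ++ K.G₂ c := fun h' => (K.mem_G h').2.2 hc h
  rw [List.mem_append, not_or] at this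
  rw [occ_eq_zero.2 this.1, occ_eq_zero.2 this.2]
  simp [h, isOwn, K.lam_ne, hc]

theorem deg_of_isOwn {c : C} {x : Lab n} (h : K.isOwn c x) : K.deg c x = 1 := by
  unfold deg
  have : x ∉ K.G₁ c ++ K.G₂ c := fun h' => (K.mem_G h').2.1 h.2.2
  rw [List.mem_append, not_or] at this
  rw [occ_eq_zero.2 this.1, occ_eq_zero.2 this.2]
  simp [h, h.1, h.2.1]

theorem deg_le (c : C) (x : Lab n) : K.deg c x ≤ 2 := by
  have := K.deg_add c (label x)
  rcases x with k | k <;> simp only [label, Sum.elim_inl, Sum.elim_inr, id] at this <;> omega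

end Core

end HamFrag

namespace HamFrag

namespace Core

variable {n : ℕ} {C : Type*} [DecidableEq C] (K : Core n C)

theorem conf_adj {j : Cls} {b : Bool} {c : C} {l : List (Lab n)} (hl : l ∈ K.paths j b c)
    {x y : Lab n} (hxy : x ≠ y) (h : Nb l x y) : (K.conf j b c).Adj x y := ⟨hxy, Or.inl ⟨l, hl, h⟩⟩

theorem conf_adj_of_nb {j : Cls} {b : Bool} {c : C} {x y : Lab n} (hxy : x ≠ y)
    (h : Nb (K.G₁ c) x y ∨ Nb (K.G₂ c) x y) : (K.conf j b c).Adj x y :=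
  ⟨hxy, Or.inl (h.elim (nb_strands₁ _ _ _ _ _ _ _) (nb_strands₂ _ _ _ _ _ _ _))⟩

theorem conf_rung {j : Cls} {b : Bool} {c : C} {k : Idx n} (h1 : k ≠ none) (h2 : k ≠ K.lam)
    (h3 : K.own k = c) : (K.conf j b c).Adj (Sum.inl k) (Sum.inr k) :=
  ⟨by simp, Or.inr ⟨rfl, h1, h2, h3⟩⟩

theorem kind_z (j : Cls) : K.kind j K.z = if j = .first then .linked else .intact := by
  simp [kind]

theorem kind_r (j : Cls) : K.kind j K.r = match j with
    | .first => .intact | .second => .closed | .other => .linked := by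
  cases j <;> simp [kind, K.z_ne_r.symm]

theorem kind_q (j : Cls) : K.kind j K.q = if j = .second then .linked else .closed := by
  simp [kind, K.z_ne_q.symm, K.q_ne_r]

theorem exists_kind (j : Cls) : (∃ c, K.sp c ∧ K.kind j c = .intact) ∧
    (∃ c, K.sp c ∧ K.kind j c = .linked) ∧ ∃ c, K.sp c ∧ K.kind j c = .closed := by
  have hz : K.sp K.z := Or.inl rfl
  have hq : K.sp K.q := Or.inr (Or.inl rfl)
  have hr : K.sp K.r := Or.inr (Or.inr rfl)
  cases j
  · exact ⟨⟨K.r, hr, by rw [kind_r]⟩, ⟨K.z, hz, by rw [kind_z]; rfl⟩, K.q, hq, by rw [kind_q]; rfl⟩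
  · exact ⟨⟨K.z, hz, by rw [kind_z]; rfl⟩, ⟨K.q, hq, by rw [kind_q]; rfl⟩, K.r, hr, by rw [kind_r]⟩
  · exact ⟨⟨K.z, hz, by rw [kind_z]; rfl⟩, ⟨K.r, hr, by rw [kind_r]⟩, K.q, hq, by rw [kind_q]; rfl⟩

/-- The colours `q` and `r` are never both of the same one of the shapes `linked` and `closed`. -/
theorem exists_closed_and_open (j : Cls) :
    (∃ c, (c = K.q ∨ c = K.r) ∧ K.kind j c = .closed) ∧
      ∃ c, (c = K.q ∨ c = K.r) ∧ K.kind j c ≠ .closed := by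
  cases j
  · exact ⟨⟨K.q, Or.inl rfl, by rw [kind_q]; rfl⟩, K.r, Or.inr rfl, by rw [kind_r]; simp⟩
  · exact ⟨⟨K.r, Or.inr rfl, by rw [kind_r]⟩, K.q, Or.inl rfl, by rw [kind_q]; simp⟩
  · exact ⟨⟨K.q, Or.inl rfl, by rw [kind_q]; rfl⟩, K.r, Or.inr rfl, by rw [kind_r]; simp⟩

theorem infix_last {α : Type*} {l : List α} {x y : α} (h : l.getLast? = some x) :
    [x, y] <:+: l ++ [y] :=
  pair_infix_append h rfl

variable {K}

theorem mem_paths_intact {j : Cls} {b : Bool} {c : C} (h : K.kind j c = .intact) :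
    (Sum.inl none :: (K.G₁ c ++ (Sum.inr none :: K.G₂ c).reverse)) ∈ K.paths j b c ∧
      [Sum.inl K.lam, Sum.inr K.lam] ∈ K.paths j b c := by
  simp [paths, h, strands]

theorem mem_paths_linked {j : Cls} {b : Bool} {c : C} (h : K.kind j c = .linked) :
    (Sum.inl none :: (K.G₁ c ++ [bif b ^^ K.σ c then Sum.inl K.lam else Sum.inr K.lam]))
        ∈ K.paths j b c ∧
      (Sum.inr none :: (K.G₂ c ++ [bif b ^^ K.σ c then Sum.inr K.lam else Sum.inl K.lam]))
        ∈ K.paths j b c := by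
  simp [paths, h, strands, bit]

theorem mem_paths_closed {j : Cls} {b : Bool} {c : C} (h : K.kind j c = .closed) :
    [Sum.inl none, Sum.inr none] ∈ K.paths j b c ∧
      ((K.G₁ c ++ [bif !b ^^ K.σ c then Sum.inl K.lam else Sum.inr K.lam]).reverse ++
        (K.G₂ c ++ [bif !b ^^ K.σ c then Sum.inr K.lam else Sum.inl K.lam])) ∈ K.paths j b c := by
  simp [paths, h, strands, bit]

theorem mem_paths_plain {j : Cls} {b : Bool} {c : C} (h : K.kind j c = .plain) :
    (Sum.inl none :: (K.G₁ c ++ (Sum.inr none :: K.G₂ c).reverse)) ∈ K.paths j b c := by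
  simp [paths, h, strands]

variable (K)

/-- The six pairs on `S`, `T` and the two halves split into three perfect matchings: the intact
colour has `S T` and the rung, the linked and the closed colour have the two matchings between `S`,
`T` and the halves. -/
theorem conf_cover_quad (j : Cls) (b : Bool) {x y : Lab n} (hxy : x ≠ y)
    (hl : label x ≠ label y) (hx : x ∈ quad K.S K.T K.lam) (hy : y ∈ quad K.S K.T K.lam) :
    ∃ c, (K.conf j b c).Adj x y := by
  obtain ⟨⟨c1, s1, h1⟩, ⟨c2, s2, h2⟩, c3, s3, h3⟩ := K.exists_kind j
  have hST : ∀ x y, x ≠ y → ((x = K.S ∧ y = K.T) ∨ (x = K.T ∧ y = K.S)) →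
      ∃ c, (K.conf j b c).Adj x y := by
    intro x y hxy h
    refine ⟨c1, K.conf_adj (mem_paths_intact h1).1 hxy ?_⟩
    have := pair_infix_append (K.last₁ c1 s1) (l₂ := (Sum.inr none :: K.G₂ c1).reverse)
      (y := bif K.σ c1 then K.T else K.S) (by
        rw [List.head?_reverse, List.getLast?_cons, K.last₂ c1 s1]; rfl)
    replace this := this.trans (List.infix_cons (a := Sum.inl none) (List.infix_refl _))
    rcases h with ⟨rfl, rfl⟩ | ⟨rfl, rfl⟩ <;> cases hs : K.σ c1 <;> rw [hs] at this
    · exact Or.inr this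
    · exact Or.inl this
    · exact Or.inl this
    · exact Or.inr this
  have hlink : ∀ β : Bool, ∃ c, ∀ x y, x ≠ y → ((x = K.S ∧ y = bif β then Sum.inl K.lam else Sum.inr K.lam)
      ∨ (x = K.T ∧ y = bif β then Sum.inr K.lam else Sum.inl K.lam)) →
      (K.conf j b c).Adj x y := by
    intro β
    have key : ∀ c, K.sp c → ∀ μ, μ = (β ^^ !(K.σ c)) →
        (∀ x y, x ≠ y → Nb (K.G₁ c ++ [bif μ then Sum.inl K.lam else Sum.inr K.lam]) x y →
          (K.conf j b c).Adj x y) →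
        (∀ x y, x ≠ y → Nb (K.G₂ c ++ [bif μ then Sum.inr K.lam else Sum.inl K.lam]) x y →
          (K.conf j b c).Adj x y) →
        ∀ x y, x ≠ y → ((x = K.S ∧ y = bif β then Sum.inl K.lam else Sum.inr K.lam)
      ∨ (x = K.T ∧ y = bif β then Sum.inr K.lam else Sum.inl K.lam)) →
      (K.conf j b c).Adj x y := by
      intro c hc μ hμ a1 a2 x y hxy h
      have i1 := infix_last (K.last₁ c hc)
        (y := bif μ then Sum.inl K.lam else Sum.inr K.lam)
      have i2 := infix_last (K.last₂ c hc)
        (y := bif μ then Sum.inr K.lam else Sum.inl K.lam)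
      rcases h with ⟨rfl, rfl⟩ | ⟨rfl, rfl⟩ <;> cases hs : K.σ c <;> cases β <;>
        rw [hs] at i1 i2 hμ <;> subst hμ <;>
        first
        | exact a1 _ _ hxy (Or.inl i1)
        | exact a2 _ _ hxy (Or.inl i2)
    have b1 : ∀ β b s : Bool, β = !b → (b ^^ s) = (β ^^ !s) := by decide
    have b2 : ∀ β b s : Bool, ¬ β = !b → (!b ^^ s) = (β ^^ !s) := by decide
    by_cases hβ : β = !b
    · refine ⟨c2, key c2 s2 (b ^^ K.σ c2) (b1 _ _ _ hβ) ?_ ?_⟩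
      · exact fun x y hxy h => K.conf_adj (mem_paths_linked h2).1 hxy
          (h.mono ⟨[Sum.inl none], [], by simp⟩)
      · exact fun x y hxy h => K.conf_adj (mem_paths_linked h2).2 hxy
          (h.mono ⟨[Sum.inr none], [], by simp⟩)
    · refine ⟨c3, key c3 s3 (!b ^^ K.σ c3) (b2 _ _ _ hβ) ?_ ?_⟩
      · exact fun x y hxy h => K.conf_adj (mem_paths_closed h3).2 hxy
          (h.reverse.mono (List.infix_append [] _ _))
      · exact fun x y hxy h => K.conf_adj (mem_paths_closed h3).2 hxy
          (h.mono (List.suffix_append _ _).isInfix)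
  obtain ⟨d1, e1⟩ := hlink true
  obtain ⟨d2, e2⟩ := hlink false
  simp only [cond_true, cond_false] at e1 e2
  have hlam : label (Sum.inl K.lam : Lab n) = label (Sum.inr K.lam : Lab n) := rfl
  simp only [quad, Set.mem_insert_iff, Set.mem_singleton_iff] at hx hy
  rcases hx with hx | hx | hx | hx <;> rcases hy with hy | hy | hy | hy <;>
    first
    | exact absurd (hx.trans hy.symm) hxy
    | exact absurd (by rw [hx, hy]; rfl) hl
    | exact hST x y hxy (Or.inl ⟨hx, hy⟩)
    | exact hST x y hxy (Or.inr ⟨hx, hy⟩)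
    | exact ⟨d1, e1 x y hxy (Or.inl ⟨hx, hy⟩)⟩
    | exact ⟨d1, e1 x y hxy (Or.inr ⟨hx, hy⟩)⟩
    | exact ⟨d2, e2 x y hxy (Or.inl ⟨hx, hy⟩)⟩
    | exact ⟨d2, e2 x y hxy (Or.inr ⟨hx, hy⟩)⟩
    | exact ⟨d1, (e1 y x hxy.symm (Or.inl ⟨hy, hx⟩)).symm⟩
    | exact ⟨d1, (e1 y x hxy.symm (Or.inr ⟨hy, hx⟩)).symm⟩
    | exact ⟨d2, (e2 y x hxy.symm (Or.inl ⟨hy, hx⟩)).symm⟩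
    | exact ⟨d2, (e2 y x hxy.symm (Or.inr ⟨hy, hx⟩)).symm⟩

/-- Exactly one of `q`, `r` is closed, and it uses `X Y` and the rung of `∞`; the other joins `X`
and `Y` to the two ends of `∞`. -/
theorem conf_cover_square (j : Cls) (b : Bool) {x y : Lab n} (hxy : x ≠ y) :
    ((x = K.X ∧ y = K.Y) ∨ (x = Sum.inl none ∧ y = Sum.inr none) ∨
      (x = Sum.inl none ∧ y = K.X) ∨ (x = Sum.inr none ∧ y = K.Y)) →
    ∃ c, (K.conf j b c).Adj x y := by
  obtain ⟨⟨c1, s1, h1⟩, c2, s2, h2⟩ := K.exists_closed_and_open j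
  rintro (⟨rfl, rfl⟩ | ⟨rfl, rfl⟩ | ⟨rfl, rfl⟩ | ⟨rfl, rfl⟩)
  · refine ⟨c1, K.conf_adj (mem_paths_closed h1).2 hxy (Or.inl (pair_infix_append ?_ ?_))⟩
    · rw [List.getLast?_reverse, List.head?_append, K.head₁ c1 s1]; rfl
    · rw [List.head?_append, K.head₂ c1 s1]; rfl
  · exact ⟨c1, K.conf_adj (mem_paths_closed h1).1 hxy (Or.inl (List.infix_refl _))⟩
  · obtain ⟨l, hl, h⟩ := nb_strands_open₁ (Sum.inl none) (Sum.inr none) (Sum.inl K.lam)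
      (Sum.inr K.lam) (K.G₁ c2) (K.G₂ c2) (K.bit j b c2) h2 (x := Sum.inl none) (y := K.X)
      (Or.inl (pair_infix_append (l₁ := [Sum.inl none]) rfl (K.head₁ c2 s2)))
    exact ⟨c2, K.conf_adj hl hxy h⟩
  · obtain ⟨l, hl, h⟩ := nb_strands_open₂ (Sum.inl none) (Sum.inr none) (Sum.inl K.lam)
      (Sum.inr K.lam) (K.G₁ c2) (K.G₂ c2) (K.bit j b c2) h2 (x := Sum.inr none) (y := K.Y)
      (Or.inl (pair_infix_append (l₁ := [Sum.inr none]) rfl (K.head₂ c2 s2)))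
    exact ⟨c2, K.conf_adj hl hxy h⟩

theorem kind_closed {j : Cls} {c : C} (h : K.kind j c = .closed) : c = K.q ∨ c = K.r := by
  unfold kind at h
  split_ifs at h with h1 h2 h3 <;> simp_all

theorem conf_cover (j : Cls) (b : Bool) {x y : Lab n} (hxy : x ≠ y) :
    ∃ c, (K.conf j b c).Adj x y := by
  by_cases h : label x = label y
  · have hrung : ∀ k, ∃ c, (K.conf j b c).Adj (Sum.inl k) (Sum.inr k) := by
      intro k
      by_cases h1 : k = none
      · subst h1
        exact K.conf_cover_square j b (by simp) (Or.inr (Or.inl ⟨rfl, rfl⟩))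
      by_cases h2 : k = K.lam
      · subst h2
        obtain ⟨⟨c1, s1, h1⟩, -⟩ := K.exists_kind j
        exact ⟨c1, K.conf_adj (mem_paths_intact h1).2 (by simp) (Or.inl (List.infix_refl _))⟩
      · exact ⟨_, K.conf_rung h1 h2 rfl⟩
    rcases label_cases x y h with h' | ⟨h1, h2⟩ | ⟨h1, h2⟩
    · exact absurd h' hxy
    · rw [h1, h2]; exact hrung _
    · rw [h1, h2]; obtain ⟨c, hc⟩ := hrung (label y); exact ⟨c, hc.symm⟩
  rcases K.cover x y hxy with h' | h' | h' | h' | ⟨c, h'⟩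
  · exact absurd h' h
  · exact K.conf_cover_quad j b hxy h h'.1 h'.2
  · exact K.conf_cover_square j b hxy (Or.inl h')
  · obtain ⟨c, hc⟩ := K.conf_cover_square j b hxy.symm (Or.inl ⟨h'.2, h'.1⟩)
    exact ⟨c, hc.symm⟩
  · rcases h' with h | h | ⟨h1, h⟩ | ⟨h1, h⟩
    · exact ⟨c, K.conf_adj_of_nb hxy (Or.inl h)⟩
    · exact ⟨c, K.conf_adj_of_nb hxy (Or.inr h)⟩
    -- A closed colour loses the edges from the two ends of `∞` to the heads of its strands. They
    -- are found in the other colour among `q`, `r`, which has the same heads.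
    · by_cases hk : K.kind j c = .closed
      · have hc := K.kind_closed hk
        have hsymm : ∀ x y, x ≠ y → ((x = Sum.inl none ∧ y = K.X) ∨ (x = Sum.inr none ∧ y = K.Y)) →
            (∃ c, (K.conf j b c).Adj x y) ∧ ∃ c, (K.conf j b c).Adj y x := by
          intro x y hxy h
          obtain ⟨c, hc⟩ := K.conf_cover_square j b hxy (Or.inr (Or.inr h))
          exact ⟨⟨c, hc⟩, c, hc.symm⟩
        rcases h with h | h
        · obtain ⟨l, hl⟩ := List.head?_eq_some_iff.1 (K.head₁ c hc)
          rw [hl] at h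
          rcases nb_cons_iff.1 h with ⟨ha, hb⟩ | ⟨ha, hb⟩ | h
          · exact (hsymm x y hxy (Or.inl ⟨ha, hb⟩)).1
          · exact (hsymm y x hxy.symm (Or.inl ⟨hb, ha⟩)).2
          · exact ⟨c, K.conf_adj_of_nb hxy (Or.inl (hl ▸ h))⟩
        · obtain ⟨l, hl⟩ := List.head?_eq_some_iff.1 (K.head₂ c hc)
          rw [hl] at h
          rcases nb_cons_iff.1 h with ⟨ha, hb⟩ | ⟨ha, hb⟩ | h
          · exact (hsymm x y hxy (Or.inr ⟨ha, hb⟩)).1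
          · exact (hsymm y x hxy.symm (Or.inr ⟨hb, ha⟩)).2
          · exact ⟨c, K.conf_adj_of_nb hxy (Or.inr (hl ▸ h))⟩
      · rcases h with h | h
        · obtain ⟨l, hl, h⟩ := nb_strands_open₁ (Sum.inl none) (Sum.inr none) (Sum.inl K.lam)
            (Sum.inr K.lam) (K.G₁ c) (K.G₂ c) (K.bit j b c) hk h
          exact ⟨c, K.conf_adj hl hxy h⟩
        · obtain ⟨l, hl, h⟩ := nb_strands_open₂ (Sum.inl none) (Sum.inr none) (Sum.inl K.lam)
            (Sum.inr K.lam) (K.G₁ c) (K.G₂ c) (K.bit j b c) hk h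
          exact ⟨c, K.conf_adj hl hxy h⟩
    · exact ⟨c, K.conf_adj (mem_paths_plain ((K.kind_eq_plain j c).2 h1)) hxy h⟩

end Core

end HamFrag

namespace HamFrag

namespace Core

variable {n : ℕ} {C : Type*} [DecidableEq C] (K : Core n C)

/-- The block of a label. -/
def blkOf (j : Cls) (c : C) (k : Idx n) : Idx n :=
  if K.kind j c = .linked ∧ k = K.lam then none else k

/-- An invariant of the components of the local colouring. -/
def blkInv (j : Cls) (c : C) (x : Lab n) : Idx n :=
  if K.isOwn c x then label x else match K.kind j c with
    | .plain => none
    | .linked => none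
    | .intact => if label x = K.lam then K.lam else none
    | .closed => if label x = none then none else K.lam

theorem mem_paths {j : Cls} {b : Bool} {c : C} {l : List (Lab n)} (hl : l ∈ K.paths j b c)
    {x : Lab n} (hx : x ∈ l) :
    label x = none ∨ (K.sp c ∧ label x = K.lam) ∨ x ∈ K.G₁ c ++ K.G₂ c := by
  have hp := K.kind_eq_plain j c
  have key : ∀ β : Bool, x = (bif β then Sum.inl K.lam else Sum.inr K.lam : Lab n) → label x = K.lam := by
    rintro (_ | _) rfl <;> rfl
  have key' : ∀ β : Bool, x = (bif β then Sum.inr K.lam else Sum.inl K.lam : Lab n) → label x = K.lam := by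
    rintro (_ | _) rfl <;> rfl
  have hA : x = Sum.inl none → label x = none := by rintro rfl; rfl
  have hB : x = Sum.inr none → label x = none := by rintro rfl; rfl
  have hl1 : x = Sum.inl K.lam → label x = K.lam := by rintro rfl; rfl
  have hl2 : x = Sum.inr K.lam → label x = K.lam := by rintro rfl; rfl
  unfold paths at hl
  cases hk : K.kind j c <;> rw [hk] at hl hp <;>
    simp only [strands, List.mem_cons, List.not_mem_nil, or_false] at hl <;>
    simp only [reduceCtorEq, false_iff, true_iff, not_not] at hp
  · subst hl
    simp only [List.mem_cons, List.mem_append, List.mem_reverse] at hx ⊢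
    tauto
  · rcases hl with rfl | rfl <;>
      simp only [List.mem_cons, List.mem_append, List.mem_reverse, List.not_mem_nil, or_false] at hx ⊢ <;>
      tauto
  · have k1 := key (K.bit j b c)
    have k2 := key' (K.bit j b c)
    rcases hl with rfl | rfl <;>
      simp only [List.mem_cons, List.mem_append, List.not_mem_nil, or_false] at hx ⊢ <;>
      tauto
  · rcases hl with rfl | rfl
    · simp only [List.mem_cons, List.not_mem_nil, or_false] at hx
      exact Or.inl (hx.elim hA hB)
    · simp only [List.mem_cons, List.mem_append, List.mem_reverse, List.not_mem_nil, or_false] at hx ⊢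
      rcases hx with (hx | hx) | hx | hx
      · exact Or.inr (Or.inr (Or.inl hx))
      · exact Or.inr (Or.inl ⟨hp, key _ hx⟩)
      · exact Or.inr (Or.inr (Or.inr hx))
      · exact Or.inr (Or.inl ⟨hp, key' _ hx⟩)

theorem not_isOwn_of_mem {j : Cls} {b : Bool} {c : C} {l : List (Lab n)} (hl : l ∈ K.paths j b c)
    {x : Lab n} (hx : x ∈ l) : ¬ K.isOwn c x := by
  rcases K.mem_paths hl hx with h | h | h
  · exact fun h' => h'.1 h
  · exact fun h' => h'.2.1 h.2
  · exact fun h' => (K.mem_G h).2.1 h'.2.2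

theorem label_bif₁ (β : Bool) : label (bif β then Sum.inl K.lam else Sum.inr K.lam : Lab n) = K.lam := by
  cases β <;> rfl

theorem label_bif₂ (β : Bool) : label (bif β then Sum.inr K.lam else Sum.inl K.lam : Lab n) = K.lam := by
  cases β <;> rfl

theorem blkInv_of_mem {j : Cls} {b : Bool} {c : C} {l : List (Lab n)} (hl : l ∈ K.paths j b c) :
    ∃ k, ∀ x ∈ l, K.blkInv j c x = k := by
  have hp := K.kind_eq_plain j c
  have hown := fun x (hx : x ∈ l) => K.not_isOwn_of_mem hl hx
  have hG : ∀ x, x ∈ K.G₁ c ∨ x ∈ K.G₂ c → label x ≠ none ∧ (K.sp c → label x ≠ K.lam) := by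
    intro x hx
    have := K.mem_G (List.mem_append.2 hx)
    exact ⟨this.1, this.2.2⟩
  unfold paths at hl
  cases hk : K.kind j c
  · exact ⟨none, fun x hx => by simp [blkInv, hown x hx, hk]⟩
  · rw [hk] at hl hp
    have hs : K.sp c := by simpa using hp
    simp only [strands, List.mem_cons, List.not_mem_nil, or_false] at hl
    rcases hl with rfl | rfl
    · refine ⟨none, fun x hx => ?_⟩
      have : label x ≠ K.lam := by
        simp only [List.mem_cons, List.mem_append, List.mem_reverse] at hx
        rcases hx with rfl | hx | rfl | hx
        · exact K.lam_ne.symm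
        · exact (hG x (Or.inl hx)).2 hs
        · exact K.lam_ne.symm
        · exact (hG x (Or.inr hx)).2 hs
      simp [blkInv, hown x hx, hk, this]
    · refine ⟨K.lam, fun x hx => ?_⟩
      have : label x = K.lam := by
        simp only [List.mem_cons, List.not_mem_nil, or_false] at hx
        rcases hx with rfl | rfl <;> rfl
      simp only [blkInv, if_neg (hown x hx), hk, if_pos this]
  · exact ⟨none, fun x hx => by simp [blkInv, hown x hx, hk]⟩
  · rw [hk] at hl hp
    simp only [strands, List.mem_cons, List.not_mem_nil, or_false] at hl
    rcases hl with rfl | rfl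
    · refine ⟨none, fun x hx => ?_⟩
      have : label x = none := by
        simp only [List.mem_cons, List.not_mem_nil, or_false] at hx
        rcases hx with rfl | rfl <;> rfl
      simp [blkInv, hown x hx, hk, this]
    · refine ⟨K.lam, fun x hx => ?_⟩
      have : label x ≠ none := by
        simp only [List.mem_cons, List.mem_append, List.mem_reverse, List.not_mem_nil,
          or_false] at hx
        rcases hx with (hx | rfl) | hx | rfl
        · exact (hG x (Or.inl hx)).1
        · rw [label_bif₁]; exact K.lam_ne
        · exact (hG x (Or.inr hx)).1
        · rw [label_bif₂]; exact K.lam_ne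
      simp [blkInv, hown x hx, hk, this]

theorem blkInv_adj {j : Cls} {b : Bool} {c : C} {x y : Lab n} (h : (K.conf j b c).Adj x y) :
    K.blkInv j c x = K.blkInv j c y := by
  rcases h.2 with ⟨l, hl, hxy⟩ | ⟨hl, ho⟩
  · obtain ⟨k, hk⟩ := K.blkInv_of_mem hl
    rw [hk x hxy.mem.1, hk y hxy.mem.2]
  · have ho' : K.isOwn c y := by unfold isOwn at *; rwa [← hl]
    rw [blkInv, blkInv, if_pos ho, if_pos ho', hl]

/-- The invariant is constant on components and equals the block at ports, so a local path cannot
join different blocks. -/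
theorem blkInv_port {j : Cls} {c : C} {x : Lab n} (h : K.deg c x = 1) :
    K.blkInv j c x = K.blkOf j c (label x) := by
  have hp := K.kind_eq_plain j c
  rcases K.deg_eq_one h with h | ⟨hs, h⟩ | h
  · have ho : ¬ K.isOwn c x := fun h' => h'.1 h
    rw [blkInv, blkOf, if_neg ho]
    cases hk : K.kind j c <;> simp [h, K.lam_ne.symm]
  · have ho : ¬ K.isOwn c x := fun h' => h'.2.1 h
    rw [blkInv, blkOf, if_neg ho]
    cases hk : K.kind j c <;> rw [hk] at hp <;> simp_all [K.lam_ne]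
  · rw [blkInv, blkOf, if_pos h, if_neg fun h' => h.2.1 h'.2]

theorem blkInv_reachable {j : Cls} {b : Bool} {c : C} {x y : Lab n}
    (h : (K.conf j b c).Reachable x y) : K.blkInv j c x = K.blkInv j c y := by
  obtain ⟨p⟩ := h
  induction p with
  | nil => rfl
  | cons h _ ih => exact (K.blkInv_adj h).trans ih

theorem reachable_of_mem {j : Cls} {b : Bool} {c : C} {l : List (Lab n)} (hl : l ∈ K.paths j b c)
    {x y : Lab n} (hx : x ∈ l) (hy : y ∈ l) : (K.conf j b c).Reachable x y := by
  have h1 := eqvGen_of_mem_list (r := (K.conf j b c).Reachable) l (fun x y h => by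
    by_cases hxy : x = y
    · rw [hxy]
    · exact (K.conf_adj hl hxy h).reachable) hx hy
  clear hx hy
  induction h1 with
  | rel _ _ h => exact h
  | refl _ => rfl
  | symm _ _ _ ih => exact ih.symm
  | trans _ _ _ _ _ ih ih' => exact ih.trans ih'

/-- A point of degree two lies on a strand, and every strand contains an end of `∞` or a half of the
distinguished label. Such a port is never one of a label with a gadget. -/
theorem exists_port {j : Cls} {b : Bool} {c : C} {x : Lab n} (h : K.deg c x ≠ 0) :
    ∃ y, K.deg c y = 1 ∧ (y = x ∨ label y = none ∨ label y = K.lam) ∧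
      (K.conf j b c).Reachable x y := by
  by_cases h1 : K.deg c x = 1
  · exact ⟨x, h1, Or.inl rfl, .rfl⟩
  have hx : x ∈ K.G₁ c ++ K.G₂ c := by
    by_contra hx
    rw [List.mem_append, not_or] at hx
    have h3 : ¬ label x = none := fun h' => h1 (K.deg_of_none h')
    have h4 : ¬ (K.sp c ∧ label x = K.lam) := fun h' => h1 (K.deg_of_lam h'.1 h'.2)
    have h5 : ¬ K.isOwn c x := fun h' => h1 (K.deg_of_isOwn h')
    unfold deg at h
    rw [occ_eq_zero.2 hx.1, occ_eq_zero.2 hx.2, if_neg h3, if_neg h4, if_neg h5] at h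
    exact h rfl
  have hA : K.deg c (Sum.inl none) = 1 := K.deg_of_none rfl
  have hB : K.deg c (Sum.inr none) = 1 := K.deg_of_none rfl
  have hp := K.kind_eq_plain j c
  rw [List.mem_append] at hx
  cases hk : K.kind j c
  · exact ⟨_, hA, Or.inr (Or.inl rfl), K.reachable_of_mem (mem_paths_plain hk)
      (by rcases hx with hx | hx <;> simp [hx]) (by simp)⟩
  · exact ⟨_, hA, Or.inr (Or.inl rfl), K.reachable_of_mem (mem_paths_intact hk).1
      (by rcases hx with hx | hx <;> simp [hx]) (by simp)⟩
  · rcases hx with hx | hx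
    · exact ⟨_, hA, Or.inr (Or.inl rfl), K.reachable_of_mem (mem_paths_linked hk).1
        (by simp [hx]) (by simp)⟩
    · exact ⟨_, hB, Or.inr (Or.inl rfl), K.reachable_of_mem (mem_paths_linked hk).2
        (by simp [hx]) (by simp)⟩
  · rw [hk] at hp
    have hs : K.sp c := by simpa using hp
    exact ⟨_, K.deg_of_lam hs (K.label_bif₁ (!b ^^ K.σ c)), Or.inr (Or.inr (K.label_bif₁ _)),
      K.reachable_of_mem (mem_paths_closed (b := b) hk).2
        (by rcases hx with hx | hx <;> simp [hx])
        (List.mem_append_left _ (List.mem_reverse.2 (List.mem_append_right _ (by simp))))⟩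

end Core

end HamFrag

namespace HamFrag

namespace Core

variable {n : ℕ} {C : Type*} [DecidableEq C] (K : Core n C)

/-- The ports of the labels owned by `c` occur in pairs joined by rungs. Removing these pairs leaves
only the two ends of `∞` and the two halves of the distinguished label. -/
theorem even_special {c : C} (hc : K.sp c) {E : Lab n → Lab n → Prop} (hE : Equivalence E)
    (hev : ∀ x, Even {y | K.deg c y = 1 ∧ E x y}.ncard) (S : Set (Lab n))
    (hS : ∀ x y, E x y → x ∈ S → y ∈ S)
    (hS' : ∀ x y, label x = label y → K.isOwn c x → x ∈ S → y ∈ S) :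
    Even {y | (label y = none ∨ label y = K.lam) ∧ y ∈ S}.ncard := by
  have h1 := even_ncard_of_saturated hE _ hev S hS
  have hown : ∀ x y : Lab n, label x = label y → K.isOwn c x → K.isOwn c y := by
    intro x y h ho; unfold isOwn at *; rwa [← h]
  have h2 : Even {y | K.isOwn c y ∧ y ∈ S ∩ {y | K.isOwn c y}}.ncard := by
    refine even_ncard_of_saturated (E := fun x y => label x = label y)
      ⟨fun _ => rfl, fun h => h.symm, fun h h' => h.trans h'⟩ _ (fun x => ?_) _ ?_
    · by_cases hx : K.isOwn c x
      · have : {y | K.isOwn c y ∧ label x = label y}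
            = {Sum.inl (label x), Sum.inr (label x)} := by
          ext y
          simp only [Set.mem_ofPred_eq, Set.mem_insert_iff, Set.mem_singleton_iff]
          constructor
          · rintro ⟨-, h⟩
            rw [h]
            rcases y with k | k
            · exact Or.inl rfl
            · exact Or.inr rfl
          · rintro (rfl | rfl) <;> exact ⟨hown x _ rfl hx, rfl⟩
        rw [this, Set.ncard_pair (by simp)]
        exact even_two
      · have : {y | K.isOwn c y ∧ label x = label y} = ∅ :=
          Set.eq_empty_of_forall_notMem fun y h => hx (hown y x h.2.symm h.1)
        simp [this]
    · rintro x y h ⟨hx, hx'⟩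
      exact ⟨hS' x y h hx' hx, hown x y h hx'⟩
  have e : {y | K.deg c y = 1 ∧ y ∈ S} = {y | (label y = none ∨ label y = K.lam) ∧ y ∈ S} ∪
      {y | K.isOwn c y ∧ y ∈ S ∩ {y | K.isOwn c y}} := by
    ext y
    simp only [Set.mem_union, Set.mem_ofPred_eq, Set.mem_inter_iff]
    constructor
    · rintro ⟨h, hy⟩
      rcases K.deg_eq_one h with h | h | h
      · exact Or.inl ⟨Or.inl h, hy⟩
      · exact Or.inl ⟨Or.inr h.2, hy⟩
      · exact Or.inr ⟨h, hy, h⟩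
    · rintro (⟨h | h, hy⟩ | ⟨h, hy, -⟩)
      · exact ⟨K.deg_of_none h, hy⟩
      · exact ⟨K.deg_of_lam hc h, hy⟩
      · exact ⟨K.deg_of_isOwn h, hy⟩
  rw [e, Set.ncard_union_eq] at h1
  · exact (Nat.even_add.1 h1).2 h2
  · refine Set.disjoint_left.2 ?_
    rintro y ⟨h | h, -⟩ ⟨h', -⟩
    · exact h'.1 h
    · exact h'.2.1 h

/-- Outside connections and rungs join `A` to an odd number of the three remaining ports: to `B`, to
a half of the distinguished label, or to all. The strands join `A` to one half and `B` to the other;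
choosing for `A` a half to which it is not already the only link makes all four connected. -/
theorem exists_bit {c : C} (hc : K.sp c) {E : Lab n → Lab n → Prop} (hE : Equivalence E)
    (hev : ∀ x, Even {y | K.deg c y = 1 ∧ E x y}.ncard) :
    ∃ μ : Bool, ∀ R : Lab n → Lab n → Prop, Equivalence R → (∀ x y, E x y → R x y) →
      (∀ x y, label x = label y → K.isOwn c x → R x y) →
      R (Sum.inl none) (bif μ then Sum.inl K.lam else Sum.inr K.lam) →
      R (Sum.inr none) (bif μ then Sum.inr K.lam else Sum.inl K.lam) →
      R (Sum.inl none) (Sum.inr none) ∧ R (Sum.inl none) (Sum.inl K.lam) ∧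
        R (Sum.inl none) (Sum.inr K.lam) := by
  classical
  let r : Lab n → Lab n → Prop := fun x y => E x y ∨ (label x = label y ∧ K.isOwn c x)
  let S : Set (Lab n) := {x | Relation.EqvGen r (Sum.inl none) x}
  have hS : ∀ R : Lab n → Lab n → Prop, Equivalence R → (∀ x y, E x y → R x y) →
      (∀ x y, label x = label y → K.isOwn c x → R x y) → ∀ x ∈ S, R (Sum.inl none) x := by
    intro R hR h1 h2 x hx
    refine hR.eqvGen_iff.1 (Relation.EqvGen.mono (r := r) (fun a b h => ?_) _ _ hx)
    exact h.elim (h1 a b) fun h => h2 a b h.1 h.2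
  have hev' := K.even_special hc hE hev S
    (fun x y h hx => hx.trans _ _ _ (.rel _ _ (Or.inl h)))
    (fun x y h h' hx => hx.trans _ _ _ (.rel _ _ (Or.inr ⟨h, h'⟩)))
  have e : {y | (label y = none ∨ label y = K.lam) ∧ y ∈ S} =
      ↑(({Sum.inl none, Sum.inr none, Sum.inl K.lam, Sum.inr K.lam} : Finset (Lab n)).filter
        (· ∈ S)) := by
    ext y
    simp only [Set.mem_ofPred_eq, Finset.coe_filter, Finset.mem_insert, Finset.mem_singleton]
    refine and_congr_left fun _ => ?_
    rcases y with k | k <;> simp [label]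
  have hA : (Sum.inl none : Lab n) ∈ S := .refl _
  have hl := K.lam_ne
  rw [e, Set.ncard_coe_finset] at hev'
  by_cases hB : (Sum.inr none : Lab n) ∈ S
  · refine ⟨true, fun R hR h1 h2 h3 h4 => ?_⟩
    have hAB := hS R hR h1 h2 _ hB
    exact ⟨hAB, h3, hR.trans hAB h4⟩
  · by_cases hl1 : (Sum.inl K.lam : Lab n) ∈ S
    · refine ⟨false, fun R hR h1 h2 h3 h4 => ?_⟩
      have h5 := hS R hR h1 h2 _ hl1
      exact ⟨hR.trans h5 (hR.symm h4), h5, h3⟩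
    · by_cases hl2 : (Sum.inr K.lam : Lab n) ∈ S
      · refine ⟨true, fun R hR h1 h2 h3 h4 => ?_⟩
        have h5 := hS R hR h1 h2 _ hl2
        exact ⟨hR.trans h5 (hR.symm h4), h3, h5⟩
      · exfalso
        rw [Finset.filter_insert, if_pos hA, Finset.filter_insert, if_neg hB,
          Finset.filter_insert, if_neg hl1, Finset.filter_singleton, if_neg hl2] at hev'
        simp at hev'

theorem linked_unique {j : Cls} {c c' : C} (h : K.kind j c = .linked) (h' : K.kind j c' = .linked) :
    c = c' := by
  unfold kind at h h'
  cases j <;> split_ifs at h h' <;> simp_all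

variable [Fintype C]

/-- All pairs are covered, and the degree bounds sum to `2 n` in each of the `2 n - 1` colours,
which is the number of ordered pairs. Disjointness of the colours follows by counting. -/
theorem conf_partition (hn : 0 < n) (hC : Fintype.card C + 1 = 2 * n) (j : Cls) (b : Bool) :
    (∀ c x, ((K.conf j b c).neighborSet x).ncard = K.deg c x) ∧
      ∀ x y, x ≠ y → ∃! c, (K.conf j b c).Adj x y := by
  refine partition_of_cover _ _ (K.ncard_conf_le j b) (fun x y h => K.conf_cover j b h) ?_
  rw [Finset.sum_comm]
  have h1 : ∀ c, ∑ x, K.deg c x = 2 * n := by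
    intro c
    rw [Fintype.sum_sum_type, ← Finset.sum_add_distrib, Finset.sum_congr rfl
      fun k _ => K.deg_add c k]
    simp; omega
  have h2 : Fintype.card (Lab n) = 2 * n := by
    simp; omega
  rw [Finset.sum_congr rfl fun c _ => h1 c, h2]
  simp only [Finset.sum_const, Finset.card_univ, smul_eq_mul]
  rw [show Fintype.card C = 2 * n - 1 by omega, mul_comm]

/-- Plain, intact and closed colours connect their blocks without outside help. Only one colour is
linked at a given vertex, so a single bit, chosen by `exists_bit` for that colour, is enough. -/
theorem switchable (hn : 0 < n) (hC : Fintype.card C + 1 = 2 * n) (j : Cls) :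
    Copies.Switchable K.deg (Idx n) (fun c x => K.blkOf j c (label x)) {ℓ | ∃ b, ℓ = K.conf j b} where
  nonempty := ⟨_, true, rfl⟩
  degree := by
    rintro _ ⟨b, rfl⟩
    exact (K.conf_partition hn hC j b).1
  attach := by
    rintro _ ⟨b, rfl⟩ c x h
    obtain ⟨y, hy, -, hxy⟩ := K.exists_port h
    exact ⟨y, hy, hxy⟩
  block := by
    rintro _ ⟨b, rfl⟩ c x y hx hy h
    rw [← K.blkInv_port hx, ← K.blkInv_port hy]
    exact K.blkInv_reachable h
  choice := by
    intro E hE hev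
    obtain ⟨-, ⟨c0, hs0, hc0⟩, -⟩ := K.exists_kind j
    obtain ⟨μ, hμ⟩ := K.exists_bit hs0 (hE c0) (hev c0)
    have hbit : ∃ b, (b ^^ K.σ c0) = μ := ⟨μ ^^ K.σ c0, by cases μ <;> cases K.σ c0 <;> rfl⟩
    obtain ⟨b, rfl⟩ := hbit
    refine ⟨_, ⟨b, rfl⟩, fun c x y hx hy hblk => ?_⟩
    let R := Relation.EqvGen fun a b' => E c a b' ∨ (K.conf j b c).Adj a b'
    have hR : Equivalence R := Relation.EqvGen.is_equivalence _
    have hadj : ∀ a b', (K.conf j b c).Adj a b' → R a b' := fun a b' h => .rel _ _ (Or.inr h)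
    have hreach : ∀ a b', (K.conf j b c).Reachable a b' → R a b' := by
      rintro a b' ⟨p⟩
      induction p with
      | nil => exact .refl _
      | cons h _ ih => exact hR.trans (hadj _ _ h) ih
    have hmem : ∀ l ∈ K.paths j b c, ∀ x ∈ l, ∀ y ∈ l, R x y :=
      fun l hl x hx y hy => hreach _ _ (K.reachable_of_mem hl hx hy)
    have hrung : ∀ x y, label x = label y → K.isOwn c x → R x y := by
      intro x y h ho
      by_cases hxy : x = y
      · rw [hxy]; exact .refl _
      · exact hadj _ _ ⟨hxy, Or.inr ⟨h, ho⟩⟩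
    have key : R (Sum.inl none) (Sum.inr none) ∧
        (K.sp c → R (Sum.inl K.lam) (Sum.inr K.lam)) ∧
        (K.kind j c = .linked → R (Sum.inl none) (Sum.inl K.lam)) := by
      have hp := K.kind_eq_plain j c
      cases hk : K.kind j c
      · rw [hk] at hp
        refine ⟨hmem _ (mem_paths_plain hk) _ (by simp) _ (by simp), fun h => ?_, by simp⟩
        exact absurd h (hp.1 rfl)
      · exact ⟨hmem _ (mem_paths_intact hk).1 _ (by simp) _ (by simp),
          fun _ => hmem _ (mem_paths_intact hk).2 _ (by simp) _ (by simp), by simp⟩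
      · obtain rfl := K.linked_unique hk hc0
        obtain ⟨h1, h2, h3⟩ := hμ R hR (fun a b' h => .rel _ _ (Or.inl h)) hrung
          (hmem _ (mem_paths_linked hk).1 _ (by simp) _ (by simp))
          (hmem _ (mem_paths_linked hk).2 _ (by simp) _ (by simp))
        exact ⟨h1, fun _ => hR.trans (hR.symm h2) h3, fun _ => h2⟩
      · refine ⟨hmem _ (mem_paths_closed hk).1 _ (by simp) _ (by simp), fun _ => ?_, by simp⟩
        have h := hmem _ (mem_paths_closed (b := b) hk).2
          (bif !b ^^ K.σ c then Sum.inl K.lam else Sum.inr K.lam) (by simp)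
          (bif !b ^^ K.σ c then Sum.inr K.lam else Sum.inl K.lam) (by simp)
        cases hβ : (!b ^^ K.σ c) <;> rw [hβ] at h
        · exact hR.symm h
        · exact h
    have hall : ∀ x y, K.deg c x = 1 → label x = label y → R x y := by
      intro x y hx h
      have main : R (Sum.inl (label y)) (Sum.inr (label y)) := by
        rcases K.deg_eq_one hx with h1 | ⟨h1, h2⟩ | h1
        · rw [← h, h1]; exact key.1
        · rw [← h, h2]; exact key.2.1 h1
        · refine hrung _ _ rfl ?_
          unfold isOwn at h1 ⊢
          rw [h] at h1
          exact h1
      rcases label_cases x y h with h' | ⟨h1, h2⟩ | ⟨h1, h2⟩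
      · rw [h']; exact .refl _
      · rw [h1, h2]; exact main
      · rw [h1, h2]; exact hR.symm main
    have hA : ∀ x, K.deg c x = 1 → K.blkOf j c (label x) = none → R x (Sum.inl none) := by
      intro x hx h
      unfold blkOf at h
      split_ifs at h with h'
      · exact hR.trans (hall x (Sum.inl K.lam) hx h'.2) (hR.symm (key.2.2 h'.1))
      · exact hall x _ hx h
    by_cases h0 : K.blkOf j c (label x) = none
    · exact hR.trans (hA x hx h0) (hR.symm (hA y hy (hblk.symm.trans h0)))
    · refine hall x y hx ?_
      have h0' : ¬ K.blkOf j c (label y) = none := fun h => h0 (hblk.trans h)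
      unfold blkOf at h0 h0' hblk
      split_ifs at h0 h0' hblk with h1 h2
      all_goals first | exact hblk | exact absurd rfl h0 | exact absurd rfl h0'

/-- The scheme given by a core. -/
def scheme (hn : 0 < n) (hC : Fintype.card C + 1 = 2 * n) : Scheme n C where
  allowed := fun _ => True
  D := fun k c => K.deg c (Sum.inr k)
  X := fun k c => K.deg c (Sum.inr k)
  D_le := fun k c => K.deg_le c _
  X_le := fun k c => K.deg_le c _
  euler := fun _ _ => Iff.rfl
  blk := fun κ c k => K.blkOf (κ K.lam) c k
  Λ := fun κ => {ℓ | ∃ b, ℓ = K.conf (κ K.lam) b}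
  switch := by
    intro κ _
    have e : degOf (fun k c => K.deg c (Sum.inr k)) (fun k c => K.deg c (Sum.inr k)) κ = K.deg := by
      funext c x
      rcases x with k | k
      · have := K.deg_add c k
        simp only [degOf, ite_self]
        omega
      · simp [degOf]
    rw [e]
    exact K.switchable hn hC _
  partition := by
    rintro κ _ _ ⟨b, rfl⟩
    exact (K.conf_partition hn hC _ b).2
  gam := fun k => k ≠ none ∧ k ≠ K.lam
  z := K.own
  p := K.p
  i := K.i
  gam_top := fun h => h.1 rfl
  z_ne_p := fun k hk => K.own_ne_p k hk.1 hk.2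
  z_ne_i := fun k hk => K.own_ne_i k hk.1 hk.2
  p_ne_i := fun k hk => K.p_ne_i k hk.1 hk.2
  rank := fun k => if k = none then 0 else 1
  link := by
    intro c k h1 h2 h3
    have hk : K.sp c ∧ k = K.lam := by
      rcases K.deg_eq_one h1 with h | h | h
      · exact absurd h h3
      · exact h
      · exact absurd ⟨⟨h.1, h.2.1⟩, h.2.2⟩ h2
    obtain ⟨hs, rfl⟩ := hk
    have hj : ∃ j, K.kind j c = .linked := by
      rcases hs with rfl | rfl | rfl
      · exact ⟨.first, by rw [kind_z]; rfl⟩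
      · exact ⟨.second, by rw [kind_q]; rfl⟩
      · exact ⟨.other, by rw [kind_r]⟩
    obtain ⟨j, hj⟩ := hj
    refine ⟨j, fun κ _ hκ => ⟨none, K.deg_of_none rfl, fun h => h.1.1 rfl, ?_, ?_⟩⟩
    · simp [h3]
    · rw [hκ, blkOf, blkOf, if_pos ⟨hj, rfl⟩]; simp
  attach := by
    rintro κ _ _ ⟨b, rfl⟩ c x h0 hown
    have e : degOf (fun k c => K.deg c (Sum.inr k)) (fun k c => K.deg c (Sum.inr k)) κ = K.deg := by
      funext c x
      rcases x with k | k
      · have := K.deg_add c k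
        simp only [degOf, ite_self]
        omega
      · simp [degOf]
    rw [e] at h0 ⊢
    obtain ⟨y, hy, hyx, h⟩ := K.exists_port h0
    refine ⟨y, hy, ?_, h⟩
    rcases hyx with rfl | hyx | hyx
    · exact hown
    · exact fun h => h.1.1 hyx
    · exact fun h => h.1.2 hyx
  gadget := by
    rintro κ _ _ ⟨b, rfl⟩
    refine ⟨K.s, K.t, ?_, fun k k' hk hk' => K.quads k k' hk.1 hk.2 hk'.1 hk'.2⟩
    rintro k ⟨hk, hk'⟩
    obtain ⟨h1, h2, h3, h4, h5⟩ := K.gadget k hk hk'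
    have hm : (K.s k ∈ K.G₁ (K.own k) ++ K.G₂ (K.own k)) ∧ K.t k ∈ K.G₁ (K.own k) ++ K.G₂ (K.own k) := by
      rw [List.mem_append, List.mem_append]
      exact ⟨h1.imp (fun h => h.mem.1) fun h => h.mem.1, h1.imp (fun h => h.mem.2) fun h => h.mem.2⟩
    have hs : label (K.s k) ≠ k := fun h => (K.mem_G hm.1).2.1 (by rw [h])
    have ht : label (K.t k) ≠ k := fun h => (K.mem_G hm.2).2.1 (by rw [h])
    have hs' : ∀ x : Lab n, label x = k → K.s k ≠ x := by rintro x hx rfl; exact hs hx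
    have ht' : ∀ x : Lab n, label x = k → x ≠ K.t k := by rintro x hx rfl; exact ht hx
    refine ⟨hs, ht, fun h => (K.mem_G hm.1).2.1 h.2, K.conf_rung hk hk' rfl,
      K.conf_adj_of_nb (K.s_ne_t k hk hk') h1, K.conf_adj_of_nb (hs' _ rfl) h2,
      K.conf_adj_of_nb (ht' _ rfl) h3, K.conf_adj_of_nb (hs' _ rfl) h4,
      K.conf_adj_of_nb (ht' _ rfl) h5⟩

end Core

end HamFrag

/-! ### Decompositions into transversal paths, and the local colourings they give -/

namespace HamFrag

/-- A decomposition of the complete graph on the `2 N` halves of `N` labels, together with two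
further vertices, into transversal paths, joined to the two further vertices, single edges joining
the halves of a label, and a closed transversal. The path that starts at `a` is `P a`. -/
structure EPlus (N : ℕ) (V : Type) [Fintype V] [DecidableEq V] where
  par : V → V
  P : V → List V
  fin : V → V
  zc : V → V
  mid : List V
  X : V
  X2 : V
  Y2 : V
  Y : V
  lam : V
  s : V → V
  t : V → V
  col : V → Option V
  par_par : ∀ x, par (par x) = x
  par_ne : ∀ x, par x ≠ x
  card : Fintype.card V = 2 * N
  head : ∀ a, (P a).head? = some a
  last : ∀ a, (P a).getLast? = some (fin a)
  fin_surj : ∀ x, ∃ a, fin a = x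
  zc_par : ∀ x, zc (par x) = zc x
  len : ∀ a, 2 * (P a).length + (Finset.univ.filter fun x => zc x = a).card = 2 * N
  mem : ∀ a x, zc x ≠ a → x ∈ P a ∨ par x ∈ P a
  o_len : (X :: X2 :: (mid ++ [Y2, Y])).length = N
  o_mem : ∀ x, x ∈ X :: X2 :: (mid ++ [Y2, Y]) ∨ par x ∈ X :: X2 :: (mid ++ [Y2, Y])
  -- The path from `X` and the closed transversal have the same ends, which supplies the two colours
  -- `q`, `r` with common heads `X`, `Y`.
  fin_X : fin X = Y
  cover : ∀ x y, x ≠ y → y = par x ∨ (∃ a, Nb (P a) x y) ∨ Nb (X :: X2 :: (mid ++ [Y2, Y])) x y ∨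
    (x = X ∧ y = Y) ∨ (x = Y ∧ y = X)
  s_par : ∀ x, s (par x) = s x
  t_par : ∀ x, t (par x) = t x
  -- The chord lies in the colour of the rung of `x`, and `s x`, `t x` surround either half of the
  -- label in two further lines: these are the three colours of the gadget.
  chord : ∀ x, Nb (P (zc x)) (s x) (t x)
  tri : ∀ x, Tr ((col x).elim (X :: X2 :: (mid ++ [Y2, Y])) P) (s x) x (t x)
  quad_inter : ∀ x y, y ≠ x → y ≠ par x → ∀ a ∈ [s x, t x, x, par x], ∀ b ∈ [s x, t x, x, par x],
    a ∈ [s y, t y, y, par y] → b ∈ [s y, t y, y, par y] → a = b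
  -- Composition takes the edges `X X2` and `Y Y2` out of the closed transversals, so gadgets must
  -- not need them. The pair `X Y` is included because it becomes such an edge in the composed
  -- decomposition.
  free : ∀ x, ∀ ab ∈ [(X, Y), (X, X2), (Y, Y2)],
    ¬ (ab.1 ∈ [s x, t x, x, par x] ∧ ab.2 ∈ [s x, t x, x, par x])
  col_lam : col lam = none
  col_par_lam : col (par lam) = some X

section Lists

variable {α : Type*}

theorem nb_append {l₁ l₂ : List α} {x y : α} (h : Nb (l₁ ++ l₂) x y) : Nb l₁ x y ∨ Nb l₂ x y ∨
    (l₁.getLast? = some x ∧ l₂.head? = some y) ∨ (l₁.getLast? = some y ∧ l₂.head? = some x) := by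
  induction l₁ with
  | nil => exact Or.inr (Or.inl h)
  | cons a l ih =>
    rcases l with _ | ⟨b, l⟩
    · rcases l₂ with _ | ⟨b, l₂⟩
      · exact absurd h not_nb_singleton
      · rcases nb_cons_iff.1 h with ⟨rfl, rfl⟩ | ⟨rfl, rfl⟩ | h
        · simp
        · simp
        · exact Or.inr (Or.inl h)
    · rcases nb_cons_iff.1 h with ⟨rfl, rfl⟩ | ⟨rfl, rfl⟩ | h
      · exact Or.inl (nb_cons_iff.2 (Or.inl ⟨rfl, rfl⟩))
      · exact Or.inl (nb_cons_iff.2 (Or.inr (Or.inl ⟨rfl, rfl⟩)))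
      · rw [List.getLast?_cons_cons]
        exact (ih h).imp_left fun h => nb_cons_iff.2 (Or.inr (Or.inr h))

theorem Nb.ne {l : List α} (hl : l.Nodup) {x y : α} (h : Nb l x y) : x ≠ y := by
  rcases h with h | h
  · have := hl.sublist h.sublist
    simpa using this
  · have := hl.sublist h.sublist
    simpa [eq_comm] using this

theorem Tr.nb₁ {l : List α} {x y z : α} (h : Tr l x y z) : Nb l x y := by
  rcases h with h | h
  · exact Or.inl (List.IsInfix.trans ⟨[], [z], rfl⟩ h)
  · exact Or.inr (List.IsInfix.trans ⟨[z], [], rfl⟩ h)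

theorem Tr.symm {l : List α} {x y z : α} (h : Tr l x y z) : Tr l z y x := Or.symm h

theorem Tr.nb₂ {l : List α} {x y z : α} (h : Tr l x y z) : Nb l y z := h.symm.nb₁.symm

theorem Tr.mem {l : List α} {x y z : α} (h : Tr l x y z) : y ∈ l := h.nb₁.mem.2

theorem occ_map {β : Type*} [DecidableEq α] [DecidableEq β] {f : α → β} (hf : Function.Injective f)
    (l : List α) (x : α) : occ (f x) (l.map f) = occ x l :=
  List.count_map_of_injective l f hf x

/-- A list that meets all labels in question, and whose length is their number, is transversal. -/
theorem occ_add_occ [Fintype α] [DecidableEq α] {par : α → α} (hpar : ∀ x, par (par x) = x)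
    (S : α → Prop) [DecidablePred S] (l : List α) {M : ℕ} (hM : Fintype.card α = M)
    (hl : 2 * l.length + (Finset.univ.filter S).card = M)
    (hmem : ∀ x, ¬ S x → x ∈ l ∨ par x ∈ l) (x : α) :
    occ x l + occ (par x) l = if S x then 0 else 1 := by
  have h1 : ∑ x, (occ x l + occ (par x) l) = 2 * l.length := by
    have e : ∑ x, occ x l = l.length := by
      have := List.sum_toFinset_count_eq_length l
      rw [← this]
      refine (Finset.sum_subset (Finset.subset_univ _) fun x _ hx => ?_).symm
      exact occ_eq_zero.2 (by simpa using hx)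
    have e' : ∑ x, occ (par x) l = ∑ x, occ x l :=
      Equiv.sum_comp (⟨par, par, hpar, hpar⟩ : α ≃ α) (fun x => occ x l)
    rw [Finset.sum_add_distrib, e', e]; ring
  have h2 : ∑ x, (if S x then 0 else 1) = 2 * l.length := by
    have := Finset.card_filter_add_card_filter_not (s := (Finset.univ : Finset α)) S
    rw [Finset.card_univ, hM] at this
    rw [Finset.sum_ite, Finset.sum_const_zero, zero_add, Finset.sum_const, smul_eq_mul, mul_one]
    omega
  have h3 : ∀ x ∈ (Finset.univ : Finset α), (if S x then 0 else 1) ≤ occ x l + occ (par x) l := by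
    intro x _
    split_ifs with h
    · exact Nat.zero_le _
    · rcases hmem x h with h | h
      · have := occ_pos.2 h; omega
      · have := occ_pos.2 h; omega
  exact ((Finset.sum_eq_sum_iff_of_le h3).1 (h2.trans h1.symm) x (Finset.mem_univ _)).symm

end Lists

namespace EPlus

variable {N : ℕ} {V : Type} [Fintype V] [DecidableEq V] (E : EPlus N V)

/-- The closed transversal. -/
def o : List V := E.X :: E.X2 :: (E.mid ++ [E.Y2, E.Y])

/-- The list that belongs to a colour. -/
def line (c : Option V) : List V := c.elim E.o E.P

/-- The vertices of the gadget of a half. -/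
def tetra (x : V) : List V := [E.s x, E.t x, x, E.par x]

theorem occ_line (c : Option V) (x : V) :
    occ x (E.line c) + occ (E.par x) (E.line c) = if some (E.zc x) = c then 0 else 1 := by
  rcases c with _ | a
  · have := occ_add_occ E.par_par (fun _ => False) E.o E.card
      (by have := E.o_len; unfold o; simp at this ⊢; omega) (fun x _ => E.o_mem x) x
    simpa [line] using this
  · have := occ_add_occ E.par_par (fun x => E.zc x = a) (E.P a) E.card (E.len a)
      (fun x h => E.mem a x h) x
    simpa [line] using this

theorem nodup_line (c : Option V) : (E.line c).Nodup := by
  refine List.nodup_iff_count_le_one.2 fun x => ?_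
  have := E.occ_line c x
  unfold occ at this
  split_ifs at this <;> omega

theorem tri' (x : V) : Tr (E.line (E.col x)) (E.s x) x (E.t x) := E.tri x

theorem chord' (x : V) : Nb (E.line (some (E.zc x))) (E.s x) (E.t x) := E.chord x

theorem head_line (c : Option V) : (E.line c).head? = some (c.getD E.X) := by
  cases c
  · rfl
  · exact E.head _

theorem last_line (c : Option V) : (E.line c).getLast? = some (E.fin (c.getD E.X)) := by
  cases c
  · simp [line, o, E.fin_X, List.getLast?_cons, List.getLast?_append]
  · exact E.last _

theorem not_mem_zc (x : V) : x ∉ E.line (some (E.zc x)) := by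
  have := E.occ_line (some (E.zc x)) x
  rw [if_pos rfl] at this
  exact occ_eq_zero.1 (by omega)

theorem not_mem_both {c : Option V} {x : V} (h : x ∈ E.line c) (h' : E.par x ∈ E.line c) : False := by
  have := E.occ_line c x
  have h1 := occ_pos.2 h
  have h2 := occ_pos.2 h'
  split_ifs at this <;> omega

theorem zc_lam_ne : E.zc E.lam ≠ E.X := by
  intro h
  have h1 := (E.tri' (E.par E.lam)).mem
  rw [E.col_par_lam, ← h, ← E.zc_par] at h1
  exact E.not_mem_zc _ h1

/-- What is removed from a line next to the distinguished label. -/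
def mark (c : Option V) : List V :=
  if c = none then [E.lam] else if c = some E.X then [E.par E.lam] else []

/-- The colours that pass through the distinguished label. -/
def Sp (c : Option V) : Prop := c = some (E.zc E.lam) ∨ c = none ∨ c = some E.X

/-- The three special lines contain `s` and `t` of the distinguished label either adjacent or
separated by one of its halves. Cutting there, and dropping that half, gives two strands; all other
lines remain whole. -/
theorem exists_split (c : Option V) : ∃ g₁ g₂ : List V, ∃ σ : Bool,
    E.line c = g₁ ++ (E.mark c ++ g₂.reverse) ∧ (¬ E.Sp c → g₂ = []) ∧
    (E.Sp c → g₁.getLast? = some (bif σ then E.s E.lam else E.t E.lam) ∧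
      g₂.getLast? = some (bif σ then E.t E.lam else E.s E.lam)) := by
  have key : ∀ a b : V, ∀ m, [a] ++ m ++ [b] <:+: E.line c → ∃ g₁ g₂ : List V,
      E.line c = g₁ ++ (m ++ g₂.reverse) ∧ g₁.getLast? = some a ∧ g₂.getLast? = some b := by
    rintro a b m ⟨l₁, l₂, h⟩
    exact ⟨l₁ ++ [a], (b :: l₂).reverse, by rw [← h]; simp, by simp, by simp⟩
  have main : E.Sp c → ([E.s E.lam] ++ E.mark c ++ [E.t E.lam] <:+: E.line c ∨
      [E.t E.lam] ++ E.mark c ++ [E.s E.lam] <:+: E.line c) := by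
    rintro (rfl | rfl | rfl)
    · have e : E.mark (some (E.zc E.lam)) = [] := by simp [mark, E.zc_lam_ne]
      rw [e]
      exact E.chord' E.lam
    · have := E.tri' E.lam
      rw [E.col_lam] at this
      exact this
    · have := E.tri' (E.par E.lam)
      rw [E.col_par_lam, E.s_par, E.t_par] at this
      have e : E.mark (some E.X) = [E.par E.lam] := by simp [mark]
      rw [e]
      exact this
  by_cases hs : E.Sp c
  · rcases main hs with h | h
    · obtain ⟨g₁, g₂, h1, h2, h3⟩ := key _ _ _ h
      exact ⟨g₁, g₂, true, h1, fun h => absurd hs h, fun _ => ⟨h2, h3⟩⟩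
    · obtain ⟨g₁, g₂, h1, h2, h3⟩ := key _ _ _ h
      exact ⟨g₁, g₂, false, h1, fun h => absurd hs h, fun _ => ⟨h2, h3⟩⟩
  · refine ⟨E.line c, [], true, ?_, fun _ => rfl, fun h => absurd h hs⟩
    have : E.mark c = [] := by
      unfold mark
      rw [if_neg fun h => hs (Or.inr (Or.inl h)), if_neg fun h => hs (Or.inr (Or.inr h))]
    simp [this]

end EPlus

end HamFrag

namespace HamFrag

/-- In coordinates modulo `2 N` the indices below `N` become elements of `A` and their partners
elements of `B`. -/
theorem EPlus.exists_coding {N : ℕ} {V : Type} [Fintype V] [DecidableEq V] (E : EPlus N V) :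
    ∃ φ : V → Lab (N + 1), Function.Injective φ ∧ (∀ x, label (φ x) ≠ none) ∧
      (∀ x, label (φ (E.par x)) = label (φ x)) ∧
      (∀ x y, label (φ x) = label (φ y) → y = x ∨ y = E.par x) ∧
      ∀ y, label y ≠ none → ∃ x, φ x = y := by
  have hN : 0 < N := by
    have := E.o_len
    simp at this; omega
  obtain ⟨c, -⟩ := exists_coord N hN E.par E.par_par E.par_ne E.card (fun _ => none)
    (by simp)
  let φ : V → Lab (N + 1) := fun x => if h : c.idx x < N then
    Sum.inl (some ⟨(c.idx x).toNat, by have := c.idx_nonneg x; simp; omega⟩)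
    else Sum.inr (some ⟨(c.idx x - N).toNat, by have := c.idx_lt x; simp; omega⟩)
  have h1 : ∀ x (i : ℤ) (hi : i < N), 0 ≤ i → x = c.u i →
      φ x = Sum.inl (some ⟨i.toNat, by simp; omega⟩) := by
    rintro x i hi h0 rfl
    have := c.idx_u h0 (by omega)
    simp only [φ, this, dif_pos hi]
  have h2 : ∀ x (i : ℤ) (hi : i < N), 0 ≤ i → x = c.u (i + N) →
      φ x = Sum.inr (some ⟨i.toNat, by simp; omega⟩) := by
    rintro x i hi h0 rfl
    have := c.idx_u (i := i + N) (by omega) (by omega)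
    simp only [φ, this, dif_neg (show ¬ i + (N : ℤ) < N by omega)]
    congr 3; omega
  have h3 : ∀ x, ∃ i : ℤ, 0 ≤ i ∧ i < N ∧ (x = c.u i ∨ x = c.u (i + N)) := by
    intro x
    have h1 := c.idx_nonneg x
    have h2 := c.idx_lt x
    by_cases h : c.idx x < N
    · exact ⟨c.idx x, h1, h, Or.inl (c.u_idx x).symm⟩
    · exact ⟨c.idx x - N, by omega, by omega, Or.inr (by rw [sub_add_cancel, c.u_idx])⟩
  have h4 : ∀ x (i : ℤ) (hi : i < N), 0 ≤ i → (x = c.u i ∨ x = c.u (i + N)) →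
      label (φ x) = some ⟨i.toNat, by simp; omega⟩ := by
    rintro x i hi h0 (h | h)
    · rw [h1 x i hi h0 h]; rfl
    · rw [h2 x i hi h0 h]; rfl
  have h5 : ∀ i, c.u (i + N) = E.par (c.u i) := c.u_add
  have h6 : ∀ x y, label (φ x) = label (φ y) → y = x ∨ y = E.par x := by
    intro x y h
    obtain ⟨i, hi0, hi, hx⟩ := h3 x
    obtain ⟨j, hj0, hj, hy⟩ := h3 y
    rw [h4 x i hi hi0 hx, h4 y j hj hj0 hy] at h
    simp only [Option.some.injEq, Fin.mk.injEq] at h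
    obtain rfl : i = j := by omega
    rw [h5] at hx hy
    rcases hx with rfl | rfl <;> rcases hy with rfl | rfl <;> simp [E.par_par]
  have h7 : ∀ x, label (φ (E.par x)) = label (φ x) := by
    intro x
    obtain ⟨i, hi0, hi, hx⟩ := h3 x
    rw [h4 x i hi hi0 hx, h4 (E.par x) i hi hi0]
    rw [h5] at hx ⊢
    rcases hx with rfl | rfl <;> simp [E.par_par]
  refine ⟨φ, ?_, ?_, h7, h6, ?_⟩
  · intro x y h
    rcases h6 x y (by rw [h]) with rfl | rfl
    · rfl
    · obtain ⟨i, hi0, hi, hx | hx⟩ := h3 x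
      · rw [h1 x i hi hi0 hx, h2 (E.par x) i hi hi0 (by rw [h5, hx])] at h
        exact absurd h (by simp)
      · rw [h2 x i hi hi0 hx, h1 (E.par x) i hi hi0 (by rw [hx, h5, E.par_par])] at h
        exact absurd h (by simp)
  · intro x
    obtain ⟨i, hi0, hi, hx⟩ := h3 x
    rw [h4 x i hi hi0 hx]; simp
  · intro y hy
    rcases y with k | k <;> obtain ⟨k, rfl⟩ := Option.ne_none_iff_exists'.1 hy
    · have hk := k.2
      simp only [Nat.add_sub_cancel] at hk
      exact ⟨c.u (k : ℕ), by rw [h1 _ (k : ℕ) (by omega) (by omega) rfl]; simp⟩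
    · have hk := k.2
      simp only [Nat.add_sub_cancel] at hk
      exact ⟨c.u ((k : ℕ) + N), by rw [h2 _ (k : ℕ) (by omega) (by omega) rfl]; simp⟩

/-- The colours are the starting points of the paths, and `none` for the closed transversal. The
ends of `∞` are joined to the first and the last point of each path; both run over all points, so
all pairs with `∞` are covered. -/
theorem EPlus.nonempty_core {N : ℕ} {V : Type} [Fintype V] [DecidableEq V] (E : EPlus N V) :
    Nonempty (Core (N + 1) (Option V)) := by
  classical
  obtain ⟨φ, hφ, hφ0, hφp, hφl, hφs⟩ := E.exists_coding
  choose g₁ g₂ σ hsplit hg2 hlast using E.exists_split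
  have hback : ∀ k : Idx (N + 1), ∃ x : V, k ≠ none → φ x = Sum.inl k := by
    intro k
    by_cases hk : k = none
    · exact ⟨E.lam, fun h => absurd hk h⟩
    · obtain ⟨x, hx⟩ := hφs (Sum.inl k) hk
      exact ⟨x, fun _ => hx⟩
  choose back hback using hback
  have hlb : ∀ k, k ≠ none → label (φ (back k)) = k := fun k hk => by rw [hback k hk]; rfl
  have hbackr : ∀ k, k ≠ none → φ (E.par (back k)) = Sum.inr k := by
    intro k hk
    have h1 : label (φ (E.par (back k))) = k := by rw [hφp, hlb k hk]
    rcases h : φ (E.par (back k)) with j | j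
    · rw [h] at h1
      obtain rfl : j = k := h1
      exact absurd (hφ (h.trans (hback j hk).symm)) (E.par_ne _)
    · rw [h] at h1
      obtain rfl : j = k := h1
      rfl
  have hlamx : ∀ x, label (φ x) = label (φ E.lam) ↔ (x = E.lam ∨ x = E.par E.lam) := by
    intro x
    refine ⟨fun h => hφl _ _ h.symm, ?_⟩
    rintro (rfl | rfl)
    · rfl
    · exact hφp _
  have hmem : ∀ c, ∀ x ∈ (g₁ c).map φ ++ (g₂ c).map φ, label x ≠ none := by
    intro c x hx
    rw [← List.map_append, List.mem_map] at hx
    obtain ⟨v, -, rfl⟩ := hx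
    exact hφ0 v
  have hocc : ∀ c x, occ x (E.line c) = occ (φ x) ((g₁ c).map φ ++ (g₂ c).map φ) + occ x (E.mark c) := by
    intro c x
    rw [← List.map_append, occ_map hφ, hsplit c, occ_append, occ_append, occ_append]
    have : occ x (g₂ c).reverse = occ x (g₂ c) := List.count_reverse
    omega
  have hown : ∀ k, k ≠ none → k ≠ label (φ E.lam) → E.par (back k) ≠ E.lam ∧ back k ≠ E.lam ∧
      back k ≠ E.par E.lam := by
    intro k hk hk'
    refine ⟨fun h => hk' ?_, fun h => hk' ?_, fun h => hk' ?_⟩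
    · rw [← hlb k hk, ← hφp, h]
    · rw [← hlb k hk, h]
    · rw [← hlb k hk, h, hφp]
  -- Cutting a special line loses only pairs inside the quadruple of the distinguished label, which
  -- the shapes put back.
  have hnbline : ∀ c x y, Nb (E.line c) x y → Nb (g₁ c) x y ∨ Nb (g₂ c) x y ∨
      (E.Sp c ∧ x ∈ E.tetra E.lam ∧ y ∈ E.tetra E.lam) := by
    intro c x y h
    by_cases hs : E.Sp c
    · obtain ⟨l1, l2⟩ := hlast c hs
      have q1 : (bif σ c then E.s E.lam else E.t E.lam) ∈ E.tetra E.lam := by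
        cases σ c <;> simp [EPlus.tetra]
      have q2 : (bif σ c then E.t E.lam else E.s E.lam) ∈ E.tetra E.lam := by
        cases σ c <;> simp [EPlus.tetra]
      have l3 : (g₂ c).reverse.head? = some (bif σ c then E.t E.lam else E.s E.lam) := by
        rw [List.head?_reverse, l2]
      have hm : E.mark c = [] ∨ ∃ m, E.mark c = [m] ∧ m ∈ E.tetra E.lam := by
        unfold EPlus.mark
        split_ifs
        · exact Or.inr ⟨_, rfl, by simp [EPlus.tetra]⟩
        · exact Or.inr ⟨_, rfl, by simp [EPlus.tetra]⟩
        · exact Or.inl rfl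
      rw [hsplit c] at h
      have hend : ∀ u w : V, some u = some w → w ∈ E.tetra E.lam → u ∈ E.tetra E.lam := by
        intro u w h hw; cases h; exact hw
      rcases nb_append h with h | h | ⟨h1, h2⟩ | ⟨h1, h2⟩
      · exact Or.inl h
      · rcases hm with hm | ⟨m, hm, hmq⟩ <;> rw [hm] at h
        · exact Or.inr (Or.inl (by simpa using Nb.reverse h))
        · rcases nb_append h with h | h | ⟨h1, h2⟩ | ⟨h1, h2⟩
          · exact absurd h not_nb_singleton
          · exact Or.inr (Or.inl (by simpa using Nb.reverse h))
          · exact Or.inr (Or.inr ⟨hs, hend _ _ h1.symm hmq, hend _ _ (h2.symm.trans l3) q2⟩)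
          · exact Or.inr (Or.inr ⟨hs, hend _ _ (h2.symm.trans l3) q2, hend _ _ h1.symm hmq⟩)
      · refine Or.inr (Or.inr ⟨hs, hend _ _ (h1.symm.trans l1) q1, ?_⟩)
        rcases hm with hm | ⟨m, hm, hmq⟩ <;> rw [hm] at h2
        · exact hend _ _ (h2.symm.trans l3) q2
        · exact hend _ _ h2.symm hmq
      · refine Or.inr (Or.inr ⟨hs, ?_, hend _ _ (h1.symm.trans l1) q1⟩)
        rcases hm with hm | ⟨m, hm, hmq⟩ <;> rw [hm] at h2
        · exact hend _ _ (h2.symm.trans l3) q2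
        · exact hend _ _ h2.symm hmq
    · have hm : E.mark c = [] := by
        unfold EPlus.mark
        rw [if_neg fun h => hs (Or.inr (Or.inl h)), if_neg fun h => hs (Or.inr (Or.inr h))]
      rw [hsplit c, hm, hg2 c hs] at h
      exact Or.inl (by simpa using h)
  have hquad : ∀ v, v ∈ E.tetra E.lam → φ v ∈ quad (φ (E.s E.lam)) (φ (E.t E.lam)) (label (φ E.lam)) := by
    intro v hv
    have hl : ∀ x, label (φ x) = label (φ E.lam) → φ x ∈ quad (φ (E.s E.lam)) (φ (E.t E.lam))
        (label (φ E.lam)) := by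
      intro x hx
      rcases h : φ x with k | k <;> rw [h] at hx
      · obtain rfl : k = _ := hx
        simp [quad]
      · obtain rfl : k = _ := hx
        simp [quad]
    simp only [EPlus.tetra, List.mem_cons, List.not_mem_nil, or_false] at hv
    rcases hv with rfl | rfl | rfl | rfl
    · simp [quad]
    · simp [quad]
    · exact hl _ rfl
    · exact hl _ (hφp _)
  have hhead : ∀ c, E.Sp c → (g₁ c).head? = some (c.getD E.X) ∧ (g₂ c).head? = some (E.fin (c.getD E.X)) := by
    intro c hs
    obtain ⟨l1, l2⟩ := hlast c hs
    have h1 := E.head_line c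
    have h2 := E.last_line c
    rw [hsplit c] at h1 h2
    obtain ⟨l, hl⟩ := List.getLast?_eq_some_iff.1 l1
    obtain ⟨l', hl'⟩ := List.getLast?_eq_some_iff.1 l2
    constructor
    · rw [List.head?_append] at h1
      rw [hl] at h1 ⊢
      cases l <;> simpa using h1
    · rw [List.getLast?_append, List.getLast?_append, List.getLast?_reverse] at h2
      rw [hl'] at h2 ⊢
      cases l' <;> simpa using h2
  -- The quadruple of another label shares at most one point with that of the distinguished label,
  -- so its gadget loses no edge.
  have hg : ∀ k, k ≠ none → k ≠ label (φ E.lam) → ∀ c x y, x ∈ E.tetra (back k) →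
      y ∈ E.tetra (back k) → Nb (E.line c) x y →
      Nb ((g₁ c).map φ) (φ x) (φ y) ∨ Nb ((g₂ c).map φ) (φ x) (φ y) := by
    intro k hk hk' c x y hx hy h
    rcases hnbline c x y h with h1 | h1 | ⟨-, h1, h2⟩
    · exact Or.inl (h1.map φ)
    · exact Or.inr (h1.map φ)
    · obtain ⟨-, n1, n2⟩ := hown k hk hk'
      exact absurd (E.quad_inter E.lam (back k) n1 n2 x h1 y h2 hx hy) (h.ne (E.nodup_line c))
  have htet : ∀ x, E.s x ∈ E.tetra x ∧ E.t x ∈ E.tetra x ∧ x ∈ E.tetra x ∧ E.par x ∈ E.tetra x := by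
    intro x; simp [EPlus.tetra]
  refine ⟨{
    lam := label (φ E.lam), S := φ (E.s E.lam), T := φ (E.t E.lam), X := φ E.X, Y := φ E.Y
    z := some (E.zc E.lam), q := none, r := some E.X
    G₁ := fun c => (g₁ c).map φ, G₂ := fun c => (g₂ c).map φ, σ := σ
    own := fun k => if k = label (φ E.lam) then some (E.zc E.lam) else some (E.zc (back k))
    p := fun k => E.col (E.par (back k)), i := fun k => E.col (back k)
    s := fun k => φ (E.s (back k)), t := fun k => φ (E.t (back k))
    lam_ne := hφ0 _
    z_ne_q := by simp
    z_ne_r := by simp [E.zc_lam_ne]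
    q_ne_r := by simp
    own_lam := if_pos rfl
    mem_ne_none := hmem
    count := ?_
    last₁ := ?_
    last₂ := ?_
    head₁ := ?_
    head₂ := ?_
    cover := ?_
    own_ne_p := ?_
    own_ne_i := ?_
    p_ne_i := ?_
    s_ne_t := ?_
    gadget := ?_
    quads := ?_ }⟩
  · intro c k hk
    have h := E.occ_line c (back k)
    rw [hocc, hocc, hback k hk, hbackr k hk] at h
    have hzk : (if k = label (φ E.lam) then some (E.zc E.lam) else some (E.zc (back k)))
        = some (E.zc (back k)) := by
      split_ifs with h1
      · rcases (hlamx (back k)).1 (by rw [hlb k hk, h1]) with h2 | h2 <;> rw [h2]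
        rw [E.zc_par]
      · rfl
    rw [hzk]
    have hm : occ (back k) (E.mark c) + occ (E.par (back k)) (E.mark c)
        = if k = label (φ E.lam) ∧ (c = none ∨ c = some E.X) then 1 else 0 := by
      have hb := hlamx (back k)
      rw [hlb k hk] at hb
      have e : ∀ v, (v = E.lam ∨ v = E.par E.lam) → occ (back k) [v] + occ (E.par (back k)) [v]
          = if k = label (φ E.lam) then 1 else 0 := by
        intro v hv
        simp only [hb, occ, List.count_singleton, beq_iff_eq]
        have n1 := E.par_ne E.lam
        rcases hv with rfl | rfl <;> by_cases h1 : back k = E.lam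
        · simp [h1, n1.symm]
        · by_cases h2 : back k = E.par E.lam
          · simp [h2, E.par_par, n1.symm]
          · have h3 : E.lam ≠ E.par (back k) := fun h => h2 (by rw [h, E.par_par])
            simp [h1, h2, Ne.symm h1, h3]
        · simp [h1, n1]
        · by_cases h2 : back k = E.par E.lam
          · simp [h2, E.par_par, n1]
          · have h3 : E.par E.lam ≠ E.par (back k) :=
              fun h => h1 (by rw [← E.par_par (back k), ← h, E.par_par])
            simp [h1, h2, Ne.symm h2, h3]
      unfold EPlus.mark
      by_cases h1 : c = none
      · rw [if_pos h1, e _ (Or.inl rfl)]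
        simp [h1]
      · rw [if_neg h1]
        by_cases h2 : c = some E.X
        · rw [if_pos h2, e _ (Or.inr rfl)]
          simp [h2]
        · rw [if_neg h2, if_neg fun h => h.2.elim h1 h2]
          rfl
    have hz : k = label (φ E.lam) ∧ (c = none ∨ c = some E.X) → some (E.zc (back k)) ≠ c := by
      rintro ⟨h1, rfl | rfl⟩
      · simp
      · rw [← hzk, if_pos h1]; simp [E.zc_lam_ne]
    by_cases h1 : some (E.zc (back k)) = c
    · rw [if_pos h1] at h
      rw [if_pos (Or.inl h1)]
      omega
    · rw [if_neg h1] at h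
      by_cases h2 : k = label (φ E.lam) ∧ (c = none ∨ c = some E.X)
      · rw [if_pos h2] at hm
        rw [if_pos (Or.inr h2)]; omega
      · rw [if_neg h2] at hm
        rw [if_neg (not_or.2 ⟨h1, h2⟩)]; omega
  · intro c hc
    rw [List.getLast?_map, (hlast c hc).1]
    cases σ c <;> rfl
  · intro c hc
    rw [List.getLast?_map, (hlast c hc).2]
    cases σ c <;> rfl
  · rintro c (rfl | rfl)
    · rw [List.head?_map, (hhead none (Or.inr (Or.inl rfl))).1]; rfl
    · rw [List.head?_map, (hhead _ (Or.inr (Or.inr rfl))).1]; rfl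
  · rintro c (rfl | rfl)
    · rw [List.head?_map, (hhead none (Or.inr (Or.inl rfl))).2]; simp [E.fin_X]
    · rw [List.head?_map, (hhead _ (Or.inr (Or.inr rfl))).2]; simp [E.fin_X]
  · have hA : ∀ v, ∃ c : Option V, c ≠ none ∧ (Nb (Sum.inl none :: (g₁ c).map φ) (Sum.inl none) (φ v) ∨
        (¬ E.Sp c ∧ Nb (Sum.inl none :: ((g₁ c).map φ ++ (Sum.inr none :: (g₂ c).map φ).reverse))
          (Sum.inl none) (φ v))) := by
      intro v
      refine ⟨some v, by simp, ?_⟩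
      by_cases hs : E.Sp (some v)
      · left
        obtain ⟨l, hl⟩ := List.head?_eq_some_iff.1 (hhead _ hs).1
        rw [hl]
        exact nb_cons_iff.2 (Or.inl ⟨rfl, rfl⟩)
      · right
        refine ⟨hs, ?_⟩
        have h1 := E.head_line (some v)
        rw [hsplit, hg2 _ hs, EPlus.mark, if_neg (by simp),
          if_neg fun h => hs (Or.inr (Or.inr h))] at h1
        obtain ⟨l, hl⟩ := List.head?_eq_some_iff.1 h1
        simp only [List.reverse_nil, List.append_nil] at hl
        rw [hl]
        exact nb_cons_iff.2 (Or.inl ⟨rfl, rfl⟩)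
    have hB : ∀ v, ∃ c : Option V, c ≠ none ∧ (Nb (Sum.inr none :: (g₂ c).map φ) (Sum.inr none) (φ v) ∨
        (¬ E.Sp c ∧ Nb (Sum.inl none :: ((g₁ c).map φ ++ (Sum.inr none :: (g₂ c).map φ).reverse))
          (Sum.inr none) (φ v))) := by
      intro v
      obtain ⟨a, rfl⟩ := E.fin_surj v
      refine ⟨some a, by simp, ?_⟩
      by_cases hs : E.Sp (some a)
      · left
        obtain ⟨l, hl⟩ := List.head?_eq_some_iff.1 (hhead _ hs).2
        rw [hl]
        exact nb_cons_iff.2 (Or.inl ⟨rfl, rfl⟩)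
      · right
        refine ⟨hs, ?_⟩
        have h1 := E.last_line (some a)
        rw [hsplit, hg2 _ hs, EPlus.mark, if_neg (by simp),
          if_neg fun h => hs (Or.inr (Or.inr h))] at h1
        obtain ⟨l, hl⟩ := List.getLast?_eq_some_iff.1 h1
        simp only [List.reverse_nil, List.append_nil] at hl
        rw [hl, hg2 _ hs]
        exact Or.inr ⟨Sum.inl none :: l.map φ, [], by simp⟩
    have hAB : ∀ x : Lab (N + 1), label x = none → ∀ v, ∃ c, (c ≠ none ∧
        (Nb (Sum.inl none :: (g₁ c).map φ) x (φ v) ∨ Nb (Sum.inr none :: (g₂ c).map φ) x (φ v))) ∨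
        (¬ E.Sp c ∧ Nb (Sum.inl none :: ((g₁ c).map φ ++ (Sum.inr none :: (g₂ c).map φ).reverse))
          x (φ v)) := by
      rintro (k | k) hx v
      · obtain rfl : k = none := hx
        obtain ⟨c, hc, h | h⟩ := hA v
        · exact ⟨c, Or.inl ⟨hc, Or.inl h⟩⟩
        · exact ⟨c, Or.inr h⟩
      · obtain rfl : k = none := hx
        obtain ⟨c, hc, h | h⟩ := hB v
        · exact ⟨c, Or.inl ⟨hc, Or.inr h⟩⟩
        · exact ⟨c, Or.inr h⟩
    intro x y hxy
    by_cases hx : label x = none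
    · by_cases hy : label y = none
      · exact Or.inl (hx.trans hy.symm)
      · obtain ⟨v, rfl⟩ := hφs y hy
        obtain ⟨c, h⟩ := hAB x hx v
        exact Or.inr (Or.inr (Or.inr (Or.inr ⟨c, Or.inr (Or.inr h)⟩)))
    · obtain ⟨u, rfl⟩ := hφs x hx
      by_cases hy : label y = none
      · obtain ⟨c, h⟩ := hAB y hy u
        refine Or.inr (Or.inr (Or.inr (Or.inr ⟨c, Or.inr (Or.inr ?_)⟩)))
        exact h.imp (fun h => ⟨h.1, h.2.imp Nb.symm Nb.symm⟩) fun h => ⟨h.1, h.2.symm⟩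
      · obtain ⟨v, rfl⟩ := hφs y hy
        have hline : ∀ c, Nb (E.line c) u v → _ := fun c h => hnbline c u v h
        rcases E.cover u v fun h => hxy (by rw [h]) with h | ⟨a, h⟩ | h | ⟨rfl, rfl⟩ | ⟨rfl, rfl⟩
        · left; rw [h, hφp]
        · rcases hline (some a) h with h | h | h
          · exact Or.inr (Or.inr (Or.inr (Or.inr ⟨_, Or.inl (h.map φ)⟩)))
          · exact Or.inr (Or.inr (Or.inr (Or.inr ⟨_, Or.inr (Or.inl (h.map φ))⟩)))
          · exact Or.inr (Or.inl ⟨hquad _ h.2.1, hquad _ h.2.2⟩)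
        · rcases hline none h with h | h | h
          · exact Or.inr (Or.inr (Or.inr (Or.inr ⟨_, Or.inl (h.map φ)⟩)))
          · exact Or.inr (Or.inr (Or.inr (Or.inr ⟨_, Or.inr (Or.inl (h.map φ))⟩)))
          · exact Or.inr (Or.inl ⟨hquad _ h.2.1, hquad _ h.2.2⟩)
        · exact Or.inr (Or.inr (Or.inl ⟨rfl, rfl⟩))
        · exact Or.inr (Or.inr (Or.inr (Or.inl ⟨rfl, rfl⟩)))
  · intro k hk hk' h
    rw [if_neg hk'] at h
    have h1 := (E.tri' (E.par (back k))).mem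
    rw [← h, ← E.zc_par] at h1
    exact E.not_mem_zc _ h1
  · intro k hk hk' h
    rw [if_neg hk'] at h
    have h1 := (E.tri' (back k)).mem
    rw [← h] at h1
    exact E.not_mem_zc _ h1
  · intro k hk hk' h
    have h1 := (E.tri' (back k)).mem
    have h2 := (E.tri' (E.par (back k))).mem
    rw [h] at h2
    exact E.not_mem_both h1 h2
  · intro k hk hk' h
    exact (E.chord' (back k)).ne (E.nodup_line _) (hφ h)
  · intro k hk hk'
    obtain ⟨t1, t2, t3, t4⟩ := htet (back k)
    have h1 := E.tri' (back k)
    have h2 := E.tri' (E.par (back k))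
    rw [E.s_par, E.t_par] at h2
    simp only [if_neg hk']
    rw [← hback k hk, ← hbackr k hk]
    exact ⟨hg k hk hk' _ _ _ t1 t2 (E.chord' _), hg k hk hk' _ _ _ t1 t4 h2.nb₁,
      hg k hk hk' _ _ _ t4 t2 h2.nb₂, hg k hk hk' _ _ _ t1 t3 h1.nb₁, hg k hk hk' _ _ _ t3 t2 h1.nb₂⟩
  · intro k k' hk hk1 hk' hk1' hkk x hx y hy
    have hq : ∀ k, k ≠ none → ∀ x, x ∈ quad (φ (E.s (back k))) (φ (E.t (back k))) k →
        ∃ v ∈ E.tetra (back k), φ v = x := by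
      intro k hk x hx
      obtain ⟨t1, t2, t3, t4⟩ := htet (back k)
      simp only [quad, Set.mem_insert_iff, Set.mem_singleton_iff] at hx
      rcases hx with rfl | rfl | rfl | rfl
      · exact ⟨_, t1, rfl⟩
      · exact ⟨_, t2, rfl⟩
      · exact ⟨_, t3, hback k hk⟩
      · exact ⟨_, t4, hbackr k hk⟩
    obtain ⟨u, hu, rfl⟩ := hq k hk x hx.1
    obtain ⟨u', hu', hxu⟩ := hq k' hk' _ hx.2
    obtain ⟨w, hw, rfl⟩ := hq k hk y hy.1
    obtain ⟨w', hw', hyw⟩ := hq k' hk' _ hy.2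
    obtain rfl := hφ hxu
    obtain rfl := hφ hyw
    rw [E.quad_inter (back k) (back k') (fun h => hkk (by rw [← hlb k hk, ← hlb k' hk', h]))
      (fun h => hkk (by rw [← hlb k hk, ← hlb k' hk', h, hφp])) _ hu _ hw hu' hw']

/-- The scheme given by a decomposition. -/
theorem EPlus.nonempty_scheme {N : ℕ} {V : Type} [Fintype V] [DecidableEq V] (E : EPlus N V) :
    ∃ Sc : Scheme (N + 1) (Option V), ∀ κ, Sc.allowed κ := by
  obtain ⟨K⟩ := E.nonempty_core
  exact ⟨K.scheme (by omega) (by rw [Fintype.card_option, E.card]; ring), fun _ => trivial⟩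

end HamFrag

/-! ### Composition of two decompositions -/

namespace HamFrag

/-- The cross part of a composition of two decompositions, with further labels `T`. -/
structure Joint {N : ℕ} {V W : Type} [Fintype V] [DecidableEq V] [Fintype W] [DecidableEq W]
    (E : EPlus N V) (F : EPlus N W) (T : Type) [Fintype T] [DecidableEq T] where
  J : V ≃ W
  parT : T → T
  m : V → List T
  mo : List T
  β : W ⊕ T → List (V ⊕ (W ⊕ T))
  fβ : W ⊕ T → V ⊕ (W ⊕ T)
  zT : T → W ⊕ T
  sT : T → W
  tT : T → V
  cT : T → V ⊕ (W ⊕ T)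
  parT_parT : ∀ t, parT (parT t) = t
  parT_ne : ∀ t, parT t ≠ t
  eq_parT : ∀ t t', t ≠ t' → t' = parT t
  m_len : ∀ a, 2 * (m a).length = Fintype.card T
  m_mem : ∀ a t, t ∈ m a ∨ parT t ∈ m a
  mo_len : 2 * mo.length = Fintype.card T
  mo_mem : ∀ t, t ∈ mo ∨ parT t ∈ mo
  J_X : J E.X = F.X
  head : ∀ y, (β y).head? = some (Sum.inr y)
  last : ∀ y, (β y).getLast? = some (fβ y)
  fβ_left : ∀ x, ∃ y, fβ y = Sum.inl x
  fβ_right : ∀ t, ∃ y, fβ y = Sum.inr (Sum.inr t)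
  zT_par : ∀ t, zT (parT t) = zT t
  len : ∀ y, 2 * (β y).length + (Finset.univ.filter fun t => zT t = y).card
    = 4 * N + Fintype.card T
  memV : ∀ y x, Sum.inl x ∈ β y ∨ Sum.inl (E.par x) ∈ β y
  memW : ∀ y x, Sum.inr (Sum.inl x) ∈ β y ∨ Sum.inr (Sum.inl (F.par x)) ∈ β y
  memT : ∀ y t, zT t ≠ y → Sum.inr (Sum.inr t) ∈ β y ∨ Sum.inr (Sum.inr (parT t)) ∈ β y
  -- A pair between the parts is used where a path of `E` is continued by a path of `F`, in one of
  -- the cross paths `β`, or in the new transversal. The last exception is the pair closing that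
  -- transversal.
  cross : ∀ x y, (∃ a, E.fin a = x ∧ J a = y ∧ m a = []) ∨
    (∃ z, Nb (β z) (Sum.inl x) (Sum.inr (Sum.inl y))) ∨ (x = E.X2 ∧ y = F.Y2 ∧ mo = []) ∨
    (x = E.X ∧ y = F.Y)
  crossX : ∃ z, Nb (β z) (Sum.inl E.X) (Sum.inl E.X2)
  crossY : ∃ z, Nb (β z) (Sum.inr (Sum.inl F.Y)) (Sum.inr (Sum.inl F.Y2))
  crossV : ∀ t x, (∃ a, E.fin a = x ∧ (m a).head? = some t) ∨
    (∃ z, Nb (β z) (Sum.inl x) (Sum.inr (Sum.inr t))) ∨ (x = E.X2 ∧ mo.head? = some t)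
  crossW : ∀ t y, (∃ a, J a = y ∧ (m a).getLast? = some t) ∨
    (∃ z, Nb (β z) (Sum.inr (Sum.inl y)) (Sum.inr (Sum.inr t))) ∨
    (y = F.Y2 ∧ mo.getLast? = some t)
  sT_par : ∀ t, sT (parT t) = sT t
  tT_par : ∀ t, tT (parT t) = tT t
  sT_ne : ∀ t, sT t ≠ F.Y
  chordT : ∀ t, Nb (β (zT t)) (Sum.inr (Sum.inl (sT t))) (Sum.inl (tT t))
  triT : ∀ t, (∃ a, cT t = Sum.inl a ∧ E.fin a = tT t ∧ J a = sT t ∧ m a = [t]) ∨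
    ∃ y, cT t = Sum.inr y ∧ Tr (β y) (Sum.inr (Sum.inl (sT t))) (Sum.inr (Sum.inr t)) (Sum.inl (tT t))

namespace Joint

variable {N : ℕ} {V W : Type} [Fintype V] [DecidableEq V] [Fintype W] [DecidableEq W]
  {E : EPlus N V} {F : EPlus N W} {T : Type} [Fintype T] [DecidableEq T] (Jt : Joint E F T)

/-- The paths of the composition. -/
def P : V ⊕ (W ⊕ T) → List (V ⊕ (W ⊕ T))
  | Sum.inl a => (E.P a).map Sum.inl ++ ((Jt.m a).map (fun t => Sum.inr (Sum.inr t)) ++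
      (F.P (Jt.J a)).map fun y => Sum.inr (Sum.inl y))
  | Sum.inr y => Jt.β y

/-- The middle part of the closed transversal of the composition. -/
def mid : List (V ⊕ (W ⊕ T)) :=
  -- The closed transversal of `E` is opened at `X X2` and that of `F` at `Y2 Y`, and the two are
  -- concatenated. The two dropped edges have to appear in cross paths, which is the purpose of
  -- `crossX` and `crossY`.
  (E.Y2 :: (E.mid.reverse ++ [E.X2])).map Sum.inl ++ (Jt.mo.map (fun t => Sum.inr (Sum.inr t)) ++
    (F.Y2 :: (F.mid.reverse ++ [F.X2])).map fun y => Sum.inr (Sum.inl y))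

/-- The closed transversal of the composition. -/
def o : List (V ⊕ (W ⊕ T)) :=
  Sum.inl E.X :: Sum.inl E.Y :: (Jt.mid ++ [Sum.inr (Sum.inl F.X), Sum.inr (Sum.inl F.Y)])

/-- The involution of the composition. -/
def par : V ⊕ (W ⊕ T) → V ⊕ (W ⊕ T) := Sum.map E.par (Sum.map F.par Jt.parT)

/-- The colours of the edges between partners in the composition. -/
def zc : V ⊕ (W ⊕ T) → V ⊕ (W ⊕ T)
  | Sum.inl x => Sum.inl (E.zc x)
  | Sum.inr (Sum.inl y) => Sum.inl (Jt.J.symm (F.zc y))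
  | Sum.inr (Sum.inr t) => Sum.inr (Jt.zT t)

/-- The ends of the paths of the composition. -/
def fin : V ⊕ (W ⊕ T) → V ⊕ (W ⊕ T)
  | Sum.inl a => Sum.inr (Sum.inl (F.fin (Jt.J a)))
  | Sum.inr y => Jt.fβ y

/-- One of the vertices of a gadget of the composition. -/
def s : V ⊕ (W ⊕ T) → V ⊕ (W ⊕ T)
  | Sum.inl x => Sum.inl (E.s x)
  | Sum.inr (Sum.inl y) => Sum.inr (Sum.inl (F.s y))
  | Sum.inr (Sum.inr t) => Sum.inr (Sum.inl (Jt.sT t))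

/-- The other vertex of a gadget of the composition. -/
def t : V ⊕ (W ⊕ T) → V ⊕ (W ⊕ T)
  | Sum.inl x => Sum.inl (E.t x)
  | Sum.inr (Sum.inl y) => Sum.inr (Sum.inl (F.t y))
  | Sum.inr (Sum.inr t) => Sum.inl (Jt.tT t)

/-- The colours of the gadgets of the composition. -/
def col : V ⊕ (W ⊕ T) → Option (V ⊕ (W ⊕ T))
  | Sum.inl x => (E.col x).map Sum.inl
  | Sum.inr (Sum.inl y) => (F.col y).map fun b => Sum.inl (Jt.J.symm b)
  | Sum.inr (Sum.inr t) => some (Jt.cT t)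

theorem infix_P_left (a : V) : (E.P a).map Sum.inl <:+: Jt.P (Sum.inl a) :=
  List.infix_append [] _ _

theorem infix_P_right (a : V) : (F.P (Jt.J a)).map (fun y => Sum.inr (Sum.inl y)) <:+:
    Jt.P (Sum.inl a) :=
  ⟨(E.P a).map Sum.inl ++ (Jt.m a).map (fun t => Sum.inr (Sum.inr t)), [], by simp [P]⟩

theorem infix_o_left : ((E.X2 :: (E.mid ++ [E.Y2, E.Y])).reverse.map Sum.inl) <:+: Jt.o :=
  ⟨[Sum.inl E.X], Jt.mo.map (fun t => Sum.inr (Sum.inr t)) ++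
    (F.Y2 :: (F.mid.reverse ++ [F.X2, F.X, F.Y])).map fun y => Sum.inr (Sum.inl y), by simp [o, mid]⟩

theorem infix_o_right : ((F.X :: F.X2 :: (F.mid ++ [F.Y2])).reverse.map
    fun y => (Sum.inr (Sum.inl y) : V ⊕ (W ⊕ T))) <:+: Jt.o :=
  ⟨((E.X :: E.Y :: E.Y2 :: (E.mid.reverse ++ [E.X2])).map Sum.inl) ++
    Jt.mo.map (fun t => Sum.inr (Sum.inr t)), [Sum.inr (Sum.inl F.Y)], by simp [o, mid]⟩

theorem cover_left (x y : V) (hxy : x ≠ y) : y = E.par x ∨ (∃ a, Nb (Jt.P a) (Sum.inl x) (Sum.inl y)) ∨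
    Nb Jt.o (Sum.inl x) (Sum.inl y) := by
  have hXX : (∃ a, Nb (Jt.P a) (Sum.inl E.X) (Sum.inl E.X2)) := by
    obtain ⟨z, hz⟩ := Jt.crossX
    exact ⟨Sum.inr z, hz⟩
  have hXY : Nb Jt.o (Sum.inl E.X) (Sum.inl E.Y) := nb_cons_iff.2 (Or.inl ⟨rfl, rfl⟩)
  rcases E.cover x y hxy with h | ⟨a, h⟩ | h | ⟨rfl, rfl⟩ | ⟨rfl, rfl⟩
  · exact Or.inl h
  · exact Or.inr (Or.inl ⟨_, (h.map Sum.inl).mono (Jt.infix_P_left a)⟩)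
  · rcases nb_cons_iff.1 h with ⟨rfl, rfl⟩ | ⟨rfl, rfl⟩ | h
    · exact Or.inr (Or.inl hXX)
    · exact Or.inr (Or.inl (hXX.imp fun _ h => h.symm))
    · exact Or.inr (Or.inr ((h.reverse.map Sum.inl).mono Jt.infix_o_left))
  · exact Or.inr (Or.inr hXY)
  · exact Or.inr (Or.inr hXY.symm)

theorem cover_right (x y : W) (hxy : x ≠ y) : y = F.par x ∨
    (∃ a, Nb (Jt.P a) (Sum.inr (Sum.inl x)) (Sum.inr (Sum.inl y))) ∨
    Nb Jt.o (Sum.inr (Sum.inl x)) (Sum.inr (Sum.inl y)) := by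
  have hYY : (∃ a, Nb (Jt.P a) (Sum.inr (Sum.inl F.Y)) (Sum.inr (Sum.inl F.Y2))) := by
    obtain ⟨z, hz⟩ := Jt.crossY
    exact ⟨Sum.inr z, hz⟩
  have hXY : Nb Jt.o (Sum.inr (Sum.inl F.X)) (Sum.inr (Sum.inl F.Y)) :=
    Or.inl ⟨Sum.inl E.X :: Sum.inl E.Y :: Jt.mid, [], by simp [o]⟩
  rcases F.cover x y hxy with h | ⟨a, h⟩ | h | ⟨rfl, rfl⟩ | ⟨rfl, rfl⟩
  · exact Or.inl h
  · refine Or.inr (Or.inl ⟨Sum.inl (Jt.J.symm a), ?_⟩)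
    have := Jt.infix_P_right (Jt.J.symm a)
    rw [Equiv.apply_symm_apply] at this
    exact (h.map _).mono this
  · rcases Nb.of_concat (l := F.X :: F.X2 :: F.mid) (a := F.Y) (b := F.Y2) (by simpa using h)
      with ⟨rfl, rfl⟩ | ⟨rfl, rfl⟩ | h
    · exact Or.inr (Or.inl hYY)
    · exact Or.inr (Or.inl (hYY.imp fun _ h => h.symm))
    · exact Or.inr (Or.inr ((h.reverse.map fun y => Sum.inr (Sum.inl y)).mono
        (by simpa using Jt.infix_o_right)))
  · exact Or.inr (Or.inr hXY)
  · exact Or.inr (Or.inr hXY.symm)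

theorem cover_cross (x : V) (y : W) : (∃ a, Nb (Jt.P a) (Sum.inl x) (Sum.inr (Sum.inl y))) ∨
    Nb Jt.o (Sum.inl x) (Sum.inr (Sum.inl y)) ∨ (x = E.X ∧ y = F.Y) := by
  rcases Jt.cross x y with ⟨a, h1, h2, h3⟩ | ⟨z, h⟩ | ⟨rfl, rfl, h⟩ | h
  · refine Or.inl ⟨Sum.inl a, Or.inl ?_⟩
    rw [P, h3, List.map_nil, List.nil_append]
    refine pair_infix_append ?_ ?_
    · rw [List.getLast?_map, E.last, h1]; rfl
    · rw [List.head?_map, F.head, h2]; rfl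
  · exact Or.inl ⟨Sum.inr z, h⟩
  · refine Or.inr (Or.inl (Or.inl ?_))
    exact ⟨Sum.inl E.X :: Sum.inl E.Y :: (E.Y2 :: E.mid.reverse).map Sum.inl,
      (F.mid.reverse ++ [F.X2, F.X, F.Y]).map fun y => Sum.inr (Sum.inl y), by simp [o, mid, h]⟩
  · exact Or.inr (Or.inr h)

theorem cover_crossV (t : T) (x : V) : (∃ a, Nb (Jt.P a) (Sum.inl x) (Sum.inr (Sum.inr t))) ∨
    Nb Jt.o (Sum.inl x) (Sum.inr (Sum.inr t)) := by
  rcases Jt.crossV t x with ⟨a, h1, h2⟩ | ⟨z, h⟩ | ⟨rfl, h⟩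
  · refine Or.inl ⟨Sum.inl a, Or.inl ?_⟩
    refine pair_infix_append ?_ ?_
    · rw [List.getLast?_map, E.last, h1]; rfl
    · rw [List.head?_append, List.head?_map, h2]; rfl
  · exact Or.inl ⟨Sum.inr z, h⟩
  · refine Or.inr (Or.inl ?_)
    obtain ⟨l, hl⟩ := List.head?_eq_some_iff.1 h
    exact ⟨Sum.inl E.X :: Sum.inl E.Y :: (E.Y2 :: E.mid.reverse).map Sum.inl,
      l.map (fun t => Sum.inr (Sum.inr t)) ++
        (F.Y2 :: (F.mid.reverse ++ [F.X2, F.X, F.Y])).map fun y => Sum.inr (Sum.inl y),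
      by simp [o, mid, hl]⟩

theorem cover_crossW (t : T) (y : W) :
    (∃ a, Nb (Jt.P a) (Sum.inr (Sum.inl y)) (Sum.inr (Sum.inr t))) ∨
    Nb Jt.o (Sum.inr (Sum.inl y)) (Sum.inr (Sum.inr t)) := by
  rcases Jt.crossW t y with ⟨a, h1, h2⟩ | ⟨z, h⟩ | ⟨rfl, h⟩
  · refine Or.inl ⟨Sum.inl a, Or.inr ?_⟩
    rw [P, ← List.append_assoc]
    refine pair_infix_append ?_ ?_
    · rw [List.getLast?_append, List.getLast?_map, h2]; rfl
    · rw [List.head?_map, F.head, h1]; rfl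
  · exact Or.inl ⟨Sum.inr z, h⟩
  · refine Or.inr (Or.inr ?_)
    obtain ⟨l, hl⟩ := List.getLast?_eq_some_iff.1 h
    exact ⟨(E.X :: E.Y :: E.Y2 :: (E.mid.reverse ++ [E.X2])).map Sum.inl ++
      l.map (fun t => Sum.inr (Sum.inr t)),
        (F.mid.reverse ++ [F.X2, F.X, F.Y]).map fun y => Sum.inr (Sum.inl y),
      by simp [o, mid, hl]⟩

/-- The composition of two decompositions. -/
def compose {M : ℕ} (hM : 4 * N + Fintype.card T = 2 * M) : EPlus M (V ⊕ (W ⊕ T)) where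
  par := Jt.par
  P := Jt.P
  fin := Jt.fin
  zc := Jt.zc
  mid := Jt.mid
  X := Sum.inl E.X
  X2 := Sum.inl E.Y
  Y2 := Sum.inr (Sum.inl F.X)
  Y := Sum.inr (Sum.inl F.Y)
  lam := Sum.inl E.lam
  s := Jt.s
  t := Jt.t
  col := Jt.col
  par_par := by
    rintro (x | x | x) <;> simp [par, E.par_par, F.par_par, Jt.parT_parT]
  par_ne := by
    rintro (x | x | x) <;> simp [par, E.par_ne, F.par_ne, Jt.parT_ne]
  card := by
    rw [Fintype.card_sum, Fintype.card_sum, E.card, F.card]; omega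
  head := by
    rintro (a | y)
    · simp [P, E.head]
    · exact Jt.head y
  last := by
    rintro (a | y)
    · simp [P, F.last, fin, List.getLast?_append, List.getLast?_map]
    · exact Jt.last y
  fin_surj := by
    rintro (x | y | t)
    · obtain ⟨y, hy⟩ := Jt.fβ_left x
      exact ⟨Sum.inr y, hy⟩
    · obtain ⟨b, rfl⟩ := F.fin_surj y
      exact ⟨Sum.inl (Jt.J.symm b), by simp [fin]⟩
    · obtain ⟨y, hy⟩ := Jt.fβ_right t
      exact ⟨Sum.inr y, hy⟩
  zc_par := by
    rintro (x | x | x) <;> simp [par, zc, E.zc_par, F.zc_par, Jt.zT_par]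
  len := by
    have hcount : ∀ p : V ⊕ (W ⊕ T) → Prop, ∀ [DecidablePred p],
        (Finset.univ.filter p).card = (Finset.univ.filter fun x => p (Sum.inl x)).card +
          ((Finset.univ.filter fun y => p (Sum.inr (Sum.inl y))).card +
            (Finset.univ.filter fun t => p (Sum.inr (Sum.inr t))).card) := by
      intro p _
      simp only [Finset.card_filter, Fintype.sum_sum_type]
    rintro (a | y) <;> rw [hcount]
    · have h1 := E.len a
      have h2 := F.len (Jt.J a)
      have h3 := Jt.m_len a
      have e : (Finset.univ.filter fun y => Jt.zc (Sum.inr (Sum.inl y)) = Sum.inl a)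
          = Finset.univ.filter fun y => F.zc y = Jt.J a := by
        ext y; simp [zc, Equiv.symm_apply_eq]
      rw [e]
      simp only [P, zc, List.length_append, List.length_map, Sum.inl.injEq, reduceCtorEq,
        Finset.filter_false, Finset.card_empty]
      omega
    · have h1 := Jt.len y
      simp only [P, zc, reduceCtorEq, Finset.filter_false, Finset.card_empty, Sum.inr.injEq]
      omega
  mem := by
    rintro (a | y) (x | x | x) h
    · have := E.mem a x fun h' => h (by simp [zc, h'])
      simpa [P, par] using this
    · have := F.mem (Jt.J a) x fun h' => h (by simp [zc, h'])
      simpa [P, par] using this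
    · have := Jt.m_mem a x
      simpa [P, par] using this
    · exact Jt.memV y x
    · exact Jt.memW y x
    · exact Jt.memT y x fun h' => h (by simp [zc, h'])
  o_len := by
    have h1 := E.o_len
    have h2 := F.o_len
    have h3 := Jt.mo_len
    simp [mid] at h1 h2 ⊢
    omega
  o_mem := by
    rintro (x | x | x)
    · have := E.o_mem x
      simp [mid, par] at this ⊢
      tauto
    · have := F.o_mem x
      simp [mid, par] at this ⊢
      tauto
    · have := Jt.mo_mem x
      simp [mid, par] at this ⊢
      tauto
  fin_X := by simp [fin, Jt.J_X, F.fin_X]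
  cover := by
    rintro (x | x | x) (y | y | y) hxy
    · rcases Jt.cover_left x y fun h => hxy (by rw [h]) with h | h | h
      · left; rw [h]; rfl
      · exact Or.inr (Or.inl h)
      · exact Or.inr (Or.inr (Or.inl h))
    · rcases Jt.cover_cross x y with h | h | ⟨rfl, rfl⟩
      · exact Or.inr (Or.inl h)
      · exact Or.inr (Or.inr (Or.inl h))
      · exact Or.inr (Or.inr (Or.inr (Or.inl ⟨rfl, rfl⟩)))
    · rcases Jt.cover_crossV y x with h | h
      · exact Or.inr (Or.inl h)
      · exact Or.inr (Or.inr (Or.inl h))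
    · rcases Jt.cover_cross y x with h | h | ⟨rfl, rfl⟩
      · exact Or.inr (Or.inl (h.imp fun _ h => h.symm))
      · exact Or.inr (Or.inr (Or.inl h.symm))
      · exact Or.inr (Or.inr (Or.inr (Or.inr ⟨rfl, rfl⟩)))
    · rcases Jt.cover_right x y fun h => hxy (by rw [h]) with h | h | h
      · left; rw [h]; rfl
      · exact Or.inr (Or.inl h)
      · exact Or.inr (Or.inr (Or.inl h))
    · rcases Jt.cover_crossW y x with h | h
      · exact Or.inr (Or.inl h)
      · exact Or.inr (Or.inr (Or.inl h))
    · rcases Jt.cover_crossV x y with h | h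
      · exact Or.inr (Or.inl (h.imp fun _ h => h.symm))
      · exact Or.inr (Or.inr (Or.inl h.symm))
    · rcases Jt.cover_crossW x y with h | h
      · exact Or.inr (Or.inl (h.imp fun _ h => h.symm))
      · exact Or.inr (Or.inr (Or.inl h.symm))
    · left
      rw [Jt.eq_parT x y fun h => hxy (by rw [h])]; rfl
  s_par := by
    rintro (x | x | x) <;> simp [par, s, E.s_par, F.s_par, Jt.sT_par]
  t_par := by
    rintro (x | x | x) <;> simp [par, t, E.t_par, F.t_par, Jt.tT_par]
  chord := by
    rintro (x | x | x)
    · exact ((E.chord x).map Sum.inl).mono (Jt.infix_P_left _)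
    · have := Jt.infix_P_right (Jt.J.symm (F.zc x))
      rw [Equiv.apply_symm_apply] at this
      exact ((F.chord x).map _).mono this
    · exact Jt.chordT x
  tri := by
    rintro (x | x | x)
    · have h := E.tri x
      cases hc : E.col x with
      | none =>
        rw [hc] at h
        -- By `free` the gadget does not use the dropped edge, so its triple survives in the opened
        -- transversal.
        have h1 := Tr.of_cons h fun hn => by
          refine E.free x (E.X, E.X2) (by simp) ?_
          rcases hn with ⟨h1 | h1, h2⟩ <;> simp [h1, h2]
        simp only [col, hc]
        exact (h1.reverse.map Sum.inl).mono Jt.infix_o_left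
      | some a =>
        rw [hc] at h
        simp only [col, hc]
        exact (h.map Sum.inl).mono (Jt.infix_P_left a)
    · have h := F.tri x
      cases hc : F.col x with
      | none =>
        rw [hc] at h
        have h1 := Tr.of_concat (l := F.X :: F.X2 :: F.mid) (a := F.Y) (b := F.Y2) (by simpa using h)
          fun hn => by
            refine F.free x (F.Y, F.Y2) (by simp) ?_
            rcases hn with ⟨h1 | h1, h2⟩ <;> simp [h1, h2]
        simp only [col, hc]
        exact (h1.reverse.map fun y => Sum.inr (Sum.inl y)).mono (by simpa [o] using Jt.infix_o_right)
      | some a =>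
        rw [hc] at h
        simp only [col, hc]
        have := Jt.infix_P_right (Jt.J.symm a)
        rw [Equiv.apply_symm_apply] at this
        exact (h.map fun y => Sum.inr (Sum.inl y)).mono this
    · rcases Jt.triT x with ⟨a, h1, h2, h3, h4⟩ | ⟨y, h1, h2⟩
      · simp only [col, h1]
        right
        obtain ⟨l, hl⟩ := List.getLast?_eq_some_iff.1 (E.last a)
        obtain ⟨l', hl'⟩ := List.head?_eq_some_iff.1 (F.head (Jt.J a))
        refine ⟨l.map Sum.inl, l'.map (fun y => Sum.inr (Sum.inl y)), ?_⟩
        rw [h3] at hl'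
        simp [P, hl, hl', h4, h2, h3, s, t]
      · simp only [col, h1]
        exact h2
  quad_inter := by
    rintro (x | x | x) (y | y | y) h1 h2 a ha b hb ha' hb'
    · have := E.quad_inter x y (fun h => h1 (by rw [h])) (fun h => h2 (by rw [h]; rfl))
      simp only [s, t, par, List.mem_cons, List.not_mem_nil, or_false, Sum.map_inl] at ha hb ha' hb'
      rcases a with a | a <;> rcases b with b | b <;> simp at ha hb ha' hb' ⊢
      exact this a (by simpa using ha) b (by simpa using hb) (by simpa using ha') (by simpa using hb')
    · rcases a with a | a <;> rcases b with b | b <;> simp [s, t, par] at ha hb ha' hb' ⊢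
    · rcases a with a | a | a <;> rcases b with b | b | b <;> simp [s, t, par] at ha hb ha' hb' ⊢
      rw [ha', hb']
    · rcases a with a | a <;> rcases b with b | b <;> simp [s, t, par] at ha hb ha' hb' ⊢
    · have := F.quad_inter x y (fun h => h1 (by rw [h])) (fun h => h2 (by rw [h]; rfl))
      rcases a with a | a | a <;> rcases b with b | b | b <;> simp [s, t, par] at ha hb ha' hb' ⊢
      exact this a (by simpa using ha) b (by simpa using hb) (by simpa using ha') (by simpa using hb')
    · rcases a with a | a | a <;> rcases b with b | b | b <;> simp [s, t, par] at ha hb ha' hb' ⊢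
      rw [ha', hb']
    · rcases a with a | a | a <;> rcases b with b | b | b <;> simp [s, t, par] at ha hb ha' hb' ⊢
      rw [ha, hb]
    · rcases a with a | a | a <;> rcases b with b | b | b <;> simp [s, t, par] at ha hb ha' hb' ⊢
      rw [ha, hb]
    · exact absurd (by rw [Jt.eq_parT x y fun h => h1 (by rw [h])]; rfl) h2
  free := by
    rintro (x | x | x) ab hab ⟨h1, h2⟩
    · simp only [List.mem_cons, List.not_mem_nil, or_false] at hab
      rcases hab with rfl | rfl | rfl
      · simp [s, t, par] at h2
      · exact E.free x (E.X, E.Y) (by simp) ⟨by simpa [s, t, par] using h1, by simpa [s, t, par] using h2⟩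
      · simp [s, t, par] at h2
    · simp only [List.mem_cons, List.not_mem_nil, or_false] at hab
      rcases hab with rfl | rfl | rfl
      · simp [s, t, par] at h1
      · simp [s, t, par] at h1
      · exact F.free x (F.X, F.Y) (by simp) ⟨by simpa [s, t, par] using h2, by simpa [s, t, par] using h1⟩
    · have hs := Jt.sT_ne x
      simp only [List.mem_cons, List.not_mem_nil, or_false] at hab
      rcases hab with rfl | rfl | rfl
      · simp [s, t, par] at h2; exact hs h2.symm
      · simp [s, t, par] at h1 h2
        have := (E.nodup_line none)
        simp [EPlus.line, EPlus.o] at this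
        exact this.1.2.2.2 (h1.trans h2.symm)
      · simp [s, t, par] at h1; exact hs h1.symm
  col_lam := by simp [col, E.col_lam]
  col_par_lam := by simp [col, par, E.col_par_lam]

end Joint

end HamFrag

/-! ### Zigzag paths between the two parts -/

namespace HamFrag

section Kappa

variable {α : Type*} (f h : ℤ → α) (N : ℕ)

/-- A zigzag path with its first element removed, or, for `y = 0`, with two edges exchanged. -/
def kappa (y : ℤ) : List α :=
  -- For `y = 0` the zigzag edges `f 0 h 1` and `f (-1) h 2` are traded for `f 0 f (-1)` and `h 1 h
  -- 2`. With the coordinates used below the latter are the edges dropped from the two transversals,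
  -- while `h 2 f (-1)` closes the new transversal.
  if y = 0 then f 0 :: f (-1) :: h 1 :: h 2 :: zigzag f h (N - 2) (-2) 3
  else h (y + 1) :: zigzag f h (N - 1) (y - 1) (y + 2)

variable {f h N}

theorem head?_zigzag {n : ℕ} (hn : 0 < n) (a b : ℤ) : (zigzag f h n a b).head? = some (f a) := by
  rcases n with _ | n
  · omega
  · rfl

theorem getLast?_kappa (hN : 5 ≤ N) (y : ℤ) : (kappa f h N y).getLast? = some (h (y + N)) := by
  unfold kappa
  split_ifs with hy
  · obtain ⟨n, rfl⟩ : ∃ n, N = n + 3 := ⟨N - 3, by omega⟩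
    have := getLast?_zigzag f h n (-2) 3
    rw [show n + 3 - 2 = n + 1 by omega, List.getLast?_cons, List.getLast?_cons, List.getLast?_cons,
      List.getLast?_cons, this, hy]
    simp only [Option.getD_some]
    congr 2; push_cast; ring
  · obtain ⟨n, rfl⟩ : ∃ n, N = n + 2 := ⟨N - 2, by omega⟩
    have := getLast?_zigzag f h n (y - 1) (y + 2)
    rw [show n + 2 - 1 = n + 1 by omega, List.getLast?_cons, this]
    simp only [Option.getD_some]
    congr 2; push_cast; ring

theorem length_kappa (hN : 5 ≤ N) (y : ℤ) :
    (kappa f h N y).length + (if y = 0 then 0 else 1) = 2 * N := by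
  unfold kappa
  split_ifs with hy <;> simp only [List.length_cons, length_zigzag] <;> omega

theorem mem_kappa_h (y : ℤ) {i : ℕ} (hi : i < N) : h (y + 1 + i) ∈ kappa f h N y := by
  unfold kappa
  split_ifs with hy
  · subst hy
    rcases i with _ | _ | i
    · simp
    · simp
    · have := mem_zigzag₂ f h (n := N - 2) (i := i) (by omega) (-2) 3
      rw [show (0 : ℤ) + 1 + ((i + 1 + 1 : ℕ) : ℤ) = 3 + i by push_cast; ring]
      simp [this]
  · rcases i with _ | i
    · simp
    · have := mem_zigzag₂ f h (n := N - 1) (i := i) (by omega) (y - 1) (y + 2)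
      rw [show y + 1 + ((i + 1 : ℕ) : ℤ) = y + 2 + i by push_cast; ring]
      simp [this]

theorem mem_kappa_f (y : ℤ) {i : ℕ} (hi : i < N) (h0 : y = 0 ∨ i ≠ 0) :
    f (y - i) ∈ kappa f h N y := by
  unfold kappa
  split_ifs with hy
  · subst hy
    rcases i with _ | _ | i
    · simp
    · simp
    · have := mem_zigzag₁ f h (n := N - 2) (i := i) (by omega) (-2) 3
      rw [show (0 : ℤ) - ((i + 1 + 1 : ℕ) : ℤ) = -2 - i by push_cast; ring]
      simp [this]
  · rcases i with _ | i
    · simp [hy] at h0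
    · have := mem_zigzag₁ f h (n := N - 1) (i := i) (by omega) (y - 1) (y + 2)
      rw [show y - ((i + 1 : ℕ) : ℤ) = y - 1 - i by push_cast; ring]
      simp [this]

theorem kappa_nb₂ (hN : 5 ≤ N) (y : ℤ) {i : ℕ} (hi : i + 1 < N) :
    Nb (kappa f h N y) (h (y + 1 + i)) (f (y - 1 - i)) := by
  unfold kappa
  split_ifs with hy
  · subst hy
    rcases i with _ | _ | i
    · rw [show (0 : ℤ) + 1 + ((0 : ℕ) : ℤ) = 1 by norm_num,
        show (0 : ℤ) - 1 - ((0 : ℕ) : ℤ) = -1 by norm_num]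
      exact Or.inr ⟨[f 0], h 2 :: zigzag f h (N - 2) (-2) 3, by simp⟩
    · have := pair_infix_append (l₁ := [f 0, f (-1), h 1, h 2]) (x := h 2) (y := f (-2)) rfl
        (head?_zigzag (f := f) (h := h) (show 0 < N - 2 by omega) (-2) 3)
      exact Or.inl (by simpa using this)
    · have := zigzag_pair₂ f h (n := N - 2) (i := i) (by omega) (-2) 3
      rw [show (0 : ℤ) + 1 + ((i + 1 + 1 : ℕ) : ℤ) = 3 + i by push_cast; ring,
        show (0 : ℤ) - 1 - ((i + 1 + 1 : ℕ) : ℤ) = -2 - i - 1 by push_cast; ring]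
      exact Or.inl (this.trans ⟨[f 0, f (-1), h 1, h 2], [], by simp⟩)
  · rcases i with _ | i
    · have := pair_infix_append (l₁ := [h (y + 1)]) (x := h (y + 1)) (y := f (y - 1)) rfl
        (head?_zigzag (f := f) (h := h) (show 0 < N - 1 by omega) (y - 1) (y + 2))
      exact Or.inl (by simpa using this)
    · have := zigzag_pair₂ f h (n := N - 1) (i := i) (by omega) (y - 1) (y + 2)
      rw [show y + 1 + ((i + 1 : ℕ) : ℤ) = y + 2 + i by push_cast; ring,
        show y - 1 - ((i + 1 : ℕ) : ℤ) = y - 1 - i - 1 by push_cast; ring]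
      exact Or.inl (this.trans ⟨[h (y + 1)], [], by simp⟩)

theorem kappa_nb₁ (y : ℤ) {i : ℕ} (hi : i < N) (h0 : i ≠ 0) (h1 : y = 0 → i ≠ 1) :
    Nb (kappa f h N y) (h (y + 1 + i)) (f (y - i)) := by
  right
  unfold kappa
  split_ifs with hy
  · subst hy
    rcases i with _ | _ | i
    · exact absurd rfl h0
    · exact absurd rfl (h1 rfl)
    · have := zigzag_pair₁ f h (n := N - 2) (i := i) (by omega) (-2) 3
      rw [show (0 : ℤ) + 1 + ((i + 1 + 1 : ℕ) : ℤ) = 3 + i by push_cast; ring,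
        show (0 : ℤ) - ((i + 1 + 1 : ℕ) : ℤ) = -2 - i by push_cast; ring]
      exact this.trans ⟨[f 0, f (-1), h 1, h 2], [], by simp⟩
  · rcases i with _ | i
    · exact absurd rfl h0
    · have := zigzag_pair₁ f h (n := N - 1) (i := i) (by omega) (y - 1) (y + 2)
      rw [show y + 1 + ((i + 1 : ℕ) : ℤ) = y + 2 + i by push_cast; ring,
        show y - ((i + 1 : ℕ) : ℤ) = y - 1 - i by push_cast; ring]
      exact this.trans ⟨[h (y + 1)], [], by simp⟩

/-- The zigzag paths contain all pairs whose indices differ by more than one. -/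
theorem kappa_cross (hN : 5 ≤ N) (hf : ∀ i, f (i + 2 * N) = f i) (hh : ∀ i, h (i + 2 * N) = h i)
    {a b : ℤ} (ha0 : 0 ≤ a) (ha : a < 2 * N) (hb0 : 0 ≤ b) (hb : b < 2 * N) (hab : a ≠ b)
    (hab1 : a ≠ b + 1) (hab2 : a + 2 * N ≠ b + 1) :
    (∃ y : ℤ, 0 ≤ y ∧ y < 2 * N ∧ Nb (kappa f h N y) (h a) (f b)) ∨ (a = 2 ∧ b = 2 * N - 1) := by
  obtain ⟨a', ha', haa⟩ : ∃ a', (a' = a ∨ a' = a + 2 * N) ∧ b + 2 ≤ a' ∧ a' < b + 2 * N := by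
    by_cases hlt : b < a
    · exact ⟨a, Or.inl rfl, by omega, by omega⟩
    · exact ⟨a + 2 * N, Or.inr rfl, by omega, by omega⟩
  have hha : h a' = h a := by rcases ha' with rfl | rfl; exacts [rfl, hh a]
  -- The difference of the indices, taken modulo `2 N`, decides by its parity between the steps from
  -- `h` to `f` and those from `f` to `h`; the path is then found from the mean of the two indices.
  obtain ⟨i, hi⟩ : ∃ i : ℕ, a' = b + 2 * i + 2 ∨ a' = b + 2 * i + 1 := by
    refine ⟨((a' - b - 1) / 2).toNat, ?_⟩
    omega
  -- reduce the index of the path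
  have hred : ∀ y : ℤ, 0 ≤ y → y < 4 * N → ∃ y' : ℤ, 0 ≤ y' ∧ y' < 2 * N ∧ (y' = y ∨ y' = y - 2 * N) := by
    intro y h0 h1
    by_cases h : y < 2 * N
    · exact ⟨y, h0, h, Or.inl rfl⟩
    · exact ⟨y - 2 * N, by omega, by omega, Or.inr rfl⟩
  have hper : ∀ y' y x : ℤ, (y' = y ∨ y' = y - 2 * N) → h (y' + x) = h (y + x) ∧ f (y' + x) = f (y + x) := by
    rintro y' y x (rfl | rfl)
    · exact ⟨rfl, rfl⟩
    · rw [← hh, ← hf]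
      rw [show y - 2 * (N : ℤ) + x + 2 * N = y + x by ring]
      exact ⟨rfl, rfl⟩
  rcases hi with hi | hi
  · obtain ⟨y', h0, h1, h2⟩ := hred (b + i + 1) (by omega) (by omega)
    left
    refine ⟨y', h0, h1, ?_⟩
    have := kappa_nb₂ (f := f) (h := h) hN y' (i := i) (by omega)
    rw [show y' + 1 + (i : ℤ) = y' + (1 + i) by ring, (hper _ _ _ h2).1,
      show y' - 1 - (i : ℤ) = y' + (-1 - i) by ring, (hper _ _ _ h2).2] at this
    rwa [show b + i + 1 + (1 + (i : ℤ)) = a' by rw [hi]; ring, hha,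
      show b + i + 1 + (-1 - (i : ℤ)) = b by ring] at this
  · obtain ⟨y', h0, h1, h2⟩ := hred (b + i) (by omega) (by omega)
    by_cases hs : y' = 0 ∧ i = 1
    · right
      omega
    · left
      refine ⟨y', h0, h1, ?_⟩
      have := kappa_nb₁ (f := f) (h := h) (N := N) y' (i := i) (by omega) (by omega)
        (fun h h' => hs ⟨h, h'⟩)
      rw [show y' + 1 + (i : ℤ) = y' + (1 + i) by ring, (hper _ _ _ h2).1,
        show y' - (i : ℤ) = y' + (-i) by ring, (hper _ _ _ h2).2] at this
      rwa [show b + i + (1 + (i : ℤ)) = a' by rw [hi]; ring, hha,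
        show b + i + (-(i : ℤ)) = b by ring] at this

end Kappa

theorem EPlus.distinct {N : ℕ} {V : Type} [Fintype V] [DecidableEq V] (E : EPlus N V) (x y : V)
    (h : [x, y].Sublist E.o ∨ [y, x].Sublist E.o) : y ≠ x ∧ y ≠ E.par x := by
  have h1 : x ∈ E.line none ∧ y ∈ E.line none :=
    h.elim (fun h => ⟨h.subset (by simp), h.subset (by simp)⟩)
      fun h => ⟨h.subset (by simp), h.subset (by simp)⟩
  have hn := E.nodup_line none
  refine ⟨?_, ?_⟩
  · rcases h with h | h <;> have := hn.sublist h <;> simp at this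
    · exact Ne.symm this
    · exact this
  · rintro rfl
    exact E.not_mem_both h1.1 h1.2

/-- Prescribing the partner of `z` at position `k` amounts to putting `z` at index `k + N`. -/
theorem exists_coord_three {N : ℕ} {V : Type} [Fintype V] [DecidableEq V] (hN : 5 ≤ N)
    (E : EPlus N V) (i j k : Fin N) (x y z : V) (hij : i ≠ j) (hik : i ≠ k) (hjk : j ≠ k)
    (hxy : y ≠ x ∧ y ≠ E.par x) (hxz : z ≠ x ∧ z ≠ E.par x) (hyz : z ≠ y ∧ z ≠ E.par y) :
    ∃ c : Coord N E.par, c.u (i : ℕ) = x ∧ c.u (j : ℕ) = y ∧ c.u (k : ℕ) = E.par z := by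
  have hflip : ∀ a b, a = E.par b → b = E.par a := by rintro a b rfl; rw [E.par_par]
  obtain ⟨c, hc⟩ := exists_coord N (by omega) E.par E.par_par E.par_ne E.card
    (fun l => if l = i then some x else if l = j then some y else if l = k then some (E.par z) else none) (by
      intro l l' u w h1 h2 h3
      have f1 := hflip x y
      have f2 := hflip x z
      have f3 := hflip y z
      have f4 := hflip (E.par z) x
      have f5 := hflip (E.par z) y
      have f6 := E.par_par z
      have f7 : ∀ a b, E.par a = E.par b → a = b := fun a b h => by
        rw [← E.par_par a, h, E.par_par]
      have f8 := f7 z x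
      have f9 := f7 z y
      split_ifs at h1 h2 <;> simp only [Option.some.injEq] at h1 h2 <;> subst h1 <;>
        subst h2 <;> grind)
  refine ⟨c, hc i x (by simp), hc j y (by simp [hij.symm]), hc k _ (by simp [hik.symm, hjk.symm])⟩

/-- Coordinates for the first factor of a composition. -/
theorem EPlus.exists_left {N : ℕ} {V : Type} [Fintype V] [DecidableEq V] (hN : 5 ≤ N)
    (E : EPlus N V) : ∃ c : Coord N E.par, c.u 1 = E.X2 ∧ c.u 2 = E.X ∧ c.u (3 + N) = E.Y := by
  -- Indices 1 and 2 belong to the edge `h 1 h 2` of the exceptional zigzag. Index `3 + N` for `Y`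
  -- is free of these labels and is fixed by both matchings of path ends used below.
  obtain ⟨c, h1, h2, h3⟩ := exists_coord_three hN E ⟨1, by omega⟩ ⟨2, by omega⟩ ⟨3, by omega⟩
    E.X2 E.X E.Y (by simp) (by simp) (by simp)
    (E.distinct _ _ (Or.inr (by simp [EPlus.o])))
    (E.distinct _ _ (Or.inl (by simp [EPlus.o])))
    (E.distinct _ _ (Or.inl (by simp [EPlus.o])))
  refine ⟨c, by simpa using h1, by simpa using h2, ?_⟩
  rw [c.u_add, ← E.par_par E.Y, ← h3]; rfl

/-- Coordinates for the second factor of a composition. -/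
theorem EPlus.exists_right {N : ℕ} {V : Type} [Fintype V] [DecidableEq V] (hN : 5 ≤ N)
    (E : EPlus N V) : ∃ c : Coord N E.par, c.u 0 = E.Y2 ∧ c.u (-1) = E.Y ∧ c.u (3 + N) = E.X := by
  have hd : [E.X, E.Y].Sublist E.o := by simp [EPlus.o]
  have hflip : ∀ a b, (b ≠ a ∧ b ≠ E.par a) → (b ≠ E.par a ∧ b ≠ E.par (E.par a)) := by
    intro a b h; rw [E.par_par]; exact h.symm
  -- Indices 0 and -1 belong to the edge `f 0 f (-1)` of the exceptional zigzag. `X` gets the index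
  -- of `Y` in the first factor, so that the path from `X` to `Y` is continued by the path from `X`.
  -- Since `N ≥ 5`, the positions 0, 3 and `N - 1` differ.
  obtain ⟨c, h1, h2, h3⟩ := exists_coord_three hN E ⟨0, by omega⟩ ⟨N - 1, by omega⟩ ⟨3, by omega⟩
    E.Y2 (E.par E.Y) E.X (by simp; omega) (by simp) (by simp; omega)
    (by
      obtain ⟨h1, h2⟩ := E.distinct E.Y E.Y2 (Or.inr (by
        simpa [EPlus.o] using (List.suffix_append (E.X :: E.X2 :: E.mid) [E.Y2, E.Y]).sublist))
      exact ⟨h2.symm, fun h => h1 (by rw [← E.par_par E.Y2, ← h, E.par_par])⟩)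
    (E.distinct _ _ (Or.inr (by simp [EPlus.o])))
    (hflip _ _ (E.distinct _ _ (Or.inr hd)))
  refine ⟨c, by simpa using h1, ?_, ?_⟩
  · have h4 := c.u_sub_two E.par_par (((N - 1 : ℕ) : ℤ) + N)
    rw [c.u_add, show c.u ((N - 1 : ℕ) : ℤ) = _ from h2, E.par_par] at h4
    rw [← h4]
    congr 1
    omega
  · rw [c.u_add, ← E.par_par E.X, ← h3]; rfl

end HamFrag

namespace HamFrag

section Matching

variable {N : ℕ} {V W : Type} [Fintype V] [DecidableEq V] [Fintype W] [DecidableEq W]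
  (E : EPlus N V) (F : EPlus N W)

/-- The matching of the paths of two decompositions that joins ends with index `i` to heads with
index `π i`. -/
theorem exists_path_matching (c : Coord N E.par) (d : Coord N F.par) (π : ℤ → ℤ)
    (hπ : ∀ j : ℤ, 0 ≤ j → j < 2 * N → ∃ i : ℤ, 0 ≤ i ∧ i < 2 * N ∧ π i = j) :
    ∃ J : V ≃ W, ∀ a, J a = d.u (π (c.idx (E.fin a))) := by
  refine ⟨Equiv.ofBijective (fun a => d.u (π (c.idx (E.fin a)))) ?_, fun a => rfl⟩
  refine (Fintype.bijective_iff_surjective_and_card _).2 ⟨fun w => ?_, by rw [E.card, F.card]⟩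
  obtain ⟨i, h0, h1, h2⟩ := hπ _ (d.idx_nonneg w) (d.idx_lt w)
  obtain ⟨a, ha⟩ := E.fin_surj (c.u i)
  exact ⟨a, by simp only [ha, c.idx_u h0 h1, h2, d.u_idx]⟩

variable {E F}

theorem Coord.mem_window (c : Coord N E.par) (hN : 0 < N) {β : Type*} (f : V → β) (l : List β) (a : ℤ)
    (h : ∀ i : ℕ, i < N → f (c.u (a + i)) ∈ l) (x : V) : f x ∈ l ∨ f (E.par x) ∈ l := by
  obtain ⟨i, hi, hx | hx⟩ := c.window E.par_par hN x a
  · rw [hx]; exact Or.inl (h i hi)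
  · rw [hx]; exact Or.inr (h i hi)

theorem Coord.mem_window_rev (c : Coord N E.par) (hN : 0 < N) {β : Type*} (f : V → β) (l : List β) (a : ℤ)
    (h : ∀ i : ℕ, i < N → f (c.u (a - i)) ∈ l) (x : V) : f x ∈ l ∨ f (E.par x) ∈ l := by
  refine c.mem_window hN f l (a - N + 1) (fun i hi => ?_) x
  have := h (N - 1 - i) (by omega)
  rwa [show a - ((N - 1 - i : ℕ) : ℤ) = a - N + 1 + i by omega] at this

variable {T : Type} (c : Coord N E.par) (d : Coord N F.par)

/-- The vertices of the second factor of a composition, by coordinates. -/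
def vR (T : Type) (d : Coord N F.par) (i : ℤ) : V ⊕ (W ⊕ T) := Sum.inr (Sum.inl (d.u i))

/-- The vertices of the first factor of a composition, by coordinates. -/
def vL (W T : Type) (c : Coord N E.par) (i : ℤ) : V ⊕ (W ⊕ T) := Sum.inl (c.u i)

theorem kappa_crossing (hN : 5 ≤ N) (x : V) (y : W) (h0 : c.idx x ≠ d.idx y)
    (h1 : c.idx x ≠ d.idx y + 1) (h2 : c.idx x + 2 * N ≠ d.idx y + 1) :
    (∃ j : ℤ, 0 ≤ j ∧ j < 2 * N ∧ Nb (kappa (vR (V := V) T d) (vL W T c) N j)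
      (Sum.inl x) (Sum.inr (Sum.inl y))) ∨ (x = c.u 2 ∧ y = d.u (-1)) := by
  have := kappa_cross (f := vR (V := V) T d) (h := vL W T c) hN
    (fun i => by simp [vR, d.u_add_two F.par_par]) (fun i => by simp [vL, c.u_add_two E.par_par])
    (c.idx_nonneg x) (c.idx_lt x) (d.idx_nonneg y) (d.idx_lt y) h0 h1 h2
  rcases this with h | h
  · left
    simpa only [vR, vL, c.u_idx, d.u_idx] using h
  · right
    rw [← c.u_idx x, h.1, ← d.u_idx y, h.2, ← d.u_sub_two F.par_par]
    exact ⟨rfl, by congr 1; ring⟩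

theorem memV_kappa (hN : 5 ≤ N) (j : ℤ) (x : V) :
    Sum.inl x ∈ kappa (vR (V := V) T d) (vL W T c) N j ∨
      Sum.inl (E.par x) ∈ kappa (vR (V := V) T d) (vL W T c) N j :=
  c.mem_window (by omega) Sum.inl _ (j + 1)
    (fun _ hi => mem_kappa_h (f := vR (V := V) T d) (h := vL W T c) j hi) x

theorem memW_kappa (hN : 5 ≤ N) (j : ℤ) (l : List (V ⊕ (W ⊕ T)))
    (hl : kappa (vR (V := V) T d) (vL W T c) N j ⊆ l) (hj : j ≠ 0 → vR T d j ∈ l) (y : W) :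
    Sum.inr (Sum.inl y) ∈ l ∨ Sum.inr (Sum.inl (F.par y)) ∈ l := by
  refine d.mem_window_rev (by omega) (fun y => Sum.inr (Sum.inl y)) _ j (fun i hi => ?_) y
  by_cases h0 : j = 0 ∨ i ≠ 0
  · exact hl (mem_kappa_f (f := vR (V := V) T d) (h := vL W T c) j hi h0)
  · push Not at h0
    have := hj h0.1
    rw [h0.2]
    simpa [vR] using this

theorem kappa_zero_nb : Nb (kappa (vR (V := V) T d) (vL W T c) N 0) (vR T d (-1)) (vR T d 0) ∧
    Nb (kappa (vR (V := V) T d) (vL W T c) N 0) (vL W T c 2) (vL W T c 1) := by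
  simp only [kappa, if_true]
  refine ⟨?_, ?_⟩
  · exact nb_cons_iff.2 (Or.inr (Or.inl ⟨rfl, rfl⟩))
  · exact nb_cons_iff.2 (Or.inr (Or.inr (nb_cons_iff.2 (Or.inr (Or.inr
      (nb_cons_iff.2 (Or.inr (Or.inl ⟨rfl, rfl⟩))))))))

/-- Cross pairs are sorted by index difference. Difference 0 joins path ends to path heads of equal
index; difference 1 is the first step of the cross path from `f j` to `h (j + 1)`, or for `j = 0`
the link between the transversals; all other differences are in zigzags, except for the closing
pair. -/
theorem exists_joint_empty (hN : 5 ≤ N) (E : EPlus N V) (F : EPlus N W) :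
    Nonempty (Joint E F Empty) := by
  obtain ⟨c, c1, c2, c3⟩ := E.exists_left hN
  obtain ⟨d, d0, d1, d3⟩ := F.exists_right hN
  obtain ⟨J, hJ⟩ := exists_path_matching E F c d id (fun j h0 h1 => ⟨j, h0, h1, rfl⟩)
  let κ : ℤ → List (V ⊕ (W ⊕ Empty)) := fun j => kappa (vR Empty d) (vL W Empty c) N j
  let B : ℤ → List (V ⊕ (W ⊕ Empty)) := fun j => (if j = 0 then [] else [vR Empty d j]) ++ κ j
  have hκ : ∀ j, κ j <:+: B j := fun j => (List.suffix_append _ _).isInfix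
  have hBd : ∀ j : ℤ, 0 ≤ j → j < 2 * N → ∃ z : W ⊕ Empty, B (d.idx (Sum.elim id Empty.elim z)) = B j :=
    fun j h0 h1 => ⟨Sum.inl (d.u j), by simp [d.idx_u h0 h1]⟩
  refine ⟨{
    J := J, parT := id, m := fun _ => [], mo := []
    β := fun z => B (d.idx (Sum.elim id Empty.elim z))
    fβ := fun z => vL W Empty c (d.idx (Sum.elim id Empty.elim z) + N)
    zT := Empty.elim, sT := Empty.elim, tT := Empty.elim, cT := Empty.elim
    parT_parT := fun t => t.elim
    parT_ne := fun t => t.elim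
    eq_parT := fun t => t.elim
    m_len := fun _ => rfl
    m_mem := fun _ t => t.elim
    mo_len := rfl
    mo_mem := fun t => t.elim
    J_X := ?_
    head := ?_
    last := ?_
    fβ_left := ?_
    fβ_right := fun t => t.elim
    zT_par := fun t => t.elim
    len := ?_
    memV := ?_
    memW := ?_
    memT := fun _ t => t.elim
    cross := ?_
    crossX := ?_
    crossY := ?_
    crossV := fun t => t.elim
    crossW := fun t => t.elim
    sT_par := fun t => t.elim
    tT_par := fun t => t.elim
    sT_ne := fun t => t.elim
    chordT := fun t => t.elim
    triT := fun t => t.elim }⟩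
  · rw [hJ, E.fin_X, ← c3, c.idx_u (by omega) (by omega)]
    exact d3
  · rintro (y | t)
    · simp only [B, κ, Sum.elim_inl, id]
      split_ifs with h
      · simp [kappa, h, vR]
        rw [← d.u_idx y, h]
      · simp [vR, d.u_idx]
    · exact t.elim
  · intro z
    simp only [B, κ]
    rw [List.getLast?_append, getLast?_kappa hN]
    rfl
  · intro x
    have h0 := c.idx_nonneg x
    have h1 := c.idx_lt x
    by_cases h : c.idx x < N
    · refine ⟨Sum.inl (d.u (c.idx x + N)), ?_⟩
      simp only [Sum.elim_inl, id, vL]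
      rw [d.idx_u (by omega) (by omega), ← c.u_sub_two E.par_par,
        show c.idx x + N + N - 2 * (N : ℤ) = c.idx x by ring, c.u_idx]
    · refine ⟨Sum.inl (d.u (c.idx x - N)), ?_⟩
      simp only [Sum.elim_inl, id, vL]
      rw [d.idx_u (by omega) (by omega), sub_add_cancel, c.u_idx]
  · intro z
    have := length_kappa (f := vR (V := V) Empty d) (h := vL W Empty c) hN
      (d.idx (Sum.elim id Empty.elim z))
    simp only [B, κ, List.length_append]
    split_ifs at this ⊢ <;> simp <;> omega
  · intro z x
    exact (memV_kappa c d hN _ x).imp (fun h => (hκ _).subset h) fun h => (hκ _).subset h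
  · intro z y
    refine memW_kappa c d hN _ _ (hκ _).subset (fun h => ?_) y
    simp only [B, if_neg h]
    simp
  · intro x y
    by_cases h0 : c.idx x = d.idx y
    · left
      obtain ⟨a, rfl⟩ := E.fin_surj x
      exact ⟨a, rfl, by rw [hJ, h0, id, d.u_idx], rfl⟩
    by_cases h1 : c.idx x = d.idx y + 1 ∨ c.idx x + 2 * N = d.idx y + 1
    · have hx : x = c.u (d.idx y + 1) := by
        rcases h1 with h1 | h1
        · rw [← h1, c.u_idx]
        · rw [← h1, c.u_add_two E.par_par, c.u_idx]
      by_cases hy : d.idx y = 0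
      · refine Or.inr (Or.inr (Or.inl ⟨?_, ?_, rfl⟩))
        · rw [hx, hy, ← c1]; rfl
        · rw [← d.u_idx y, hy, d0]
      · refine Or.inr (Or.inl ⟨Sum.inl y, ?_⟩)
        simp only [Sum.elim_inl, id, B, κ, kappa, if_neg hy]
        refine nb_cons_iff.2 (Or.inr (Or.inl ⟨?_, ?_⟩))
        · rw [hx]; rfl
        · simp [vR, d.u_idx]
    · push Not at h1
      rcases kappa_crossing (T := Empty) c d hN x y h0 h1.1 h1.2 with ⟨j, j0, j1, hj⟩ | ⟨h, h'⟩
      · obtain ⟨z, hz⟩ := hBd j j0 j1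
        exact Or.inr (Or.inl ⟨z, by rw [hz]; exact hj.mono (hκ j)⟩)
      · exact Or.inr (Or.inr (Or.inr ⟨h.trans c2, h'.trans d1⟩))
  · obtain ⟨z, hz⟩ := hBd 0 le_rfl (by omega)
    refine ⟨z, ?_⟩
    rw [hz, ← c2, ← c1]
    exact (kappa_zero_nb c d).2.mono (hκ 0)
  · obtain ⟨z, hz⟩ := hBd 0 le_rfl (by omega)
    refine ⟨z, ?_⟩
    rw [hz, ← d1, ← d0]
    exact (kappa_zero_nb c d).1.mono (hκ 0)

end Matching

end HamFrag

/-! ### Composition with one further label -/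

namespace HamFrag

variable {N : ℕ} {V W : Type} [Fintype V] [DecidableEq V] [Fintype W] [DecidableEq W]

section Lines

variable {α : Type*} (f h : ℤ → α) (g : Bool → α) (N : ℕ)

/-- What precedes the zigzag path with index `j`. -/
def zigPre (j : ℤ) : List α :=
  -- Inserting a half of the new label between `f j` and `h (j + 1)` covers its pairs with these
  -- points and frees the pair of difference one for the stairs. At `N - 1` and `2 * N - 1` the new
  -- half comes first, so that both halves start a path.
  if j = 0 then [] else if j ≤ N - 2 then [f j, g false] else if j = N - 1 then [g false, f j]
  else if j = N then [f j] else if j ≤ 2 * N - 2 then [f j, g true] else [g true, f j]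

/-- What follows the zigzag path with index `j`. -/
def zigSuf (j : ℤ) : List α := if j = 0 then [g true] else if j = N then [g false] else []

/-- The path with index `j` of a composition with one further label. -/
def zigLine (j : ℤ) : List α := zigPre f g N j ++ (kappa f h N j ++ zigSuf g N j)

/-- The two paths of a composition with one further label that are no zigzag paths. -/
def stairs : Bool → List α
  | true => zigzag f (fun i => h (-i)) (N - 1) (2 * N - 1) (-(2 * N - 1)) ++ [g true, f N, h N]
  -- This path misses both halves of the new label; its colour therefore receives the rung of that
  -- label.
  | false => zigzag f (fun i => h (-i)) N (N - 1) (-(N - 1))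

variable {f h g N}

theorem kappa_infix_zigLine (j : ℤ) : kappa f h N j <:+: zigLine f h g N j :=
  ⟨zigPre f g N j, zigSuf g N j, by simp [zigLine]⟩

theorem zigLine_zero : zigLine f h g N 0 = kappa f h N 0 ++ [g true] := by
  simp [zigLine, zigPre, zigSuf]

theorem zigLine_low {j : ℤ} (h0 : j ≠ 0) (h1 : j ≤ N - 2) :
    zigLine f h g N j = f j :: g false :: h (j + 1) :: zigzag f h (N - 1) (j - 1) (j + 2) := by
  have : j ≠ N := by omega
  simp [zigLine, zigPre, zigSuf, h0, h1, this, kappa]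

theorem zigLine_mid (hN : 5 ≤ N) : zigLine f h g N (N - 1) =
    g false :: f (N - 1) :: h N :: zigzag f h (N - 1) (N - 2) (N + 1) := by
  have h0 : (N : ℤ) - 1 ≠ 0 := by omega
  have h1 : ¬ (N : ℤ) - 1 ≤ N - 2 := by omega
  have h2 : ¬ (N : ℤ) - 1 = N := by omega
  simp only [zigLine, zigPre, zigSuf, kappa, if_neg h0, if_neg h1, if_neg h2, if_true]
  simp [show (N : ℤ) - 1 - 1 = N - 2 by ring, show (N : ℤ) - 1 + 2 = N + 1 by ring]

theorem zigLine_N (hN : 5 ≤ N) : zigLine f h g N N =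
    f N :: h (N + 1) :: (zigzag f h (N - 1) (N - 1) (N + 2) ++ [g false]) := by
  have h0 : (N : ℤ) ≠ 0 := by omega
  have h1 : ¬ (N : ℤ) ≤ N - 2 := by omega
  have h2 : ¬ (N : ℤ) = N - 1 := by omega
  simp only [zigLine, zigPre, zigSuf, kappa, if_neg h0, if_neg h1, if_neg h2, if_true]
  simp

theorem zigLine_high {j : ℤ} (h0 : N < j) (h1 : j ≤ 2 * N - 2) :
    zigLine f h g N j = f j :: g true :: h (j + 1) :: zigzag f h (N - 1) (j - 1) (j + 2) := by
  have e1 : j ≠ 0 := by omega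
  have e2 : ¬ j ≤ N - 2 := by omega
  have e3 : ¬ j = N - 1 := by omega
  have e4 : ¬ j = N := by omega
  simp [zigLine, zigPre, zigSuf, h1, e1, e2, e3, e4, kappa]

theorem zigLine_top (hN : 5 ≤ N) : zigLine f h g N (2 * N - 1) =
    g true :: f (2 * N - 1) :: h (2 * N) :: zigzag f h (N - 1) (2 * N - 2) (2 * N + 1) := by
  have e1 : (2 * N - 1 : ℤ) ≠ 0 := by omega
  have e2 : ¬ (2 * N - 1 : ℤ) ≤ N - 2 := by omega
  have e3 : ¬ (2 * N - 1 : ℤ) = N - 1 := by omega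
  have e4 : ¬ (2 * N - 1 : ℤ) = N := by omega
  have e5 : ¬ (2 * N - 1 : ℤ) ≤ 2 * N - 2 := by omega
  simp only [zigLine, zigPre, zigSuf, kappa, if_neg e1, if_neg e2, if_neg e3, if_neg e4, if_neg e5]
  simp [show 2 * (N : ℤ) - 1 - 1 = 2 * N - 2 by ring, show 2 * (N : ℤ) - 1 + 2 = 2 * N + 1 by ring]

theorem length_zigLine (hN : 5 ≤ N) (j : ℤ) :
    (zigLine f h g N j).length = 2 * N + 1 := by
  have := length_kappa (f := f) (h := h) hN j
  simp only [zigLine, zigPre, zigSuf, List.length_append]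
  split_ifs at this ⊢ <;> simp <;> omega

theorem mem_zigLine (hN : 5 ≤ N) (j : ℤ) : (j ≠ 0 → f j ∈ zigLine f h g N j) ∧
    ∃ b, g b ∈ zigLine f h g N j := by
  simp only [zigLine, zigPre, zigSuf]
  by_cases h0 : j = 0
  · exact ⟨fun h => absurd h0 h, true, by simp [h0]⟩
  · by_cases h1 : j ≤ N - 2 ∨ j = N - 1 ∨ j = N
    · refine ⟨fun _ => ?_, false, ?_⟩ <;> split_ifs <;> simp <;> omega
    · refine ⟨fun _ => ?_, true, ?_⟩ <;> split_ifs <;> simp <;> omega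

theorem getLast?_zigLine (hN : 5 ≤ N) (j : ℤ) : (zigLine f h g N j).getLast? =
    some (if j = 0 then g true else if j = N then g false else h (j + N)) := by
  simp only [zigLine, List.getLast?_append, getLast?_kappa hN, zigSuf]
  split_ifs <;> simp

theorem stairs_pair₁ (hN : 5 ≤ N) {j : ℤ} (h0 : 0 ≤ j) (h1 : j < 2 * N) :
    ∃ b, Nb (stairs f h g N b) (h j) (f j) := by
  rcases lt_trichotomy j N with hj | hj | hj
  · have := zigzag_pair₁ f (fun i => h (-i)) (n := N) (i := (N - 1 - j).toNat) (by omega)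
      (N - 1) (-(N - 1))
    refine ⟨false, Or.inr ?_⟩
    rwa [show (N : ℤ) - 1 - ((N - 1 - j).toNat : ℤ) = j by omega,
      show -(-((N : ℤ) - 1) + ((N - 1 - j).toNat : ℤ)) = j by omega] at this
  · subst hj
    exact ⟨true, Or.inr ⟨_ ++ [g true], [], by simp [stairs]; rfl⟩⟩
  · have := zigzag_pair₁ f (fun i => h (-i)) (n := N - 1) (i := (2 * N - 1 - j).toNat) (by omega)
      (2 * N - 1) (-(2 * N - 1))
    refine ⟨true, Or.inr (List.IsInfix.trans ?_ (List.prefix_append _ _).isInfix)⟩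
    rwa [show 2 * (N : ℤ) - 1 - ((2 * N - 1 - j).toNat : ℤ) = j by omega,
      show -(-(2 * (N : ℤ) - 1) + ((2 * N - 1 - j).toNat : ℤ)) = j by omega] at this

theorem stairs_low (hN : 5 ≤ N) {j : ℤ} (h0 : 0 ≤ j) (h1 : j ≤ N - 2) :
    Nb (stairs f h g N false) (h (j + 1)) (f j) := by
  have := zigzag_pair₂ f (fun i => h (-i)) (n := N) (i := (N - 2 - j).toNat) (by omega)
    (N - 1) (-(N - 1))
  refine Or.inl ?_
  rwa [show (N : ℤ) - 1 - ((N - 2 - j).toNat : ℤ) - 1 = j by omega,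
    show -(-((N : ℤ) - 1) + ((N - 2 - j).toNat : ℤ)) = j + 1 by omega] at this

theorem stairs_high (hN : 5 ≤ N) {j : ℤ} (h0 : N < j) (h1 : j ≤ 2 * N - 2) :
    Nb (stairs f h g N true) (h (j + 1)) (f j) := by
  have := zigzag_pair₂ f (fun i => h (-i)) (n := N - 1) (i := (2 * N - 2 - j).toNat) (by omega)
    (2 * N - 1) (-(2 * N - 1))
  refine Or.inl (List.IsInfix.trans ?_ (List.prefix_append _ _).isInfix)
  rwa [show 2 * (N : ℤ) - 1 - ((2 * N - 2 - j).toNat : ℤ) - 1 = j by omega,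
    show -(-(2 * (N : ℤ) - 1) + ((2 * N - 2 - j).toNat : ℤ)) = j + 1 by omega] at this

theorem stairs_true (hN : 5 ≤ N) : [h (N + 1), g true] <:+: stairs f h g N true ∧
    [g true, f N] <:+: stairs f h g N true := by
  refine ⟨pair_infix_append ?_ rfl, ⟨zigzag f (fun i => h (-i)) (N - 1) (2 * N - 1) (-(2 * N - 1)), [h N], by simp [stairs]⟩⟩
  obtain ⟨n, rfl⟩ : ∃ n, N = n + 2 := ⟨N - 2, by omega⟩
  rw [show n + 2 - 1 = n + 1 by omega, getLast?_zigzag]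
  congr 2; push_cast; ring

theorem mem_stairs_h (hN : 5 ≤ N) (b : Bool) {i : ℕ} (hi : i < N) :
    h ((if b then N else 0) + i) ∈ stairs f h g N b := by
  cases b
  · have := mem_zigzag₂ f (fun i => h (-i)) (n := N) (i := N - 1 - i) (by omega) (N - 1) (-(N - 1))
    simp only [Bool.false_eq_true, if_false, stairs]
    rwa [show -(-((N : ℤ) - 1) + ((N - 1 - i : ℕ) : ℤ)) = 0 + i by omega] at this
  · simp only [if_true, stairs]
    rcases Nat.eq_zero_or_pos i with rfl | h0
    · simp
    · have := mem_zigzag₂ f (fun i => h (-i)) (n := N - 1) (i := N - 1 - i) (by omega) (2 * N - 1)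
        (-(2 * N - 1))
      rw [show -(-(2 * (N : ℤ) - 1) + ((N - 1 - i : ℕ) : ℤ)) = N + i by omega] at this
      exact List.mem_append_left _ this

theorem mem_stairs_f (hN : 5 ≤ N) (b : Bool) {i : ℕ} (hi : i < N) :
    f ((if b then N else 0) + i) ∈ stairs f h g N b := by
  cases b
  · have := mem_zigzag₁ f (fun i => h (-i)) (n := N) (i := N - 1 - i) (by omega) (N - 1) (-(N - 1))
    simp only [Bool.false_eq_true, if_false, stairs]
    rwa [show (N : ℤ) - 1 - ((N - 1 - i : ℕ) : ℤ) = 0 + i by omega] at this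
  · simp only [if_true, stairs]
    rcases Nat.eq_zero_or_pos i with rfl | h0
    · simp
    · have := mem_zigzag₁ f (fun i => h (-i)) (n := N - 1) (i := N - 1 - i) (by omega) (2 * N - 1)
        (-(2 * N - 1))
      rw [show 2 * (N : ℤ) - 1 - ((N - 1 - i : ℕ) : ℤ) = N + i by omega] at this
      exact List.mem_append_left _ this

theorem getLast?_stairs (hN : 5 ≤ N) (b : Bool) :
    (stairs f h g N b).getLast? = some (h (if b then N else 0)) := by
  cases b
  · obtain ⟨n, rfl⟩ : ∃ n, N = n + 1 := ⟨N - 1, by omega⟩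
    simp only [stairs, Bool.false_eq_true, if_false]
    rw [getLast?_zigzag]
    congr 2; push_cast; ring
  · simp [stairs, List.getLast?_append]

theorem head?_stairs (hN : 5 ≤ N) (b : Bool) :
    (stairs f h g N b).head? = some (f (if b then 2 * N - 1 else N - 1)) := by
  cases b
  · simp only [stairs, Bool.false_eq_true, if_false]
    exact head?_zigzag (by omega) _ _
  · simp only [stairs, if_true]
    rw [List.head?_append, head?_zigzag (by omega)]
    rfl

theorem length_stairs (hN : 5 ≤ N) (b : Bool) :
    (stairs f h g N b).length = 2 * N + if b then 1 else 0 := by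
  cases b
  · simp [stairs, length_zigzag]
  · simp [stairs, length_zigzag]; omega

end Lines

/-- The continued paths now pass through a half of the new label, so they no longer take the pairs
of difference 0. These and most pairs of difference 1 are taken by the two stairs, which start at
the heads `f (N - 1)` and `f (2 * N - 1)` given up by the zigzag lines. The remaining pairs of the
new halves occur at ends of two lines, in one staircase, and in the transversal. -/
theorem exists_joint_bool (hN : 5 ≤ N) (E : EPlus N V) (F : EPlus N W) :
    Nonempty (Joint E F Bool) := by
  obtain ⟨c, c1, c2, c3⟩ := E.exists_left hN
  obtain ⟨d, d0, d1, d3⟩ := F.exists_right hN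
  -- The shift below `N` makes the path ending at index 2 continue, through the half `true`, at
  -- index 1. With the line of index 1, which runs through `f 1`, the half `false` and `h 2`, this
  -- provides both triples of the new gadget, and its chord is a step of the stairs.
  obtain ⟨J, hJ⟩ := exists_path_matching E F c d
    (fun i => if N ≤ i then i else if i = 0 then N - 1 else i - 1) (fun j h0 h1 => by
      by_cases hj : N ≤ j
      · exact ⟨j, h0, h1, if_pos hj⟩
      · by_cases hj' : j = N - 1
        · exact ⟨0, le_rfl, by omega, by rw [if_neg (by omega), if_pos rfl, hj']⟩
        · exact ⟨j + 1, by omega, by omega, by rw [if_neg (by omega), if_neg (by omega)]; ring⟩)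
  let f : ℤ → V ⊕ (W ⊕ Bool) := vR Bool d
  let h : ℤ → V ⊕ (W ⊕ Bool) := vL W Bool c
  let g : Bool → V ⊕ (W ⊕ Bool) := fun b => Sum.inr (Sum.inr b)
  have hh : ∀ i, h (i + 2 * N) = h i := fun i => by simp [h, vL, c.u_add_two E.par_par]
  let B : ℤ → List (V ⊕ (W ⊕ Bool)) := zigLine f h g N
  let β : W ⊕ Bool → List (V ⊕ (W ⊕ Bool)) := fun z => match z with
    | Sum.inl w => if d.idx w = N - 1 then stairs f h g N false else
        if d.idx w = 2 * N - 1 then stairs f h g N true else B (d.idx w)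
    | Sum.inr b => B (if b then 2 * N - 1 else N - 1)
  have hβB : ∀ z, (∃ b, β z = stairs f h g N b ∧ z = Sum.inl (d.u (if b then 2 * N - 1 else N - 1)))
      ∨ ∃ j, 0 ≤ j ∧ β z = B j := by
    rintro (w | b)
    · by_cases h1 : d.idx w = N - 1
      · exact Or.inl ⟨false, by simp [β, h1], by simp [← h1, d.u_idx]⟩
      · by_cases h2 : d.idx w = 2 * N - 1
        · refine Or.inl ⟨true, ?_, by simp [← h2, d.u_idx]⟩
          simp only [β, if_neg h1, if_pos h2]
        · exact Or.inr ⟨d.idx w, d.idx_nonneg w, by simp only [β, if_neg h1, if_neg h2]⟩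
    · exact Or.inr ⟨if b then 2 * N - 1 else N - 1, by split_ifs <;> omega, rfl⟩
  have hst : ∀ b, ∃ z, β z = stairs f h g N b := by
    rintro (_ | _)
    · refine ⟨Sum.inl (d.u (N - 1)), ?_⟩
      simp only [β, d.idx_u (show (0 : ℤ) ≤ N - 1 by omega) (by omega), if_true]
    · refine ⟨Sum.inl (d.u (2 * N - 1)), ?_⟩
      simp only [β, d.idx_u (show (0 : ℤ) ≤ 2 * N - 1 by omega) (by omega), if_true]
      rw [if_neg (by omega)]
  have hBz : ∀ j : ℤ, 0 ≤ j → j < 2 * N → ∃ z, β z = B j := by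
    intro j h0 h1
    by_cases hj : j = N - 1
    · exact ⟨Sum.inr false, by simp [β, hj]⟩
    · by_cases hj' : j = 2 * N - 1
      · exact ⟨Sum.inr true, by simp [β, hj']⟩
      · exact ⟨Sum.inl (d.u j), by simp only [β, d.idx_u h0 h1, if_neg hj, if_neg hj']⟩
  have hBnb : ∀ j : ℤ, 0 ≤ j → j < 2 * N → ∀ x y, Nb (B j) x y → ∃ z, Nb (β z) x y := by
    intro j h0 h1 x y hxy
    obtain ⟨z, hz⟩ := hBz j h0 h1
    exact ⟨z, by rw [hz]; exact hxy⟩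
  have hSnb : ∀ b, ∀ x y, Nb (stairs f h g N b) x y → ∃ z, Nb (β z) x y := by
    intro b x y hxy
    obtain ⟨z, hz⟩ := hst b
    exact ⟨z, by rw [hz]; exact hxy⟩
  obtain ⟨a0, ha0⟩ := E.fin_surj (c.u 2)
  have hidx2 : c.idx (c.u 2) = 2 := c.idx_u (by omega) (by omega)
  have hfx : ∀ x, (Sum.inl x : V ⊕ (W ⊕ Bool)) = h (c.idx x) := fun x => by simp [h, vL, c.u_idx]
  have hfy : ∀ y, (Sum.inr (Sum.inl y) : V ⊕ (W ⊕ Bool)) = f (d.idx y) :=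
    fun y => by simp [f, vR, d.u_idx]
  refine ⟨{
    J := J, parT := not
    m := fun a => if c.idx (E.fin a) < N then [true] else [false]
    mo := [false]
    β := β
    fβ := fun z => match z with
      | Sum.inl w => if d.idx w = N - 1 then h 0 else if d.idx w = 2 * N - 1 then h N else
          if d.idx w = 0 then g true else if d.idx w = N then g false else h (d.idx w + N)
      | Sum.inr b => h ((if b then 2 * (N : ℤ) - 1 else N - 1) + N)
    zT := fun _ => Sum.inl (d.u (N - 1))
    sT := fun _ => d.u 1
    tT := fun _ => c.u 2
    cT := fun t => if t then Sum.inl a0 else Sum.inr (Sum.inl (d.u 1))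
    parT_parT := by decide
    parT_ne := by decide
    eq_parT := by decide
    m_len := fun a => by split_ifs <;> rfl
    m_mem := fun a t => by split_ifs <;> cases t <;> simp
    mo_len := rfl
    mo_mem := by decide
    J_X := ?_
    head := ?_
    last := ?_
    fβ_left := ?_
    fβ_right := ?_
    zT_par := fun _ => rfl
    len := ?_
    memV := ?_
    memW := ?_
    memT := ?_
    cross := ?_
    crossX := ?_
    crossY := ?_
    crossV := ?_
    crossW := ?_
    sT_par := fun _ => rfl
    tT_par := fun _ => rfl
    sT_ne := ?_
    chordT := ?_
    triT := ?_ }⟩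
  · rw [hJ, E.fin_X, ← c3, c.idx_u (by omega) (by omega), if_pos (by omega)]
    exact d3
  · rintro (y | b)
    · simp only [β]
      split_ifs with h1 h2
      · rw [head?_stairs hN, hfy, h1]; rfl
      · rw [head?_stairs hN, hfy, h2]; rfl
      · rw [hfy]
        have k0 := d.idx_nonneg y
        have k1 := d.idx_lt y
        by_cases h3 : d.idx y = 0
        · simp [B, h3, zigLine_zero, kappa]
        · by_cases h4 : d.idx y ≤ N - 2
          · simp [B, zigLine_low h3 h4]
          · by_cases h5 : d.idx y = N
            · simp [B, h5, zigLine_N hN]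
            · simp [B, zigLine_high (show (N : ℤ) < d.idx y by omega) (by omega)]
    · cases b
      · simp [β, B, zigLine_mid hN, g]
      · simp [β, B, zigLine_top hN, g]
  · rintro (y | b)
    · simp only [β]
      split_ifs with h1 h2 h3 h4
      · simpa using getLast?_stairs (f := f) (h := h) (g := g) hN false
      · simpa using getLast?_stairs (f := f) (h := h) (g := g) hN true
      · simp only [B, getLast?_zigLine hN, if_pos h3]
      · simp only [B, getLast?_zigLine hN, if_neg h3, if_pos h4]
      · simp only [B, getLast?_zigLine hN, if_neg h3, if_neg h4]
    · simp only [β, B, getLast?_zigLine hN]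
      rw [if_neg (by split_ifs <;> omega), if_neg (by split_ifs <;> omega)]
  · intro x
    have k0 := c.idx_nonneg x
    have k1 := c.idx_lt x
    rw [hfx]
    by_cases h1 : c.idx x = 0
    · exact ⟨Sum.inl (d.u (N - 1)), by
        simp only [d.idx_u (show (0 : ℤ) ≤ N - 1 by omega) (by omega), if_true, h1]⟩
    by_cases h2 : c.idx x = N
    · exact ⟨Sum.inl (d.u (2 * N - 1)), by
        simp only [d.idx_u (show (0 : ℤ) ≤ 2 * N - 1 by omega) (by omega), if_true, h2]
        rw [if_neg (by omega)]⟩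
    by_cases h3 : c.idx x = N - 1
    · refine ⟨Sum.inr true, ?_⟩
      simp only [if_true, h3]
      rw [← hh (N - 1)]; congr 1; ring
    by_cases h4 : c.idx x = 2 * N - 1
    · refine ⟨Sum.inr false, ?_⟩
      simp only [Bool.false_eq_true, if_false, h4]
      congr 1; ring
    by_cases h5 : c.idx x < N
    · refine ⟨Sum.inl (d.u (c.idx x + N)), ?_⟩
      simp only [d.idx_u (show 0 ≤ c.idx x + N by omega) (by omega)]
      rw [if_neg (by omega), if_neg (by omega), if_neg (by omega), if_neg (by omega), ← hh (c.idx x)]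
      congr 1; ring
    · refine ⟨Sum.inl (d.u (c.idx x - N)), ?_⟩
      simp only [d.idx_u (show 0 ≤ c.idx x - N by omega) (by omega)]
      rw [if_neg (by omega), if_neg (by omega), if_neg (by omega), if_neg (by omega)]
      congr 1; ring
  · rintro (_ | _)
    · refine ⟨Sum.inl (d.u N), ?_⟩
      simp only [d.idx_u (show (0 : ℤ) ≤ N by omega) (by omega), if_true]
      rw [if_neg (by omega), if_neg (by omega), if_neg (by omega)]
    · refine ⟨Sum.inl (d.u 0), ?_⟩
      simp only [d.idx_u (show (0 : ℤ) ≤ 0 by omega) (by omega), if_true]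
      rw [if_neg (by omega), if_neg (by omega)]
  · intro z
    have hflt : ∀ j : ℤ, (Finset.univ.filter fun _ : Bool => (Sum.inl (d.u (N - 1)) : W ⊕ Bool)
        = Sum.inl (d.u j)).card = if d.u (N - 1) = d.u j then 2 else 0 := by
      intro j
      by_cases hj : d.u (N - 1) = d.u j <;> simp [hj]
    rcases z with w | b
    · rw [show w = d.u (d.idx w) from (d.u_idx w).symm, hflt]
      simp only [β, d.u_idx]
      have hinj : d.u (N - 1) = w ↔ d.idx w = N - 1 := by
        refine ⟨fun h => ?_, fun h => by rw [← h, d.u_idx]⟩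
        rw [← h]; exact d.idx_u (by omega) (by omega)
      simp only [hinj, Fintype.card_bool]
      split_ifs with h1 h2
      · rw [length_stairs hN]; simp; ring
      · rw [length_stairs hN]; simp; ring
      · simp only [B]
        rw [length_zigLine hN]; ring
    · simp only [β, B, reduceCtorEq, Finset.filter_false, Finset.card_empty, Fintype.card_bool]
      rw [length_zigLine hN]; ring
  · intro z x
    rcases hβB z with ⟨b, hb, -⟩ | ⟨j, -, hj⟩
    · rw [hb]
      exact c.mem_window (by omega) Sum.inl _ _ (fun i hi => mem_stairs_h (f := f) (h := h) hN b hi) x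
    · rw [hj]
      exact (memV_kappa c d hN j x).imp (fun h => (kappa_infix_zigLine j).subset h)
        fun h => (kappa_infix_zigLine j).subset h
  · intro z y
    rcases hβB z with ⟨b, hb, -⟩ | ⟨j, -, hj⟩
    · rw [hb]
      exact d.mem_window (by omega) (fun y => Sum.inr (Sum.inl y)) _ _
        (fun i hi => mem_stairs_f (f := f) (h := h) hN b hi) y
    · rw [hj]
      exact memW_kappa c d hN j _ (kappa_infix_zigLine j).subset (mem_zigLine hN j).1 y
  · intro z t ht
    have hg : ∀ l : List (V ⊕ (W ⊕ Bool)), (∃ b, g b ∈ l) →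
        Sum.inr (Sum.inr t) ∈ l ∨ Sum.inr (Sum.inr (!t)) ∈ l := by
      rintro l ⟨b, hb⟩
      cases t <;> cases b <;> first | exact Or.inl hb | exact Or.inr hb
    rcases hβB z with ⟨b, hb, hz⟩ | ⟨j, -, hj⟩
    · cases b
      · exact absurd hz.symm (by simpa using ht)
      · rw [hb]
        exact hg _ ⟨true, (stairs_true hN).1.subset (by simp)⟩
    · rw [hj]
      exact hg _ (mem_zigLine hN j).2
  · intro x y
    have k0 := d.idx_nonneg y
    have k1 := d.idx_lt y
    by_cases h0 : c.idx x = d.idx y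
    · obtain ⟨b, hb⟩ := stairs_pair₁ (f := f) (h := h) (g := g) hN k0 k1
      refine Or.inr (Or.inl (hSnb b _ _ ?_))
      rw [hfx, hfy, h0]; exact hb
    by_cases h1 : c.idx x = d.idx y + 1 ∨ c.idx x + 2 * N = d.idx y + 1
    · have hx : h (c.idx x) = h (d.idx y + 1) := by
        rcases h1 with h1 | h1
        · rw [h1]
        · rw [← hh, h1]
      rw [hfx, hfy, hx]
      refine Or.inr (Or.inl ?_)
      by_cases e1 : d.idx y ≤ N - 2
      · exact hSnb _ _ _ (stairs_low hN k0 e1)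
      by_cases e2 : d.idx y = N - 1
      · refine hBnb (N - 1) (by omega) (by omega) _ _ ?_
        simp only [B]
        rw [zigLine_mid hN, e2, sub_add_cancel]
        exact nb_cons_iff.2 (Or.inr (Or.inr (nb_cons_iff.2 (Or.inr (Or.inl ⟨rfl, rfl⟩)))))
      by_cases e3 : d.idx y = N
      · refine hBnb N (by omega) (by omega) _ _ ?_
        simp only [B]
        rw [zigLine_N hN, e3]
        exact nb_cons_iff.2 (Or.inr (Or.inl ⟨rfl, rfl⟩))
      by_cases e4 : d.idx y = 2 * N - 1
      · refine hBnb (2 * N - 1) (by omega) (by omega) _ _ ?_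
        simp only [B]
        rw [zigLine_top hN, e4, sub_add_cancel]
        exact nb_cons_iff.2 (Or.inr (Or.inr (nb_cons_iff.2 (Or.inr (Or.inl ⟨rfl, rfl⟩)))))
      · exact hSnb _ _ _ (stairs_high hN (by omega) (by omega))
    · push Not at h1
      rcases kappa_crossing (T := Bool) c d hN x y h0 h1.1 h1.2 with ⟨j, j0, j1, hj⟩ | ⟨h, h'⟩
      · exact Or.inr (Or.inl (hBnb j j0 j1 _ _ (hj.mono (kappa_infix_zigLine j))))
      · exact Or.inr (Or.inr (Or.inr ⟨h.trans c2, h'.trans d1⟩))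
  · refine hBnb 0 le_rfl (by omega) _ _ ?_
    rw [← c2, ← c1]
    exact (kappa_zero_nb c d).2.mono (kappa_infix_zigLine 0)
  · refine hBnb 0 le_rfl (by omega) _ _ ?_
    rw [← d1, ← d0]
    exact (kappa_zero_nb c d).1.mono (kappa_infix_zigLine 0)
  · intro t x
    have k0 := c.idx_nonneg x
    have k1 := c.idx_lt x
    obtain ⟨a, ha⟩ := E.fin_surj x
    cases t
    · by_cases e0 : c.idx x < N
      · right
        by_cases e1 : c.idx x = 0
        · left
          refine hBnb N (by omega) (by omega) _ _ (Or.inl ?_)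
          have := pair_infix_append (l₁ := zigPre f g N N ++ kappa f h N N) (l₂ := [g false])
            (by rw [List.getLast?_append, getLast?_kappa hN]; rfl) rfl
          rw [hfx, e1, ← hh, zero_add]
          simp only [B, zigLine, zigSuf]
          rw [if_neg (by omega), if_pos trivial, ← List.append_assoc, two_mul]
          exact this
        by_cases e2 : c.idx x = 1
        · right
          exact ⟨by rw [← c1, ← e2, c.u_idx], rfl⟩
        · left
          refine hBnb (c.idx x - 1) (by omega) (by omega) _ _ ?_
          simp only [B]
          rw [zigLine_low (by omega) (by omega), hfx, sub_add_cancel]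
          exact nb_cons_iff.2 (Or.inr (Or.inr (nb_cons_iff.2 (Or.inr (Or.inl ⟨rfl, rfl⟩)))))
      · left
        exact ⟨a, ha, by rw [ha, if_neg e0]; rfl⟩
    · by_cases e0 : c.idx x < N
      · left
        exact ⟨a, ha, by rw [ha, if_pos e0]; rfl⟩
      · right; left
        by_cases e1 : c.idx x = N
        · refine hBnb 0 (by omega) (by omega) _ _ (Or.inl ?_)
          have := pair_infix_append (l₂ := [g true]) (getLast?_kappa (f := f) (h := h) hN 0) rfl
          rw [zero_add] at this
          simp only [B]
          rw [zigLine_zero, hfx, e1]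
          exact this
        by_cases e2 : c.idx x = N + 1
        · refine hSnb true _ _ (Or.inl ?_)
          rw [hfx, e2]
          exact (stairs_true (f := f) (h := h) (g := g) hN).1
        · refine hBnb (c.idx x - 1) (by omega) (by omega) _ _ ?_
          simp only [B]
          rw [zigLine_high (by omega) (by omega), hfx, sub_add_cancel]
          exact nb_cons_iff.2 (Or.inr (Or.inr (nb_cons_iff.2 (Or.inr (Or.inl ⟨rfl, rfl⟩)))))
  · intro t y
    have k0 := d.idx_nonneg y
    have k1 := d.idx_lt y
    cases t
    · by_cases e0 : d.idx y < N
      · right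
        by_cases e1 : d.idx y = 0
        · right
          exact ⟨by rw [← d0, ← e1, d.u_idx], rfl⟩
        left
        by_cases e2 : d.idx y = N - 1
        · refine hBnb (N - 1) (by omega) (by omega) _ _ ?_
          simp only [B]
          rw [zigLine_mid hN, hfy, e2]
          exact nb_cons_iff.2 (Or.inr (Or.inl ⟨rfl, rfl⟩))
        · refine hBnb (d.idx y) (by omega) (by omega) _ _ ?_
          simp only [B]
          rw [zigLine_low (by omega) (by omega), hfy]
          exact nb_cons_iff.2 (Or.inl ⟨rfl, rfl⟩)
      · left
        obtain ⟨a, ha⟩ := E.fin_surj (c.u (d.idx y))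
        have e := c.idx_u k0 k1
        refine ⟨a, ?_, ?_⟩
        · rw [hJ, ha, e, if_pos (by omega), d.u_idx]
        · rw [ha, e, if_neg e0]; rfl
    · by_cases e0 : d.idx y < N
      · left
        by_cases e1 : d.idx y = N - 1
        · obtain ⟨a, ha⟩ := E.fin_surj (c.u 0)
          have e := c.idx_u (i := 0) (by omega) (by omega)
          refine ⟨a, ?_, ?_⟩
          · rw [hJ, ha, e, if_neg (by omega), if_pos rfl, ← e1, d.u_idx]
          · rw [ha, e, if_pos (by omega)]; rfl
        · obtain ⟨a, ha⟩ := E.fin_surj (c.u (d.idx y + 1))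
          have e := c.idx_u (i := d.idx y + 1) (by omega) (by omega)
          refine ⟨a, ?_, ?_⟩
          · rw [hJ, ha, e, if_neg (by omega), if_neg (by omega), add_sub_cancel_right, d.u_idx]
          · rw [ha, e, if_pos (by omega)]; rfl
      · right; left
        by_cases e1 : d.idx y = N
        · refine hSnb true _ _ (Or.inr ?_)
          rw [hfy, e1]
          exact (stairs_true (f := f) (h := h) (g := g) hN).2
        by_cases e2 : d.idx y = 2 * N - 1
        · refine hBnb (2 * N - 1) (by omega) (by omega) _ _ ?_
          simp only [B]
          rw [zigLine_top hN, hfy, e2]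
          exact nb_cons_iff.2 (Or.inr (Or.inl ⟨rfl, rfl⟩))
        · refine hBnb (d.idx y) (by omega) (by omega) _ _ ?_
          simp only [B]
          rw [zigLine_high (by omega) (by omega), hfy]
          exact nb_cons_iff.2 (Or.inl ⟨rfl, rfl⟩)
  · intro _ h
    have := d.inj 1 (-1) (h.trans d1.symm) (by omega) (by omega)
    omega
  · intro _
    have := stairs_low (f := f) (h := h) (g := g) hN (j := 1) (by omega) (by omega)
    simp only [β, d.idx_u (show (0 : ℤ) ≤ N - 1 by omega) (by omega), if_true]
    exact this.symm
  · rintro (_ | _)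
    · right
      refine ⟨_, if_neg (by simp), ?_⟩
      have e := d.idx_u (i := 1) (by omega) (by omega)
      simp only [β, e]
      rw [if_neg (by omega), if_neg (by omega)]
      simp only [B]
      rw [zigLine_low (by omega) (by omega)]
      exact Or.inl ⟨[], zigzag f h (N - 1) (1 - 1) (1 + 2), by simp [f, h, g, vR, vL]⟩
    · left
      refine ⟨a0, if_pos rfl, ha0, ?_, ?_⟩
      · rw [hJ, ha0, hidx2, if_neg (by omega), if_neg (by omega)]; rfl
      · rw [ha0, hidx2, if_pos (by omega)]

/-- From a decomposition for `N` labels one obtains decompositions for `2 N` and `2 N + 1`. -/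
theorem EPlus.double (hN : 5 ≤ N) (E : EPlus N V) :
    (∃ (U : Type) (_ : Fintype U) (_ : DecidableEq U), Nonempty (EPlus (2 * N) U)) ∧
      ∃ (U : Type) (_ : Fintype U) (_ : DecidableEq U), Nonempty (EPlus (2 * N + 1) U) := by
  obtain ⟨J⟩ := exists_joint_empty hN E E
  obtain ⟨J'⟩ := exists_joint_bool hN E E
  exact ⟨⟨_, _, _, ⟨J.compose (by simp; ring)⟩⟩, ⟨_, _, _, ⟨J'.compose (by simp; ring)⟩⟩⟩

end HamFrag

/-! ### Explicit decompositions and the induction -/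

namespace HamFrag

instance {α : Type*} [DecidableEq α] (l : List α) (x y : α) : Decidable (Nb l x y) :=
  inferInstanceAs (Decidable (_ ∨ _))

instance {α : Type*} [DecidableEq α] (l : List α) (x y z : α) : Decidable (Tr l x y z) :=
  inferInstanceAs (Decidable (_ ∨ _))

set_option maxRecDepth 10000 in
set_option synthInstance.maxHeartbeats 200000 in
set_option synthInstance.maxSize 1000 in
/-- A decomposition for 6 labels. -/
def ePlus6 : EPlus 6 (Fin 12) where
  par x := x + 6
  P := ![[0, 3, 1, 10, 5],
      [1, 2, 3, 10, 11],
      [2, 9, 5, 0, 7, 10],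
      [3, 11, 2, 6, 1, 4],
      [4, 11, 6, 9, 7, 2],
      [5, 2, 10, 6, 7],
      [6, 5, 4, 8, 9, 1],
      [7, 4, 6, 8, 3],
      [8, 7, 11, 9, 0],
      [9, 4, 0, 11, 8],
      [10, 8, 5, 7, 3, 6],
      [11, 1, 8, 0, 10, 9]]
  fin := ![5, 11, 10, 4, 2, 7, 1, 3, 0, 8, 6, 9]
  zc := ![1, 9, 0, 5, 8, 7, 1, 9, 0, 5, 8, 7]
  mid := [1, 0]
  X := 3
  X2 := 5
  Y2 := 2
  Y := 4
  lam := 0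
  s := ![1, 8, 5, 6, 0, 4, 1, 8, 5, 6, 0, 4]
  t := ![2, 11, 10, 7, 9, 6, 2, 11, 10, 7, 9, 6]
  col := ![none, some 11, some 5, some 10, some 9, some 6, some 3, some 8, some 10, some 4, some 11, some 4]
  par_par := by decide +kernel
  par_ne := by decide +kernel
  card := by simp
  head := by decide +kernel
  last := by decide +kernel
  fin_surj := by decide +kernel
  zc_par := by decide +kernel
  len := by decide +kernel
  mem := by decide +kernel
  o_len := rfl
  o_mem := by decide +kernel
  fin_X := by decide +kernel
  cover := by decide +kernel
  s_par := by decide +kernel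
  t_par := by decide +kernel
  chord := by decide +kernel
  tri := by decide +kernel
  quad_inter := by decide +kernel
  free := by decide +kernel
  col_lam := by decide +kernel
  col_par_lam := by decide +kernel

set_option maxRecDepth 10000 in
set_option synthInstance.maxHeartbeats 200000 in
set_option synthInstance.maxSize 1000 in
/-- A decomposition for 7 labels. -/
def ePlus7 : EPlus 7 (Fin 14) where
  par x := x + 7
  P := ![[0, 12, 1, 13, 11, 2, 10],
      [1, 10, 11, 12, 7, 6],
      [2, 8, 6, 4, 0, 3, 12],
      [3, 1, 7, 2, 6, 12, 4],
      [4, 2, 12, 13, 3, 7],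
      [5, 10, 4, 13, 2, 1],
      [6, 11, 0, 5, 8, 3, 2],
      [7, 4, 1, 5, 6, 9, 3],
      [8, 7, 9, 13, 5, 3, 11],
      [9, 8, 11, 7, 10, 13],
      [10, 0, 8, 4, 9, 5],
      [11, 9, 10, 12, 8, 13, 0],
      [12, 9, 0, 6, 10, 8],
      [13, 7, 5, 11, 1, 9]]
  fin := ![10, 6, 12, 4, 7, 1, 2, 3, 11, 13, 5, 0, 8, 9]
  zc := ![5, 4, 1, 13, 12, 9, 10, 5, 4, 1, 13, 12, 9, 10]
  mid := [1, 0, 2]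
  X := 3
  X2 := 6
  Y2 := 5
  Y := 4
  lam := 0
  s := ![1, 12, 10, 7, 0, 7, 5, 1, 12, 10, 7, 0, 7, 5]
  t := ![2, 13, 11, 13, 6, 11, 9, 2, 13, 11, 13, 6, 11, 9]
  col := ![none, some 0, some 0, some 4, some 2, some 13, some 7, some 3, some 11, some 11, some 9, some 6, some 1, some 8]
  par_par := by decide +kernel
  par_ne := by decide +kernel
  card := by simp
  head := by decide +kernel
  last := by decide +kernel
  fin_surj := by decide +kernel
  zc_par := by decide +kernel
  len := by decide +kernel
  mem := by decide +kernel
  o_len := rfl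
  o_mem := by decide +kernel
  fin_X := by decide +kernel
  cover := by decide +kernel
  s_par := by decide +kernel
  t_par := by decide +kernel
  chord := by decide +kernel
  tri := by decide +kernel
  quad_inter := by decide +kernel
  free := by decide +kernel
  col_lam := by decide +kernel
  col_par_lam := by decide +kernel

set_option maxRecDepth 10000 in
set_option synthInstance.maxHeartbeats 200000 in
set_option synthInstance.maxSize 1000 in
/-- A decomposition for 8 labels. -/
def ePlus8 : EPlus 8 (Fin 16) where
  par x := x + 8
  P := ![[0, 7, 4, 1, 3, 10, 5, 6],
      [1, 6, 12, 0, 11, 13, 7, 2],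
      [2, 12, 3, 0, 5, 1, 14, 7],
      [3, 13, 1, 8, 2, 15, 6, 4],
      [4, 10, 8, 11, 7, 9, 6, 13],
      [5, 11, 4, 15, 0, 14, 10, 1],
      [6, 11, 9, 4, 0, 13, 10],
      [7, 8, 4, 14, 5, 2, 3],
      [8, 9, 15, 12, 11, 2, 14],
      [9, 3, 5, 8, 6, 7, 12],
      [10, 7, 3, 8, 14, 9, 5],
      [11, 1, 15, 5, 12, 10, 0],
      [12, 1, 2, 13, 14, 11, 15],
      [13, 9, 10, 15, 3, 14, 12, 8],
      [14, 15, 8, 13, 4, 2, 9],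
      [15, 13, 12, 9, 0, 6, 10, 11]]
  fin := ![6, 2, 7, 4, 13, 1, 10, 3, 14, 12, 5, 0, 15, 8, 9, 11]
  zc := ![12, 7, 9, 14, 10, 8, 11, 6, 12, 7, 9, 14, 10, 8, 11, 6]
  mid := [2, 0, 1, 7]
  X := 3
  X2 := 6
  Y2 := 5
  Y := 4
  lam := 0
  s := ![1, 5, 3, 14, 8, 12, 0, 0, 1, 5, 3, 14, 8, 12, 0, 0]
  t := ![2, 14, 5, 15, 14, 15, 10, 4, 2, 14, 5, 15, 14, 15, 10, 4]
  col := ![none, some 2, some 7, some 13, some 7, some 11, some 15, some 0, some 3, some 10, some 0, some 12, some 13, some 15, some 5, some 5]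
  par_par := by decide +kernel
  par_ne := by decide +kernel
  card := by simp
  head := by decide +kernel
  last := by decide +kernel
  fin_surj := by decide +kernel
  zc_par := by decide +kernel
  len := by decide +kernel
  mem := by decide +kernel
  o_len := rfl
  o_mem := by decide +kernel
  fin_X := by decide +kernel
  cover := by decide +kernel
  s_par := by decide +kernel
  t_par := by decide +kernel
  chord := by decide +kernel
  tri := by decide +kernel
  quad_inter := by decide +kernel
  free := by decide +kernel
  col_lam := by decide +kernel
  col_par_lam := by decide +kernel

set_option maxRecDepth 10000 in
set_option synthInstance.maxHeartbeats 200000 in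
set_option synthInstance.maxSize 1000 in
/-- A decomposition for 9 labels. -/
def ePlus9 : EPlus 9 (Fin 18) where
  par x := x + 9
  P := ![[0, 13, 14, 3, 1, 7, 11, 6, 8],
      [1, 5, 0, 12, 11, 4, 16, 17, 6],
      [2, 8, 9, 13, 15, 5, 16, 10],
      [3, 2, 9, 1, 14, 15, 16, 8, 4],
      [4, 6, 3, 9, 11, 17, 7, 14],
      [5, 11, 10, 17, 9, 7, 13, 3, 15],
      [6, 13, 17, 14, 12, 2, 10, 0, 7],
      [7, 6, 0, 14, 4, 12, 8, 1],
      [8, 14, 11, 0, 4, 1, 15, 7, 12],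
      [9, 5, 7, 10, 8, 11, 15, 12, 13],
      [10, 6, 2, 7, 4, 5, 3, 8, 0],
      [11, 3, 17, 0, 15, 4, 10, 5],
      [12, 17, 4, 9, 10, 15, 2, 16],
      [13, 10, 3, 0, 16, 6, 14, 2],
      [14, 16, 9, 12, 1, 13, 2, 17],
      [15, 8, 13, 5, 2, 1, 16, 3],
      [16, 13, 11, 1, 17, 5, 12, 6, 9],
      [17, 15, 9, 14, 10, 12, 16, 11]]
  fin := ![8, 6, 10, 4, 14, 15, 7, 1, 12, 13, 0, 5, 16, 2, 17, 3, 9, 11]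
  zc := ![15, 4, 7, 2, 17, 12, 14, 11, 13, 15, 4, 7, 2, 17, 12, 14, 11, 13]
  mid := [8, 5, 6, 1, 0]
  X := 3
  X2 := 7
  Y2 := 2
  Y := 4
  lam := 0
  s := ![1, 11, 6, 13, 11, 12, 14, 5, 0, 1, 11, 6, 13, 11, 12, 14, 5, 0]
  t := ![2, 17, 7, 15, 16, 17, 16, 10, 3, 2, 17, 7, 15, 16, 17, 16, 10, 3]
  col := ![none, some 16, some 10, some 5, some 1, some 16, some 13, some 9, some 10, some 3, some 5, some 0, some 9, some 16, some 6, some 3, some 2, some 11]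
  par_par := by decide +kernel
  par_ne := by decide +kernel
  card := by simp
  head := by decide +kernel
  last := by decide +kernel
  fin_surj := by decide +kernel
  zc_par := by decide +kernel
  len := by decide +kernel
  mem := by decide +kernel
  o_len := rfl
  o_mem := by decide +kernel
  fin_X := by decide +kernel
  cover := by decide +kernel
  s_par := by decide +kernel
  t_par := by decide +kernel
  chord := by decide +kernel
  tri := by decide +kernel
  quad_inter := by decide +kernel
  free := by decide +kernel
  col_lam := by decide +kernel
  col_par_lam := by decide +kernel

set_option maxRecDepth 10000 in
set_option synthInstance.maxHeartbeats 200000 in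
set_option synthInstance.maxSize 1000 in
/-- A decomposition for 10 labels. -/
def ePlus10 : EPlus 10 (Fin 20) where
  par x := x + 10
  P := ![[0, 16, 18, 3, 19, 14, 15, 1, 12],
      [1, 5, 13, 0, 6, 14, 8, 2, 9, 7],
      [2, 17, 19, 0, 11, 5, 14, 13, 16],
      [3, 2, 10, 1, 8, 16, 9, 17, 15, 4],
      [4, 11, 16, 19, 10, 7, 8, 12, 3, 15],
      [5, 19, 4, 7, 3, 6, 12, 0, 18, 11],
      [6, 13, 1, 19, 15, 18, 4, 10, 17],
      [7, 19, 2, 14, 3, 11, 8, 0, 15, 6],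
      [8, 19, 6, 11, 2, 13, 7, 14, 0, 5],
      [9, 5, 12, 13, 10, 14, 18, 7, 16, 1],
      [10, 16, 12, 14, 1, 17, 8, 9, 13],
      [11, 7, 2, 4, 16, 5, 10, 8, 3],
      [12, 17, 13, 4, 9, 15, 11, 10, 6, 8],
      [13, 8, 15, 7, 0, 4, 12, 11, 19],
      [14, 16, 17, 18, 2, 15, 13, 11, 9, 0],
      [15, 12, 18, 6, 9, 10, 3, 17, 14],
      [16, 2, 5, 3, 0, 17, 11, 14, 9, 18],
      [17, 5, 4, 6, 1, 18, 19, 12, 10],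
      [18, 10, 15, 16, 3, 1, 7, 12, 9],
      [19, 13, 18, 5, 6, 17, 4, 1, 2]]
  fin := ![12, 7, 16, 4, 15, 11, 17, 6, 5, 1, 13, 3, 8, 19, 0, 14, 18, 10, 9, 2]
  zc := ![19, 15, 6, 17, 18, 10, 13, 0, 2, 11, 19, 15, 6, 17, 18, 10, 13, 0, 2, 11]
  mid := [1, 0, 2, 6, 7, 5]
  X := 3
  X2 := 9
  Y2 := 8
  Y := 4
  lam := 0
  s := ![1, 14, 15, 18, 10, 10, 11, 16, 0, 2, 1, 14, 15, 18, 10, 10, 11, 16, 0, 2]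
  t := ![2, 17, 18, 19, 18, 16, 19, 18, 11, 7, 2, 17, 18, 19, 18, 16, 19, 18, 11, 7]
  col := ![none, some 10, some 14, some 0, some 6, some 11, some 8, some 9, some 7, some 1, some 3, some 16, some 15, some 19, some 9, some 18, some 4, some 14, some 5, some 7]
  par_par := by decide +kernel
  par_ne := by decide +kernel
  card := by simp
  head := by decide +kernel
  last := by decide +kernel
  fin_surj := by decide +kernel
  zc_par := by decide +kernel
  len := by decide +kernel
  mem := by decide +kernel
  o_len := rfl
  o_mem := by decide +kernel
  fin_X := by decide +kernel
  cover := by decide +kernel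
  s_par := by decide +kernel
  t_par := by decide +kernel
  chord := by decide +kernel
  tri := by decide +kernel
  quad_inter := by decide +kernel
  free := by decide +kernel
  col_lam := by decide +kernel
  col_par_lam := by decide +kernel

set_option maxRecDepth 10000 in
set_option synthInstance.maxHeartbeats 200000 in
set_option synthInstance.maxSize 1000 in
/-- A decomposition for 11 labels. -/
def ePlus11 : EPlus 11 (Fin 22) where
  par x := x + 11
  P := ![[0, 9, 1, 8, 2, 7, 3, 16, 10, 17],
      [1, 20, 7, 19, 16, 6, 10, 13, 3, 11, 15],
      [2, 20, 11, 8, 5, 10, 14, 4, 7, 17, 1],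
      [3, 20, 21, 1, 11, 2, 16, 17, 8, 18, 4],
      [4, 1, 5, 0, 3, 6, 9, 10, 8, 7],
      [5, 2, 3, 18, 12, 15, 19, 21, 9, 11, 6],
      [6, 14, 21, 8, 15, 9, 12, 13, 16, 11, 18],
      [7, 11, 14, 17, 9, 4, 12, 19, 13, 21, 5],
      [8, 20, 5, 3, 1, 2, 4, 6, 18, 21],
      [9, 8, 0, 7, 1, 6, 2, 10, 15, 16],
      [10, 0, 14, 1, 13, 15, 5, 19, 18, 20],
      [11, 17, 2, 18, 14, 16, 21, 15, 20, 12],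
      [12, 0, 13, 4, 21, 17, 18, 9, 3, 8],
      [13, 9, 14, 8, 16, 4, 10, 7, 12, 6, 0],
      [14, 5, 17, 4, 19, 1, 18, 0, 21, 2],
      [15, 14, 13, 18, 16, 9, 19, 17, 12, 10, 11],
      [16, 7, 13, 8, 12, 11, 4, 20, 17, 3],
      [17, 0, 16, 1, 15, 2, 14, 20, 19, 10],
      [18, 10, 20, 13, 6, 15, 3, 12, 5, 11, 19],
      [19, 14, 12, 21, 11, 13, 17, 15, 18, 5, 9],
      [20, 6, 7, 21, 3, 19, 0, 4, 5, 13],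
      [21, 6, 19, 2, 12, 16, 20, 0, 15, 7, 14]]
  fin := ![17, 15, 1, 4, 7, 6, 18, 5, 21, 16, 20, 12, 8, 0, 2, 11, 3, 10, 19, 9, 13, 14]
  zc := ![8, 20, 4, 9, 0, 12, 10, 17, 11, 14, 16, 8, 20, 4, 9, 0, 12, 10, 17, 11, 14, 16]
  mid := [1, 0, 2, 9, 7, 5, 6]
  X := 3
  X2 := 10
  Y2 := 8
  Y := 4
  lam := 0
  s := ![1, 6, 7, 8, 10, 9, 13, 19, 15, 4, 11, 1, 6, 7, 8, 10, 9, 13, 19, 15, 4, 11]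
  t := ![2, 7, 8, 9, 16, 18, 15, 20, 21, 17, 12, 2, 7, 8, 9, 16, 18, 15, 20, 21, 17, 12]
  col := ![none, some 9, some 0, some 12, some 13, some 19, some 18, some 1, some 6, some 7, some 15, some 3, some 13, some 16, some 13, some 9, some 15, some 19, some 10, some 5, some 16, some 19]
  par_par := by decide +kernel
  par_ne := by decide +kernel
  card := by simp
  head := by decide +kernel
  last := by decide +kernel
  fin_surj := by decide +kernel
  zc_par := by decide +kernel
  len := by decide +kernel
  mem := by decide +kernel
  o_len := rfl
  o_mem := by decide +kernel
  fin_X := by decide +kernel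
  cover := by decide +kernel
  s_par := by decide +kernel
  t_par := by decide +kernel
  chord := by decide +kernel
  tri := by decide +kernel
  quad_inter := by decide +kernel
  free := by decide +kernel
  col_lam := by decide +kernel
  col_par_lam := by decide +kernel

/-- Halving takes every `N ≥ 12` to a value of at least 6, so the six listed decompositions start
the recursion; the two compositions account for the two parities. -/
theorem exists_ePlus (N : ℕ) (hN : 6 ≤ N) :
    ∃ (U : Type) (_ : Fintype U) (_ : DecidableEq U), Nonempty (EPlus N U) := by
  induction N using Nat.strong_induction_on with
  | _ N ih =>
  by_cases h : N < 12
  · interval_cases N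
    · exact ⟨_, _, _, ⟨ePlus6⟩⟩
    · exact ⟨_, _, _, ⟨ePlus7⟩⟩
    · exact ⟨_, _, _, ⟨ePlus8⟩⟩
    · exact ⟨_, _, _, ⟨ePlus9⟩⟩
    · exact ⟨_, _, _, ⟨ePlus10⟩⟩
    · exact ⟨_, _, _, ⟨ePlus11⟩⟩
  · obtain ⟨U, hU, hU', ⟨E⟩⟩ := ih (N / 2) (by omega) (by omega)
    obtain ⟨h1, h2⟩ := E.double (by omega)
    rcases Nat.mod_two_eq_zero_or_one N with h' | h'
    · rwa [show 2 * (N / 2) = N by omega] at h1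
    · rwa [show 2 * (N / 2) + 1 = N by omega] at h2

theorem exists_scheme_of_six_le (N : ℕ) (hN : 6 ≤ N) :
    ∃ (C : Type) (Sc : Scheme (N + 1) C), ∀ κ, Sc.allowed κ := by
  obtain ⟨U, _, _, ⟨E⟩⟩ := exists_ePlus N hN
  obtain ⟨Sc, h⟩ := E.nonempty_scheme
  exact ⟨_, Sc, h⟩

end HamFrag

/-! ### Conclusion -/

open HamFrag

theorem HamFrag.exists_scheme {N : ℕ} (hN : N ≠ 2) :
    ∃ (C : Type) (Sc : Scheme (N + 1) C), ∀ κ, Sc.allowed κ := by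
  rcases Nat.lt_or_ge N 6 with h | h
  · exact exists_scheme_of_lt_six N h hN
  · exact exists_scheme_of_six_le N h

/-- Any placement works unless `n = 3`, where the placement has to avoid the combination of roles
without a local colouring. -/
theorem HamFrag.hamiltonDecomposable_unionCopies {V : Type*} [Finite V] {G : SimpleGraph V} {n : ℕ}
    (hn : 0 < n) (F : DirTwoFactorisation G n) (htop : ∀ v w : V, (F.next none).SameCycle v w) :
    HamiltonDecomposable (F.unionCopies ⊤) := by
  obtain ⟨N, rfl⟩ : ∃ N, n = N + 1 := ⟨n - 1, by omega⟩
  by_cases hN : N = 2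
  · subst hN
    obtain ⟨C, Sc, k₀, k₁, hk, hSc⟩ := exists_scheme_two
    obtain ⟨P, hP⟩ := exists_placement_avoiding F k₀ k₁ hk
    exact Sc.hamiltonDecomposable F P (fun v => hSc _ (hP v)) htop
  · obtain ⟨C, Sc, hSc⟩ := exists_scheme hN
    obtain ⟨P⟩ := exists_placement F
    exact Sc.hamiltonDecomposable F P (fun v => hSc _) htop

theorem mainTheorem2 (n : ℕ) (hn : 0 < n) :
    (∃ D : Set (SimpleGraph (HamFrag.Lab n)),
      HamFrag.IsDecomposition ⊤ D ∧ ∀ H ∈ D, HamFrag.IsHamiltonFragment.{u} H) ∧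
    (∀ (V : Type u) [Fintype V] (G : SimpleGraph V) [DecidableRel G.Adj],
      G.IsRegularOfDegree (2 * n) → HamFrag.HasHamiltonCycle G →
        HamFrag.HamiltonDecomposable G.lineGraph) := by
  -- The complete graph is taken as the only fragment; it has an edge because the two ends of `∞`
  -- are distinct.
  refine ⟨⟨{⊤}, ⟨?_, fun e he => ?_⟩, ?_⟩, ?_⟩
  · rintro _ rfl
    refine ⟨fun h => ?_, le_rfl⟩
    have : (⊤ : SimpleGraph (Lab n)).Adj (Sum.inl none) (Sum.inr none) := by simp
    rw [h] at this
    exact this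
  · exact ⟨⊤, ⟨rfl, he⟩, fun H hH => hH.1⟩
  · rintro _ rfl V _ G _ _ _ F htop
    exact hamiltonDecomposable_unionCopies hn F htop
  · rintro V _ G _ hG ⟨C, hCG, hC⟩
    obtain ⟨F, htop⟩ := exists_dirTwoFactorisation (n := n) hn (fun v => by
      rw [← hG v, ← SimpleGraph.card_neighborSet_eq_degree, ← Nat.card_eq_fintype_card,
        Nat.card_coe_set_eq]) hCG hC
    rw [← unionCopies_top F]
    exact hamiltonDecomposable_unionCopies hn F htop
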